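/- **Setting.** Let $\Bbbk$ be a field of characteristic $0$ and $\mathbb G=\{\mathbb Z\to G\to\mathbb Z/2\}$ a grading datum (abelian groups, surjective composition; integers are regarded as degrees via $\mathbb Z\to G$, Koszul signs use $G\to\mathbb Z/2$). Let $P$ be a finite set, $f:\mathbb Z^P\to G$ a homomorphism landing in the even part of $G$, and $\mathsf N\subset\mathbb R^P$ a convex cone with non-empty interior. Put $M=\mathsf N^\vee\cap\mathbb Z^P$, let $\tilde R=\Bbbk[M]$ with monomials $r^u$ of degree $f(u)$, let $\tilde{\mathfrak m}$ be the ideal spanned by the $r^u$, $u\neq0$, let $R$ be the $\tilde{\mathfrak m}$-adic completion of $\tilde R$ in the $\mathbb G$-graded sense, and let $\mathfrak m\subset R$ and, more generally, $\mathfrak m^n\subset R$ be the completions of $\tilde{\mathfrak m}$ and $\tilde{\mathfrak m}^n$. Write $u_p$ for the basis vectors of $\mathbb Z^P$, $r_p=r^{u_p}$, and a subscript $0$ for degree-$0$ parts. $\operatorname{Aut}(R)$ is the group of $\mathbb G$-graded $\Bbbk$-algebra automorphisms of $R$ preserving the filtration $(\mathfrak m^n)$. Assume that $R$ is *nice*: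 for every $p$, $r_p\in\mathfrak m$, $r_p\notin\mathfrak m^2$, $r_p$ generates $\tilde{\mathfrak m}_{f(u_p)}$ as an $\tilde R_0$-module and generates $\mathfrak m_{f(u_p)}$ as an $R_0$-module (the last condition follows from the previous one if $M$ is finitely generated, e.g. if $\mathsf N$ is rational polyhedral). Let $\Gamma$ be a finite group acting on $\mathbb G$ by morphisms of grading data, on the set $P$, and on $R$ by filtration-preserving $\Bbbk$-algebra automorphisms with $g(R_y)\subset R_{g\cdot y}$ and $g\cdot r_p=\pm r_{g\cdot p}$ for all $g,p$. **(1) Differential graded Lie algebras.** Let $\mathfrak g$ be a differential $\mathbb G$-graded Lie algebra over $\Bbbk$ on which $\Gamma$ acts linearly, compatibly with $\partial$ and $[\cdot,\cdot]$, with $g(\mathfrak g_y)\subset\mathfrak g_{g\cdot y}$. Then $\Gamma$ acts on $\mathfrak g\otimes\tilde{\mathfrak m}$ and on the $\mathbb G$-graded completion $\mathfrak g\widehat\otimes\mathfrak m$. Let $MC_{\mathfrak g}(R)^\Gamma$ be the set of $\Gamma$-invariant $\alpha=\sum_u r^u\alpha_u\in(\mathfrak g\widehat\otimes\mathfrak m)_1$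 with $\partial\alpha+\frac12[\alpha,\alpha]=0$. Its elements have first-order deformation classes $r_p\mathsf a_p\in H^1(\mathfrak g\otimes\tilde{\mathfrak m})$, $\mathsf a_p=[\alpha_{u_p}]$. Let $MC'_{\mathfrak g}(R)^\Gamma$ be the set of those $\beta\in MC_{\mathfrak g}(R)^\Gamma$ for which the span of the first-order deformation classes contains $H^1(\mathfrak g\otimes\tilde{\mathfrak m}/\tilde{\mathfrak m}^2)^\Gamma$. Gauge equivalence $\sim$ is the orbit relation of $e^\gamma$, $\gamma\in(\mathfrak g\widehat\otimes\mathfrak m)_0$, where $e^{t\gamma}\cdot\alpha$ solves $\frac{d}{dt}\alpha_t=-\partial\gamma+[\gamma,\alpha_t]$, $\alpha_0=\alpha$. Call $\alpha$ *$R$-complete* if for every $\beta\in MC'_{\mathfrak g}(R)^\Gamma$ there is $\psi^*\in\operatorname{Aut}(R)$ with $\beta\sim\psi^*\alpha$, and *$R$-versal* if moreover the induced map $\psi^*:\mathfrak m/\mathfrak m^2\to\mathfrak m/\mathfrak m^2$ is uniquely determined by $\beta$. Let $\alpha\in MC_{\mathfrak g}(R)^\Gamma$ and suppose that $H^1(\mathfrak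 g\otimes\tilde{\mathfrak m})^\Gamma$ is contained in the $\tilde R_0$-span of the classes $r_p\mathsf a_p$. Then $\alpha$ is $R$-complete. If furthermore $\mathsf a_p\neq0$ for all $p$, then $\alpha$ is $R$-versal. **(2) $A_\infty$ algebras.** Let $\mathcal A=(A,\mu^*)$ be a $\mathbb G$-graded (uncurved) $A_\infty$ algebra over $\Bbbk$, and $\sigma:\Gamma\to\mathbb Z/2$ a homomorphism. Let $\Gamma$ act linearly on $A$ with $g(A_y)\subset A_{g\cdot y}$, and on Hochschild cochains by $$(g\cdot\eta)^s(a_1,\dots,a_s)=g\cdot\eta^s(g^{-1}a_1,\dots,g^{-1}a_s)\ \text{ if }\sigma(g)=0,\qquad g\cdot\eta^s_{op}(g^{-1}a_1,\dots,g^{-1}a_s)\ \text{ if }\sigma(g)=1,$$ where $\eta^s_{op}(a_1,\dots,a_s)=(-1)^{\sum_{i<j}(|a_i|+1)(|a_j|+1)}\eta^s(a_s,\dots,a_1)$; assume $g\cdot\mu^*=\mu^*$ for all $g$, i.e. even elements act by strict automorphisms and odd elements by strict isomorphisms to the opposite $A_\infty$ algebra. A deformation of $\mathcal A$ over $R$ is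 a (possibly curved) $R$-linear $A_\infty$ structure $\mu^*_R=\sum_u r^u\mu^*_u$ on $A\widehat\otimes R$ with $\mu^*_R-\mu^*\in(CC^\bullet(A)[1]\widehat\otimes\mathfrak m)_1$; it is $(\Gamma,\sigma)$-equivariant if $\mu_R^*$ is $\Gamma$-invariant. Put $HH^2(\mathcal A,\mathcal A\otimes V)=H^1(CC^\bullet(\mathcal A)[1]\otimes V)$ for $V=\tilde{\mathfrak m}$ or $\tilde{\mathfrak m}/\tilde{\mathfrak m}^2$. The first-order deformation classes are $r_p\mathsf a_p$, $\mathsf a_p=[\mu^*_{u_p}]$. Call an equivariant deformation $\mathcal A_R$ *$R$-complete* if for every equivariant deformation $\mathcal B_R$ the span of whose first-order deformation classes contains $HH^2(\mathcal A,\mathcal A\otimes\tilde{\mathfrak m}/\tilde{\mathfrak m}^2)^\Gamma$, there are $\psi^*\in\operatorname{Aut}(R)$ and a (possibly curved) $A_\infty$ homomorphism $F^*:\mathcal B_R\dashrightarrow\psi^*\mathcal A_R$ with $F^*\equiv\mathrm{id}$ mod $\mathfrak m$, and *$R$-versal* if moreover $\psi^*:\mathfrak m/\mathfrak m^2\to\mathfrak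 m/\mathfrak m^2$ is uniquely determined by $\mathcal B_R$. Let $\mathcal A_R$ be an equivariant deformation such that $HH^2(\mathcal A,\mathcal A\otimes\tilde{\mathfrak m})^\Gamma$ is contained in the $\tilde R_0$-span of the classes $r_p\mathsf a_p$. Then $\mathcal A_R$ is $R$-complete. If furthermore $\mathsf a_p\neq0$ for all $p$, then $\mathcal A_R$ is $R$-versal. -/

import Mathlib

namespace EqVers

/-! ### Grading data and coefficient rings -/

/-- A grading datum `ℤ → G → ℤ/2`, with surjective composition. -/
structure GradingDatum (G : Type*) [AddCommGroup G] where
  ι : ℤ →+ G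
  par : G →+ ZMod 2
  surj : Function.Surjective (par.comp ι)

/-- `Γ` acts on the grading datum by morphisms of grading data. -/
def GradingDatum.IsInvariant {G : Type*} [AddCommGroup G] (𝔾 : GradingDatum G)
    (Γ : Type*) [Group Γ] [DistribMulAction Γ G] : Prop :=
  (∀ (g : Γ) (n : ℤ), g • 𝔾.ι n = 𝔾.ι n) ∧ ∀ (g : Γ) (y : G), 𝔾.par (g • y) = 𝔾.par y

/-- The combinatorial data from which the coefficient ring is built: a convex cone `N` in `ℝ^P`
with non-empty interior (so that its dual cone contains no line), and a homomorphism
`f : ℤ^P → G` landing in the even part of `G`. -/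
structure CoeffDatum (P : Type*) [Fintype P] {G : Type*} [AddCommGroup G]
    (𝔾 : GradingDatum G) where
  cone : ConvexCone ℝ (P → ℝ)
  cone_interior : (interior (cone : Set (P → ℝ))).Nonempty
  f : (P → ℤ) →+ G
  f_even : ∀ u, 𝔾.par (f u) = 0

namespace CoeffDatum

variable {P : Type*} [Fintype P] {G : Type*} [AddCommGroup G] {𝔾 : GradingDatum G}

/-- The monoid `N^∨ ∩ ℤ^P`. -/
def monoid (D : CoeffDatum P 𝔾) : AddSubmonoid (P → ℤ) where
  carrier := {u | ∀ x ∈ D.cone, 0 ≤ ∑ p, (u p : ℝ) * x p}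
  zero_mem' := by intro x _; simp
  add_mem' := by
    intro a b ha hb x hx
    have := add_nonneg (ha x hx) (hb x hx)
    rw [← Finset.sum_add_distrib] at this
    simpa [add_mul] using this

/-- The monoid `N^∨ ∩ ℤ^P`, as a type: `u : D.Mon` stands for the monomial `r^u`. -/
abbrev Mon (D : CoeffDatum P 𝔾) : Type _ := D.monoid

/-- The degree of the monomial `r^u`. -/
def deg (D : CoeffDatum P 𝔾) (u : D.Mon) : G := D.f u

theorem finite_divisors (D : CoeffDatum P 𝔾) (u : D.Mon) :
    {v : D.Mon × D.Mon | v.1 + v.2 = u}.Finite := by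
  classical
  obtain ⟨x₀, hx₀⟩ := D.cone_interior
  obtain ⟨ε, hε, hball⟩ := Metric.isOpen_iff.1 isOpen_interior x₀ hx₀
  have hmem : ∀ (p : P) (t : ℝ), |t| < ε → x₀ + Pi.single p t ∈ D.cone := by
    intro p t ht
    apply interior_subset
    apply hball
    rw [Metric.mem_ball, dist_eq_norm, add_sub_cancel_left]
    refine (pi_norm_lt_iff hε).2 fun q => ?_
    by_cases h : q = p
    · subst h; simpa using ht
    · simpa [Pi.single_eq_of_ne h] using hε
  let pr : (P → ℤ) → (P → ℝ) → ℝ := fun v x => ∑ p, (v p : ℝ) * x p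
  have pr_add : ∀ v w x, pr (v + w) x = pr v x + pr w x := by
    intro v w x; simp [pr, add_mul, Finset.sum_add_distrib]
  have pr_single : ∀ v p t, pr v (x₀ + Pi.single p t) = pr v x₀ + v p * t := by
    intro v p t
    simp [pr, mul_add, Finset.sum_add_distrib, Pi.single_apply]
  have hε2 : |ε / 2| < ε := by rw [abs_of_pos (by linarith)]; linarith
  have hε2' : |-(ε / 2)| < ε := by rwa [abs_neg]
  let C : P → ℝ := fun p =>
    (pr u (x₀ + Pi.single p (ε / 2)) + pr u (x₀ + Pi.single p (-(ε / 2)))) / ε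
  have key : ∀ v w : D.Mon, v + w = u → ∀ p, |((v : P → ℤ) p : ℝ)| ≤ C p := by
    intro v w h p
    have hu : (u : P → ℤ) = v + w := by rw [← h]; rfl
    have h1 := v.2 _ (hmem p _ hε2)
    have h2 := v.2 _ (hmem p _ hε2')
    have h3 := w.2 _ (hmem p _ hε2)
    have h4 := w.2 _ (hmem p _ hε2')
    change 0 ≤ pr v _ at h1
    change 0 ≤ pr v _ at h2
    change 0 ≤ pr w _ at h3
    change 0 ≤ pr w _ at h4
    have e1 : pr u (x₀ + Pi.single p (ε / 2)) =
      pr v (x₀ + Pi.single p (ε / 2)) + pr w (x₀ + Pi.single p (ε / 2)) := by rw [hu, pr_add]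
    have e2 : pr u (x₀ + Pi.single p (-(ε / 2))) =
      pr v (x₀ + Pi.single p (-(ε / 2))) + pr w (x₀ + Pi.single p (-(ε / 2))) := by
      rw [hu, pr_add]
    simp only [C]
    rw [le_div_iff₀ hε, e1, e2]
    simp only [pr_single] at h1 h2 h3 h4 ⊢
    rcases abs_cases (((v : P → ℤ) p : ℝ)) with ⟨h, _⟩ | ⟨h, _⟩ <;> rw [h] <;> nlinarith
  have hfin : {v : P → ℤ | ∀ p, |(v p : ℝ)| ≤ C p}.Finite := by
    have : {v : P → ℤ | ∀ p, |(v p : ℝ)| ≤ C p} ⊆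
        Set.Icc (fun p => -⌈C p⌉) (fun p => ⌈C p⌉) := by
      intro v hv
      refine ⟨fun p => ?_, fun p => ?_⟩
      · have := (abs_le.1 (hv p)).1
        have h2 := Int.le_ceil (C p)
        have : (-(⌈C p⌉ : ℝ)) ≤ v p := by linarith
        exact_mod_cast this
      · have := (abs_le.1 (hv p)).2
        have h2 := Int.le_ceil (C p)
        have : (v p : ℝ) ≤ ⌈C p⌉ := by linarith
        exact_mod_cast this
    exact (Set.finite_Icc _ _).subset this
  have hfin2 : {v : D.Mon | ∀ p, |((v : P → ℤ) p : ℝ)| ≤ C p}.Finite :=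
    hfin.preimage Subtype.val_injective.injOn
  refine (hfin2.prod hfin2).subset ?_
  rintro ⟨v, w⟩ h
  exact ⟨key v w h, key w v (by rw [add_comm]; exact h)⟩

noncomputable instance (D : CoeffDatum P 𝔾) : Finset.HasAntidiagonal D.Mon where
  antidiagonal u := (D.finite_divisors u).toFinset
  mem_antidiagonal := by intro u v; simp

/-- The monomials `r^u` lying in the `n`-th power of the toric maximal ideal: `u` is a sum of
at least `n` non-zero elements of the monoid. -/
def pow (D : CoeffDatum P 𝔾) (n : ℕ) : Set D.Mon :=
  {u | ∃ s : Multiset D.Mon, n ≤ s.card ∧ (∀ v ∈ s, v ≠ 0) ∧ s.sum = u}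

theorem pow_add_mem {D : CoeffDatum P 𝔾} {n : ℕ} {u v : D.Mon} (h : u ∈ D.pow n) :
    u + v ∈ D.pow n := by
  obtain ⟨s, h1, h2, h3⟩ := h
  by_cases hv : v = 0
  · exact ⟨s, h1, h2, by simp [h3, hv]⟩
  · refine ⟨v ::ₘ s, by simp; omega, ?_, by simp [h3, add_comm]⟩
    intro w hw
    rcases Multiset.mem_cons.1 hw with rfl | hw
    · exact hv
    · exact h2 w hw

/-- All formal sums `∑ a_u r^u` over the monoid, with the convolution product. -/
def Formal (D : CoeffDatum P 𝔾) (k : Type*) : Type _ := D.Mon → k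

namespace Formal

theorem ext {D : CoeffDatum P 𝔾} {k : Type*} {a b : D.Formal k} (h : ∀ u, a u = b u) : a = b :=
  funext h

variable {D : CoeffDatum P 𝔾} {k : Type*} [Field k]

instance : AddCommGroup (D.Formal k) := inferInstanceAs (AddCommGroup (D.Mon → k))

instance : Module k (D.Formal k) := inferInstanceAs (Module k (D.Mon → k))

noncomputable instance : Mul (D.Formal k) :=
  ⟨fun a b u => ∑ v ∈ Finset.HasAntidiagonal.antidiagonal u, a v.1 * b v.2⟩

open Classical in
noncomputable instance : One (D.Formal k) := ⟨Pi.single (M := fun _ : D.Mon => k) 0 1⟩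

theorem mul_apply (a b : D.Formal k) (u : D.Mon) :
    (a * b) u = ∑ v ∈ Finset.HasAntidiagonal.antidiagonal u, a v.1 * b v.2 := rfl

theorem add_apply (a b : D.Formal k) (u : D.Mon) : (a + b) u = a u + b u := rfl

theorem smul_apply (c : k) (a : D.Formal k) (u : D.Mon) : (c • a) u = c * a u := rfl

theorem zero_apply (u : D.Mon) : (0 : D.Formal k) u = 0 := rfl

open Classical in
theorem one_apply (u : D.Mon) : (1 : D.Formal k) u = if u = 0 then 1 else 0 := by
  change Pi.single (M := fun _ : D.Mon => k) 0 1 u = _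
  rw [Pi.single_apply]

protected theorem mul_comm (a b : D.Formal k) : a * b = b * a := by
  refine ext fun u => ?_
  rw [mul_apply, mul_apply]
  exact Finset.sum_equiv (Equiv.prodComm _ _) (by simp [add_comm]) (by simp [mul_comm])

protected theorem one_mul (a : D.Formal k) : 1 * a = a := by
  classical
  refine ext fun u => ?_
  rw [mul_apply, Finset.sum_eq_single (0, u)]
  · simp [one_apply]
  · rintro ⟨v, w⟩ hv hne
    rw [one_apply, if_neg, zero_mul]
    rintro rfl
    apply hne
    simpa using hv
  · intro h; simp at h

protected theorem mul_assoc (a b c : D.Formal k) : a * b * c = a * (b * c) := by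
  refine ext fun u => ?_
  simp only [mul_apply, Finset.sum_mul, Finset.mul_sum, Finset.sum_sigma']
  apply Finset.sum_nbij' (fun ⟨⟨_, j⟩, ⟨k, l⟩⟩ ↦ ⟨(k, l + j), (l, j)⟩)
    (fun ⟨⟨i, _⟩, ⟨k, l⟩⟩ ↦ ⟨(i + k, l), (i, k)⟩)
  · rintro ⟨⟨i, j⟩, ⟨k, l⟩⟩ h
    simp only [Finset.mem_sigma, Finset.HasAntidiagonal.mem_antidiagonal] at h ⊢
    rw [← h.1, ← h.2, add_assoc]; simp
  · rintro ⟨⟨i, j⟩, ⟨k, l⟩⟩ h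
    simp only [Finset.mem_sigma, Finset.HasAntidiagonal.mem_antidiagonal] at h ⊢
    rw [← h.1, ← h.2, add_assoc]; simp
  · rintro ⟨⟨i, j⟩, ⟨k, l⟩⟩ h
    simp only [Finset.mem_sigma, Finset.HasAntidiagonal.mem_antidiagonal] at h ⊢
    rw [← h.2]
  · rintro ⟨⟨i, j⟩, ⟨k, l⟩⟩ h
    simp only [Finset.mem_sigma, Finset.HasAntidiagonal.mem_antidiagonal] at h ⊢
    rw [← h.2]
  · rintro ⟨⟨i, j⟩, ⟨k, l⟩⟩ h
    simp [mul_assoc]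

protected theorem left_distrib (a b c : D.Formal k) : a * (b + c) = a * b + a * c := by
  refine ext fun u => ?_
  simp [mul_apply, add_apply, mul_add, Finset.sum_add_distrib]

protected theorem smul_mul (t : k) (a b : D.Formal k) : t • a * b = t • (a * b) := by
  refine ext fun u => ?_
  simp [mul_apply, smul_apply, Finset.mul_sum, mul_assoc]

noncomputable instance : CommRing (D.Formal k) :=
  { (inferInstance : AddCommGroup (D.Formal k)) with
    mul := (· * ·)
    one := 1
    left_distrib := Formal.left_distrib
    right_distrib := fun a b c => by
      rw [Formal.mul_comm, Formal.left_distrib, Formal.mul_comm c a, Formal.mul_comm c b]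
    zero_mul := fun a => by refine ext fun u => ?_; simp [mul_apply, zero_apply]
    mul_zero := fun a => by refine ext fun u => ?_; simp [mul_apply, zero_apply]
    mul_assoc := Formal.mul_assoc
    one_mul := Formal.one_mul
    mul_one := fun a => by rw [Formal.mul_comm, Formal.one_mul]
    mul_comm := Formal.mul_comm }

noncomputable instance : Algebra k (D.Formal k) :=
  Algebra.ofModule Formal.smul_mul
    (fun t a b => by rw [Formal.mul_comm, Formal.smul_mul, Formal.mul_comm])

end Formal

/-- The `𝔾`-graded completion `R` of the monoid algebra `k[N^∨ ∩ ℤ^P]` along the powers of its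
toric maximal ideal, i.e. the direct sum over `y` of the completions of the degree `y` parts:
its elements are the formal sums of monomials which involve finitely many degrees, and finitely
many monomials outside each power of the toric maximal ideal. -/
noncomputable def R (D : CoeffDatum P 𝔾) (k : Type*) [Field k] : Subalgebra k (D.Formal k) where
  carrier := {a | {y | ∃ u, a u ≠ 0 ∧ D.deg u = y}.Finite ∧
    ∀ n, {u | a u ≠ 0 ∧ u ∉ D.pow n}.Finite}
  add_mem' := by
    rintro a b ⟨ha, ha'⟩ ⟨hb, hb'⟩
    have key : ∀ u, (a + b) u ≠ 0 → a u ≠ 0 ∨ b u ≠ 0 := by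
      intro u h
      by_contra! hc
      exact h (by rw [Formal.add_apply, hc.1, hc.2, add_zero])
    refine ⟨(ha.union hb).subset ?_, fun n => ((ha' n).union (hb' n)).subset ?_⟩
    · rintro y ⟨u, hu, rfl⟩
      exact (key u hu).imp (fun h => ⟨u, h, rfl⟩) (fun h => ⟨u, h, rfl⟩)
    · rintro u ⟨hu, hn⟩
      exact (key u hu).imp (fun h => ⟨h, hn⟩) (fun h => ⟨h, hn⟩)
  mul_mem' := by
    rintro a b ⟨ha, ha'⟩ ⟨hb, hb'⟩
    have key : ∀ u, (a * b) u ≠ 0 → ∃ v w, v + w = u ∧ a v ≠ 0 ∧ b w ≠ 0 := by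
      intro u h
      rw [Formal.mul_apply] at h
      obtain ⟨v, hv, hne⟩ := Finset.exists_ne_zero_of_sum_ne_zero h
      exact ⟨v.1, v.2, Finset.HasAntidiagonal.mem_antidiagonal.1 hv, left_ne_zero_of_mul hne,
        right_ne_zero_of_mul hne⟩
    refine ⟨((ha.prod hb).image fun z => z.1 + z.2).subset ?_,
      fun n => (((ha' n).prod (hb' n)).image fun z => z.1 + z.2).subset ?_⟩
    · rintro y ⟨u, hu, rfl⟩
      obtain ⟨v, w, rfl, hv, hw⟩ := key u hu
      exact ⟨(D.deg v, D.deg w), ⟨⟨v, hv, rfl⟩, ⟨w, hw, rfl⟩⟩, by simp [deg]⟩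
    · rintro u ⟨hu, hn⟩
      obtain ⟨v, w, rfl, hv, hw⟩ := key u hu
      exact ⟨(v, w), ⟨⟨hv, fun h => hn (pow_add_mem h)⟩,
        ⟨hw, fun h => hn (by rw [add_comm]; exact pow_add_mem h)⟩⟩, rfl⟩
  algebraMap_mem' := by
    classical
    intro t
    have key : ∀ u, (algebraMap k (D.Formal k) t) u ≠ 0 → u = 0 := by
      intro u h
      by_contra hc
      apply h
      rw [Algebra.algebraMap_eq_smul_one, Formal.smul_apply, Formal.one_apply, if_neg hc,
        mul_zero]
    refine ⟨(Set.finite_singleton (D.deg 0)).subset ?_,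
      fun n => (Set.finite_singleton 0).subset ?_⟩
    · rintro y ⟨u, hu, rfl⟩
      rw [key u hu]; rfl
    · rintro u ⟨hu, _⟩
      exact key u hu

section ring

variable (D : CoeffDatum P 𝔾) (k : Type*) [Field k]

/-- The coefficient of `r^u` in an element of `R`. -/
def coeff {D : CoeffDatum P 𝔾} {k : Type*} [Field k] (u : D.Mon) (a : D.R k) : k :=
  (a : D.Formal k) u

open Classical in
/-- The monomial `r^u`. -/
noncomputable def mono (u : D.Mon) : D.R k :=
  ⟨Pi.single (M := fun _ : D.Mon => k) u 1, by
    have key : ∀ v, (Pi.single (M := fun _ : D.Mon => k) u 1) v ≠ 0 → v = u := by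
      intro v h
      by_contra hc
      exact h (Pi.single_eq_of_ne hc _)
    refine ⟨(Set.finite_singleton (D.deg u)).subset ?_,
      fun n => (Set.finite_singleton u).subset ?_⟩
    · rintro y ⟨v, hv, rfl⟩
      rw [key v hv]; rfl
    · rintro v ⟨hv, _⟩
      exact key v hv⟩

/-- `R_y`. -/
def homog (y : G) : Set (D.R k) := {a | ∀ u, coeff u a ≠ 0 → D.deg u = y}

/-- The `𝔪`-adic filtration of `R`: the completion of the `n`-th power of the toric maximal
ideal. In particular `D.fil k 1` is the ideal `𝔪`. -/
def fil (n : ℕ) : Set (D.R k) := {a | ∀ u, coeff u a ≠ 0 → u ∈ D.pow n}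

/-- The elements of `R` which are finite sums of monomials, that is, the monoid algebra. -/
def poly : Set (D.R k) := {a | {u | coeff u a ≠ 0}.Finite}

variable {D k}

/-- `ψ` respects the `𝔪`-adic filtration. -/
def IsFiltered (ψ : D.R k ≃ₐ[k] D.R k) : Prop := ∀ n a, a ∈ D.fil k n ↔ ψ a ∈ D.fil k n

/-- `ψ ∈ Aut(R)`: the `𝔾`-graded algebra automorphisms respecting the `𝔪`-adic filtration. -/
def IsAut (ψ : D.R k ≃ₐ[k] D.R k) : Prop :=
  (∀ y, ∀ a ∈ D.homog k y, ψ a ∈ D.homog k y) ∧ IsFiltered ψ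

end ring

theorem finite_compl_pow (D : CoeffDatum P 𝔾) (hfg : D.monoid.FG) (n : ℕ) :
    {u | u ∉ D.pow n}.Finite := by
  obtain ⟨S, hS⟩ := ((AddMonoid.fg_iff_addSubmonoid_fg _).2 hfg : AddMonoid.FG D.Mon).fg_top
  have hE : ∀ n : ℕ, {u : D.Mon | ∃ s : Multiset D.Mon, s.card ≤ n ∧ (∀ v ∈ s, v ∈ S) ∧
      s.sum = u}.Finite := by
    intro n
    induction n with
    | zero =>
      refine (Set.finite_singleton 0).subset ?_
      rintro u ⟨s, h1, _, rfl⟩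
      have : s = 0 := by simpa using h1
      simp [this]
    | succ n ih =>
      refine (ih.union ((S.finite_toSet.prod ih).image fun z => z.1 + z.2)).subset ?_
      rintro u ⟨s, h1, h2, rfl⟩
      induction s using Multiset.induction with
      | empty => exact Or.inl ⟨0, by simp, by simp, rfl⟩
      | cons a t _ =>
        refine Or.inr ⟨(a, t.sum), ⟨h2 a (by simp), t, ?_, fun v hv => h2 v (by simp [hv]), rfl⟩,
          by simp⟩
        simpa using h1
  refine (hE n).subset fun u hu => ?_
  have hmem : u ∈ AddSubmonoid.closure (S : Set D.Mon) := by rw [hS]; trivial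
  obtain ⟨s, h1, h2⟩ := AddSubmonoid.exists_multiset_of_mem_closure hmem
  classical
  refine ⟨s.filter (· ≠ 0), ?_, fun v hv => h1 v (Multiset.mem_of_mem_filter hv), ?_⟩
  · by_contra! hc
    refine hu ⟨s.filter (· ≠ 0), hc.le, fun v hv => (Multiset.mem_filter.1 hv).2, ?_⟩
    rw [← h2]
    conv_rhs => rw [← Multiset.filter_add_not (· ≠ 0) s]
    simp [Multiset.filter_eq']
  · rw [← h2]
    conv_rhs => rw [← Multiset.filter_add_not (· ≠ 0) s]
    simp [Multiset.filter_eq']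

theorem coeff_mul_mono {D : CoeffDatum P 𝔾} {k : Type*} [Field k] (c : D.R k) (v w : D.Mon) :
    coeff (v + w) (c * D.mono k w) = coeff v c := by
  classical
  change ∑ z ∈ Finset.HasAntidiagonal.antidiagonal (v + w), (c : D.Formal k) z.1 *
    Pi.single (M := fun _ : D.Mon => k) w 1 z.2 = _
  rw [Finset.sum_eq_single (v, w)]
  · simp [coeff]
  · rintro ⟨x, y⟩ hz hne
    by_cases h : y = w
    · subst h
      exact absurd (by simpa using hz) hne
    · rw [Pi.single_eq_of_ne h, mul_zero]
  · simp

theorem exists_of_coeff_mul_mono {D : CoeffDatum P 𝔾} {k : Type*} [Field k] (c : D.R k)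
    (u w : D.Mon) (h : coeff u (c * D.mono k w) ≠ 0) : ∃ v, v + w = u := by
  classical
  change ∑ z ∈ Finset.HasAntidiagonal.antidiagonal u, (c : D.Formal k) z.1 *
    Pi.single (M := fun _ : D.Mon => k) w 1 z.2 ≠ 0 at h
  obtain ⟨⟨x, y⟩, hz, hne⟩ := Finset.exists_ne_zero_of_sum_ne_zero h
  have : y = w := by
    by_contra hc
    exact hne (by rw [Pi.single_eq_of_ne hc, mul_zero])
  subst this
  exact ⟨x, by simpa using hz⟩

variable [DecidableEq P]

/-- The basis vector `u_p` of `ℤ^P`, when it lies in the monoid. -/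
def basis {D : CoeffDatum P 𝔾} (h : ∀ p, Pi.single p 1 ∈ D.monoid) (p : P) : D.Mon :=
  ⟨Pi.single p 1, h p⟩

/-- `R` is nice. The field `gen` asks that `r_p` generates the degree `f(u_p)` part of the toric
maximal ideal of the monoid algebra over its degree `0` part, the field `gen_hat` asks the same
for the completions. (If the monoid is finitely generated, then `gen` implies `gen_hat`.) -/
structure IsNice (D : CoeffDatum P 𝔾) (k : Type*) [Field k] : Prop where
  mem : ∀ p, Pi.single p 1 ∈ D.monoid
  gen : ∀ p, ∀ a ∈ D.fil k 1 ∩ D.poly k ∩ D.homog k (D.deg (basis mem p)),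
    ∃ c ∈ D.poly k ∩ D.homog k 0, a = c * D.mono k (basis mem p)
  gen_hat : ∀ p, ∀ a ∈ D.fil k 1 ∩ D.homog k (D.deg (basis mem p)),
    ∃ c ∈ D.homog k 0, a = c * D.mono k (basis mem p)
  not_mem_sq : ∀ p, D.mono k (basis mem p) ∉ D.fil k 2

/-- If the monoid is finitely generated (e.g. if the cone is rational polyhedral), then the
condition on the completions is automatic. -/
theorem IsNice.of_fg (D : CoeffDatum P 𝔾) (k : Type*) [Field k] (hfg : D.monoid.FG)
    (mem : ∀ p, Pi.single p 1 ∈ D.monoid)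
    (gen : ∀ p, ∀ a ∈ D.fil k 1 ∩ D.poly k ∩ D.homog k (D.deg (basis mem p)),
      ∃ c ∈ D.poly k ∩ D.homog k 0, a = c * D.mono k (basis mem p))
    (not_mem_sq : ∀ p, D.mono k (basis mem p) ∉ D.fil k 2) : D.IsNice k := by
  refine ⟨mem, gen, ?_, not_mem_sq⟩
  classical
  rintro p a ⟨ha1, ha2⟩
  have hdeg : ∀ v : D.Mon, coeff (v + basis mem p) a ≠ 0 → D.deg v = 0 := by
    intro v hv
    have := ha2 _ hv
    simpa [deg] using this
  have hone : ∀ u v : D.Mon, coeff v (D.mono k u) ≠ 0 → v = u := by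
    intro u v h
    by_contra hc
    exact h (Pi.single_eq_of_ne (M := fun _ : D.Mon => k) hc _)
  have hdiv : ∀ u, coeff u a ≠ 0 → ∃ v, v + basis mem p = u := by
    intro u hu
    obtain ⟨c, -, hc⟩ := gen p (D.mono k u)
      ⟨⟨fun v hv => by rw [hone u v hv]; exact ha1 u hu,
        (Set.finite_singleton u).subset fun v hv => hone u v hv⟩,
        fun v hv => by rw [hone u v hv]; exact ha2 u hu⟩
    refine exists_of_coeff_mul_mono c u (basis mem p) ?_
    rw [← hc]
    change Pi.single (M := fun _ : D.Mon => k) u 1 u ≠ 0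
    simp
  refine ⟨⟨fun v => coeff (v + basis mem p) a, ?_, fun n => ?_⟩, fun v hv => hdeg v hv, ?_⟩
  · refine (Set.finite_singleton 0).subset ?_
    rintro y ⟨v, hv, rfl⟩
    exact hdeg v hv
  · exact (D.finite_compl_pow hfg n).subset fun v hv => hv.2
  · refine Subtype.ext (Formal.ext fun u => ?_)
    change coeff u a = coeff u (_ * D.mono k (basis mem p))
    by_cases h : ∃ v, v + basis mem p = u
    · obtain ⟨v, rfl⟩ := h
      exact Eq.trans (by rfl) (coeff_mul_mono (k := k) _ v _).symm
    · have h1 : coeff u a = 0 := by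
        by_contra hc
        exact h (hdiv u hc)
      refine Eq.trans (show coeff u a = 0 from h1) ?_
      symm
      by_contra hc
      exact h (exists_of_coeff_mul_mono (k := k) _ u _ hc)

/-- An action of `Γ` on `R` by automorphisms which respect the filtration, are graded relative to
the action on `G`, and satisfy `g · r_p = ± r_{g · p}`. -/
structure IsSpecialAction {D : CoeffDatum P 𝔾} {k : Type*} [Field k] (hD : D.IsNice k)
    {Γ : Type*} [Group Γ] [DistribMulAction Γ G] [MulAction Γ P]
    (a : Γ →* (D.R k ≃ₐ[k] D.R k)) : Prop where
  filtered : ∀ g, IsFiltered (a g)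
  graded : ∀ g y, ∀ x ∈ D.homog k y, a g x ∈ D.homog k (g • y)
  special : ∀ g p, a g (D.mono k (basis hD.mem p)) = D.mono k (basis hD.mem (g • p)) ∨
    a g (D.mono k (basis hD.mem p)) = -D.mono k (basis hD.mem (g • p))

/-! ### Completed tensor products with `R` -/

section hat

variable (D : CoeffDatum P 𝔾) {k : Type*} [Field k] {V : Type*} [AddCommGroup V] [Module k V]

/-- The degree `z` part of the `𝔾`-graded completion of `V ⊗ R`, where `V` is graded by the
submodules `gr y`: the formal sums `∑ r^u a_u` with `a_u` of degree `z - deg r^u`, having finitely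
many non-zero terms outside each power of the toric maximal ideal. -/
def Hat (gr : G → Submodule k V) (z : G) : Set (D.Mon → V) :=
  {a | (∀ u, a u ∈ gr (z - D.deg u)) ∧ ∀ n, {u | a u ≠ 0 ∧ u ∉ D.pow n}.Finite}

/-- The degree `z` part of the completion of `V ⊗ 𝔪`. -/
def HatM (gr : G → Submodule k V) (z : G) : Set (D.Mon → V) := {a | a ∈ D.Hat gr z ∧ a 0 = 0}

/-- The degree `z` part of `V ⊗ 𝔪̃` (no completion), `𝔪̃` the toric maximal ideal of the monoid
algebra. -/
def PolyM (gr : G → Submodule k V) (z : G) : Set (D.Mon → V) :=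
  {a | a ∈ D.HatM gr z ∧ {u | a u ≠ 0}.Finite}

variable {D}

/-- The map `φ ⊗ ψ : ∑ r^u a_u ↦ ∑ ψ(r^u) φ(a_u)`. (For `ψ` respecting the filtration, each
coefficient is a finite sum.) -/
noncomputable def tensorMap (ψ : D.R k ≃ₐ[k] D.R k) (φ : V → V) (a : D.Mon → V) : D.Mon → V :=
  fun v => ∑ᶠ u, coeff v (ψ (D.mono k u)) • φ (a u)

/-- Multiplication of a formal sum by an element of `R`. -/
noncomputable def hatSMul (c : D.R k) (a : D.Mon → V) : D.Mon → V :=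
  fun u => ∑ v ∈ Finset.HasAntidiagonal.antidiagonal u, coeff v.1 c • a v.2

end hat

/-! ### First-order deformation classes and the cohomology `H¹(V ⊗ 𝔪̃)^Γ` -/

/-- The data of a graded complex with operators indexed by `Γ`, as far as it is used to form the
cohomology of `V ⊗ 𝔪̃` in degree `1`: the grading, the differentials `d0` and `d1` out of total
degree `0` and `1` (elements of `V ⊗ R` of these degrees have coefficients of even, respectively
odd degree, and the formula for the differential may depend on this parity), and the operators. -/
structure EqComplex (k Γ G V : Type*) [Field k] [AddCommGroup V] [Module k V] where
  gr : G → Submodule k V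
  d0 : V → V
  d1 : V → V
  act : Γ → V → V

section classes

variable {D : CoeffDatum P 𝔾} {k : Type*} [Field k] {V : Type*} [AddCommGroup V] [Module k V]
  {Γ : Type*} [Group Γ]

/-- `x` represents a cocycle of degree `1` in `V ⊗ (𝔪̃ / I)`, where `I` is the monomial ideal
spanned by the set of monomials `S`. -/
def IsCocycle (C : EqComplex k Γ G V) (S : Set D.Mon) (x : D.Mon → V) : Prop :=
  x ∈ D.PolyM C.gr (𝔾.ι 1) ∧ ∀ u ∉ S, C.d1 (x u) = 0

/-- `x` represents a coboundary of degree `1` in `V ⊗ (𝔪̃ / I)`. -/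
def IsCoboundary (C : EqComplex k Γ G V) (S : Set D.Mon) (x : D.Mon → V) : Prop :=
  ∃ y ∈ D.PolyM C.gr 0, ∀ u ∉ S, x u = C.d0 (y u)

/-- The class of `x` in `H¹(V ⊗ (𝔪̃ / I))` is invariant under `Γ`. -/
def IsInvClass (a : Γ →* (D.R k ≃ₐ[k] D.R k)) (C : EqComplex k Γ G V) (S : Set D.Mon)
    (x : D.Mon → V) : Prop :=
  ∀ g, IsCoboundary C S (tensorMap (a g) (C.act g) x - x)

open Classical in
/-- The cochain `r_p α_{u_p}`, which represents the first-order deformation class `r_p a_p`. -/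
noncomputable def firstOrder (h : ∀ p, Pi.single p 1 ∈ D.monoid) (α : D.Mon → V) (p : P) :
    D.Mon → V :=
  Pi.single (M := fun _ : D.Mon => V) (basis h p) (α (basis h p))

/-- The class of `x` in `H¹(V ⊗ (𝔪̃ / I))` lies in the `R̃_0`-span of the first-order deformation
classes of `α`. -/
def InSpan (h : ∀ p, Pi.single p 1 ∈ D.monoid) (C : EqComplex k Γ G V) (S : Set D.Mon)
    (α x : D.Mon → V) : Prop :=
  ∃ c : P → D.R k, (∀ p, c p ∈ D.poly k ∩ D.homog k 0) ∧
    IsCoboundary C S (x - ∑ p, hatSMul (c p) (firstOrder h α p))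

/-- `H¹(V ⊗ (𝔪̃ / I))^Γ` is contained in the `R̃_0`-span of the first-order deformation classes
of `α`. -/
def SpansInv (h : ∀ p, Pi.single p 1 ∈ D.monoid) (a : Γ →* (D.R k ≃ₐ[k] D.R k))
    (C : EqComplex k Γ G V) (S : Set D.Mon) (α : D.Mon → V) : Prop :=
  ∀ x, IsCocycle C S x → IsInvClass a C S x → InSpan h C S α x

/-- The class `a_p = [α_{u_p}]` vanishes in `H^{1 - f(u_p)}(V)`. -/
def ClassIsZero (h : ∀ p, Pi.single p 1 ∈ D.monoid) (C : EqComplex k Γ G V) (α : D.Mon → V)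
    (p : P) : Prop :=
  ∃ y ∈ C.gr (0 - D.deg (basis h p)), C.d0 y = α (basis h p)

/-- `α` is invariant under the simultaneous action of `Γ` on `V` and `R`. -/
def IsInvElt (a : Γ →* (D.R k ≃ₐ[k] D.R k)) (C : EqComplex k Γ G V) (α : D.Mon → V) : Prop :=
  ∀ g, tensorMap (a g) (C.act g) α = α

/-- `R`-completeness with respect to a class `T` of objects, where `rel ψ β` says that `β` is
equivalent to the pullback by `ψ` of the given object. -/
def IsComplete {X : Type*} (T : Set X) (rel : (D.R k ≃ₐ[k] D.R k) → X → Prop) : Prop :=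
  ∀ β ∈ T, ∃ ψ, IsAut ψ ∧ rel ψ β

/-- `R`-versality: `R`-completeness, and the map induced by `ψ` on `𝔪 / 𝔪²` is determined by
`β`. -/
def IsVersal {X : Type*} (T : Set X) (rel : (D.R k ≃ₐ[k] D.R k) → X → Prop) : Prop :=
  IsComplete T rel ∧ ∀ β ∈ T, ∀ ψ ψ', IsAut ψ → IsAut ψ' → rel ψ β → rel ψ' β →
    ∀ x ∈ D.fil k 1, ψ x - ψ' x ∈ D.fil k 2

end classes

end CoeffDatum

/-- The sign `(-1)^s`. -/
def sgn (s : ZMod 2) : ℤ := (-1) ^ s.val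

/-! ### Graded Lie algebras and the Maurer–Cartan equation -/

/-- A differential `𝔾`-graded Lie algebra structure on the vector space `L`. -/
structure DGLA (k : Type*) [Field k] {G : Type*} [AddCommGroup G] [DecidableEq G]
    (𝔾 : GradingDatum G) (L : Type*) [AddCommGroup L] [Module k L] where
  gr : G → Submodule k L
  isInternal : DirectSum.IsInternal gr
  d : L →ₗ[k] L
  d_mem : ∀ y, ∀ a ∈ gr y, d a ∈ gr (y + 𝔾.ι 1)
  d_d : ∀ a, d (d a) = 0
  br : L →ₗ[k] L →ₗ[k] L
  br_mem : ∀ y z, ∀ a ∈ gr y, ∀ b ∈ gr z, br a b ∈ gr (y + z)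
  br_symm : ∀ y z, ∀ a ∈ gr y, ∀ b ∈ gr z, br a b = -(sgn (𝔾.par y * 𝔾.par z) • br b a)
  d_br : ∀ y z, ∀ a ∈ gr y, ∀ b ∈ gr z, d (br a b) = br (d a) b + sgn (𝔾.par y) • br a (d b)
  jacobi : ∀ y z, ∀ a ∈ gr y, ∀ b ∈ gr z, ∀ c,
    br a (br b c) = br (br a b) c + sgn (𝔾.par y * 𝔾.par z) • br b (br a c)

namespace DGLA

open CoeffDatum

variable {P : Type*} [Fintype P] {G : Type*} [AddCommGroup G] [DecidableEq G]
  {𝔾 : GradingDatum G} {k : Type*} [Field k] {L : Type*} [AddCommGroup L] [Module k L]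

/-- `Γ` acts on the differential graded Lie algebra, relative to its action on `G`. -/
structure IsAction (𝔤 : DGLA k 𝔾 L) {Γ : Type*} [Group Γ] [DistribMulAction Γ G]
    (ρ : Representation k Γ L) : Prop where
  mem : ∀ g y, ∀ a ∈ 𝔤.gr y, ρ g a ∈ 𝔤.gr (g • y)
  d : ∀ g a, ρ g (𝔤.d a) = 𝔤.d (ρ g a)
  br : ∀ g a b, ρ g (𝔤.br a b) = 𝔤.br (ρ g a) (ρ g b)

/-- The underlying complex, with the operators of `ρ`. -/
def toEqComplex (𝔤 : DGLA k 𝔾 L) {Γ : Type*} [Group Γ] (ρ : Representation k Γ L) :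
    EqComplex k Γ G L where
  gr := 𝔤.gr
  d0 := 𝔤.d
  d1 := 𝔤.d
  act g := ρ g

variable (D : CoeffDatum P 𝔾)

/-- The bracket of the completion of `L ⊗ R`. -/
noncomputable def hatBr (𝔤 : DGLA k 𝔾 L) (a b : D.Mon → L) : D.Mon → L :=
  fun u => ∑ v ∈ Finset.HasAntidiagonal.antidiagonal u, 𝔤.br (a v.1) (b v.2)

/-- The solutions of the Maurer–Cartan equation `∂ α + ½ [α, α] = 0` over `R`. -/
def MC (𝔤 : DGLA k 𝔾 L) : Set (D.Mon → L) :=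
  {α | α ∈ D.HatM 𝔤.gr (𝔾.ι 1) ∧
    ∀ u, 𝔤.d (α u) + (2 : k)⁻¹ • hatBr D 𝔤 α α u = 0}

/-- The derivatives at `t = 0` of the flow of the vector field `α ↦ -∂γ + [γ, α]`. -/
noncomputable def gaugeIter (𝔤 : DGLA k 𝔾 L) (γ α : D.Mon → L) : ℕ → D.Mon → L
  | 0 => α
  | 1 => fun u => -𝔤.d (γ u) + hatBr D 𝔤 γ α u
  | n + 2 => hatBr D 𝔤 γ (gaugeIter 𝔤 γ α (n + 1))

/-- The gauge action `e^γ · α`: the Taylor series at time `1` of the solution of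
`dα_t/dt = -∂γ + [γ, α_t]`, `α_0 = α`. (Each coefficient is a finite sum.) -/
noncomputable def gauge (𝔤 : DGLA k 𝔾 L) (γ α : D.Mon → L) : D.Mon → L :=
  fun u => ∑ᶠ n : ℕ, ((n.factorial : k)⁻¹) • gaugeIter D 𝔤 γ α n u

/-- Gauge equivalence `α ∼ β`. -/
def GaugeEquiv (𝔤 : DGLA k 𝔾 L) (α β : D.Mon → L) : Prop :=
  ∃ γ ∈ D.HatM 𝔤.gr 0, β = gauge D 𝔤 γ α

variable {D} [DecidableEq P] {Γ : Type*} [Group Γ]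

/-- `MC'(R)^Γ`: the `Γ`-invariant Maurer–Cartan elements such that the span of the first-order
deformation classes contains `H¹(L ⊗ 𝔪̃/𝔪̃²)^Γ`. -/
def MCprime (𝔤 : DGLA k 𝔾 L) (ρ : Representation k Γ L) (h : ∀ p, Pi.single p 1 ∈ D.monoid)
    (a : Γ →* (D.R k ≃ₐ[k] D.R k)) : Set (D.Mon → L) :=
  {β | β ∈ MC D 𝔤 ∧ IsInvElt a (𝔤.toEqComplex ρ) β ∧
    SpansInv h a (𝔤.toEqComplex ρ) (D.pow 2) β}

/-- `β ∼ ψ^* α`. -/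
def PullbackEquiv (𝔤 : DGLA k 𝔾 L) (α : D.Mon → L) (ψ : D.R k ≃ₐ[k] D.R k)
    (β : D.Mon → L) : Prop :=
  GaugeEquiv D 𝔤 β (tensorMap ψ id α)

end DGLA

/-! ### `A∞` algebras -/

/-- Hochschild cochains of `A` are encoded as functions `η` of a list of inputs. -/
abbrev Cochain (A : Type*) := List A → A

namespace Ainf

open CoeffDatum

variable {P : Type*} [Fintype P] {G : Type*} [AddCommGroup G] [DecidableEq G]
  (𝔾 : GradingDatum G) {k : Type*} [Field k] {A : Type*} [AddCommGroup A] [Module k A]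
  (gr : G → Submodule k A)

/-- The degree `y` part `CC^y(A)'` of the shifted Hochschild cochains (so the `A∞` structure is in
degree `1`): functions of lists which are multilinear on lists of each length, and which are
homogeneous of degree `y` for the shifted grading `A' = A[1]`, in which an element of `A_x` has
degree `x - 1`. -/
def CC (y : G) : Submodule k (Cochain A) where
  carrier := {η | (∀ l₁ l₂ : List A, IsLinearMap k fun a => η (l₁ ++ a :: l₂)) ∧
    ∀ (xs : List G) (l : List A), List.Forall₂ (fun x a => a ∈ gr x) xs l →
      η l ∈ gr (y + (xs.map fun x => x - 𝔾.ι 1).sum + 𝔾.ι 1)}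
  zero_mem' := ⟨fun _ _ => ⟨by simp, by simp⟩, fun _ _ _ => by simp⟩
  add_mem' := by
    rintro η ξ ⟨h1, h2⟩ ⟨h3, h4⟩
    refine ⟨fun l₁ l₂ => ⟨fun a b => ?_, fun c a => ?_⟩,
      fun xs l h => Submodule.add_mem _ (h2 xs l h) (h4 xs l h)⟩
    · simp only [Pi.add_apply, (h1 l₁ l₂).map_add, (h3 l₁ l₂).map_add]; abel
    · simp only [Pi.add_apply, (h1 l₁ l₂).map_smul, (h3 l₁ l₂).map_smul, smul_add]
  smul_mem' := by
    rintro t η ⟨h1, h2⟩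
    refine ⟨fun l₁ l₂ => ⟨fun a b => ?_, fun c a => ?_⟩,
      fun xs l h => Submodule.smul_mem _ _ (h2 xs l h)⟩
    · simp only [Pi.smul_apply, (h1 l₁ l₂).map_add, smul_add]
    · simp only [Pi.smul_apply, (h1 l₁ l₂).map_smul, smul_comm t c]

section signs

variable [DirectSum.Decomposition gr]

/-- The projection of `A` to the elements of shifted parity `s`. -/
noncomputable def parPart (s : ZMod 2) : A →ₗ[k] A :=
  (DirectSum.toModule k G A fun x => if 𝔾.par x + 1 = s then (gr x).subtype else 0) ∘ₗ
    (DirectSum.decomposeLinearEquiv gr).toLinearMap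

/-- The Koszul sign of moving something of parity `s` past `a`: this is `a ↦ (-1)^{s |a|'} a` on
homogeneous elements, where `|a|'` is the shifted parity. -/
noncomputable def koszul (s : ZMod 2) : A →ₗ[k] A := parPart 𝔾 gr 0 + sgn s • parPart 𝔾 gr 1

/-- The Gerstenhaber product `φ ∘ ψ`, where `ψ` has (shifted) parity `s`: the sum of the terms
`± φ(a_1, …, a_i, ψ(a_{i+1}, …, a_{i+j}), …, a_n)`, with the Koszul sign of moving `ψ` past
`a_1, …, a_i`. -/
noncomputable def circ (s : ZMod 2) (φ ψ : Cochain A) : Cochain A := fun l =>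
  ∑ i ∈ Finset.range (l.length + 1), ∑ j ∈ Finset.range (l.length - i + 1),
    φ ((l.take i).map (koszul 𝔾 gr s) ++ ψ ((l.drop i).take j) :: l.drop (i + j))

/-- The Hochschild differential `[μ, η] = μ ∘ η - (-1)^s η ∘ μ` of a cochain `η` of (shifted)
parity `s`. -/
noncomputable def hochD (μ : Cochain A) (s : ZMod 2) (η : Cochain A) : Cochain A :=
  circ 𝔾 gr s μ η - sgn s • circ 𝔾 gr 1 η μ

/-- `μ` is an `A∞` structure on the `𝔾`-graded vector space `A` (without curvature). -/
structure IsAinf (μ : Cochain A) : Prop where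
  mem : μ ∈ CC 𝔾 gr (𝔾.ι 1)
  rel : circ 𝔾 gr 1 μ μ = 0
  uncurved : μ [] = 0

/-- Auxiliary recursion for `op`: `acc` holds the inputs already read, in reversed order, and `s`
is the sum of their parities. -/
noncomputable def opAux (η : Cochain A) : List A → ZMod 2 → List A → A
  | acc, _, [] => η acc
  | acc, s, a :: l => opAux η (parPart 𝔾 gr 0 a :: acc) s l +
      sgn s • opAux η (parPart 𝔾 gr 1 a :: acc) (s + 1) l

/-- The opposite cochain: `η_op(a_1, …, a_n) = (-1)^† η(a_n, …, a_1)` for homogeneous inputs,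
where `†` is the sum of `|a_i|' |a_j|'` over `i < j`. -/
noncomputable def op (η : Cochain A) : Cochain A := opAux 𝔾 gr η [] 0

/-- The action of the signed group `(Γ, σ)` on Hochschild cochains: even elements act by
`η ↦ g · η(g⁻¹ a_1, …, g⁻¹ a_n)`, odd elements by `η ↦ g · η_op(g⁻¹ a_1, …, g⁻¹ a_n)`. -/
noncomputable def signedAct {Γ : Type*} [Group Γ] (σ : Γ →* Multiplicative (ZMod 2))
    (ρ : Representation k Γ A) (g : Γ) (η : Cochain A) : Cochain A := fun l =>
  ρ g ((if σ g = 1 then η else op 𝔾 gr η) (l.map (ρ g⁻¹)))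

/-- The signed group `(Γ, σ)` acts on the `A∞` algebra `(A, μ)`, relative to the action of `Γ` on
`G`: even elements act by strict automorphisms, odd elements by strict isomorphisms to the opposite
algebra. -/
structure IsSignedAction (μ : Cochain A) {Γ : Type*} [Group Γ] [DistribMulAction Γ G]
    (σ : Γ →* Multiplicative (ZMod 2)) (ρ : Representation k Γ A) : Prop where
  mem : ∀ g y, ∀ a ∈ gr y, ρ g a ∈ gr (g • y)
  map_μ : ∀ g, signedAct 𝔾 gr σ ρ g μ = μ

/-- The Hochschild complex (with the shifted grading), with the operators of a signed group. -/
noncomputable def hochComplex (μ : Cochain A) {Γ : Type*} [Group Γ]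
    (σ : Γ →* Multiplicative (ZMod 2)) (ρ : Representation k Γ A) :
    EqComplex k Γ G (Cochain A) where
  gr := CC 𝔾 gr
  d0 := hochD 𝔾 gr μ 0
  d1 := hochD 𝔾 gr μ 1
  act := signedAct 𝔾 gr σ ρ

/-- The deformations of `(A, μ)` over `R`: (possibly curved) `R`-linear `A∞` structures
`m = ∑ r^u m_u` on the completion of `A ⊗ R` with `m = μ` modulo `𝔪`. -/
def Deformations {𝔾 : GradingDatum G} (D : CoeffDatum P 𝔾) (gr : G → Submodule k A)
    [DirectSum.Decomposition gr] (μ : Cochain A) : Set (D.Mon → Cochain A) :=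
  {m | m ∈ D.Hat (CC 𝔾 gr) (𝔾.ι 1) ∧ m 0 = μ ∧
    ∀ u, ∑ v ∈ Finset.HasAntidiagonal.antidiagonal u, circ 𝔾 gr 1 (m v.1) (m v.2) = 0}

/-- The identity, as a cochain. -/
def idCochain : Cochain A
  | [a] => a
  | _ => 0

/-- `F = ∑ r^u F_u` is a (possibly curved) `R`-linear `A∞` homomorphism, equal to the identity
modulo `𝔪`, from the deformation `m` to the deformation `m'`, that is
`∑ m'(F(a_1, …), …, F(…, a_n)) = ∑ ± F(a_1, …, m(…), …, a_n)`.
In the sum on the left the list of inputs is cut into consecutive, possibly empty, blocks; since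
`F^0` is of order `𝔪`, each coefficient is a finite sum. -/
structure IsHom {𝔾 : GradingDatum G} {D : CoeffDatum P 𝔾} (gr : G → Submodule k A)
    [DirectSum.Decomposition gr] (m m' F : D.Mon → Cochain A) : Prop where
  mem : F ∈ D.Hat (CC 𝔾 gr) 0
  zero : F 0 = idCochain
  rel : ∀ (u : D.Mon) (l : List A),
    ∑ᶠ q : {q : D.Mon × List (List A × D.Mon) //
        q.1 + (q.2.map Prod.snd).sum = u ∧ (q.2.map Prod.fst).flatten = l},
      m' q.1.1 (q.1.2.map fun b => F b.2 b.1) =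
    ∑ v ∈ Finset.HasAntidiagonal.antidiagonal u, circ 𝔾 gr 1 (F v.1) (m v.2) l

/-- There is a (possibly curved) `A∞` homomorphism `F : m ⇢ ψ^* m'` which is the identity
modulo `𝔪`; here `m'` is fixed and `m` varies. -/
def PullbackHom {𝔾 : GradingDatum G} {D : CoeffDatum P 𝔾} (gr : G → Submodule k A)
    [DirectSum.Decomposition gr] (m' : D.Mon → Cochain A) (ψ : D.R k ≃ₐ[k] D.R k)
    (m : D.Mon → Cochain A) : Prop :=
  ∃ F, IsHom gr m (tensorMap ψ id m') F

/-- The `(Γ, σ)`-equivariant deformations such that the span of the first-order deformation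
classes contains `HH²(A, A ⊗ 𝔪̃/𝔪̃²)^Γ`. -/
def DeformationsPrime [DecidableEq P] {𝔾 : GradingDatum G} {D : CoeffDatum P 𝔾}
    (gr : G → Submodule k A) [DirectSum.Decomposition gr] (μ : Cochain A) {Γ : Type*} [Group Γ]
    (σ : Γ →* Multiplicative (ZMod 2)) (ρ : Representation k Γ A)
    (h : ∀ p, Pi.single p 1 ∈ D.monoid) (a : Γ →* (D.R k ≃ₐ[k] D.R k)) :
    Set (D.Mon → Cochain A) :=
  {m | m ∈ Deformations D gr μ ∧ IsInvElt a (hochComplex 𝔾 gr μ σ ρ) m ∧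
    SpansInv h a (hochComplex 𝔾 gr μ σ ρ) (D.pow 2) m}

end signs

end Ainf

end EqVers

set_option linter.unusedSectionVars false

/-! Write `c^u` for the product of the `c_p ^ u_p`. Because `R` is nice, an element of `Aut(R)`
multiplies each `r_p` by a unit `c_p` of degree zero, and then each `r^u` by `c^u`
(`IsAut.exists_units`). Conversely every family of such units defines an automorphism (`rescale`).
Completeness in part (1) therefore asks for `γ` and `c` such that `e^γ · β` equals the pullback of
`α` by `c`.

This is solved by successive approximation. Suppose the difference `E` of the two sides vanishes
outside the `s`-th step of a filtration of the monoid. Subtracting the two Maurer–Cartan equations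
shows that `∂E` vanishes modulo the next step (`d_sub_eq_zero`). The layer of `E` between the two
steps is a finite sum of monomials, so it is an invariant cocycle in `𝔤 ⊗ 𝔪̃`, and by hypothesis it
equals `∂y + ∑ e_p r_p α_{u_p}`. In characteristic zero `y` and `e` can be averaged over `Γ`
(`exists_correction`). To first order, adding `y` to `γ` changes the gauge transform by `-∂y`
(`suppIn_gauge_sub`), and adding `e_p` to `c_p` changes the pullback by `∑ e_p r_p α_{u_p}`
(`suppIn_pull_sub`), so the error moves one step deeper (`IsApprox.step`). The process starts by
matching the coefficients of the `r_p` up to coboundaries and non-zero scalars (`exists_scalars`).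
The scalars can be taken non-zero because the classes of `β` span the invariant first-order classes
too.

The delicate point is the filtration. Knowing that `r^v r_p` is deep in the `𝔪`-adic filtration
gives no immediate bound on the depth of `r^v`, hence none on `r^v r^z` for other monomials `r^z`.
The filtration `filt` has the required bound built in. Niceness of the completed ring shows that it
is cofinal with the `𝔪`-adic one and that the units converge in `R` (`exists_pow_of_add_basis`,
`exists_filt_subset`).

For versality, only the coefficients of the irreducible monomials `r_p` matter. There the pullback
multiplies `α_{u_p}` by the constant term of `c_p`, and equivalences alter it by coboundaries. If
`a_p ≠ 0`, this constant term is determined, and the constant terms determine the map on `𝔪/𝔪²`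
(`IsComplete.isVersal`).

Part (2) is reduced to part (1). The Gerstenhaber product satisfies the graded pre-Lie identity, so
Hochschild cochains form a differential graded Lie algebra (`hochDGLA`) on which the signed group
acts, and the positive-order part of a deformation is a Maurer–Cartan element. A gauge equivalence
by `γ` becomes an `A∞` homomorphism by exponentiating the insertion of `γ` and applying the result
to the identity cochain. The insertion obeys a Leibniz rule for cutting lists, so its exponential is
multiplicative over blocks (`expInsert_eq`), and commuting it past insertions of the structure
produces the iterated brackets (`adIter_sum`). -/

namespace EqVers

namespace CoeffDatum

/-! ### The monoid of exponents and its powers -/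

section monoid

variable {P : Type*} [Fintype P] {G : Type*} [AddCommGroup G] {𝔾 : GradingDatum G}
  {D : CoeffDatum P 𝔾}

theorem deg_zero : D.deg 0 = 0 := by simp [deg]

theorem deg_add (u v : D.Mon) : D.deg (u + v) = D.deg u + D.deg v := by simp [deg]

theorem par_deg (u : D.Mon) : 𝔾.par (D.deg u) = 0 := D.f_even u

theorem par_ι_one : 𝔾.par (𝔾.ι 1) = 1 := by
  obtain ⟨n, hn⟩ := 𝔾.surj 1
  by_contra h
  have h0 : 𝔾.par (𝔾.ι 1) = 0 := by
    generalize 𝔾.par (𝔾.ι 1) = x at h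
    revert h; revert x; decide
  have : (𝔾.par.comp 𝔾.ι) n = 0 := by
    have e : 𝔾.par.comp 𝔾.ι = 0 := by
      ext
      simpa using h0
    rw [e]; rfl
  rw [this] at hn
  exact absurd hn (by decide)

/-- If `u ≠ 0`, the pairs `(n • u, n • v)` would be infinitely many decompositions of `0`, whereas
the cone has an interior and decompositions are finite in number. -/
theorem Mon.add_eq_zero {u v : D.Mon} (h : u + v = 0) : u = 0 := by
  by_contra hu
  have hinj : Function.Injective fun n : ℕ => (n • u, n • v) := by
    intro m n hmn
    have h1 : m • u = n • u := congrArg Prod.fst hmn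
    by_contra hne
    apply hu
    obtain ⟨p, hp⟩ : ∃ p, (u : P → ℤ) p ≠ 0 := by
      by_contra! hc
      exact hu (Subtype.ext (funext hc))
    exfalso
    have h2 : (m : ℤ) * (u : P → ℤ) p = n * (u : P → ℤ) p := by
      have := congrFun (congrArg Subtype.val h1) p
      simpa using this
    exact hne (by exact_mod_cast mul_right_cancel₀ hp h2)
  refine Set.infinite_of_injective_forall_mem hinj (s := {w : D.Mon × D.Mon | w.1 + w.2 = 0}) ?_
    (D.finite_divisors 0)
  intro n
  change n • u + n • v = 0
  rw [← nsmul_add, h, nsmul_zero]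

theorem Mon.add_eq_zero' {u v : D.Mon} (h : u + v = 0) : v = 0 :=
  Mon.add_eq_zero (by rwa [add_comm])

theorem pow_zero_mem (u : D.Mon) : u ∈ D.pow 0 := by
  by_cases h : u = 0
  · exact ⟨0, by simp, by simp, by simp [h]⟩
  · exact ⟨{u}, by simp, by simpa using h, by simp⟩

theorem add_mem_pow {m n : ℕ} {u v : D.Mon} (hu : u ∈ D.pow m) (hv : v ∈ D.pow n) :
    u + v ∈ D.pow (m + n) := by
  obtain ⟨s, h1, h2, rfl⟩ := hu
  obtain ⟨t, h3, h4, rfl⟩ := hv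
  refine ⟨s + t, by simp; omega, fun v hv => ?_, by simp⟩
  rcases Multiset.mem_add.1 hv with h | h
  exacts [h2 v h, h4 v h]

theorem pow_antitone {m n : ℕ} (h : m ≤ n) : D.pow n ⊆ D.pow m := by
  rintro u ⟨s, h1, h2⟩
  exact ⟨s, h.trans h1, h2⟩

theorem mem_pow_one {u : D.Mon} : u ∈ D.pow 1 ↔ u ≠ 0 := by
  constructor
  · rintro ⟨s, h1, h2, rfl⟩ h
    obtain ⟨a, ha⟩ := Multiset.card_pos_iff_exists_mem.1 (by omega : 0 < s.card)
    obtain ⟨t, rfl⟩ := Multiset.exists_cons_of_mem ha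
    rw [Multiset.sum_cons] at h
    exact h2 a ha (Mon.add_eq_zero h)
  · intro h
    exact ⟨{u}, by simp, by simpa using h, by simp⟩

theorem add_mem_pow_two {u v : D.Mon} (hu : u ≠ 0) (hv : v ≠ 0) : u + v ∈ D.pow 2 :=
  add_mem_pow (mem_pow_one.2 hu) (mem_pow_one.2 hv)

theorem mem_pow_succ {n : ℕ} {u : D.Mon} :
    u ∈ D.pow (n + 1) ↔ ∃ a v, a ≠ 0 ∧ v ∈ D.pow n ∧ v + a = u := by
  constructor
  · rintro ⟨s, h1, h2, rfl⟩
    obtain ⟨a, ha⟩ := Multiset.card_pos_iff_exists_mem.1 (by omega : 0 < s.card)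
    obtain ⟨t, rfl⟩ := Multiset.exists_cons_of_mem ha
    refine ⟨a, t.sum, h2 a ha, ⟨t, by simpa using h1, fun v hv => h2 v (by simp [hv]), rfl⟩, ?_⟩
    rw [Multiset.sum_cons, add_comm]
  · rintro ⟨a, v, ha, hv, rfl⟩
    exact add_mem_pow hv (mem_pow_one.2 ha)

/-- Multiplying by a further non-zero monomial `a` strictly increases the number of decompositions:
those of `v` embed by adding `a` to the second factor, and `(v + a, 0)` is missed. Hence a monomial
has bounded order, and the filtration by powers is separated. -/
theorem lt_card_antidiagonal {n : ℕ} : ∀ {u : D.Mon}, u ∈ D.pow n →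
    n < (Finset.HasAntidiagonal.antidiagonal u).card := by
  induction n with
  | zero =>
    intro u _
    exact Finset.card_pos.2 ⟨(0, u), by simp⟩
  | succ n ih =>
    intro u hu
    obtain ⟨a, v, ha, hv, rfl⟩ := mem_pow_succ.1 hu
    refine (Nat.succ_le_of_lt (ih hv)).trans_lt ?_
    let e : D.Mon × D.Mon ↪ D.Mon × D.Mon :=
      ⟨fun z => (z.1, z.2 + a), fun z w h => by
        have h1 := congrArg Prod.fst h
        have h2 := congrArg Prod.snd h
        exact Prod.ext h1 (add_right_cancel h2)⟩
    rw [← Finset.card_map e]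
    refine Finset.card_lt_card ⟨?_, fun h => ?_⟩
    · intro z hz
      obtain ⟨w, hw, rfl⟩ := Finset.mem_map.1 hz
      simp only [Finset.HasAntidiagonal.mem_antidiagonal] at hw ⊢
      change w.1 + (w.2 + a) = v + a
      rw [← add_assoc, hw]
    · have := h (show (v + a, 0) ∈ _ by simp)
      obtain ⟨w, -, hw⟩ := Finset.mem_map.1 this
      exact ha (Mon.add_eq_zero' (congrArg Prod.snd hw))

theorem exists_notMem_pow (u : D.Mon) : ∃ n, u ∉ D.pow n :=
  ⟨_, fun h => lt_irrefl _ (lt_card_antidiagonal h)⟩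

/-- Induction on a monomial along proper divisors. -/
theorem Mon.divisor_induction {C : D.Mon → Prop}
    (h : ∀ u, (∀ v w, v + w = u → w ≠ 0 → C v) → C u) (u : D.Mon) : C u := by
  obtain ⟨n, hn⟩ := exists_notMem_pow u
  induction n generalizing u with
  | zero => exact absurd (pow_zero_mem u) hn
  | succ n ih =>
    refine h u fun v w hvw hw => ih v fun hv => hn ?_
    exact mem_pow_succ.2 ⟨w, v, hw, hv, hvw⟩

theorem sum_antidiagonal_triple {X : Type*} [AddCommMonoid X] (F : D.Mon → D.Mon → D.Mon → X)
    (u : D.Mon) :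
    ∑ v ∈ Finset.HasAntidiagonal.antidiagonal u,
      ∑ w ∈ Finset.HasAntidiagonal.antidiagonal v.1, F w.1 w.2 v.2 =
    ∑ v ∈ Finset.HasAntidiagonal.antidiagonal u,
      ∑ w ∈ Finset.HasAntidiagonal.antidiagonal v.2, F v.1 w.1 w.2 := by
  simp only [Finset.sum_sigma']
  apply Finset.sum_nbij' (fun ⟨⟨_, j⟩, ⟨k, l⟩⟩ ↦ ⟨(k, l + j), (l, j)⟩)
    (fun ⟨⟨i, _⟩, ⟨k, l⟩⟩ ↦ ⟨(i + k, l), (i, k)⟩)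
  · rintro ⟨⟨i, j⟩, ⟨k, l⟩⟩ h
    simp only [Finset.mem_sigma, Finset.HasAntidiagonal.mem_antidiagonal] at h ⊢
    rw [← h.1, ← h.2, add_assoc]; simp
  · rintro ⟨⟨i, j⟩, ⟨k, l⟩⟩ h
    simp only [Finset.mem_sigma, Finset.HasAntidiagonal.mem_antidiagonal] at h ⊢
    rw [← h.1, ← h.2, add_assoc]; simp
  · rintro ⟨⟨i, j⟩, ⟨k, l⟩⟩ h
    simp only [Finset.mem_sigma, Finset.HasAntidiagonal.mem_antidiagonal] at h ⊢
    rw [← h.2]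
  · rintro ⟨⟨i, j⟩, ⟨k, l⟩⟩ h
    simp only [Finset.mem_sigma, Finset.HasAntidiagonal.mem_antidiagonal] at h ⊢
    rw [← h.2]
  · rintro ⟨⟨i, j⟩, ⟨k, l⟩⟩ h
    rfl

theorem sum_antidiagonal_swap {X : Type*} [AddCommMonoid X] (F : D.Mon → D.Mon → X)
    (u : D.Mon) :
    ∑ v ∈ Finset.HasAntidiagonal.antidiagonal u, F v.1 v.2 =
    ∑ v ∈ Finset.HasAntidiagonal.antidiagonal u, F v.2 v.1 :=
  Finset.sum_equiv (Equiv.prodComm _ _) (by simp [add_comm]) (by simp)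

end monoid

/-! ### Coefficients and monomials in `R` -/

section coefficients

variable {P : Type*} [Fintype P] {G : Type*} [AddCommGroup G] {𝔾 : GradingDatum G}
  {D : CoeffDatum P 𝔾} {k : Type*} [Field k]

theorem coeff_ext {a b : D.R k} (h : ∀ u, coeff u a = coeff u b) : a = b :=
  Subtype.ext (Formal.ext h)

theorem coeff_add (u : D.Mon) (a b : D.R k) : coeff u (a + b) = coeff u a + coeff u b := rfl

theorem coeff_sub (u : D.Mon) (a b : D.R k) : coeff u (a - b) = coeff u a - coeff u b := rfl

theorem coeff_zero (u : D.Mon) : coeff u (0 : D.R k) = 0 := rfl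

theorem coeff_smul (u : D.Mon) (c : k) (a : D.R k) : coeff u (c • a) = c * coeff u a := rfl

theorem coeff_mul (u : D.Mon) (a b : D.R k) : coeff u (a * b) =
    ∑ v ∈ Finset.HasAntidiagonal.antidiagonal u, coeff v.1 a * coeff v.2 b := rfl

open Classical in
theorem coeff_mono (u v : D.Mon) : coeff v (D.mono k u) = if v = u then 1 else 0 := by
  change Pi.single (M := fun _ : D.Mon => k) u 1 v = _
  rw [Pi.single_apply]

theorem coeff_mono_self (u : D.Mon) : coeff u (D.mono k u) = 1 := by
  rw [coeff_mono, if_pos rfl]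

theorem coeff_mono_ne {u v : D.Mon} (h : v ≠ u) : coeff v (D.mono k u) = 0 := by
  rw [coeff_mono, if_neg h]

open Classical in
theorem coeff_one (u : D.Mon) : coeff u (1 : D.R k) = if u = 0 then 1 else 0 :=
  Formal.one_apply u

/-- The coefficient map as a linear map. -/
def coeffₗ (u : D.Mon) : D.R k →ₗ[k] k where
  toFun := coeff u
  map_add' := coeff_add u
  map_smul' := coeff_smul u

theorem coeff_sum {I : Type*} (s : Finset I) (a : I → D.R k) (u : D.Mon) :
    coeff u (∑ i ∈ s, a i) = ∑ i ∈ s, coeff u (a i) := map_sum (coeffₗ u) a s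

theorem mono_zero : D.mono k 0 = 1 := by
  refine coeff_ext fun u => ?_
  rw [coeff_mono, coeff_one]

theorem mono_add (u v : D.Mon) : D.mono k (u + v) = D.mono k u * D.mono k v := by
  refine coeff_ext fun w => ?_
  by_cases h : ∃ x, x + v = w
  · obtain ⟨x, rfl⟩ := h
    rw [coeff_mul_mono]
    by_cases hx : x = u
    · subst hx; rw [coeff_mono_self, coeff_mono_self]
    · rw [coeff_mono_ne hx, coeff_mono_ne fun h => hx (add_right_cancel h)]
  · rw [coeff_mono_ne fun hc => h ⟨u, hc.symm⟩]
    by_contra hc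
    exact h (exists_of_coeff_mul_mono _ _ _ (Ne.symm hc))

theorem mul_mono_cancel {a b : D.R k} {u : D.Mon} (h : a * D.mono k u = b * D.mono k u) :
    a = b := by
  refine coeff_ext fun v => ?_
  rw [← coeff_mul_mono a v u, h, coeff_mul_mono]

theorem exists_of_coeff_mul_ne_zero {a b : D.R k} {u : D.Mon} (h : coeff u (a * b) ≠ 0) :
    ∃ v w, v + w = u ∧ coeff v a ≠ 0 ∧ coeff w b ≠ 0 := by
  rw [coeff_mul] at h
  obtain ⟨v, hv, hne⟩ := Finset.exists_ne_zero_of_sum_ne_zero h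
  exact ⟨v.1, v.2, Finset.HasAntidiagonal.mem_antidiagonal.1 hv, left_ne_zero_of_mul hne,
    right_ne_zero_of_mul hne⟩

theorem coeff_zero_mul (a b : D.R k) : coeff 0 (a * b) = coeff 0 a * coeff 0 b := by
  rw [coeff_mul, Finset.sum_eq_single (0, 0)]
  · rintro ⟨v, w⟩ h hne
    simp only [Finset.HasAntidiagonal.mem_antidiagonal] at h
    exact absurd (Prod.ext (Mon.add_eq_zero h) (Mon.add_eq_zero' h)) hne
  · simp

theorem mono_mem_homog (u : D.Mon) : D.mono k u ∈ D.homog k (D.deg u) := by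
  intro v hv
  by_contra hc
  exact hv (coeff_mono_ne fun h => hc (by rw [h]))

theorem mono_mem_fil {u : D.Mon} {n : ℕ} : D.mono k u ∈ D.fil k n ↔ u ∈ D.pow n := by
  constructor
  · intro h
    exact h u (by rw [coeff_mono_self]; exact one_ne_zero)
  · intro h v hv
    by_contra hc
    exact hv (coeff_mono_ne fun h' => hc (by rwa [h']))

theorem mono_mem_poly (u : D.Mon) : D.mono k u ∈ D.poly k :=
  (Set.finite_singleton u).subset fun v hv => by
    by_contra hc
    exact hv (coeff_mono_ne hc)

theorem mul_mem_homog {y z : G} {a b : D.R k} (ha : a ∈ D.homog k y) (hb : b ∈ D.homog k z) :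
    a * b ∈ D.homog k (y + z) := by
  intro u hu
  obtain ⟨v, w, rfl, hv, hw⟩ := exists_of_coeff_mul_ne_zero hu
  rw [deg_add, ha v hv, hb w hw]

end coefficients

/-! ### Divisibility by the coordinates in a nice ring -/

section nice

variable {P : Type*} [Fintype P] [DecidableEq P] {G : Type*} [AddCommGroup G]
  {𝔾 : GradingDatum G} {D : CoeffDatum P 𝔾} {k : Type*} [Field k]

theorem basis_injective (h : ∀ p, Pi.single p 1 ∈ D.monoid) :
    Function.Injective (basis (D := D) h) := by
  intro p q hpq
  have := congrFun (congrArg Subtype.val hpq) p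
  by_contra hne
  simp [basis, Pi.single_eq_of_ne hne] at this

theorem IsNice.basis_notMem_pow_two (hD : D.IsNice k) (p : P) : basis hD.mem p ∉ D.pow 2 :=
  fun h => hD.not_mem_sq p (mono_mem_fil.2 h)

theorem IsNice.basis_ne_zero (hD : D.IsNice k) (p : P) : basis hD.mem p ≠ 0 := by
  intro h
  have := congrFun (congrArg Subtype.val h) p
  simp [basis] at this

theorem IsNice.add_ne_basis (hD : D.IsNice k) {u v : D.Mon} (hu : u ≠ 0) (hv : v ≠ 0) (p : P) :
    u + v ≠ basis hD.mem p :=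
  fun h => hD.basis_notMem_pow_two p (h ▸ add_mem_pow_two hu hv)

/-- Every non-zero monomial of the degree of `r_p` is a multiple of `r_p`. -/
theorem IsNice.exists_add_basis (hD : D.IsNice k) {u : D.Mon} (hu : u ≠ 0) {p : P}
    (h : D.deg u = D.deg (basis hD.mem p)) : ∃ t, D.deg t = 0 ∧ t + basis hD.mem p = u := by
  obtain ⟨c, -, hc⟩ := hD.gen p (D.mono k u) ⟨⟨mono_mem_fil.2 (mem_pow_one.2 hu), mono_mem_poly u⟩,
    h ▸ mono_mem_homog u⟩
  obtain ⟨t, ht⟩ := exists_of_coeff_mul_mono c u (basis hD.mem p)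
    (by rw [← hc, coeff_mono_self]; exact one_ne_zero)
  refine ⟨t, ?_, ht⟩
  rw [← ht, deg_add] at h
  simpa using h

/-- If a degree `0` monomial multiple of `r_p` is deep in the filtration, so is the factor. -/
theorem IsNice.exists_pow_of_add_basis (hD : D.IsNice k) (p : P) (n : ℕ) :
    ∃ N, ∀ v : D.Mon, D.deg v = 0 → v + basis hD.mem p ∈ D.pow N → v ∈ D.pow n := by
  classical
  -- A counterexample is a sequence `v N` of degree zero that stays outside `D.pow n` while `v N +
  -- u_p` gets arbitrarily deep.
  by_contra! hc
  choose v hv0 hvN hvn using hc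
  have hfib : ∀ w : D.Mon, {N | v N = w}.Finite := by
    intro w
    obtain ⟨m, hm⟩ := exists_notMem_pow (w + basis hD.mem p)
    refine (Set.finite_lt_nat m).subset fun N hN => ?_
    by_contra hc
    rw [Set.mem_ofPred_eq, not_lt] at hc
    exact hm (pow_antitone hc (by rw [← hN]; exact hvN N))
  have hinf : (Set.range v).Infinite := by
    intro hfin
    refine Set.infinite_univ (α := ℕ) ((hfin.biUnion fun w _ => hfib w).subset fun N _ => ?_)
    exact Set.mem_biUnion ⟨N, rfl⟩ rfl
  -- The sum of the monomials `r^{v N} r_p` converges in `R`, since its terms get deeper and all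
  -- have the degree of `r_p`.
  let a : D.R k := ⟨fun u => if ∃ N, v N + basis hD.mem p = u then 1 else 0, by
    refine ⟨(Set.finite_singleton (D.deg (basis hD.mem p))).subset ?_, fun m => ?_⟩
    · rintro y ⟨u, hu, rfl⟩
      obtain ⟨N, rfl⟩ : ∃ N, v N + basis hD.mem p = u := by
        by_contra h; exact hu (if_neg h)
      simp [deg_add, hv0]
    · refine ((Set.finite_lt_nat m).image fun N => v N + basis hD.mem p).subset ?_
      rintro u ⟨hu, hum⟩
      obtain ⟨N, rfl⟩ : ∃ N, v N + basis hD.mem p = u := by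
        by_contra h; exact hu (if_neg h)
      refine ⟨N, ?_, rfl⟩
      by_contra hc
      rw [Set.mem_ofPred_eq, not_lt] at hc
      exact hum (pow_antitone hc (hvN N))⟩
  have ha : ∀ u, coeff u a = if ∃ N, v N + basis hD.mem p = u then 1 else 0 := fun _ => rfl
  have ha' : ∀ u, coeff u a ≠ 0 → ∃ N, v N + basis hD.mem p = u := by
    intro u hu
    by_contra h; rw [ha, if_neg h] at hu; exact hu rfl
  obtain ⟨c, -, hca⟩ := hD.gen_hat p a ⟨fun u hu => by
      obtain ⟨N, rfl⟩ := ha' u hu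
      rw [mem_pow_one]
      exact fun h => hD.basis_ne_zero p (Mon.add_eq_zero' h),
    fun u hu => by
      obtain ⟨N, rfl⟩ := ha' u hu
      simp [deg_add, hv0]⟩
  -- The quotient of `a` by `r_p` lies in `R` by niceness of the completion, yet it contains every
  -- `r^{v N}`: infinitely many terms outside `D.pow n`.
  refine hinf ((c.2.2 n).subset ?_)
  rintro _ ⟨N, rfl⟩
  refine ⟨?_, hvn N⟩
  change coeff (v N) c ≠ 0
  rw [← coeff_mul_mono c (v N) (basis hD.mem p), ← hca, ha, if_pos ⟨N, rfl⟩]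
  exact one_ne_zero

end nice

end CoeffDatum

namespace CoeffDatum

/-! ### A filtration adapted to rescaling the coordinates -/

section filtration

variable {P : Type*} [Fintype P] [DecidableEq P] {G : Type*} [AddCommGroup G]
  {𝔾 : GradingDatum G} {D : CoeffDatum P 𝔾} {k : Type*} [Field k]

/-- A filtration by monomial ideals, equivalent to the `𝔪`-adic one, for which multiplying the
coordinate `r_p` by a degree `0` monomial `r^v` with `r^v r_p` in the `s`-th step changes the other
monomials only by terms in the `s + 1`-st step. -/
def filt (h : ∀ p, Pi.single p 1 ∈ D.monoid) : ℕ → Set D.Mon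
  | 0 => Set.univ
  | s + 1 => {u | (∃ v z, v ∈ filt h s ∧ z ≠ 0 ∧ v + z = u) ∨
      ∃ v z, D.deg v = 0 ∧ (∃ p, v + basis h p ∈ filt h s) ∧ z ≠ 0 ∧ (∀ q, z ≠ basis h q) ∧
        v + z = u}

variable {h : ∀ p, Pi.single p 1 ∈ D.monoid}

theorem filt_add_succ {s : ℕ} {u z : D.Mon} (hu : u ∈ filt h s) (hz : z ≠ 0) :
    u + z ∈ filt h (s + 1) := Or.inl ⟨u, z, hu, hz, rfl⟩

theorem filt_shift {s : ℕ} {v z : D.Mon} {p : P} (hv : D.deg v = 0)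
    (hp : v + basis h p ∈ filt h s) (hz : z ≠ 0) (hq : ∀ q, z ≠ basis h q) :
    v + z ∈ filt h (s + 1) := Or.inr ⟨v, z, hv, ⟨p, hp⟩, hz, hq, rfl⟩

theorem filt_succ_subset (s : ℕ) : filt h (s + 1) ⊆ filt h s := by
  induction s with
  | zero => exact fun _ _ => trivial
  | succ s ih =>
    rintro u (⟨v, z, hv, hz, rfl⟩ | ⟨v, z, hv, ⟨p, hp⟩, hz, hq, rfl⟩)
    · exact filt_add_succ (ih hv) hz
    · exact filt_shift hv (ih hp) hz hq

theorem filt_antitone {s t : ℕ} (hst : s ≤ t) : filt h t ⊆ filt h s := by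
  induction hst with
  | refl => exact subset_rfl
  | step _ ih => exact (filt_succ_subset _).trans ih

theorem filt_add {s : ℕ} {u : D.Mon} (hu : u ∈ filt h s) (z : D.Mon) : u + z ∈ filt h s := by
  by_cases hz : z = 0
  · simpa [hz] using hu
  · exact filt_succ_subset s (filt_add_succ hu hz)

theorem pow_subset_filt (s : ℕ) : D.pow s ⊆ filt h s := by
  induction s with
  | zero => exact fun _ _ => trivial
  | succ s ih =>
    intro u hu
    obtain ⟨a, v, ha, hv, rfl⟩ := mem_pow_succ.1 hu
    exact filt_add_succ (ih hv) ha

theorem mem_filt_one {u : D.Mon} : u ∈ filt h 1 ↔ u ≠ 0 := by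
  constructor
  · rintro (⟨v, z, -, hz, rfl⟩ | ⟨v, z, -, -, hz, -, rfl⟩) h0
    all_goals exact hz (Mon.add_eq_zero' h0)
  · intro hu
    simpa using filt_add_succ (h := h) (show (0 : D.Mon) ∈ filt h 0 from trivial) hu

/-- The second clause in the definition of `filt`, with trivial multiplier `v = 0`, puts every
non-constant monomial other than the coordinates into step two, including irreducible ones. The base
case of the approximation thus concerns the `r_p` alone. Without coordinates the monoid is trivial.
-/
theorem mem_filt_two (hD : D.IsNice k) {u : D.Mon} :
    u ∈ filt hD.mem 2 ↔ u ≠ 0 ∧ ∀ q, u ≠ basis hD.mem q := by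
  constructor
  · intro hu
    refine ⟨mem_filt_one.1 (filt_succ_subset 1 hu), fun q hq => ?_⟩
    rcases hu with ⟨v, z, hv, hz, rfl⟩ | ⟨v, z, -, -, hz, hz', rfl⟩
    · exact hD.add_ne_basis (mem_filt_one.1 hv) hz q hq
    · by_cases h0 : v = 0
      · subst h0
        exact hz' q (by simpa using hq)
      · exact hD.add_ne_basis h0 hz q hq
  · rintro ⟨h0, hq⟩
    by_cases hP : Nonempty P
    · obtain ⟨p⟩ := hP
      have := filt_shift (h := hD.mem) (s := 1) (p := p) (deg_zero (D := D))
        (mem_filt_one.2 (by simpa using hD.basis_ne_zero p)) h0 hq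
      simpa using this
    · exfalso
      have := not_nonempty_iff.1 hP
      exact h0 (Subtype.ext (Subsingleton.elim _ _))

/-- Together with `pow_subset_filt` this makes the two filtrations cofinal. The control of the
quotient by `r_p` is carried along because the second clause of `filt` needs it in the induction,
and because it later makes the limits of the units `c_p` lie in `R`. -/
theorem exists_filt_subset (hD : D.IsNice k) (n : ℕ) : ∃ s, ∀ u ∈ filt hD.mem s, u ∈ D.pow n ∧
    ∀ v p, D.deg v = 0 → v + basis hD.mem p = u → v ∈ D.pow n := by
  induction n with
  | zero => exact ⟨0, fun u _ => ⟨pow_zero_mem u, fun v _ _ _ => pow_zero_mem v⟩⟩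
  | succ n ih =>
    obtain ⟨s, hs⟩ := ih
    choose N hN using fun p => hD.exists_pow_of_add_basis p (n + 1)
    let T : Set D.Mon := {u | ∃ v y, D.deg v = 0 ∧ v ∈ D.pow (n + 1) ∧ y ≠ 0 ∧ v + y = u}
    -- The products that the second clause of `filt` creates once its multiplier is known to lie in
    -- `D.pow n`.
    let W : Set D.Mon := {u | ∃ v z, D.deg v = 0 ∧ v ∈ D.pow n ∧ z ≠ 0 ∧
      (∀ q, z ≠ basis hD.mem q) ∧ v + z = u}
    -- Both multipliers have degree zero, so `r^y` has the degree of `r_p` and is divisible by it.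
    -- Cancelling `r_p` compares `v'` with `v`.
    have hdiv : ∀ {v y v' : D.Mon} {p : P}, D.deg v = 0 → D.deg v' = 0 → y ≠ 0 →
        v' + basis hD.mem p = v + y → ∃ t, t + basis hD.mem p = y ∧ v' = v + t := by
      intro v y v' p hv hv' hy he
      have : D.deg y = D.deg (basis hD.mem p) := by
        have := congrArg D.deg he
        rw [deg_add, deg_add, hv, hv', zero_add, zero_add] at this
        exact this.symm
      obtain ⟨t, -, ht⟩ := hD.exists_add_basis hy this
      refine ⟨t, ht, ?_⟩
      rw [← ht, ← add_assoc] at he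
      exact add_right_cancel he
    have hTshift : ∀ {u v' : D.Mon} {p : P}, u ∈ T → D.deg v' = 0 → v' + basis hD.mem p = u →
        v' ∈ D.pow (n + 1) := by
      rintro u v' p ⟨v, y, hv, hvn, hy, rfl⟩ hv' he
      obtain ⟨t, -, rfl⟩ := hdiv hv hv' hy he
      exact pow_add_mem hvn
    have hWshift : ∀ {u v' : D.Mon} {p : P}, u ∈ W → D.deg v' = 0 → v' + basis hD.mem p = u →
        v' ∈ D.pow (n + 1) := by
      rintro u v' p ⟨v, y, hv, hvn, hy, hq, rfl⟩ hv' he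
      obtain ⟨t, ht, rfl⟩ := hdiv hv hv' hy he
      refine mem_pow_succ.2 ⟨t, v, ?_, hvn, rfl⟩
      rintro rfl
      exact hq p (by simpa using ht.symm)
    -- Beyond step `s`, the first clause keeps elements of `T` and `W` in place and raises the power
    -- for the others. The second clause lands in `W`, because the induction hypothesis puts its
    -- multiplier in `D.pow n`.
    have key : ∀ j, filt hD.mem (s + j) ⊆ T ∪ W ∪ D.pow j := by
      intro j
      induction j with
      | zero => exact fun u _ => Or.inr (pow_zero_mem u)
      | succ j ih =>
        rintro u (⟨v, z, hv, hz, rfl⟩ | ⟨v, z, hv, ⟨p, hp⟩, hz, hq, rfl⟩)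
        · rcases ih hv with (⟨v, y, h1, h2, h3, rfl⟩ | ⟨v, y, h1, h2, h3, h4, rfl⟩) | h1
          · exact Or.inl (Or.inl ⟨v, y + z, h1, h2, fun h => h3 (Mon.add_eq_zero h),
              (add_assoc _ _ _).symm⟩)
          · exact Or.inl (Or.inr ⟨v, y + z, h1, h2, fun h => h3 (Mon.add_eq_zero h),
              fun q => hD.add_ne_basis h3 hz q, (add_assoc _ _ _).symm⟩)
          · exact Or.inr (mem_pow_succ.2 ⟨z, v, hz, h1, rfl⟩)
        · exact Or.inl (Or.inr ⟨v, z, hv,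
            (hs _ (filt_antitone (Nat.le_add_right s j) hp)).2 v p hv rfl, hz, hq, rfl⟩)
    -- The shift dominates both `n + 1` and every `N p`, as needed when the monomial is only known
    -- to lie in a power.
    refine ⟨s + (n + 1 + ∑ p, N p), fun u hu => ?_⟩
    rcases key _ hu with (hT | hW) | hj
    · refine ⟨?_, fun v p hv he => hTshift hT hv he⟩
      obtain ⟨v, y, -, hv, -, rfl⟩ := hT
      exact pow_add_mem hv
    · refine ⟨?_, fun v p hv he => hWshift hW hv he⟩
      obtain ⟨v, y, -, hv, hy, -, rfl⟩ := hW
      exact mem_pow_succ.2 ⟨y, v, hy, hv, rfl⟩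
    · refine ⟨pow_antitone (by omega) hj, fun v p hv he => hN p v hv ?_⟩
      rw [he]
      refine pow_antitone ?_ hj
      have := Finset.single_le_sum (f := N) (fun _ _ => Nat.zero_le _) (Finset.mem_univ p)
      omega

theorem exists_notMem_filt (hD : D.IsNice k) (u : D.Mon) : ∃ s, u ∉ filt hD.mem s := by
  obtain ⟨n, hn⟩ := exists_notMem_pow u
  obtain ⟨s, hs⟩ := exists_filt_subset hD n
  exact ⟨s, fun h => hn (hs u h).1⟩

end filtration

end CoeffDatum

namespace CoeffDatum

/-! ### Geometric series and units in `R` -/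

section neumann

variable {P : Type*} [Fintype P] {G : Type*} [AddCommGroup G] {𝔾 : GradingDatum G}
  {D : CoeffDatum P 𝔾} {k : Type*} [Field k]

theorem add_mem_fil {n : ℕ} {a b : D.R k} (ha : a ∈ D.fil k n) (hb : b ∈ D.fil k n) :
    a + b ∈ D.fil k n := by
  intro u hu
  by_contra hc
  have h1 : coeff u a = 0 := by by_contra h; exact hc (ha u h)
  have h2 : coeff u b = 0 := by by_contra h; exact hc (hb u h)
  exact hu (by rw [coeff_add, h1, h2, add_zero])

theorem mul_mem_fil {m n : ℕ} {a b : D.R k} (ha : a ∈ D.fil k m) (hb : b ∈ D.fil k n) :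
    a * b ∈ D.fil k (m + n) := by
  intro u hu
  obtain ⟨v, w, rfl, hv, hw⟩ := exists_of_coeff_mul_ne_zero hu
  exact add_mem_pow (ha v hv) (hb w hw)

theorem coeff_eq_zero_of_mem_fil {n : ℕ} {a : D.R k} (ha : a ∈ D.fil k n) {u : D.Mon}
    (hu : u ∉ D.pow n) : coeff u a = 0 := by
  by_contra h; exact hu (ha u h)

/-- The inverse is the series `∑ N^j`. It converges coefficientwise because `N` raises the
filtration; the hypothesis on degrees keeps the sum within finitely many degrees, as the graded
completion requires. -/
theorem sub_apply_bijective (N : D.R k →ₗ[k] D.R k)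
    (hN : ∀ n, ∀ x ∈ D.fil k n, N x ∈ D.fil k (n + 1))
    (hdeg : ∀ (S : Set G) (x : D.R k), (∀ u, coeff u x ≠ 0 → D.deg u ∈ S) →
      ∀ u, coeff u (N x) ≠ 0 → D.deg u ∈ S) :
    Function.Bijective fun x => x - N x := by
  constructor
  · intro x y hxy
    have h0 : x - y = N (x - y) := by
      rw [map_sub]
      have : x - N x = y - N y := hxy
      linear_combination this
    have h1 : ∀ n, x - y ∈ D.fil k n := by
      intro n
      induction n with
      | zero => exact fun u _ => pow_zero_mem u
      | succ n ih => rw [h0]; exact hN n _ ih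
    rw [← sub_eq_zero]
    refine coeff_ext fun u => ?_
    obtain ⟨n, hn⟩ := exists_notMem_pow u
    exact coeff_eq_zero_of_mem_fil (h1 n) hn
  · intro y
    let z : ℕ → D.R k := fun j => (N ^ j) y
    have hz : ∀ j, z j ∈ D.fil k j := by
      intro j
      induction j with
      | zero => exact fun u _ => pow_zero_mem u
      | succ j ih =>
        change (N ^ (j + 1)) y ∈ _
        rw [pow_succ']
        exact hN j _ ih
    have hzdeg : ∀ j u, coeff u (z j) ≠ 0 → D.deg u ∈ {d | ∃ v, coeff v y ≠ 0 ∧ D.deg v = d} := by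
      intro j
      induction j with
      | zero => exact fun u hu => ⟨u, hu, rfl⟩
      | succ j ih =>
        have : z (j + 1) = N (z j) := by
          change (N ^ (j + 1)) y = _
          rw [pow_succ']; rfl
        rw [this]
        exact hdeg _ _ ih
    -- Past the index `ht u` no term of the series contributes to the coefficient of `r^u`.
    choose ht hht using fun u : D.Mon => exists_notMem_pow u
    have hsum : ∀ u n, u ∉ D.pow n →
        ∑ j ∈ Finset.range (ht u), coeff u (z j) = ∑ j ∈ Finset.range n, coeff u (z j) := by
      have hvan : ∀ u n j, u ∉ D.pow n → n ≤ j → coeff u (z j) = 0 := fun u n j hn hj =>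
        coeff_eq_zero_of_mem_fil (hz j) fun h => hn (pow_antitone hj h)
      intro u n hn
      rcases le_total n (ht u) with h | h
      · refine (Finset.sum_subset (Finset.range_mono h) fun j _ hj => ?_).symm
        exact hvan u n j hn (by simpa using hj)
      · refine Finset.sum_subset (Finset.range_mono h) fun j _ hj => ?_
        exact hvan u _ j (hht u) (by simpa using hj)
    let x : D.R k := ⟨fun u => ∑ j ∈ Finset.range (ht u), coeff u (z j), by
      refine ⟨y.2.1.subset ?_, fun n => ?_⟩
      · rintro d ⟨u, hu, rfl⟩
        obtain ⟨j, -, hj⟩ := Finset.exists_ne_zero_of_sum_ne_zero hu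
        exact hzdeg j u hj
      · refine ((Finset.range n).finite_toSet.biUnion fun j _ => (z j).2.2 n).subset ?_
        rintro u ⟨hu, hn⟩
        change ∑ j ∈ Finset.range (ht u), coeff u (z j) ≠ 0 at hu
        rw [hsum u n hn] at hu
        obtain ⟨j, hj, hne⟩ := Finset.exists_ne_zero_of_sum_ne_zero hu
        exact Set.mem_biUnion hj ⟨hne, hn⟩⟩
    refine ⟨x, coeff_ext fun u => ?_⟩
    obtain ⟨n, hn⟩ := exists_notMem_pow u
    -- `N` is only known to be linear, so it is applied to a finite partial sum and to a remainder
    -- in `D.fil k n`. The partial sums telescope, and the remainder is invisible at `u`.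
    let r := x - ∑ j ∈ Finset.range n, z j
    have hr : r ∈ D.fil k n := by
      intro v hv
      by_contra hc
      apply hv
      rw [coeff_sub, coeff_sum]
      change ∑ j ∈ Finset.range (ht v), coeff v (z j) - _ = 0
      rw [hsum v n hc, sub_self]
    have hx : x = r + ∑ j ∈ Finset.range n, z j := by simp [r]
    have hNz : ∀ j, N (z j) = z (j + 1) := fun j => by
      change _ = (N ^ (j + 1)) y
      rw [pow_succ']; rfl
    have : x - N x = y + (r - N r) - z n := by
      conv_lhs => rw [hx, map_add, map_sum]
      simp only [hNz]
      have := Finset.sum_range_sub z n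
      rw [Finset.sum_sub_distrib] at this
      have hz0 : z 0 = y := rfl
      rw [hz0] at this
      linear_combination -this
    change coeff u (x - N x) = _
    rw [this, coeff_sub, coeff_add, coeff_sub, coeff_eq_zero_of_mem_fil hr hn,
      coeff_eq_zero_of_mem_fil (hz n) hn,
      coeff_eq_zero_of_mem_fil (hN n r hr) fun h => hn (pow_antitone (Nat.le_succ n) h)]
    simp

/-- Used to see that `rescale` reflects the filtration as well as preserving it. -/
theorem mem_fil_of_sub_apply {N : D.R k →ₗ[k] D.R k}
    (hN : ∀ n, ∀ x ∈ D.fil k n, N x ∈ D.fil k (n + 1)) {x : D.R k} {n : ℕ}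
    (h : x - N x ∈ D.fil k n) : x ∈ D.fil k n := by
  have key : ∀ m ≤ n, x ∈ D.fil k m := by
    intro m
    induction m with
    | zero => exact fun _ u _ => pow_zero_mem u
    | succ m ih =>
      intro hm
      have h1 := hN m x (ih (by omega))
      have h2 : x - N x ∈ D.fil k (m + 1) := fun u hu => pow_antitone hm (h u hu)
      simpa using add_mem_fil h2 h1
  exact key n le_rfl

/-- The part of an element of `R` supported on a set of monomials. -/
noncomputable def restr (S : Set D.Mon) (a : D.R k) : D.R k := by
  classical
  exact ⟨fun u => if u ∈ S then coeff u a else 0,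
    a.2.1.subset (by
      rintro y ⟨u, hu, rfl⟩
      exact ⟨u, fun h => hu (by simp only [coeff, h, ite_self]), rfl⟩),
    fun n => (a.2.2 n).subset (by
      rintro u ⟨hu, hn⟩
      exact ⟨fun h => hu (by simp only [coeff, h, ite_self]), hn⟩)⟩

theorem coeff_restr_of_mem {S : Set D.Mon} {u : D.Mon} (h : u ∈ S) (a : D.R k) :
    coeff u (restr S a) = coeff u a := if_pos h

theorem coeff_restr_of_notMem {S : Set D.Mon} {u : D.Mon} (h : u ∉ S) (a : D.R k) :
    coeff u (restr S a) = 0 := if_neg h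

theorem one_mem_homog : (1 : D.R k) ∈ D.homog k 0 := by
  rw [← mono_zero, ← deg_zero (D := D)]
  exact mono_mem_homog 0

/-- The degree zero part of `b` is already an inverse of `a`, and inverses are unique. -/
theorem mem_homog_of_mul_eq_one {a b : D.R k} (ha : a ∈ D.homog k 0) (hab : a * b = 1) :
    b ∈ D.homog k 0 := by
  have h : a * restr {u | D.deg u = 0} b = 1 := by
    refine coeff_ext fun u => ?_
    by_cases hu : D.deg u = 0
    · rw [← hab, coeff_mul, coeff_mul]
      refine Finset.sum_congr rfl fun v hv => ?_
      by_cases h0 : coeff v.1 a = 0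
      · rw [h0, zero_mul, zero_mul]
      · rw [coeff_restr_of_mem]
        have := ha _ h0
        simp only [Finset.HasAntidiagonal.mem_antidiagonal] at hv
        rw [← hv, deg_add, this, zero_add] at hu
        exact hu
    · have h1 : coeff u (1 : D.R k) = 0 := by
        by_contra hc
        exact hu (one_mem_homog u hc)
      rw [h1]
      by_contra hc
      obtain ⟨v, w, rfl, hv, hw⟩ := exists_of_coeff_mul_ne_zero hc
      apply hw
      refine coeff_restr_of_notMem (fun h0 => hu ?_) _
      rw [deg_add, ha v hv, zero_add]
      exact h0
  have : b = restr {u | D.deg u = 0} b := by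
    calc b = b * (a * restr {u | D.deg u = 0} b) := by rw [h, mul_one]
      _ = a * b * restr {u | D.deg u = 0} b := by ring
      _ = _ := by rw [hab, one_mul]
  rw [this]
  intro u hu
  by_contra hc
  exact hu (coeff_restr_of_notMem hc _)

/-- After division by the constant term, `a` is `1 - n` with `n ∈ 𝔪` of degree zero, and the
geometric series applies to multiplication by `n`. -/
theorem isUnit_of_coeff_zero {a : D.R k} (ha : a ∈ D.homog k 0) (h0 : coeff 0 a ≠ 0) :
    IsUnit a := by
  set n : D.R k := 1 - (coeff 0 a)⁻¹ • a with hn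
  have hn1 : n ∈ D.fil k 1 := by
    intro u hu
    rw [mem_pow_one]
    rintro rfl
    apply hu
    rw [hn, coeff_sub, coeff_smul, coeff_one, if_pos rfl, inv_mul_cancel₀ h0, sub_self]
  have hn0 : n ∈ D.homog k 0 := by
    intro u hu
    rw [hn, coeff_sub, coeff_smul] at hu
    by_contra hc
    have h1 : coeff u (1 : D.R k) = 0 := by by_contra h; exact hc (one_mem_homog u h)
    have h2 : coeff u a = 0 := by by_contra h; exact hc (ha u h)
    exact hu (by rw [h1, h2]; simp)
  obtain ⟨x, hx⟩ := (sub_apply_bijective (LinearMap.mulLeft k n)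
    (fun m x hx => by
      rw [add_comm]; exact mul_mem_fil hn1 hx)
    (fun S x hx u hu => by
      obtain ⟨v, w, rfl, hv, hw⟩ := exists_of_coeff_mul_ne_zero hu
      rw [deg_add, hn0 v hv, zero_add]
      exact hx w hw)).2 1
  refine IsUnit.of_mul_eq_one ((coeff 0 a)⁻¹ • x) ?_
  have : x - n * x = 1 := hx
  rw [← this, hn, sub_mul, one_mul, smul_mul_assoc, mul_smul_comm]
  abel

theorem coeff_zero_ne_zero {a b : D.R k} (h : a * b = 1) : coeff 0 a ≠ 0 := by
  intro h0
  have := coeff_zero_mul a b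
  rw [h, h0, zero_mul, coeff_one, if_pos rfl] at this
  exact one_ne_zero this

end neumann

/-! ### Units of degree zero and the pullback of formal sums -/

section pull

variable {P : Type*} [Fintype P] {G : Type*} [AddCommGroup G] {𝔾 : GradingDatum G}
  {D : CoeffDatum P 𝔾} {k : Type*} [Field k]

variable (D k) in
/-- The units of `R_0`. -/
noncomputable def unitsZero : Subgroup (D.R k)ˣ where
  carrier := {x | (x : D.R k) ∈ D.homog k 0}
  mul_mem' := by
    intro a b ha hb
    simpa using mul_mem_homog ha hb
  one_mem' := one_mem_homog
  inv_mem' := by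
    intro a ha
    exact mem_homog_of_mul_eq_one ha a.mul_inv

/-- The unit `∏ c_p ^ {u_p}`. -/
noncomputable def unitPow (c : P → unitsZero D k) (u : D.Mon) : unitsZero D k :=
  ∏ p, c p ^ ((u : P → ℤ) p)

/-- `unitPow` as an element of `R`. -/
noncomputable def unitVal (c : P → unitsZero D k) (u : D.Mon) : D.R k :=
  ((unitPow c u : (D.R k)ˣ) : D.R k)

theorem unitPow_add (c : P → unitsZero D k) (u v : D.Mon) :
    unitPow c (u + v) = unitPow c u * unitPow c v := by
  simp [unitPow, zpow_add, Finset.prod_mul_distrib]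

theorem unitPow_zero (c : P → unitsZero D k) : unitPow c (0 : D.Mon) = 1 := by
  simp [unitPow]

theorem unitPow_basis [DecidableEq P] (c : P → unitsZero D k) (h : ∀ p, Pi.single p 1 ∈ D.monoid)
    (p : P) : unitPow c (basis h p) = c p := by
  rw [unitPow, Finset.prod_eq_single p]
  · simp [basis]
  · intro q _ hq
    simp [basis, Pi.single_eq_of_ne hq]
  · simp

theorem unitVal_add (c : P → unitsZero D k) (u v : D.Mon) :
    unitVal c (u + v) = unitVal c u * unitVal c v := by
  simp [unitVal, unitPow_add]

theorem unitVal_zero (c : P → unitsZero D k) : unitVal c (0 : D.Mon) = 1 := by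
  simp [unitVal, unitPow_zero]

theorem unitVal_basis [DecidableEq P] (c : P → unitsZero D k) (h : ∀ p, Pi.single p 1 ∈ D.monoid)
    (p : P) : unitVal c (basis h p) = ((c p : (D.R k)ˣ) : D.R k) := by
  simp [unitVal, unitPow_basis]

theorem unitVal_mem_homog (c : P → unitsZero D k) (u : D.Mon) : unitVal c u ∈ D.homog k 0 :=
  (unitPow c u).2

theorem coeff_zero_unitVal_ne_zero (c : P → unitsZero D k) (u : D.Mon) :
    coeff 0 (unitVal c u) ≠ 0 :=
  coeff_zero_ne_zero (unitPow c u : (D.R k)ˣ).mul_inv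

variable {V W X : Type*} [AddCommGroup V] [Module k V] [AddCommGroup W] [Module k W]
  [AddCommGroup X] [Module k X]

/-- The pullback `∑ r^u a_u ↦ ∑ r^u c^u a_u` of formal sums. -/
noncomputable def pull (c : P → unitsZero D k) (a : D.Mon → V) : D.Mon → V :=
  fun w => ∑ v ∈ Finset.HasAntidiagonal.antidiagonal w, coeff v.2 (unitVal c v.1) • a v.1

/-- The `R`-bilinear extension of a bilinear map to formal sums. -/
noncomputable def conv (B : V →ₗ[k] W →ₗ[k] X) (a : D.Mon → V) (b : D.Mon → W) : D.Mon → X :=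
  fun u => ∑ v ∈ Finset.HasAntidiagonal.antidiagonal u, B (a v.1) (b v.2)

theorem exists_of_sum_antidiagonal_ne_zero {X : Type*} [AddCommMonoid X] {F : D.Mon → D.Mon → X}
    {u : D.Mon} (h : ∑ v ∈ Finset.HasAntidiagonal.antidiagonal u, F v.1 v.2 ≠ 0) :
    ∃ v w, v + w = u ∧ F v w ≠ 0 := by
  obtain ⟨v, hv, hne⟩ := Finset.exists_ne_zero_of_sum_ne_zero h
  exact ⟨v.1, v.2, Finset.HasAntidiagonal.mem_antidiagonal.1 hv, hne⟩

theorem exists_of_pull_ne_zero {c : P → unitsZero D k} {a : D.Mon → V} {w : D.Mon}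
    (h : pull c a w ≠ 0) : ∃ u v, u + v = w ∧ coeff v (unitVal c u) ≠ 0 ∧ a u ≠ 0 := by
  obtain ⟨u, v, huv, hne⟩ := exists_of_sum_antidiagonal_ne_zero
    (F := fun u v => coeff v (unitVal c u) • a u) h
  exact ⟨u, v, huv, fun h => hne (by rw [h, zero_smul]), fun h => hne (by rw [h, smul_zero])⟩

theorem exists_of_conv_ne_zero {B : V →ₗ[k] W →ₗ[k] X} {a : D.Mon → V} {b : D.Mon → W}
    {u : D.Mon} (h : conv B a b u ≠ 0) : ∃ v w, v + w = u ∧ a v ≠ 0 ∧ b w ≠ 0 := by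
  obtain ⟨v, w, hvw, hne⟩ := exists_of_sum_antidiagonal_ne_zero (F := fun v w => B (a v) (b w)) h
  exact ⟨v, w, hvw, fun h => hne (by simp [h]), fun h => hne (by simp [h])⟩

theorem finite_pull {c : P → unitsZero D k} {a : D.Mon → V}
    (ha : ∀ n, {u | a u ≠ 0 ∧ u ∉ D.pow n}.Finite) (n : ℕ) :
    {u | pull c a u ≠ 0 ∧ u ∉ D.pow n}.Finite := by
  refine ((ha n).biUnion fun u _ => ((unitVal c u).2.2 n).image fun v => u + v).subset ?_
  rintro w ⟨hw, hn⟩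
  obtain ⟨u, v, rfl, hv, hu⟩ := exists_of_pull_ne_zero hw
  exact Set.mem_biUnion ⟨hu, fun h => hn (pow_add_mem h)⟩
    ⟨v, ⟨hv, fun h => hn (by rw [add_comm]; exact pow_add_mem h)⟩, rfl⟩

theorem pull_mem_Hat {gr : G → Submodule k V} {z : G} (c : P → unitsZero D k) {a : D.Mon → V}
    (ha : a ∈ D.Hat gr z) : pull c a ∈ D.Hat gr z := by
  refine ⟨fun w => Submodule.sum_mem _ fun v hv => ?_, finite_pull ha.2⟩
  by_cases h0 : coeff v.2 (unitVal c v.1) = 0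
  · rw [h0, zero_smul]; exact Submodule.zero_mem _
  · refine Submodule.smul_mem _ _ ?_
    have h1 := unitVal_mem_homog c v.1 v.2 h0
    rw [Finset.HasAntidiagonal.mem_antidiagonal] at hv
    rw [← hv, deg_add, h1, add_zero]
    exact ha.1 v.1

theorem pull_apply_zero (c : P → unitsZero D k) (a : D.Mon → V) : pull c a 0 = a 0 := by
  rw [pull, Finset.sum_eq_single (0, 0)]
  · rw [unitVal_zero, coeff_one, if_pos rfl, one_smul]
  · rintro ⟨v, w⟩ h hne
    simp only [Finset.HasAntidiagonal.mem_antidiagonal] at h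
    exact absurd (Prod.ext (Mon.add_eq_zero h) (Mon.add_eq_zero' h)) hne
  · simp

theorem pull_mem_HatM {gr : G → Submodule k V} {z : G} (c : P → unitsZero D k) {a : D.Mon → V}
    (ha : a ∈ D.HatM gr z) : pull c a ∈ D.HatM gr z :=
  ⟨pull_mem_Hat c ha.1, by rw [pull_apply_zero, ha.2]⟩

theorem sum_antidiagonal_four {X : Type*} [AddCommMonoid X]
    (F : D.Mon → D.Mon → D.Mon → D.Mon → X) (u : D.Mon) :
    ∑ v ∈ Finset.HasAntidiagonal.antidiagonal u, ∑ x ∈ Finset.HasAntidiagonal.antidiagonal v.1,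
      ∑ y ∈ Finset.HasAntidiagonal.antidiagonal v.2, F x.1 x.2 y.1 y.2 =
    ∑ v ∈ Finset.HasAntidiagonal.antidiagonal u, ∑ x ∈ Finset.HasAntidiagonal.antidiagonal v.1,
      ∑ y ∈ Finset.HasAntidiagonal.antidiagonal v.2, F x.1 y.1 x.2 y.2 := by
  simp only [Finset.sum_sigma']
  apply Finset.sum_nbij'
    (fun z ↦ ⟨(z.2.1.1 + z.2.2.1, z.2.1.2 + z.2.2.2), ⟨(z.2.1.1, z.2.2.1), (z.2.1.2, z.2.2.2)⟩⟩)
    (fun z ↦ ⟨(z.2.1.1 + z.2.2.1, z.2.1.2 + z.2.2.2), ⟨(z.2.1.1, z.2.2.1), (z.2.1.2, z.2.2.2)⟩⟩)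
  · rintro ⟨⟨a, b⟩, ⟨⟨p, q⟩, ⟨r, s⟩⟩⟩ h
    simp only [Finset.mem_sigma, Finset.HasAntidiagonal.mem_antidiagonal] at h ⊢
    obtain ⟨rfl, rfl, rfl⟩ := h
    simp [add_add_add_comm]
  · rintro ⟨⟨a, b⟩, ⟨⟨p, q⟩, ⟨r, s⟩⟩⟩ h
    simp only [Finset.mem_sigma, Finset.HasAntidiagonal.mem_antidiagonal] at h ⊢
    obtain ⟨rfl, rfl, rfl⟩ := h
    simp [add_add_add_comm]
  · rintro ⟨⟨a, b⟩, ⟨⟨p, q⟩, ⟨r, s⟩⟩⟩ h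
    simp only [Finset.mem_sigma, Finset.HasAntidiagonal.mem_antidiagonal] at h ⊢
    obtain ⟨rfl, rfl, rfl⟩ := h
    rfl
  · rintro ⟨⟨a, b⟩, ⟨⟨p, q⟩, ⟨r, s⟩⟩⟩ h
    simp only [Finset.mem_sigma, Finset.HasAntidiagonal.mem_antidiagonal] at h ⊢
    obtain ⟨rfl, rfl, rfl⟩ := h
    rfl
  · intro z _
    rfl

/-- Rescaling is compatible with products because `c^{u+v} = c^u c^v`. Both sides are sums over
decompositions into four monomials, with the middle two interchanged. -/
theorem conv_pull (B : V →ₗ[k] W →ₗ[k] X) (c : P → unitsZero D k) (a : D.Mon → V)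
    (b : D.Mon → W) : conv B (pull c a) (pull c b) = pull c (conv B a b) := by
  funext w
  have h1 : conv B (pull c a) (pull c b) w =
      ∑ v ∈ Finset.HasAntidiagonal.antidiagonal w, ∑ x ∈ Finset.HasAntidiagonal.antidiagonal v.1,
        ∑ y ∈ Finset.HasAntidiagonal.antidiagonal v.2,
          (coeff x.2 (unitVal c x.1) * coeff y.2 (unitVal c y.1)) • B (a x.1) (b y.1) := by
    refine Finset.sum_congr rfl fun v _ => ?_
    simp only [pull, map_sum, LinearMap.sum_apply, map_smul, LinearMap.smul_apply, Finset.smul_sum, smul_smul]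
    rw [Finset.sum_comm]
    refine Finset.sum_congr rfl fun x _ => Finset.sum_congr rfl fun y _ => ?_
    rw [mul_comm]
  have h2 : pull c (conv B a b) w =
      ∑ v ∈ Finset.HasAntidiagonal.antidiagonal w, ∑ x ∈ Finset.HasAntidiagonal.antidiagonal v.1,
        ∑ y ∈ Finset.HasAntidiagonal.antidiagonal v.2,
          (coeff y.1 (unitVal c x.1) * coeff y.2 (unitVal c x.2)) • B (a x.1) (b x.2) := by
    refine Finset.sum_congr rfl fun v _ => ?_
    simp only [conv, Finset.smul_sum]
    refine Finset.sum_congr rfl fun x hx => ?_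
    rw [Finset.HasAntidiagonal.mem_antidiagonal] at hx
    rw [← hx, unitVal_add, coeff_mul, Finset.sum_smul]
  rw [h1, h2]
  exact sum_antidiagonal_four
    (fun x1 x2 y1 y2 => (coeff x2 (unitVal c x1) * coeff y2 (unitVal c y1)) • B (a x1) (b y1)) w

end pull

/-! ### The automorphism attached to a family of units -/

section rescale

variable {P : Type*} [Fintype P] {G : Type*} [AddCommGroup G] {𝔾 : GradingDatum G}
  {D : CoeffDatum P 𝔾} {k : Type*} [Field k]

/-- The algebra endomorphism `r^u ↦ r^u c^u` of `R`. -/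
noncomputable def rescaleHom (c : P → unitsZero D k) : D.R k →ₐ[k] D.R k where
  toFun x := ⟨pull (V := k) c (x : D.Formal k), by
    refine ⟨x.2.1.subset ?_, finite_pull x.2.2⟩
    rintro y ⟨w, hw, rfl⟩
    obtain ⟨u, v, rfl, hv, hu⟩ := exists_of_pull_ne_zero hw
    exact ⟨u, hu, by rw [deg_add, unitVal_mem_homog c u v hv, add_zero]⟩⟩
  map_one' := by
    refine coeff_ext fun w => ?_
    change ∑ v ∈ Finset.HasAntidiagonal.antidiagonal w, coeff v.2 (unitVal c v.1) •
      coeff v.1 (1 : D.R k) = _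
    rw [Finset.sum_eq_single (0, w)]
    · simp [unitVal_zero, coeff_one]
    · rintro ⟨v, u⟩ hv hne
      rw [coeff_one, if_neg, smul_zero]
      rintro rfl
      exact hne (by simpa using hv)
    · simp
  -- Multiplicativity is the compatibility of pullback with convolution, for the product of the
  -- field.
  map_mul' x y := Subtype.ext
    (conv_pull (LinearMap.mul k k) c (x : D.Formal k) (y : D.Formal k)).symm
  map_zero' := by
    refine coeff_ext fun w => ?_
    exact Finset.sum_eq_zero fun v _ => smul_zero _
  map_add' x y := by
    refine coeff_ext fun w => ?_
    change ∑ v ∈ Finset.HasAntidiagonal.antidiagonal w, coeff v.2 (unitVal c v.1) •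
      coeff v.1 (x + y) = ∑ v ∈ Finset.HasAntidiagonal.antidiagonal w, _ +
        ∑ v ∈ Finset.HasAntidiagonal.antidiagonal w, _
    rw [← Finset.sum_add_distrib]
    exact Finset.sum_congr rfl fun v _ => smul_add _ _ _
  commutes' t := by
    refine coeff_ext fun w => ?_
    rw [Algebra.algebraMap_eq_smul_one]
    change ∑ v ∈ Finset.HasAntidiagonal.antidiagonal w, coeff v.2 (unitVal c v.1) •
      coeff v.1 (t • (1 : D.R k)) = _
    rw [Finset.sum_eq_single (0, w)]
    · simp [unitVal_zero, coeff_one, coeff_smul, mul_comm]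
    · rintro ⟨v, u⟩ hv hne
      rw [coeff_smul, coeff_one, if_neg, mul_zero, smul_zero]
      rintro rfl
      exact hne (by simpa using hv)
    · simp

theorem coeff_rescaleHom (c : P → unitsZero D k) (x : D.R k) (w : D.Mon) :
    coeff w (rescaleHom c x) =
      ∑ v ∈ Finset.HasAntidiagonal.antidiagonal w, coeff v.2 (unitVal c v.1) * coeff v.1 x := rfl

theorem rescaleHom_mono (c : P → unitsZero D k) (u : D.Mon) :
    rescaleHom c (D.mono k u) = D.mono k u * unitVal c u := by
  refine coeff_ext fun w => ?_
  rw [coeff_rescaleHom, coeff_mul]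
  refine Finset.sum_congr rfl fun v _ => ?_
  by_cases h : v.1 = u
  · rw [h, mul_comm]
  · rw [coeff_mono_ne h, mul_zero, zero_mul]

/-- Multiplication of the coefficients by scalars. -/
noncomputable def scale (s : D.Mon → k) : D.R k →ₗ[k] D.R k where
  toFun x := ⟨fun u => s u * coeff u x,
    x.2.1.subset (by
      rintro y ⟨u, hu, rfl⟩
      exact ⟨u, right_ne_zero_of_mul hu, rfl⟩),
    fun n => (x.2.2 n).subset (by
      rintro u ⟨hu, hn⟩
      exact ⟨right_ne_zero_of_mul hu, hn⟩)⟩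
  map_add' x y := coeff_ext fun u => mul_add _ _ _
  map_smul' t x := coeff_ext fun u => mul_left_comm _ _ _

theorem coeff_scale (s : D.Mon → k) (x : D.R k) (u : D.Mon) :
    coeff u (scale s x) = s u * coeff u x := rfl

/-- Once the coefficient of `r^w` is divided by the constant term of `c^w`, the diagonal
contribution is exactly that of `x`; whatever is left comes from proper divisors of `w`. -/
theorem coeff_scale_rescaleHom (c : P → unitsZero D k) (x : D.R k) (w : D.Mon)
    (h : coeff w (x - scale (fun u => (coeff 0 (unitVal c u))⁻¹) (rescaleHom c x)) ≠ 0) :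
    ∃ u v, u + v = w ∧ v ≠ 0 ∧ coeff v (unitVal c u) ≠ 0 ∧ coeff u x ≠ 0 := by
  classical
  rw [coeff_sub, coeff_scale, coeff_rescaleHom,
    ← Finset.add_sum_erase _ _ (show (w, 0) ∈ Finset.HasAntidiagonal.antidiagonal w by simp),
    mul_add, inv_mul_cancel_left₀ (coeff_zero_unitVal_ne_zero c w), sub_add_cancel_left,
    neg_ne_zero] at h
  obtain ⟨⟨u, v⟩, huv, hne⟩ := Finset.exists_ne_zero_of_sum_ne_zero (right_ne_zero_of_mul h)
  rw [Finset.mem_erase, Finset.HasAntidiagonal.mem_antidiagonal] at huv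
  refine ⟨u, v, huv.2, ?_, left_ne_zero_of_mul hne, right_ne_zero_of_mul hne⟩
  rintro rfl
  exact huv.1 (Prod.ext (by simpa using huv.2) rfl)

/-- `scale s ∘ rescaleHom c = 1 - N` with `N` raising the filtration. -/
noncomputable def rescaleDefect (c : P → unitsZero D k) : D.R k →ₗ[k] D.R k :=
  LinearMap.id - scale (fun u => (coeff 0 (unitVal c u))⁻¹) ∘ₗ (rescaleHom c).toLinearMap

theorem rescaleDefect_mem_fil (c : P → unitsZero D k) (n : ℕ) (x : D.R k) (hx : x ∈ D.fil k n) :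
    rescaleDefect c x ∈ D.fil k (n + 1) := by
  intro w hw
  obtain ⟨u, v, rfl, hv, -, hu⟩ := coeff_scale_rescaleHom c x w hw
  exact mem_pow_succ.2 ⟨v, u, hv, hx u hu, rfl⟩

theorem sub_rescaleDefect (c : P → unitsZero D k) (x : D.R k) :
    x - rescaleDefect c x = scale (fun u => (coeff 0 (unitVal c u))⁻¹) (rescaleHom c x) := by
  simp [rescaleDefect]

/-- Composition with an invertible diagonal scaling gives `1 - N` with `N` raising the filtration,
which is bijective by the geometric series. -/
theorem rescaleHom_bijective (c : P → unitsZero D k) : Function.Bijective (rescaleHom c) := by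
  have h := sub_apply_bijective (rescaleDefect c) (rescaleDefect_mem_fil c) (by
    intro S x hx w hw
    obtain ⟨u, v, rfl, -, hv, hu⟩ := coeff_scale_rescaleHom c x w hw
    rw [deg_add, unitVal_mem_homog c u v hv, add_zero]
    exact hx u hu)
  simp only [sub_rescaleDefect] at h
  refine ⟨fun x y hxy => h.1 (by simp only [hxy]), fun y => ?_⟩
  obtain ⟨x, hx⟩ := h.2 (scale (fun u => (coeff 0 (unitVal c u))⁻¹) y)
  refine ⟨x, coeff_ext fun u => ?_⟩
  have := congrArg (coeff u) hx
  simp only [coeff_scale] at this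
  exact mul_left_cancel₀ (inv_ne_zero (coeff_zero_unitVal_ne_zero c u)) this

/-- The algebra automorphism `r^u ↦ r^u c^u` of `R`. -/
noncomputable def rescale (c : P → unitsZero D k) : D.R k ≃ₐ[k] D.R k :=
  AlgEquiv.ofBijective (rescaleHom c) (rescaleHom_bijective c)

theorem rescale_mono (c : P → unitsZero D k) (u : D.Mon) :
    rescale c (D.mono k u) = D.mono k u * unitVal c u := rescaleHom_mono c u

theorem isAut_rescale (c : P → unitsZero D k) : IsAut (rescale c) := by
  refine ⟨fun y x hx w hw => ?_, fun n x => ⟨fun hx w hw => ?_, fun hx => ?_⟩⟩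
  · obtain ⟨u, v, rfl, hne⟩ := exists_of_sum_antidiagonal_ne_zero
      (F := fun u v => coeff v (unitVal c u) * coeff u x) hw
    rw [deg_add, unitVal_mem_homog c u v (left_ne_zero_of_mul hne), add_zero]
    exact hx u (right_ne_zero_of_mul hne)
  · obtain ⟨u, v, rfl, hne⟩ := exists_of_sum_antidiagonal_ne_zero
      (F := fun u v => coeff v (unitVal c u) * coeff u x) hw
    exact pow_add_mem (hx u (right_ne_zero_of_mul hne))
  · refine mem_fil_of_sub_apply (rescaleDefect_mem_fil c) ?_
    rw [sub_rescaleDefect]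
    intro u hu
    exact hx u (right_ne_zero_of_mul hu)

/-- Only divisors of `w` contribute to the coefficient of `r^w`, so the formal sum defining
`tensorMap` becomes a sum over decompositions of `w`. -/
theorem tensorMap_eq_pull {V : Type*} [AddCommGroup V] [Module k V] {ψ : D.R k ≃ₐ[k] D.R k}
    {c : P → unitsZero D k} (h : ∀ u, ψ (D.mono k u) = D.mono k u * unitVal c u)
    (a : D.Mon → V) : tensorMap ψ id a = pull c a := by
  classical
  funext w
  have hinj : Set.InjOn Prod.fst (Finset.HasAntidiagonal.antidiagonal w : Set (D.Mon × D.Mon)) := by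
    rintro ⟨u, v⟩ h1 ⟨u', v'⟩ h2 h3
    simp only [Finset.mem_coe, Finset.HasAntidiagonal.mem_antidiagonal] at h1 h2 h3
    subst h3
    exact Prod.ext rfl (add_left_cancel (h1.trans h2.symm))
  rw [tensorMap, finsum_eq_sum_of_support_subset (s :=
    (Finset.HasAntidiagonal.antidiagonal w).image Prod.fst), Finset.sum_image hinj, pull]
  · refine Finset.sum_congr rfl fun v hv => ?_
    rw [Finset.HasAntidiagonal.mem_antidiagonal] at hv
    rw [h, mul_comm, ← hv, add_comm, coeff_mul_mono, id]
  · intro u hu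
    have h1 : coeff w (ψ (D.mono k u)) ≠ 0 := fun h0 => hu (by simp [h0])
    rw [h, mul_comm] at h1
    obtain ⟨v, hv⟩ := exists_of_coeff_mul_mono _ _ _ h1
    simp only [Finset.coe_image, Set.mem_image, Finset.mem_coe,
      Finset.HasAntidiagonal.mem_antidiagonal]
    exact ⟨(u, v), by rw [← hv, add_comm], rfl⟩

end rescale

/-! ### Every automorphism rescales the coordinates -/

section automorphisms

variable {P : Type*} [Fintype P] [DecidableEq P] {G : Type*} [AddCommGroup G]
  {𝔾 : GradingDatum G} {D : CoeffDatum P 𝔾} {k : Type*} [Field k]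

/-- Every monomial is the quotient of two monomials in the `r_p`. -/
theorem exists_add_eq_sum_basis (h : ∀ p, Pi.single p 1 ∈ D.monoid) (u : D.Mon) :
    u + ∑ p, (-(u : P → ℤ) p).toNat • basis h p = ∑ p, ((u : P → ℤ) p).toNat • basis h p := by
  apply Subtype.ext
  funext q
  have key : ∀ m : P → ℕ, ((∑ p, m p • basis h p : D.Mon) : P → ℤ) q = m q := by
    intro m
    rw [AddSubmonoid.coe_finsetSum, Finset.sum_apply, Finset.sum_eq_single q]
    · simp [basis]
    · intro p _ hp
      simp [basis, Pi.single_eq_of_ne hp.symm]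
    · simp
  change (u : P → ℤ) q + ((∑ p, (-(u : P → ℤ) p).toNat • basis h p : D.Mon) : P → ℤ) q = _
  rw [key, key]
  omega

theorem sum_basis_induction {C : D.Mon → Prop} (h : ∀ p, Pi.single p 1 ∈ D.monoid)
    (h0 : C 0) (hadd : ∀ u v, C u → C v → C (u + v)) (hb : ∀ p, C (basis h p)) (m : P → ℕ) :
    C (∑ p, m p • basis h p) := by
  refine Finset.sum_induction _ C hadd h0 fun p _ => ?_
  induction m p with
  | zero => simpa using h0
  | succ n ih => rw [succ_nsmul]; exact hadd _ _ ih (hb p)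

/-- The image of `r_p` lies in `𝔪` and has the degree of `r_p`, so niceness writes it as `c_p r_p`.
The values on the remaining monomials follow because each is a quotient of two monomials in the
`r_p`, and multiplication by a monomial is injective. -/
theorem IsAut.exists_units (hD : D.IsNice k) {ψ : D.R k ≃ₐ[k] D.R k} (hψ : IsAut ψ) :
    ∃ c : P → unitsZero D k, ∀ u, ψ (D.mono k u) = D.mono k u * unitVal c u := by
  have h1 : ∀ p, ∃ c : unitsZero D k, ψ (D.mono k (basis hD.mem p)) =
      D.mono k (basis hD.mem p) * ((c : (D.R k)ˣ) : D.R k) := by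
    intro p
    have hm : D.mono k (basis hD.mem p) ∈ D.fil k 1 :=
      mono_mem_fil.2 (mem_pow_one.2 (hD.basis_ne_zero p))
    obtain ⟨c, hc, hcp⟩ := hD.gen_hat p _ ⟨(hψ.2 1 _).1 hm, hψ.1 _ _ (mono_mem_homog _)⟩
    -- If the constant term vanished, the image of `r_p` would lie in `𝔪²`, and hence so would
    -- `r_p`.
    have h0 : coeff 0 c ≠ 0 := by
      intro h0
      apply hD.not_mem_sq p
      rw [hψ.2 2, hcp]
      refine mul_mem_fil (m := 1) (fun u hu => ?_) hm
      rw [mem_pow_one]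
      rintro rfl
      exact hu h0
    obtain ⟨x, hx⟩ := isUnit_of_coeff_zero hc h0
    exact ⟨⟨x, by
      change (x : D.R k) ∈ D.homog k 0; rw [hx]; exact hc⟩, by
      rw [hcp, mul_comm]; simp only [hx]⟩
  choose c hc using h1
  refine ⟨c, fun u => ?_⟩
  have h2 : ∀ m : P → ℕ, ψ (D.mono k (∑ p, m p • basis hD.mem p)) =
      D.mono k (∑ p, m p • basis hD.mem p) * unitVal c (∑ p, m p • basis hD.mem p) := by
    refine sum_basis_induction (C := fun u => ψ (D.mono k u) = D.mono k u * unitVal c u) hD.mem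
      ?_ ?_ ?_
    · rw [mono_zero, unitVal_zero, map_one, one_mul]
    · intro u v hu hv
      rw [mono_add, map_mul, hu, hv, unitVal_add]; ring
    · intro p
      rw [hc, unitVal_basis]
  have h3 := exists_add_eq_sum_basis hD.mem u
  set w := ∑ p, (-(u : P → ℤ) p).toNat • basis hD.mem p with hw
  -- Here `u + w` and `w` are both sums of basis vectors, so `ψ` is known on their monomials. The
  -- factor of `w`, a unit times a monomial, is then cancelled.
  have h4 : ψ (D.mono k u) * ψ (D.mono k w) = D.mono k u * unitVal c u * ψ (D.mono k w) := by
    rw [← map_mul, ← mono_add, h3, h2, ← h3, hw, h2, ← hw, mono_add, unitVal_add]; ring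
  rw [hw, h2, ← hw, ← mul_assoc, ← mul_assoc] at h4
  have h5 : IsUnit (unitVal c w) := (unitPow c w : (D.R k)ˣ).isUnit
  have h6 := h5.mul_right_cancel h4
  exact mul_mono_cancel h6

end automorphisms

end CoeffDatum

namespace CoeffDatum

/-! ### Continuity of filtered automorphisms -/

section continuity

variable {P : Type*} [Fintype P] {G : Type*} [AddCommGroup G] {𝔾 : GradingDatum G}
  {D : CoeffDatum P 𝔾} {k : Type*} [Field k]

/-- Automorphisms respecting the filtration are determined by their values on monomials. -/
theorem IsFiltered.coeff_apply {ψ : D.R k ≃ₐ[k] D.R k} (hψ : IsFiltered ψ) {n : ℕ} {w : D.Mon}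
    (hw : w ∉ D.pow n) (x : D.R k) {S : Finset D.Mon}
    (hS : ∀ u, coeff u x ≠ 0 → u ∉ D.pow n → u ∈ S) :
    coeff w (ψ x) = ∑ u ∈ S, coeff u x * coeff w (ψ (D.mono k u)) := by
  classical
  -- Modulo the `n`-th step, `x` is a finite combination of monomials, to which linearity of `ψ`
  -- applies.
  have h : x - ∑ u ∈ S, coeff u x • D.mono k u ∈ D.fil k n := by
    intro v hv
    by_contra hc
    apply hv
    rw [coeff_sub, coeff_sum]
    by_cases hvS : v ∈ S
    · rw [Finset.sum_eq_single v]
      · rw [coeff_smul, coeff_mono_self, mul_one, sub_self]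
      · intro u _ hu
        rw [coeff_smul, coeff_mono_ne hu.symm, mul_zero]
      · exact fun h => absurd hvS h
    · rw [Finset.sum_eq_zero, sub_zero]
      · by_contra hx
        exact hvS (hS v hx hc)
      · intro u hu
        rw [coeff_smul, coeff_mono_ne (by rintro rfl; exact hvS hu), mul_zero]
  have h2 := coeff_eq_zero_of_mem_fil ((hψ n _).1 h) hw
  rw [map_sub, coeff_sub, sub_eq_zero, map_sum, coeff_sum] at h2
  rw [h2]
  exact Finset.sum_congr rfl fun u _ => by rw [map_smul, coeff_smul]

end continuity

/-! ### The action of the group on monomials -/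

section monomials

variable {P : Type*} [Fintype P] [DecidableEq P] {G : Type*} [AddCommGroup G]
  {𝔾 : GradingDatum G} {D : CoeffDatum P 𝔾} {k : Type*} [Field k] {hD : D.IsNice k}
  {Γ : Type*} [Group Γ] [DistribMulAction Γ G] [MulAction Γ P]
  {a : Γ →* (D.R k ≃ₐ[k] D.R k)}

/-- The group permutes the `r_p` up to sign, hence also the products of the `r_p`. A general
monomial is a quotient of two such products, and its image is found by division. -/
theorem IsSpecialAction.exists_mono (hR : IsSpecialAction hD a) (g : Γ) (u : D.Mon) :
    ∃ w : D.Mon, (∀ q, (w : P → ℤ) q = (u : P → ℤ) (g⁻¹ • q)) ∧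
      ∃ s : k, s * s = 1 ∧ a g (D.mono k u) = s • D.mono k w := by
  let C : D.Mon → Prop := fun u => ∃ w : D.Mon, (∀ q, (w : P → ℤ) q = (u : P → ℤ) (g⁻¹ • q)) ∧
      ∃ s : k, s * s = 1 ∧ a g (D.mono k u) = s • D.mono k w
  have h : ∀ m : P → ℕ, C (∑ p, m p • basis hD.mem p) := by
    refine sum_basis_induction hD.mem ⟨0, fun q => rfl, 1, by simp, by simp [mono_zero]⟩ ?_ ?_
    · rintro u v ⟨w, hw, s, hs, h1⟩ ⟨x, hx, t, ht, h2⟩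
      refine ⟨w + x, fun q => ?_, s * t, ?_, ?_⟩
      · change (w : P → ℤ) q + (x : P → ℤ) q = (u : P → ℤ) _ + (v : P → ℤ) _
        rw [hw, hx]
      · rw [mul_mul_mul_comm, hs, ht, one_mul]
      · rw [mono_add, map_mul, h1, h2, mono_add, smul_mul_smul_comm]
    · intro p
      refine ⟨basis hD.mem (g • p), fun q => ?_, ?_⟩
      · simp [basis, Pi.single_apply, inv_smul_eq_iff]
      · rcases hR.special g p with h | h
        · exact ⟨1, by simp, by simp [h]⟩
        · exact ⟨-1, by simp, by simp [h]⟩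
  have h3 := exists_add_eq_sum_basis hD.mem u
  obtain ⟨x, hx, s, hs, h1⟩ := h fun p => (-(u : P → ℤ) p).toNat
  obtain ⟨y, hy, t, ht, h2⟩ := h fun p => ((u : P → ℤ) p).toNat
  rw [← h3] at h2 hy
  set v := ∑ p, (-(u : P → ℤ) p).toNat • basis hD.mem p with hv
  have hs0 : s ≠ 0 := by rintro rfl; simp at hs
  have ht0 : t ≠ 0 := by rintro rfl; simp at ht
  have h4 : a g (D.mono k u) * D.mono k x = (s * t) • D.mono k y := by
    rw [mul_smul, ← h2, mono_add, map_mul, h1, mul_smul_comm, smul_smul, hs, one_smul]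
  -- The image of `r^u`, multiplied by `r^x`, is `± r^y`. So `x` divides `y`, and the quotient is
  -- the required monomial.
  have h5 : coeff y (a g (D.mono k u) * D.mono k x) ≠ 0 := by
    rw [h4, coeff_smul, coeff_mono_self, mul_one]
    exact mul_ne_zero hs0 ht0
  obtain ⟨w, rfl⟩ := exists_of_coeff_mul_mono _ _ _ h5
  refine ⟨w, fun q => ?_, s * t, ?_, ?_⟩
  · have h6 := hy q
    have h7 := hx q
    change (w : P → ℤ) q + (x : P → ℤ) q = (u : P → ℤ) _ + (v : P → ℤ) _ at h6
    rw [h7] at h6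
    exact add_right_cancel h6
  · rw [mul_mul_mul_comm, hs, ht, one_mul]
  · rw [mono_add, ← smul_mul_assoc] at h4
    exact mul_mono_cancel h4

/-- The action of `Γ` on monomials. -/
noncomputable def mact (hR : IsSpecialAction hD a) (g : Γ) (u : D.Mon) : D.Mon :=
  (hR.exists_mono g u).choose

/-- The sign with which `g` acts on a monomial. -/
noncomputable def msgn (hR : IsSpecialAction hD a) (g : Γ) (u : D.Mon) : k :=
  (hR.exists_mono g u).choose_spec.2.choose

variable (hR : IsSpecialAction hD a)

theorem mact_apply (g : Γ) (u : D.Mon) (q : P) :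
    (mact hR g u : P → ℤ) q = (u : P → ℤ) (g⁻¹ • q) :=
  (hR.exists_mono g u).choose_spec.1 q

theorem msgn_mul_self (g : Γ) (u : D.Mon) : msgn hR g u * msgn hR g u = 1 :=
  (hR.exists_mono g u).choose_spec.2.choose_spec.1

theorem act_mono (g : Γ) (u : D.Mon) :
    a g (D.mono k u) = msgn hR g u • D.mono k (mact hR g u) :=
  (hR.exists_mono g u).choose_spec.2.choose_spec.2

theorem msgn_ne_zero (g : Γ) (u : D.Mon) : msgn hR g u ≠ 0 :=
  left_ne_zero_of_mul_eq_one (msgn_mul_self hR g u)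

theorem mact_add (g : Γ) (u v : D.Mon) : mact hR g (u + v) = mact hR g u + mact hR g v := by
  refine Subtype.ext (funext fun q => ?_)
  change _ = (mact hR g u : P → ℤ) q + (mact hR g v : P → ℤ) q
  rw [mact_apply, mact_apply, mact_apply]; rfl

theorem mact_zero (g : Γ) : mact hR g 0 = 0 := by
  refine Subtype.ext (funext fun q => ?_)
  rw [mact_apply]; rfl

theorem mact_mul (g h : Γ) (u : D.Mon) : mact hR (g * h) u = mact hR g (mact hR h u) := by
  refine Subtype.ext (funext fun q => ?_)
  rw [mact_apply, mact_apply, mact_apply, mul_inv_rev, mul_smul]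

theorem mact_one (u : D.Mon) : mact hR (1 : Γ) u = u := by
  refine Subtype.ext (funext fun q => ?_)
  rw [mact_apply, inv_one, one_smul]

theorem mact_basis (g : Γ) (p : P) : mact hR g (basis hD.mem p) = basis hD.mem (g • p) := by
  refine Subtype.ext (funext fun q => ?_)
  rw [mact_apply]
  simp [basis, Pi.single_apply, inv_smul_eq_iff]

@[simp] theorem mact_inv_mact (g : Γ) (u : D.Mon) : mact hR g⁻¹ (mact hR g u) = u := by
  rw [← mact_mul, inv_mul_cancel, mact_one]

@[simp] theorem mact_mact_inv (g : Γ) (u : D.Mon) : mact hR g (mact hR g⁻¹ u) = u := by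
  rw [← mact_mul, mul_inv_cancel, mact_one]

theorem mact_injective (g : Γ) : Function.Injective (mact hR g) :=
  Function.LeftInverse.injective (mact_inv_mact hR g)

theorem mact_eq_zero {g : Γ} {u : D.Mon} : mact hR g u = 0 ↔ u = 0 := by
  constructor
  · intro h
    exact mact_injective hR g (h.trans (mact_zero hR g).symm)
  · rintro rfl
    exact mact_zero hR g

theorem msgn_add (g : Γ) (u v : D.Mon) :
    msgn hR g (u + v) = msgn hR g u * msgn hR g v := by
  have h := act_mono hR g (u + v)
  rw [mono_add, map_mul, act_mono hR, act_mono hR, smul_mul_smul_comm, ← mono_add,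
    ← mact_add] at h
  have := congrArg (coeff (mact hR g (u + v))) h
  rw [coeff_smul, coeff_smul, coeff_mono_self, mul_one, mul_one] at this
  exact this.symm

theorem msgn_mul (g h : Γ) (u : D.Mon) :
    msgn hR (g * h) u = msgn hR g (mact hR h u) * msgn hR h u := by
  have e := act_mono hR (g * h) u
  rw [map_mul, AlgEquiv.mul_apply, act_mono hR, map_smul, act_mono hR, smul_smul,
    ← mact_mul] at e
  have := congrArg (coeff (mact hR (g * h) u)) e
  rw [coeff_smul, coeff_smul, coeff_mono_self, mul_one, mul_one] at this
  rw [← this, mul_comm]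

theorem deg_mact (g : Γ) (u : D.Mon) : D.deg (mact hR g u) = g • D.deg u := by
  refine hR.graded g _ _ (mono_mem_homog u) (mact hR g u) ?_
  rw [act_mono hR, coeff_smul, coeff_mono_self, mul_one]
  exact msgn_ne_zero hR g u

theorem mact_mem_pow_of_mem {g : Γ} {u : D.Mon} {n : ℕ} (h : u ∈ D.pow n) :
    mact hR g u ∈ D.pow n := by
  refine (hR.filtered g n _).1 (mono_mem_fil.2 h) (mact hR g u) ?_
  rw [act_mono hR, coeff_smul, coeff_mono_self, mul_one]
  exact msgn_ne_zero hR g u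

theorem mact_mem_pow {g : Γ} {u : D.Mon} {n : ℕ} : mact hR g u ∈ D.pow n ↔ u ∈ D.pow n :=
  ⟨fun h => by simpa using mact_mem_pow_of_mem hR (g := g⁻¹) h, mact_mem_pow_of_mem hR⟩

theorem mact_ne_basis {g : Γ} {z : D.Mon} (hz : ∀ q, z ≠ basis hD.mem q) (q : P) :
    mact hR g z ≠ basis hD.mem q := by
  intro h
  apply hz (g⁻¹ • q)
  rw [← mact_basis hR, ← h, mact_inv_mact]

theorem mact_mem_filt_of_mem {g : Γ} {u : D.Mon} {s : ℕ} (h : u ∈ filt hD.mem s) :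
    mact hR g u ∈ filt hD.mem s := by
  induction s generalizing u with
  | zero => trivial
  | succ s ih =>
    rcases h with ⟨v, z, hv, hz, rfl⟩ | ⟨v, z, hv, ⟨p, hp⟩, hz, hq, rfl⟩
    · rw [mact_add]
      exact filt_add_succ (ih hv) (mt (mact_eq_zero hR).1 hz)
    · rw [mact_add]
      refine filt_shift (p := g • p) (by rw [deg_mact, hv, smul_zero]) ?_
        (mt (mact_eq_zero hR).1 hz) (mact_ne_basis hR hq)
      rw [← mact_basis hR, ← mact_add]
      exact ih hp

theorem mact_mem_filt {g : Γ} {u : D.Mon} {s : ℕ} :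
    mact hR g u ∈ filt hD.mem s ↔ u ∈ filt hD.mem s :=
  ⟨fun h => by simpa using mact_mem_filt_of_mem hR (g := g⁻¹) h, mact_mem_filt_of_mem hR⟩

theorem sum_antidiagonal_mact {X : Type*} [AddCommMonoid X] (g : Γ) (F : D.Mon → D.Mon → X)
    (u : D.Mon) :
    ∑ v ∈ Finset.HasAntidiagonal.antidiagonal (mact hR g u), F v.1 v.2 =
    ∑ v ∈ Finset.HasAntidiagonal.antidiagonal u, F (mact hR g v.1) (mact hR g v.2) := by
  symm
  refine Finset.sum_nbij' (fun v => (mact hR g v.1, mact hR g v.2))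
    (fun v => (mact hR g⁻¹ v.1, mact hR g⁻¹ v.2)) ?_ ?_ ?_ ?_ ?_
  · rintro v hv
    rw [Finset.HasAntidiagonal.mem_antidiagonal] at hv ⊢
    rw [← mact_add, hv]
  · rintro v hv
    rw [Finset.HasAntidiagonal.mem_antidiagonal] at hv ⊢
    rw [← mact_add, hv, mact_inv_mact]
  · rintro v _
    simp
  · rintro v _
    simp
  · rintro v _
    rfl

/-- Being filtered, the action is continuous, so its effect on a series can be read off from the
signed permutation of monomials. -/
theorem coeff_act (g : Γ) (x : D.R k) (u : D.Mon) :
    coeff (mact hR g u) (a g x) = msgn hR g u * coeff u x := by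
  classical
  obtain ⟨n, hn⟩ := exists_notMem_pow (mact hR g u)
  rw [(hR.filtered g).coeff_apply hn x (S := insert u (x.2.2 n).toFinset)
    (fun v hv hvn => Finset.mem_insert_of_mem (by simpa using ⟨hv, hvn⟩)),
    Finset.sum_eq_single u]
  · rw [act_mono hR, coeff_smul, coeff_mono_self, mul_one, mul_comm]
  · intro v _ hv
    rw [act_mono hR, coeff_smul, coeff_mono_ne, mul_zero, mul_zero]
    exact fun h => hv (mact_injective hR g h).symm
  · intro h
    exact absurd (Finset.mem_insert_self _ _) h

theorem act_unitVal {c : P → unitsZero D k} (g : Γ)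
    (hc : ∀ p, a g ((c p : (D.R k)ˣ) : D.R k) = ((c (g • p) : (D.R k)ˣ) : D.R k)) (u : D.Mon) :
    a g (unitVal c u) = unitVal c (mact hR g u) := by
  have h1 : Units.map (a g : D.R k →* D.R k) (unitPow c u : (D.R k)ˣ) =
      (unitPow c (mact hR g u) : (D.R k)ˣ) := by
    simp only [unitPow, Subgroup.val_finsetProd, SubgroupClass.coe_zpow, map_prod, map_zpow]
    refine Fintype.prod_equiv (MulAction.toPerm g) _ _ fun p => ?_
    rw [MulAction.toPerm_apply, mact_apply, inv_smul_smul]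
    congr 1
    exact Units.ext (hc p)
  exact congrArg Units.val h1

theorem funext_mact {V : Type*} (g : Γ) {x y : D.Mon → V}
    (h : ∀ u, x (mact hR g u) = y (mact hR g u)) : x = y := by
  funext u
  have := h (mact hR g⁻¹ u)
  rwa [mact_mact_inv] at this

variable {V : Type*} [AddCommGroup V] [Module k V]

theorem tensorMap_mact (g : Γ) (φ : V → V) (x : D.Mon → V) (u : D.Mon) :
    tensorMap (a g) φ x (mact hR g u) = msgn hR g u • φ (x u) := by
  rw [tensorMap, finsum_eq_single _ u]
  · rw [act_mono hR, coeff_smul, coeff_mono_self, mul_one]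
  · intro v hv
    rw [act_mono hR, coeff_smul, coeff_mono_ne, mul_zero, zero_smul]
    exact fun h => hv (mact_injective hR g h).symm

/-- `φ ⊗ g` as a linear map. -/
noncomputable def tensorAct (g : Γ) (φ : V →ₗ[k] V) : (D.Mon → V) →ₗ[k] (D.Mon → V) where
  toFun := tensorMap (a g) φ
  map_add' x y := funext_mact hR g fun u => by
    simp only [Pi.add_apply, tensorMap_mact hR, map_add, smul_add]
  map_smul' t x := funext_mact hR g fun u => by
    simp only [Pi.smul_apply, tensorMap_mact hR, map_smul, RingHom.id_apply]
    rw [smul_comm]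

theorem tensorAct_mact (g : Γ) (φ : V →ₗ[k] V) (x : D.Mon → V) (u : D.Mon) :
    tensorAct hR g φ x (mact hR g u) = msgn hR g u • φ (x u) := tensorMap_mact hR g φ x u

theorem tensorAct_mul (g h : Γ) (φ χ : V →ₗ[k] V) (x : D.Mon → V) :
    tensorAct hR (g * h) (φ ∘ₗ χ) x = tensorAct hR g φ (tensorAct hR h χ x) := by
  refine funext_mact hR (g * h) fun u => ?_
  rw [tensorAct_mact, mact_mul, tensorAct_mact, tensorAct_mact, msgn_mul, map_smul, smul_smul]
  rfl

theorem tensorAct_conv {W X : Type*} [AddCommGroup W] [Module k W] [AddCommGroup X] [Module k X]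
    (g : Γ) {B : V →ₗ[k] W →ₗ[k] X} {φ : V →ₗ[k] V} {χ : W →ₗ[k] W} {θ : X →ₗ[k] X}
    (h : ∀ x y, θ (B x y) = B (φ x) (χ y)) (x : D.Mon → V) (y : D.Mon → W) :
    tensorAct hR g θ (conv B x y) = conv B (tensorAct hR g φ x) (tensorAct hR g χ y) := by
  refine funext_mact hR g fun u => ?_
  rw [tensorAct_mact, conv, conv, sum_antidiagonal_mact hR g (fun v w =>
    B (tensorAct hR g φ x v) (tensorAct hR g χ y w)), map_sum, Finset.smul_sum]
  refine Finset.sum_congr rfl fun v hv => ?_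
  rw [Finset.HasAntidiagonal.mem_antidiagonal] at hv
  rw [tensorAct_mact, tensorAct_mact, h, ← hv, msgn_add]
  simp only [map_smul, LinearMap.smul_apply, smul_smul]
  rw [mul_comm]

/-- Rescaling by an equivariant family of units commutes with the group, so pullbacks of invariant
elements stay invariant. -/
theorem tensorAct_pull {c : P → unitsZero D k} (g : Γ)
    (hc : ∀ p, a g ((c p : (D.R k)ˣ) : D.R k) = ((c (g • p) : (D.R k)ˣ) : D.R k))
    (φ : V →ₗ[k] V) (x : D.Mon → V) :
    tensorAct hR g φ (pull c x) = pull c (tensorAct hR g φ x) := by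
  refine funext_mact hR g fun u => ?_
  rw [tensorAct_mact, pull, pull, sum_antidiagonal_mact hR g (fun v w =>
    coeff w (unitVal c v) • tensorAct hR g φ x v), map_sum, Finset.smul_sum]
  refine Finset.sum_congr rfl fun v hv => ?_
  rw [Finset.HasAntidiagonal.mem_antidiagonal] at hv
  rw [tensorAct_mact, ← act_unitVal hR g hc, coeff_act, ← hv, msgn_add, map_smul, smul_smul,
    smul_smul]
  congr 1
  ring

theorem tensorAct_hatSMul (g : Γ) (φ : V →ₗ[k] V) (c : D.R k) (x : D.Mon → V) :
    tensorAct hR g φ (hatSMul c x) = hatSMul (a g c) (tensorAct hR g φ x) := by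
  refine funext_mact hR g fun u => ?_
  rw [tensorAct_mact, hatSMul, hatSMul, sum_antidiagonal_mact hR g (fun v w =>
    coeff v (a g c) • tensorAct hR g φ x w), map_sum, Finset.smul_sum]
  refine Finset.sum_congr rfl fun v hv => ?_
  rw [Finset.HasAntidiagonal.mem_antidiagonal] at hv
  rw [tensorAct_mact, coeff_act, ← hv, msgn_add, map_smul, smul_smul, smul_smul]
  congr 1
  ring

theorem tensorAct_firstOrder (g : Γ) (φ : V →ₗ[k] V) (x : D.Mon → V) (p : P) :
    tensorAct hR g φ (firstOrder hD.mem x p) =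
      firstOrder hD.mem (tensorAct hR g φ x) (g • p) := by
  classical
  refine funext_mact hR g fun u => ?_
  rw [tensorAct_mact, firstOrder, firstOrder, ← mact_basis hR, tensorAct_mact, Pi.single_apply,
    Pi.single_apply]
  by_cases h : u = basis hD.mem p
  · simp [h]
  · rw [if_neg h, if_neg fun h' => h (mact_injective hR g h')]
    simp

theorem hatSMul_firstOrder_add (h : ∀ p, Pi.single p 1 ∈ D.monoid) (c : D.R k) (x : D.Mon → V)
    (p : P) (v : D.Mon) :
    hatSMul c (firstOrder h x p) (v + basis h p) = coeff v c • x (basis h p) := by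
  classical
  rw [hatSMul, Finset.sum_eq_single (v, basis h p)]
  · simp [firstOrder]
  · rintro ⟨y, z⟩ hz hne
    by_cases h' : z = basis h p
    · subst h'
      exact absurd (by simpa using hz) hne
    · simp [firstOrder, h']
  · simp

theorem exists_of_hatSMul_firstOrder_ne_zero (h : ∀ p, Pi.single p 1 ∈ D.monoid) {c : D.R k}
    {x : D.Mon → V} {p : P} {u : D.Mon} (hu : hatSMul c (firstOrder h x p) u ≠ 0) :
    ∃ v, v + basis h p = u ∧ coeff v c ≠ 0 := by
  classical
  obtain ⟨⟨v, w⟩, hvw, hne⟩ := Finset.exists_ne_zero_of_sum_ne_zero hu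
  rw [Finset.HasAntidiagonal.mem_antidiagonal] at hvw
  have : w = basis h p := by
    by_contra hc
    exact hne (by simp [firstOrder, hc])
  subst this
  exact ⟨v, hvw, fun h0 => hne (by simp [h0])⟩

end monomials

end CoeffDatum

theorem sgn_zero : sgn 0 = 1 := by simp [sgn]

theorem sgn_one : sgn 1 = -1 := by
  have : (1 : ZMod 2).val = 1 := by decide
  simp [sgn, this]

namespace CoeffDatum

/-! ### Extension of bilinear and trilinear maps to formal sums -/

section conv

variable {P : Type*} [Fintype P] {G : Type*} [AddCommGroup G] {𝔾 : GradingDatum G}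
  {D : CoeffDatum P 𝔾} {k : Type*} [Field k]

/-- A formal sum is supported in `S`. -/
def SuppIn {V : Type*} [AddCommGroup V] (S : Set D.Mon) (x : D.Mon → V) : Prop :=
  ∀ u ∉ S, x u = 0

section

variable {V : Type*} [AddCommGroup V]

theorem SuppIn.add {S : Set D.Mon} {x y : D.Mon → V} (hx : SuppIn S x) (hy : SuppIn S y) :
    SuppIn S (x + y) := fun u hu => by rw [Pi.add_apply, hx u hu, hy u hu, add_zero]

theorem SuppIn.neg {S : Set D.Mon} {x : D.Mon → V} (hx : SuppIn S x) :
    SuppIn S (-x) := fun u hu => by rw [Pi.neg_apply, hx u hu, neg_zero]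

theorem SuppIn.mono {S T : Set D.Mon} {x : D.Mon → V} (hx : SuppIn S x) (h : S ⊆ T) :
    SuppIn T x := fun u hu => hx u fun hc => hu (h hc)

theorem suppIn_pow_zero (x : D.Mon → V) : SuppIn (D.pow 0) x :=
  fun u hu => absurd (pow_zero_mem u) hu

theorem suppIn_pow_one {x : D.Mon → V} : SuppIn (D.pow 1) x ↔ x 0 = 0 := by
  constructor
  · exact fun h => h 0 fun h0 => mem_pow_one.1 h0 rfl
  · intro h u hu
    rw [mem_pow_one, not_not] at hu
    rw [hu, h]

end

section

variable {V W X Y : Type*} [AddCommGroup Y]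

/-- The extension of a trilinear map to formal sums. -/
noncomputable def conv₃ (t : V → W → X → Y) (x : D.Mon → V) (y : D.Mon → W)
    (z : D.Mon → X) : D.Mon → Y := fun u =>
  ∑ v ∈ Finset.HasAntidiagonal.antidiagonal u, ∑ w ∈ Finset.HasAntidiagonal.antidiagonal v.1,
    t (x w.1) (y w.2) (z v.2)

theorem conv₃_swap_left (t : V → W → X → Y) (x : D.Mon → V) (y : D.Mon → W) (z : D.Mon → X) :
    conv₃ t x y z = conv₃ (fun b a c => t a b c) y x z := by
  funext u
  refine Finset.sum_congr rfl fun v _ => ?_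
  exact sum_antidiagonal_swap (fun p q => t (x p) (y q) (z v.2)) v.1

theorem conv₃_congr {t t' : V → W → X → Y} {x : D.Mon → V} {y : D.Mon → W} {z : D.Mon → X}
    (h : ∀ u v w, t (x u) (y v) (z w) = t' (x u) (y v) (z w)) :
    conv₃ t x y z = conv₃ t' x y z := by
  funext u
  exact Finset.sum_congr rfl fun v _ => Finset.sum_congr rfl fun w _ => h _ _ _

theorem conv₃_add (t t' : V → W → X → Y) (x : D.Mon → V) (y : D.Mon → W) (z : D.Mon → X) :
    conv₃ (fun a b c => t a b c + t' a b c) x y z = conv₃ t x y z + conv₃ t' x y z := by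
  funext u
  simp [conv₃, Finset.sum_add_distrib]

end

variable {V W X Y Z : Type*} [AddCommGroup V] [Module k V] [AddCommGroup W] [Module k W]
  [AddCommGroup X] [Module k X] [AddCommGroup Y] [Module k Y] [AddCommGroup Z] [Module k Z]

/-- `conv` as a bilinear map. -/
noncomputable def convₗ (B : V →ₗ[k] W →ₗ[k] X) :
    (D.Mon → V) →ₗ[k] (D.Mon → W) →ₗ[k] (D.Mon → X) :=
  LinearMap.mk₂ k (conv B)
    (fun x y z => funext fun u => by simp [conv, Finset.sum_add_distrib])
    (fun t x y => funext fun u => by simp [conv, Finset.smul_sum])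
    (fun x y z => funext fun u => by simp [conv, Finset.sum_add_distrib])
    (fun t x y => funext fun u => by simp [conv, Finset.smul_sum])

theorem convₗ_apply (B : V →ₗ[k] W →ₗ[k] X) (x : D.Mon → V) (y : D.Mon → W) :
    convₗ B x y = conv B x y := rfl

theorem conv_suppIn_pow {B : V →ₗ[k] W →ₗ[k] X} {m n : ℕ} {x : D.Mon → V} {y : D.Mon → W}
    (hx : SuppIn (D.pow m) x) (hy : SuppIn (D.pow n) y) : SuppIn (D.pow (m + n)) (conv B x y) := by
  intro u hu
  by_contra hc
  obtain ⟨v, w, rfl, hv, hw⟩ := exists_of_conv_ne_zero hc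
  exact hu (add_mem_pow (by by_contra h; exact hv (hx v h)) (by by_contra h; exact hw (hy w h)))

theorem conv_mem_Hat {gr₁ : G → Submodule k V} {gr₂ : G → Submodule k W}
    {gr₃ : G → Submodule k X} {B : V →ₗ[k] W →ₗ[k] X}
    (hB : ∀ y z, ∀ a ∈ gr₁ y, ∀ b ∈ gr₂ z, B a b ∈ gr₃ (y + z)) {y z : G} {a : D.Mon → V}
    {b : D.Mon → W} (ha : a ∈ D.Hat gr₁ y) (hb : b ∈ D.Hat gr₂ z) :
    conv B a b ∈ D.Hat gr₃ (y + z) := by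
  refine ⟨fun u => Submodule.sum_mem _ fun v hv => ?_, fun n => ?_⟩
  · rw [Finset.HasAntidiagonal.mem_antidiagonal] at hv
    have := hB _ _ _ (ha.1 v.1) _ (hb.1 v.2)
    rwa [← hv, deg_add, add_sub_add_comm]
  · refine (((ha.2 n).prod (hb.2 n)).image fun z => z.1 + z.2).subset ?_
    rintro u ⟨hu, hn⟩
    obtain ⟨v, w, rfl, hv, hw⟩ := exists_of_conv_ne_zero hu
    exact ⟨(v, w), ⟨⟨hv, fun h => hn (pow_add_mem h)⟩,
      ⟨hw, fun h => hn (by rw [add_comm]; exact pow_add_mem h)⟩⟩, rfl⟩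

theorem conv_conv_left (B₁ : Z →ₗ[k] X →ₗ[k] Y) (B₂ : V →ₗ[k] W →ₗ[k] Z) (x : D.Mon → V)
    (y : D.Mon → W) (z : D.Mon → X) :
    conv B₁ (conv B₂ x y) z = conv₃ (fun a b c => B₁ (B₂ a b) c) x y z := by
  funext u
  refine Finset.sum_congr rfl fun v _ => ?_
  rw [conv, map_sum, LinearMap.sum_apply]

theorem conv_conv_right (B₁ : V →ₗ[k] Z →ₗ[k] Y) (B₂ : W →ₗ[k] X →ₗ[k] Z) (x : D.Mon → V)
    (y : D.Mon → W) (z : D.Mon → X) :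
    conv B₁ x (conv B₂ y z) = conv₃ (fun a b c => B₁ a (B₂ b c)) x y z := by
  funext u
  rw [conv₃, sum_antidiagonal_triple (fun p q r => B₁ (x p) (B₂ (y q) (z r)))]
  refine Finset.sum_congr rfl fun v _ => ?_
  rw [conv, map_sum]

theorem conv_swap (B : V →ₗ[k] W →ₗ[k] X) (x : D.Mon → V) (y : D.Mon → W) :
    conv B x y = conv B.flip y x := by
  funext u
  exact sum_antidiagonal_swap (fun p q => B (x p) (y q)) u

theorem conv_congr {B B' : V →ₗ[k] W →ₗ[k] X} {x : D.Mon → V} {y : D.Mon → W}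
    (h : ∀ u v, B (x u) (y v) = B' (x u) (y v)) : conv B x y = conv B' x y := by
  funext u
  exact Finset.sum_congr rfl fun v _ => h _ _

theorem conv_suppIn_filt_left [DecidableEq P] {h : ∀ p, Pi.single p 1 ∈ D.monoid}
    {B : V →ₗ[k] W →ₗ[k] X} {s : ℕ} {x : D.Mon → V} {y : D.Mon → W}
    (hx : SuppIn (filt h s) x) (hy : y 0 = 0) : SuppIn (filt h (s + 1)) (conv B x y) := by
  intro u hu
  by_contra hc
  obtain ⟨v, w, rfl, hv, hw⟩ := exists_of_conv_ne_zero hc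
  exact hu (filt_add_succ (by by_contra h; exact hv (hx v h)) (by rintro rfl; exact hw hy))

theorem conv_suppIn_filt_right [DecidableEq P] {h : ∀ p, Pi.single p 1 ∈ D.monoid}
    {B : V →ₗ[k] W →ₗ[k] X} {s : ℕ} {x : D.Mon → V} {y : D.Mon → W}
    (hx : x 0 = 0) (hy : SuppIn (filt h s) y) : SuppIn (filt h (s + 1)) (conv B x y) := by
  rw [conv_swap]
  exact conv_suppIn_filt_left hy hx

end conv

section Hat

variable {P : Type*} [Fintype P] {G : Type*} [AddCommGroup G] {𝔾 : GradingDatum G}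
  {D : CoeffDatum P 𝔾} {k : Type*} [Field k] {V : Type*} [AddCommGroup V] [Module k V]
  {gr : G → Submodule k V} {z : G}

theorem zero_mem_Hat : (0 : D.Mon → V) ∈ D.Hat gr z :=
  ⟨fun _ => Submodule.zero_mem _, fun _ => Set.finite_empty.subset fun _ hu => hu.1 rfl⟩

theorem add_mem_Hat {x y : D.Mon → V} (hx : x ∈ D.Hat gr z) (hy : y ∈ D.Hat gr z) :
    x + y ∈ D.Hat gr z := by
  refine ⟨fun u => Submodule.add_mem _ (hx.1 u) (hy.1 u),
    fun n => ((hx.2 n).union (hy.2 n)).subset ?_⟩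
  rintro u ⟨hu, hn⟩
  by_cases hx0 : x u = 0
  · exact Or.inr ⟨fun h => hu (by rw [Pi.add_apply, hx0, h, add_zero]), hn⟩
  · exact Or.inl ⟨hx0, hn⟩

theorem smul_mem_Hat {x : D.Mon → V} (t : k) (hx : x ∈ D.Hat gr z) : t • x ∈ D.Hat gr z :=
  ⟨fun u => Submodule.smul_mem _ _ (hx.1 u),
    fun n => (hx.2 n).subset fun _ hu => ⟨fun h => hu.1 (by rw [Pi.smul_apply, h, smul_zero]), hu.2⟩⟩

theorem sub_mem_Hat {x y : D.Mon → V} (hx : x ∈ D.Hat gr z) (hy : y ∈ D.Hat gr z) :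
    x - y ∈ D.Hat gr z := by
  rw [sub_eq_add_neg, ← neg_one_smul k y]
  exact add_mem_Hat hx (smul_mem_Hat _ hy)

end Hat

/-! ### Exponential series of formal sums -/

section expSum

variable {P : Type*} [Fintype P] {G : Type*} [AddCommGroup G] {𝔾 : GradingDatum G}
  {D : CoeffDatum P 𝔾} {k : Type*} [Field k]
  {V W X : Type*} [AddCommGroup V] [Module k V] [AddCommGroup W] [Module k W]
  [AddCommGroup X] [Module k X]

variable (k) in
/-- The exponential generating sum `∑ f_n / n!`. -/
noncomputable def expSum (f : ℕ → D.Mon → V) : D.Mon → V :=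
  fun u => ∑ᶠ n : ℕ, ((n.factorial : k)⁻¹) • f n u

theorem expSum_eq_sum {f : ℕ → D.Mon → V} (hf : ∀ n, SuppIn (D.pow n) (f n)) {u : D.Mon} {N : ℕ}
    (hN : u ∉ D.pow N) :
    expSum k f u = ∑ n ∈ Finset.range N, ((n.factorial : k)⁻¹) • f n u := by
  refine finsum_eq_sum_of_support_subset _ fun n hn => ?_
  rw [Finset.coe_range, Set.mem_Iio]
  by_contra hc
  rw [not_lt] at hc
  exact hn (by simp only; rw [hf n u fun h => hN (pow_antitone hc h), smul_zero])

theorem expSum_apply_zero {f : ℕ → D.Mon → V} (hf : ∀ n, SuppIn (D.pow n) (f n)) :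
    expSum k f 0 = f 0 0 := by
  rw [expSum_eq_sum hf (N := 1) fun h => mem_pow_one.1 h rfl]
  simp

theorem expSum_mem_Hat {gr : G → Submodule k V} {z : G} {f : ℕ → D.Mon → V}
    (hf : ∀ n, SuppIn (D.pow n) (f n)) (h : ∀ n, f n ∈ D.Hat gr z) : expSum k f ∈ D.Hat gr z := by
  refine ⟨fun u => ?_, fun n => ?_⟩
  · obtain ⟨N, hN⟩ := exists_notMem_pow u
    rw [expSum_eq_sum hf hN]
    exact Submodule.sum_mem _ fun n _ => Submodule.smul_mem _ _ ((h n).1 u)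
  · refine ((Finset.range n).finite_toSet.biUnion fun j _ => (h j).2 n).subset ?_
    rintro u ⟨hu, hn⟩
    rw [expSum_eq_sum hf hn] at hu
    obtain ⟨j, hj, hne⟩ := Finset.exists_ne_zero_of_sum_ne_zero hu
    exact Set.mem_biUnion hj ⟨fun h0 => hne (by rw [h0, smul_zero]), hn⟩

theorem compLeft_expSum (L : V →ₗ[k] W) {f : ℕ → D.Mon → V}
    (hf : ∀ n, SuppIn (D.pow n) (f n)) :
    L.compLeft D.Mon (expSum k f) = expSum k fun n => L.compLeft D.Mon (f n) := by
  funext u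
  obtain ⟨N, hN⟩ := exists_notMem_pow u
  have h : ∀ n, SuppIn (D.pow n) (L.compLeft D.Mon (f n)) := fun n v hv => by
    rw [LinearMap.compLeft_apply, Function.comp_apply, hf n v hv, map_zero]
  rw [expSum_eq_sum h hN, LinearMap.compLeft_apply, Function.comp_apply, expSum_eq_sum hf hN, map_sum]
  exact Finset.sum_congr rfl fun n _ => by
    rw [map_smul, LinearMap.compLeft_apply, Function.comp_apply]

theorem expSum_add {f g : ℕ → D.Mon → V} (hf : ∀ n, SuppIn (D.pow n) (f n))
    (hg : ∀ n, SuppIn (D.pow n) (g n)) :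
    expSum k f + expSum k g = expSum k fun n => f n + g n := by
  funext u
  obtain ⟨N, hN⟩ := exists_notMem_pow u
  rw [Pi.add_apply, expSum_eq_sum hf hN, expSum_eq_sum hg hN,
    expSum_eq_sum (fun n => (hf n).add (hg n)) hN, ← Finset.sum_add_distrib]
  exact Finset.sum_congr rfl fun n _ => (smul_add _ _ _).symm

variable [CharZero k]

/-- The Cauchy product: `1/(i! j!)` is the binomial coefficient `C(i+j, i)` divided by `(i+j)!`. -/
theorem expSum_expSum {T : ℕ → ℕ → D.Mon → V} (hT : ∀ i j, SuppIn (D.pow (i + j)) (T i j))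
    {u : D.Mon} {N : ℕ} (hN : u ∉ D.pow N) :
    ∑ i ∈ Finset.range N, ∑ j ∈ Finset.range N,
      ((i.factorial : k)⁻¹ * (j.factorial : k)⁻¹) • T i j u =
    expSum k (fun n => ∑ ij ∈ Finset.HasAntidiagonal.antidiagonal n, n.choose ij.1 • T ij.1 ij.2) u := by
  rw [expSum_eq_sum _ hN, ← Finset.sum_product']
  · have hsub : ((Finset.range N ×ˢ Finset.range N).filter fun ij => ij.1 + ij.2 < N) =
        (Finset.range N).biUnion Finset.HasAntidiagonal.antidiagonal := by
      ext ⟨i, j⟩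
      simp only [Finset.mem_filter, Finset.mem_product, Finset.mem_range, Finset.mem_biUnion,
        Finset.HasAntidiagonal.mem_antidiagonal]
      constructor
      · rintro ⟨-, h⟩
        exact ⟨_, h, rfl⟩
      · rintro ⟨n, h, rfl⟩
        omega
    rw [← Finset.sum_filter_add_sum_filter_not _ (fun ij : ℕ × ℕ => ij.1 + ij.2 < N), hsub,
      Finset.sum_biUnion, Finset.sum_eq_zero (s := Finset.filter _ _), add_zero]
    · refine Finset.sum_congr rfl fun n _ => ?_
      rw [Finset.sum_apply, Finset.smul_sum]
      refine Finset.sum_congr rfl fun ij hij => ?_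
      rw [Finset.HasAntidiagonal.mem_antidiagonal] at hij
      rw [Pi.smul_apply, ← Nat.cast_smul_eq_nsmul k, smul_smul]
      congr 1
      have h1 := Nat.choose_mul_factorial_mul_factorial (show ij.1 ≤ n by omega)
      rw [show n - ij.1 = ij.2 by omega] at h1
      have h2 : ((n.choose ij.1 : ℕ) : k) * (ij.1.factorial : k) * (ij.2.factorial : k) =
          (n.factorial : k) := by exact_mod_cast h1
      have h3 : ((ij.1.factorial : ℕ) : k) ≠ 0 := by exact_mod_cast ij.1.factorial_ne_zero
      have h4 : ((ij.2.factorial : ℕ) : k) ≠ 0 := by exact_mod_cast ij.2.factorial_ne_zero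
      have h5 : ((n.factorial : ℕ) : k) ≠ 0 := by exact_mod_cast n.factorial_ne_zero
      field_simp
      rw [← h2]
      ring
    · rintro ⟨i, j⟩ hij
      rw [Finset.mem_filter, not_lt] at hij
      rw [hT i j u fun h => hN (pow_antitone hij.2 h), smul_zero]
    · intro m _ n _ hmn
      rw [Function.onFun, Finset.disjoint_left]
      intro ij h1 h2
      rw [Finset.HasAntidiagonal.mem_antidiagonal] at h1 h2
      exact hmn (h1.symm.trans h2)
  · intro n v hv
    rw [Finset.sum_apply]
    refine Finset.sum_eq_zero fun ij hij => ?_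
    rw [Finset.HasAntidiagonal.mem_antidiagonal] at hij
    rw [Pi.smul_apply, hT _ _ v (by rwa [hij]), smul_zero]

theorem suppIn_leibniz {T : ℕ → ℕ → D.Mon → V} (hT : ∀ i j, SuppIn (D.pow (i + j)) (T i j))
    (n : ℕ) :
    SuppIn (D.pow n) (∑ ij ∈ Finset.HasAntidiagonal.antidiagonal n, n.choose ij.1 • T ij.1 ij.2) := by
  intro v hv
  rw [Finset.sum_apply]
  refine Finset.sum_eq_zero fun ij hij => ?_
  rw [Finset.HasAntidiagonal.mem_antidiagonal] at hij
  rw [Pi.smul_apply, hT _ _ v (by rwa [hij]), smul_zero]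

theorem conv_expSum (B : V →ₗ[k] W →ₗ[k] X) {f : ℕ → D.Mon → V} {g : ℕ → D.Mon → W}
    (hf : ∀ n, SuppIn (D.pow n) (f n)) (hg : ∀ n, SuppIn (D.pow n) (g n)) :
    conv B (expSum k f) (expSum k g) =
      expSum k fun n => ∑ ij ∈ Finset.HasAntidiagonal.antidiagonal n, n.choose ij.1 • conv B (f ij.1) (g ij.2) := by
  funext u
  obtain ⟨N, hN⟩ := exists_notMem_pow u
  rw [← expSum_expSum (fun i j => conv_suppIn_pow (hf i) (hg j)) hN, conv]
  simp only [conv, Finset.smul_sum]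
  have h1 : ∀ v ∈ Finset.HasAntidiagonal.antidiagonal u, B (expSum k f v.1) (expSum k g v.2) =
      ∑ i ∈ Finset.range N, ∑ j ∈ Finset.range N,
        ((i.factorial : k)⁻¹ * (j.factorial : k)⁻¹) • B (f i v.1) (g j v.2) := by
    intro v hv
    rw [Finset.HasAntidiagonal.mem_antidiagonal] at hv
    rw [expSum_eq_sum hf (N := N) fun h => hN (by rw [← hv]; exact pow_add_mem h),
      expSum_eq_sum hg (N := N) fun h => hN (by rw [← hv, add_comm]; exact pow_add_mem h)]
    simp only [map_sum, LinearMap.sum_apply, map_smul, LinearMap.smul_apply, Finset.smul_sum, smul_smul]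
    rw [Finset.sum_comm]
    refine Finset.sum_congr rfl fun i _ => Finset.sum_congr rfl fun j _ => ?_
    rw [mul_comm]
  rw [Finset.sum_congr rfl h1, Finset.sum_comm]
  exact Finset.sum_congr rfl fun i _ => Finset.sum_comm

end expSum

end CoeffDatum

namespace DGLA

open CoeffDatum

/-! ### The gauge action on Maurer–Cartan elements -/

section gauge

variable {P : Type*} [Fintype P] {G : Type*} [AddCommGroup G] [DecidableEq G]
  {𝔾 : GradingDatum G} {D : CoeffDatum P 𝔾} {k : Type*} [Field k]
  {L : Type*} [AddCommGroup L] [Module k L] (𝔤 : DGLA k 𝔾 L)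

/-- The differential on formal sums. -/
noncomputable def hatD : (D.Mon → L) →ₗ[k] (D.Mon → L) := 𝔤.d.compLeft D.Mon

theorem hatD_apply (x : D.Mon → L) (u : D.Mon) : 𝔤.hatD x u = 𝔤.d (x u) := rfl

theorem hatD_hatD (x : D.Mon → L) : 𝔤.hatD (𝔤.hatD x) = 0 := funext fun _ => 𝔤.d_d _

theorem hatD_mem_Hat {x : D.Mon → L} {z : G} (hx : x ∈ D.Hat 𝔤.gr z) :
    𝔤.hatD x ∈ D.Hat 𝔤.gr (z + 𝔾.ι 1) := by
  refine ⟨fun u => ?_, fun n => (hx.2 n).subset fun u hu => ⟨fun h => hu.1 ?_, hu.2⟩⟩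
  · have := 𝔤.d_mem _ _ (hx.1 u)
    rwa [sub_add_eq_add_sub] at this
  · rw [hatD_apply, h, map_zero]

theorem conv_mem {x y : D.Mon → L} {s t : G} (hx : x ∈ D.Hat 𝔤.gr s) (hy : y ∈ D.Hat 𝔤.gr t) :
    conv 𝔤.br x y ∈ D.Hat 𝔤.gr (s + t) := conv_mem_Hat 𝔤.br_mem hx hy

variable {𝔤}

/-- Monomials have even degree, so the coefficients on both sides are odd and graded antisymmetry
turns into symmetry. -/
theorem conv_comm_of_odd {x y : D.Mon → L} (hx : x ∈ D.Hat 𝔤.gr (𝔾.ι 1))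
    (hy : y ∈ D.Hat 𝔤.gr (𝔾.ι 1)) : conv 𝔤.br x y = conv 𝔤.br y x := by
  rw [conv_swap]
  refine conv_congr fun u v => ?_
  have := 𝔤.br_symm _ _ _ (hx.1 v) _ (hy.1 u)
  rw [LinearMap.flip_apply, this, map_sub, map_sub, par_deg, par_deg, par_ι_one]
  simp [sgn_one]

/-- As `γ` has even coefficients, bracketing with it is a derivation without signs. -/
theorem conv_jacobi {γ x y : D.Mon → L} {s : G} (hγ : γ ∈ D.Hat 𝔤.gr 0)
    (hx : x ∈ D.Hat 𝔤.gr s) : conv 𝔤.br γ (conv 𝔤.br x y) =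
      conv 𝔤.br (conv 𝔤.br γ x) y + conv 𝔤.br x (conv 𝔤.br γ y) := by
  rw [conv_conv_right, conv_conv_right, conv_conv_left, conv₃_swap_left _ x γ y, ← conv₃_add]
  refine conv₃_congr fun u v w => ?_
  have := 𝔤.jacobi _ _ _ (hγ.1 u) _ (hx.1 v) (y w)
  rw [this, map_sub, map_zero, par_deg]
  simp [sgn_zero]

theorem hatD_conv {γ x : D.Mon → L} {s : G} (hγ : γ ∈ D.Hat 𝔤.gr 0) (hx : x ∈ D.Hat 𝔤.gr s) :
    𝔤.hatD (conv 𝔤.br γ x) = conv 𝔤.br (𝔤.hatD γ) x + conv 𝔤.br γ (𝔤.hatD x) := by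
  funext u
  rw [hatD_apply, conv, map_sum, Pi.add_apply, conv, conv, ← Finset.sum_add_distrib]
  refine Finset.sum_congr rfl fun v _ => ?_
  rw [𝔤.d_br _ _ _ (hγ.1 _) _ (hx.1 _), map_sub, map_zero, par_deg]
  simp [sgn_zero, hatD_apply]

theorem gaugeIter_succ (γ α : D.Mon → L) (n : ℕ) :
    gaugeIter D 𝔤 γ α (n + 1) =
      conv 𝔤.br γ (gaugeIter D 𝔤 γ α n) - if n = 0 then 𝔤.hatD γ else 0 := by
  cases n with
  | zero =>
    funext u
    rw [if_pos rfl, Pi.sub_apply, sub_eq_neg_add]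
    rfl
  | succ n => rw [if_neg (Nat.succ_ne_zero n), sub_zero]; rfl

theorem gauge_eq_expSum (γ α : D.Mon → L) :
    gauge D 𝔤 γ α = expSum k (gaugeIter D 𝔤 γ α) := rfl

theorem suppIn_hatD {x : D.Mon → L} {S : Set D.Mon} (hx : SuppIn S x) : SuppIn S (𝔤.hatD x) :=
  fun u hu => by rw [hatD_apply, hx u hu, map_zero]

theorem suppIn_gaugeIter {γ : D.Mon → L} (hγ : γ 0 = 0) (α : D.Mon → L) (n : ℕ) :
    SuppIn (D.pow n) (gaugeIter D 𝔤 γ α n) := by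
  have hγ1 := suppIn_pow_one.2 hγ
  induction n with
  | zero => exact suppIn_pow_zero _
  | succ n ih =>
    rw [gaugeIter_succ, sub_eq_add_neg]
    refine SuppIn.add (by rw [add_comm n]; exact conv_suppIn_pow hγ1 ih) (SuppIn.neg ?_)
    split_ifs with h
    · subst h; exact suppIn_hatD hγ1
    · exact fun _ _ => rfl

theorem gaugeIter_mem {γ α : D.Mon → L} (hγ : γ ∈ D.Hat 𝔤.gr 0) (hα : α ∈ D.Hat 𝔤.gr (𝔾.ι 1))
    (n : ℕ) : gaugeIter D 𝔤 γ α n ∈ D.Hat 𝔤.gr (𝔾.ι 1) := by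
  induction n with
  | zero => exact hα
  | succ n ih =>
    rw [gaugeIter_succ]
    refine sub_mem_Hat (by simpa using conv_mem 𝔤 hγ ih) ?_
    split_ifs
    · simpa using hatD_mem_Hat 𝔤 hγ
    · exact zero_mem_Hat

theorem gauge_mem {γ α : D.Mon → L} (hγ : γ ∈ D.HatM 𝔤.gr 0) (hα : α ∈ D.HatM 𝔤.gr (𝔾.ι 1)) :
    gauge D 𝔤 γ α ∈ D.HatM 𝔤.gr (𝔾.ι 1) := by
  refine ⟨expSum_mem_Hat (suppIn_gaugeIter hγ.2 α) (gaugeIter_mem hγ.1 hα.1), ?_⟩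
  rw [gauge_eq_expSum, expSum_apply_zero (suppIn_gaugeIter hγ.2 α)]
  exact hα.2

theorem mem_MC_iff [CharZero k] {α : D.Mon → L} : α ∈ MC D 𝔤 ↔
    α ∈ D.HatM 𝔤.gr (𝔾.ι 1) ∧ (2 : k) • 𝔤.hatD α + conv 𝔤.br α α = 0 := by
  refine and_congr_right fun _ => ?_
  constructor
  · intro h
    funext u
    have := congrArg (fun x => (2 : k) • x) (h u)
    simp only [smul_add, smul_smul, smul_zero] at this
    rw [mul_inv_cancel₀ two_ne_zero, one_smul] at this
    exact this
  · intro h u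
    have := congrArg (fun x => (2 : k)⁻¹ • x) (congrFun h u)
    simp only [Pi.add_apply, Pi.smul_apply, smul_add, smul_smul, Pi.zero_apply, smul_zero] at this
    rw [inv_mul_cancel₀ two_ne_zero, one_smul] at this
    exact this

/-- Along the flow, the curvature `2∂α_t + [α_t, α_t]` satisfies the linear equation `K' = [γ, K]`.
It vanishes at time zero, so all its Taylor coefficients vanish. -/
theorem gauge_mem_MC [CharZero k] {γ α : D.Mon → L} (hγ : γ ∈ D.HatM 𝔤.gr 0) (hα : α ∈ MC D 𝔤) :
    gauge D 𝔤 γ α ∈ MC D 𝔤 := by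
  rw [mem_MC_iff] at hα ⊢
  refine ⟨gauge_mem hγ hα.1, ?_⟩
  set A := gaugeIter D 𝔤 γ α with hA
  have hAs : ∀ n, SuppIn (D.pow n) (A n) := suppIn_gaugeIter hγ.2 α
  have hAm : ∀ n, A n ∈ D.Hat 𝔤.gr (𝔾.ι 1) := gaugeIter_mem hγ.1 hα.1.1
  have hdγ : 𝔤.hatD γ ∈ D.Hat 𝔤.gr (𝔾.ι 1) := by simpa using hatD_mem_Hat 𝔤 hγ.1
  have hAsucc : ∀ n, A (n + 1) = conv 𝔤.br γ (A n) - if n = 0 then 𝔤.hatD γ else 0 :=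
    gaugeIter_succ γ α
  -- The `n`-th derivative at `t = 0` of the curvature along the flow, by the Leibniz rule.
  let K : ℕ → D.Mon → L := fun n => (2 : k) • 𝔤.hatD (A n) +
    ∑ ij ∈ Finset.HasAntidiagonal.antidiagonal n, n.choose ij.1 • conv 𝔤.br (A ij.1) (A ij.2)
  have hK0 : K 0 = 0 := by
    simp only [K]
    rw [Finset.Nat.antidiagonal_zero, Finset.sum_singleton, Nat.choose_self, one_smul]
    exact hα.2
  have hright : ∀ i j, conv 𝔤.br (A i) (A (j + 1)) =
      conv 𝔤.br (A i) (conv 𝔤.br γ (A j)) - if j = 0 then conv 𝔤.br (A i) (𝔤.hatD γ) else 0 := by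
    intro i j
    rw [hAsucc, ← convₗ_apply, map_sub]
    split_ifs
    · rfl
    · rw [map_zero]; rfl
  have hleft : ∀ i j, conv 𝔤.br (A (i + 1)) (A j) =
      conv 𝔤.br (conv 𝔤.br γ (A i)) (A j) - if i = 0 then conv 𝔤.br (𝔤.hatD γ) (A j) else 0 := by
    intro i j
    rw [hAsucc, ← convₗ_apply, map_sub, LinearMap.sub_apply]
    split_ifs
    · rfl
    · rw [map_zero]; rfl
  -- The inhomogeneous term `-∂γ` of the flow contributes `-[∂γ, A_n]` twice through the bracket.
  -- This cancels against the `[∂γ, A_n]` that arises, with factor two, from differentiating `[γ,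
  -- A_n]`.
  have hK : ∀ n, K (n + 1) = conv 𝔤.br γ (K n) := by
    intro n
    have h1 : ∑ ij ∈ Finset.HasAntidiagonal.antidiagonal n,
        n.choose ij.1 • conv 𝔤.br (A ij.1) (A (ij.2 + 1)) =
        (∑ ij ∈ Finset.HasAntidiagonal.antidiagonal n,
          n.choose ij.1 • conv 𝔤.br (A ij.1) (conv 𝔤.br γ (A ij.2))) -
            conv 𝔤.br (A n) (𝔤.hatD γ) := by
      simp only [hright, smul_sub, Finset.sum_sub_distrib]
      congr 1
      rw [Finset.sum_eq_single (n, 0)]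
      · simp
      · rintro ⟨i, j⟩ hij hne
        rw [if_neg, smul_zero]
        rintro rfl
        exact hne (Prod.ext (by simpa using hij) rfl)
      · simp
    have h2 : ∑ ij ∈ Finset.HasAntidiagonal.antidiagonal n,
        n.choose ij.2 • conv 𝔤.br (A (ij.1 + 1)) (A ij.2) =
        (∑ ij ∈ Finset.HasAntidiagonal.antidiagonal n,
          n.choose ij.1 • conv 𝔤.br (conv 𝔤.br γ (A ij.1)) (A ij.2)) -
            conv 𝔤.br (𝔤.hatD γ) (A n) := by
      have : ∀ ij ∈ Finset.HasAntidiagonal.antidiagonal n,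
          n.choose ij.2 • conv 𝔤.br (A (ij.1 + 1)) (A ij.2) =
          n.choose ij.1 • conv 𝔤.br (A (ij.1 + 1)) (A ij.2) := by
        intro ij hij
        rw [Finset.HasAntidiagonal.mem_antidiagonal] at hij
        rw [Nat.choose_symm_of_eq_add hij.symm]
      rw [Finset.sum_congr rfl this]
      simp only [hleft, smul_sub, Finset.sum_sub_distrib]
      congr 1
      rw [Finset.sum_eq_single (0, n)]
      · simp
      · rintro ⟨i, j⟩ hij hne
        rw [if_neg, smul_zero]
        rintro rfl
        exact hne (Prod.ext rfl (by simpa using hij))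
      · simp
    have h3 : 𝔤.hatD (A (n + 1)) =
        conv 𝔤.br (𝔤.hatD γ) (A n) + conv 𝔤.br γ (𝔤.hatD (A n)) := by
      rw [hAsucc, map_sub, hatD_conv hγ.1 (hAm n)]
      split_ifs
      · rw [hatD_hatD, sub_zero]
      · rw [map_zero, sub_zero]
    have h4 : conv 𝔤.br γ (K n) = (2 : k) • conv 𝔤.br γ (𝔤.hatD (A n)) +
        ∑ ij ∈ Finset.HasAntidiagonal.antidiagonal n, n.choose ij.1 •
          (conv 𝔤.br (conv 𝔤.br γ (A ij.1)) (A ij.2) +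
            conv 𝔤.br (A ij.1) (conv 𝔤.br γ (A ij.2))) := by
      rw [← convₗ_apply]
      simp only [K, map_add, map_smul, map_sum, map_nsmul, convₗ_apply]
      congr 1
      exact Finset.sum_congr rfl fun ij _ => by rw [conv_jacobi hγ.1 (hAm _)]
    rw [h4]
    simp only [K]
    rw [Finset.sum_antidiagonal_choose_succ_nsmul (fun i j => conv 𝔤.br (A i) (A j)), h1, h2, h3,
      conv_comm_of_odd (hAm n) hdγ]
    simp only [smul_add, Finset.sum_add_distrib, two_smul]
    abel
  have hKz : ∀ n, K n = 0 := by
    intro n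
    induction n with
    | zero => exact hK0
    | succ n ih => rw [hK, ih, ← convₗ_apply, map_zero]
  have hd : ∀ n, SuppIn (D.pow n) ((2 : k) • 𝔤.hatD (A n)) := fun n u hu => by
    rw [Pi.smul_apply, suppIn_hatD (hAs n) u hu, smul_zero]
  have e1 : (2 : k) • 𝔤.hatD (expSum k A) = expSum k fun n => (2 : k) • 𝔤.hatD (A n) :=
    compLeft_expSum ((2 : k) • 𝔤.d) hAs
  rw [gauge_eq_expSum, e1, conv_expSum 𝔤.br hAs hAs,
    expSum_add hd (suppIn_leibniz fun i j => conv_suppIn_pow (hAs i) (hAs j))]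
  have : (fun n => (2 : k) • 𝔤.hatD (A n) + ∑ ij ∈ Finset.HasAntidiagonal.antidiagonal n,
      n.choose ij.1 • conv 𝔤.br (A ij.1) (A ij.2)) = fun _ => 0 := funext hKz
  rw [this]
  funext u
  simp [expSum]

theorem pull_mem_MC [CharZero k] {α : D.Mon → L} (c : P → unitsZero D k) (hα : α ∈ MC D 𝔤) :
    pull c α ∈ MC D 𝔤 := by
  rw [mem_MC_iff] at hα ⊢
  refine ⟨pull_mem_HatM c hα.1, ?_⟩
  have h1 : 𝔤.hatD (pull c α) = pull c (𝔤.hatD α) := by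
    funext u
    simp only [hatD_apply, pull, map_sum, map_smul]
  have h2 : conv 𝔤.br α α = -((2 : k) • 𝔤.hatD α) := by
    rw [eq_neg_iff_add_eq_zero, add_comm]; exact hα.2
  rw [conv_pull, h1, h2]
  funext u
  simp only [pull, Pi.add_apply, Pi.smul_apply, Pi.neg_apply, Pi.zero_apply, Finset.smul_sum,
    ← Finset.sum_add_distrib]
  refine Finset.sum_eq_zero fun v _ => ?_
  rw [smul_neg, smul_comm, add_neg_cancel]

/-- A bracket of something in step `s` with something without constant term lies in step `s + 1`. So
the only change of the derivatives visible at step `s` is `-∂(γ' - γ)`, which occurs in the first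
derivative. -/
theorem suppIn_gaugeIter_sub [DecidableEq P] {h : ∀ p, Pi.single p 1 ∈ D.monoid}
    {γ γ' β : D.Mon → L} (hγ : γ 0 = 0) (hγ' : γ' 0 = 0) (hβ : β 0 = 0) {s : ℕ}
    (hs : SuppIn (filt h s) (γ' - γ)) (n : ℕ) :
    SuppIn (filt h (s + 1)) (gaugeIter D 𝔤 γ' β n - gaugeIter D 𝔤 γ β n +
      if n = 1 then 𝔤.hatD (γ' - γ) else 0) := by
  have h0 : ∀ n, gaugeIter D 𝔤 γ' β n 0 = 0 := by
    intro n
    cases n with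
    | zero => exact hβ
    | succ n =>
      refine suppIn_gaugeIter hγ' β (n + 1) 0 fun h0 => ?_
      exact mem_pow_one.1 (pow_antitone (Nat.succ_le_succ (Nat.zero_le n)) h0) rfl
  induction n with
  | zero =>
    intro u _
    simp [gaugeIter]
  | succ n ih =>
    -- Dropping the correction term of the induction hypothesis costs one step, which the outer
    -- bracket with `γ` restores.
    have hprev : SuppIn (filt h s) (gaugeIter D 𝔤 γ' β n - gaugeIter D 𝔤 γ β n) := by
      have h1 := (ih.mono (filt_succ_subset s)).add (y := -if n = 1 then 𝔤.hatD (γ' - γ) else 0)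
        (SuppIn.neg (by
          split_ifs
          · exact suppIn_hatD hs
          · exact fun _ _ => rfl))
      simpa using h1
    have e : gaugeIter D 𝔤 γ' β (n + 1) - gaugeIter D 𝔤 γ β (n + 1) +
        (if n + 1 = 1 then 𝔤.hatD (γ' - γ) else 0) =
        conv 𝔤.br (γ' - γ) (gaugeIter D 𝔤 γ' β n) +
          conv 𝔤.br γ (gaugeIter D 𝔤 γ' β n - gaugeIter D 𝔤 γ β n) := by
      rw [gaugeIter_succ, gaugeIter_succ]
      simp only [← convₗ_apply, map_sub, LinearMap.sub_apply]
      by_cases hn : n = 0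
      · subst hn
        simp only [if_pos]
        abel
      · rw [if_neg hn, if_neg hn, if_neg (by omega)]
        abel
    rw [e]
    exact (conv_suppIn_filt_left hs (h0 n)).add (conv_suppIn_filt_right hγ hprev)

/-- The gauge action to first order. -/
theorem suppIn_gauge_sub [DecidableEq P] {h : ∀ p, Pi.single p 1 ∈ D.monoid}
    {γ γ' β : D.Mon → L} (hγ : γ 0 = 0) (hγ' : γ' 0 = 0) (hβ : β 0 = 0) {s : ℕ}
    (hs : SuppIn (filt h s) (γ' - γ)) :
    SuppIn (filt h (s + 1)) (gauge D 𝔤 γ' β - gauge D 𝔤 γ β + 𝔤.hatD (γ' - γ)) := by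
  intro u hu
  obtain ⟨N, hN⟩ := exists_notMem_pow u
  -- The larger cutoff guarantees that the index `1`, which carries the linear term, lies in the
  -- range of summation.
  have hN' : u ∉ D.pow (N + 2) := fun h => hN (pow_antitone (by omega) h)
  rw [Pi.add_apply, Pi.sub_apply, gauge_eq_expSum, gauge_eq_expSum,
    expSum_eq_sum (suppIn_gaugeIter hγ' β) hN', expSum_eq_sum (suppIn_gaugeIter hγ β) hN',
    ← Finset.sum_sub_distrib]
  have h1 : 𝔤.hatD (γ' - γ) u = ∑ n ∈ Finset.range (N + 2), ((n.factorial : k)⁻¹) •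
      (if n = 1 then 𝔤.hatD (γ' - γ) else 0) u := by
    rw [Finset.sum_eq_single 1]
    · simp
    · intro n _ hn
      rw [if_neg hn, Pi.zero_apply, smul_zero]
    · simp
  rw [h1, ← Finset.sum_add_distrib]
  refine Finset.sum_eq_zero fun n _ => ?_
  rw [← smul_sub, ← smul_add, ← Pi.sub_apply, ← Pi.add_apply,
    suppIn_gaugeIter_sub hγ hγ' hβ hs n u hu, smul_zero]

theorem gauge_zero (β : D.Mon → L) : gauge D 𝔤 0 β = β := by
  have h : ∀ n, gaugeIter D 𝔤 0 β (n + 1) = 0 := by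
    intro n
    rw [gaugeIter_succ, ← convₗ_apply, map_zero, LinearMap.zero_apply, map_zero, ite_self, sub_zero]
  funext u
  rw [gauge, finsum_eq_single _ 0]
  · simp [gaugeIter]
  · intro n hn
    obtain ⟨m, rfl⟩ := Nat.exists_eq_succ_of_ne_zero hn
    rw [Nat.succ_eq_add_one, h, Pi.zero_apply, smul_zero]

theorem tensorAct_hatD [DecidableEq P] {hD : D.IsNice k} {Γ : Type*} [Group Γ]
    [DistribMulAction Γ G] [MulAction Γ P] {a : Γ →* (D.R k ≃ₐ[k] D.R k)}
    (hR : IsSpecialAction hD a) {ρ : Representation k Γ L} (hρ : 𝔤.IsAction ρ) (g : Γ)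
    (x : D.Mon → L) : tensorAct hR g (ρ g) (𝔤.hatD x) = 𝔤.hatD (tensorAct hR g (ρ g) x) := by
  refine funext_mact hR g fun u => ?_
  rw [tensorAct_mact, hatD_apply, hatD_apply, tensorAct_mact, map_smul, hρ.d]

theorem tensorAct_gauge [DecidableEq P] {hD : D.IsNice k} {Γ : Type*} [Group Γ]
    [DistribMulAction Γ G] [MulAction Γ P] {a : Γ →* (D.R k ≃ₐ[k] D.R k)}
    (hR : IsSpecialAction hD a) {ρ : Representation k Γ L} (hρ : 𝔤.IsAction ρ) (g : Γ)
    {γ β : D.Mon → L} (hγ0 : γ 0 = 0) (hγ : tensorAct hR g (ρ g) γ = γ)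
    (hβ : tensorAct hR g (ρ g) β = β) :
    tensorAct hR g (ρ g) (gauge D 𝔤 γ β) = gauge D 𝔤 γ β := by
  have hn : ∀ n, tensorAct hR g (ρ g) (gaugeIter D 𝔤 γ β n) = gaugeIter D 𝔤 γ β n := by
    intro n
    induction n with
    | zero => exact hβ
    | succ n ih =>
      rw [gaugeIter_succ, map_sub, tensorAct_conv hR g (hρ.br g), hγ, ih]
      congr 1
      split_ifs
      · rw [tensorAct_hatD hR hρ, hγ]
      · rw [map_zero]
  refine funext_mact hR g fun u => ?_
  obtain ⟨N, hN⟩ := exists_notMem_pow u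
  rw [tensorAct_mact, gauge_eq_expSum, expSum_eq_sum (suppIn_gaugeIter hγ0 β) hN,
    expSum_eq_sum (suppIn_gaugeIter hγ0 β) (mt (mact_mem_pow hR).1 hN), map_sum, Finset.smul_sum]
  refine Finset.sum_congr rfl fun n _ => ?_
  rw [← hn n, tensorAct_mact, hn n, map_smul, smul_comm]

end gauge

end DGLA

namespace CoeffDatum

/-! ### First-order variation of the pullback -/

section congruence

variable {P : Type*} [Fintype P] [DecidableEq P] {G : Type*} [AddCommGroup G]
  {𝔾 : GradingDatum G} {D : CoeffDatum P 𝔾} {k : Type*} [Field k]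

/-- The unit `c_p` as an element of `R`. -/
noncomputable abbrev unitElt (c : P → unitsZero D k) (p : P) : D.R k :=
  ((c p : (D.R k)ˣ) : D.R k)

/-- The ideal of the elements `x` with `r^u x` in the `t`-th step of the filtration. -/
def shiftIdeal (h : ∀ p, Pi.single p 1 ∈ D.monoid) (t : ℕ) (u : D.Mon) : Ideal (D.R k) where
  carrier := {x | ∀ v, coeff v x ≠ 0 → v + u ∈ filt h t}
  zero_mem' := fun v hv => absurd (coeff_zero v) hv
  add_mem' := by
    intro x y hx hy v hv
    by_cases h0 : coeff v x = 0
    · exact hy v fun h1 => hv (by rw [coeff_add, h0, h1, add_zero])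
    · exact hx v h0
  smul_mem' := by
    intro y x hx v hv
    obtain ⟨v, w, rfl, -, hw⟩ := exists_of_coeff_mul_ne_zero hv
    rw [add_assoc, add_comm]
    exact filt_add (hx w hw) v

/-- In the quotient by `J` the two families give the same units, hence the same monomials in them,
negative exponents included. -/
theorem unitVal_sub_mem {c c' : P → unitsZero D k} (J : Ideal (D.R k))
    (h : ∀ p, unitElt c' p - unitElt c p ∈ J) (u : D.Mon) :
    unitVal c' u - unitVal c u ∈ J := by
  rw [← Ideal.Quotient.eq]
  have h1 : ∀ p, Units.map (Ideal.Quotient.mk J : D.R k →* D.R k ⧸ J) (c' p : (D.R k)ˣ) =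
      Units.map (Ideal.Quotient.mk J : D.R k →* D.R k ⧸ J) (c p : (D.R k)ˣ) :=
    fun p => Units.ext (Ideal.Quotient.eq.2 (h p))
  have h2 : Units.map (Ideal.Quotient.mk J : D.R k →* D.R k ⧸ J) (unitPow c' u : (D.R k)ˣ) =
      Units.map (Ideal.Quotient.mk J : D.R k →* D.R k ⧸ J) (unitPow c u : (D.R k)ˣ) := by
    simp only [unitPow, Subgroup.val_finsetProd, SubgroupClass.coe_zpow, map_prod, map_zpow, h1]
  exact congrArg Units.val h2

variable {V : Type*} [AddCommGroup V] [Module k V]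

/-- The pullback to first order in the automorphism. -/
theorem suppIn_pull_sub {h : ∀ p, Pi.single p 1 ∈ D.monoid} {c c' : P → unitsZero D k}
    {α : D.Mon → V} (hα : α 0 = 0) {s : ℕ}
    (hc : ∀ p v, coeff v (unitElt c' p - unitElt c p) ≠ 0 → v + basis h p ∈ filt h s) :
    SuppIn (filt h (s + 1)) (pull c' α - pull c α -
      ∑ p, hatSMul (unitElt c' p - unitElt c p) (firstOrder h α p)) := by
  classical
  intro w hw
  have h1 : (pull c' α - pull c α) w = ∑ v ∈ Finset.HasAntidiagonal.antidiagonal w,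
      coeff v.2 (unitVal c' v.1 - unitVal c v.1) • α v.1 := by
    rw [Pi.sub_apply, pull, pull, ← Finset.sum_sub_distrib]
    exact Finset.sum_congr rfl fun v _ => by rw [coeff_sub, sub_smul]
  have h2 : (∑ p, hatSMul (unitElt c' p - unitElt c p) (firstOrder h α p)) w =
      ∑ v ∈ Finset.HasAntidiagonal.antidiagonal w,
        ∑ p, coeff v.2 (unitElt c' p - unitElt c p) • firstOrder h α p v.1 := by
    rw [Finset.sum_apply, Finset.sum_comm]
    refine Finset.sum_congr rfl fun p _ => ?_
    exact sum_antidiagonal_swap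
      (fun v u => coeff v (unitElt c' p - unitElt c p) • firstOrder h α p u) w
  rw [Pi.sub_apply, h1, h2, ← Finset.sum_sub_distrib]
  refine Finset.sum_eq_zero fun v hv => ?_
  rw [Finset.HasAntidiagonal.mem_antidiagonal] at hv
  -- On a coordinate `r_q` the unit `c^{u_q}` is `c_q` itself, so the difference there is exactly
  -- the linear term. All other monomials must be absorbed in the next step.
  by_cases hb : ∃ q, v.1 = basis h q
  · obtain ⟨q, hq⟩ := hb
    rw [Finset.sum_eq_single q, hq, unitVal_basis, unitVal_basis]
    · simp [firstOrder]
    · intro p _ hpq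
      have : firstOrder h α p v.1 = 0 := by
        rw [firstOrder, Pi.single_eq_of_ne]
        rw [hq]
        exact fun h' => hpq (basis_injective h h').symm
      rw [this, smul_zero]
    · simp
  · have h3 : ∀ p, firstOrder h α p v.1 = 0 := fun p => by
      rw [firstOrder, Pi.single_eq_of_ne fun h' => hb ⟨p, h'⟩]
    simp only [h3, smul_zero, Finset.sum_const_zero, sub_zero]
    by_cases h0 : v.1 = 0
    · rw [h0, hα, smul_zero]
    -- The second clause of `filt` puts each `(c'_p - c_p) r^u` in step `s + 1` when `r^u` is
    -- neither constant nor a coordinate. This is an ideal condition on the first factor, so it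
    -- passes to the difference of the units `c^u`.
    · have h4 := unitVal_sub_mem (c := c) (c' := c') (shiftIdeal h (s + 1) v.1) (fun p x hx => by
        refine filt_shift ?_ (hc p x hx) h0 fun q hq => hb ⟨q, hq⟩
        by_contra hd
        apply hx
        have e1 : coeff x (unitElt c' p) = 0 := by
          by_contra h; exact hd ((c' p).2 x h)
        have e2 : coeff x (unitElt c p) = 0 := by
          by_contra h; exact hd ((c p).2 x h)
        rw [coeff_sub, e1, e2, sub_zero]) v.1
      have h5 : coeff v.2 (unitVal c' v.1 - unitVal c v.1) = 0 := by
        by_contra hne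
        have := h4 v.2 hne
        rw [add_comm v.2, hv] at this
        exact hw this
      rw [h5, zero_smul]

/-- The monomial `r_p` is irreducible, so only its own coefficient contributes, multiplied by a
constant term. -/
theorem pull_basis (hD : D.IsNice k) (c : P → unitsZero D k) (α : D.Mon → V) (p : P) :
    pull c α (basis hD.mem p) = coeff 0 (unitElt c p) • α (basis hD.mem p) := by
  rw [pull, Finset.sum_eq_single (basis hD.mem p, 0)]
  · rw [unitVal_basis]
  · rintro ⟨u, v⟩ huv hne
    rw [Finset.HasAntidiagonal.mem_antidiagonal] at huv
    simp only at huv ⊢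
    by_cases hu : u = 0
    · subst hu
      rw [unitVal_zero, coeff_one, if_neg, zero_smul]
      rintro rfl
      exact hD.basis_ne_zero p (by simpa using huv.symm)
    · by_cases hv : v = 0
      · subst hv
        rw [add_zero] at huv
        exact absurd (by rw [huv]) hne
      · exact absurd huv (hD.add_ne_basis hu hv p)
  · simp

/-- The map induced on `𝔪 / 𝔪²` only depends on the constant terms of the `c_p`. -/
theorem sub_mem_fil_two {ψ ψ' : D.R k ≃ₐ[k] D.R k} (hψ : IsFiltered ψ) (hψ' : IsFiltered ψ')
    {c c' : P → unitsZero D k} (hc : ∀ u, ψ (D.mono k u) = D.mono k u * unitVal c u)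
    (hc' : ∀ u, ψ' (D.mono k u) = D.mono k u * unitVal c' u)
    (h : ∀ p, coeff 0 (unitElt c p) = coeff 0 (unitElt c' p)) {x : D.R k} (hx : x ∈ D.fil k 1) :
    ψ x - ψ' x ∈ D.fil k 2 := by
  classical
  intro w hw
  by_contra hw2
  apply hw
  have hS : ∀ u, coeff u x ≠ 0 → u ∉ D.pow 2 → u ∈ (x.2.2 2).toFinset :=
    fun u hu hn => by simpa using ⟨hu, hn⟩
  rw [coeff_sub, hψ.coeff_apply hw2 x hS, hψ'.coeff_apply hw2 x hS, ← Finset.sum_sub_distrib]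
  refine Finset.sum_eq_zero fun u hu => ?_
  rw [Set.Finite.mem_toFinset] at hu
  have hu0 : u ≠ 0 := mem_pow_one.1 (hx u hu.1)
  -- Taking constant terms is a ring homomorphism. Its kernel is an ideal modulo which the two
  -- families of units agree.
  let J : Ideal (D.R k) := RingHom.ker ({
    toFun := coeff 0
    map_one' := by rw [coeff_one, if_pos rfl]
    map_mul' := coeff_zero_mul
    map_zero' := coeff_zero 0
    map_add' := coeff_add 0 } : D.R k →+* k)
  have hJ : coeff 0 (unitVal c u) = coeff 0 (unitVal c' u) := by
    have := unitVal_sub_mem (c := c') (c' := c) J (fun p => by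
      change coeff 0 (unitElt c p - unitElt c' p) = 0
      rw [coeff_sub, h, sub_self]) u
    change coeff 0 (unitVal c u - unitVal c' u) = 0 at this
    rwa [coeff_sub, sub_eq_zero] at this
  rw [← mul_sub, ← coeff_sub, hc, hc', ← mul_sub]
  by_contra hne
  obtain ⟨v, z, rfl, hv, hz⟩ := exists_of_coeff_mul_ne_zero (right_ne_zero_of_mul hne)
  have hvu : v = u := by by_contra h; exact hv (coeff_mono_ne h)
  subst hvu
  by_cases hz0 : z = 0
  · subst hz0
    rw [coeff_sub, hJ, sub_self] at hz
    exact hz rfl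
  · exact hw2 (add_mem_pow_two hu0 hz0)

end congruence

/-! ### Averaging over the group -/

section averaging

variable {P : Type*} [Fintype P] [DecidableEq P] {G : Type*} [AddCommGroup G]
  {𝔾 : GradingDatum G} {D : CoeffDatum P 𝔾} {k : Type*} [Field k] {hD : D.IsNice k}
  {Γ : Type*} [Group Γ] [DistribMulAction Γ G] [MulAction Γ P]
  {a : Γ →* (D.R k ≃ₐ[k] D.R k)} (hR : IsSpecialAction hD a)
  {V : Type*} [AddCommGroup V] [Module k V]

theorem tensorAct_mem_Hat (g : Γ) {φ : V →ₗ[k] V} {gr : G → Submodule k V}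
    (hφ : ∀ y, ∀ v ∈ gr y, φ v ∈ gr (g • y)) {z : G} (hz : g • z = z) {x : D.Mon → V}
    (hx : x ∈ D.Hat gr z) : tensorAct hR g φ x ∈ D.Hat gr z := by
  refine ⟨fun u => ?_, fun n => ((hx.2 n).image (mact hR g)).subset ?_⟩
  · have h := hφ _ _ (hx.1 (mact hR g⁻¹ u))
    rw [smul_sub, hz, ← deg_mact hR, mact_mact_inv] at h
    have h2 := tensorAct_mact hR g φ x (mact hR g⁻¹ u)
    rw [mact_mact_inv] at h2
    rw [h2]
    exact Submodule.smul_mem _ _ h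
  · rintro u ⟨hu, hn⟩
    refine ⟨mact hR g⁻¹ u, ⟨fun h => hu ?_, fun h => hn ((mact_mem_pow hR).1 h)⟩,
      mact_mact_inv hR g u⟩
    have h2 := tensorAct_mact hR g φ x (mact hR g⁻¹ u)
    rw [mact_mact_inv, h, map_zero, smul_zero] at h2
    exact h2

theorem indicator_mem_Hat {gr : G → Submodule k V} {z : G} {x : D.Mon → V} (S : Set D.Mon)
    (hx : x ∈ D.Hat gr z) : S.indicator x ∈ D.Hat gr z := by
  refine ⟨fun u => ?_, fun n => (hx.2 n).subset fun u hu => ⟨fun h => hu.1 ?_, hu.2⟩⟩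
  · by_cases hu : u ∈ S
    · rw [Set.indicator_of_mem hu]; exact hx.1 u
    · rw [Set.indicator_of_notMem hu]; exact Submodule.zero_mem _
  · rw [Set.indicator_apply_eq_zero]
    exact fun _ => h

theorem tensorAct_indicator (g : Γ) (φ : V →ₗ[k] V) {S : Set D.Mon}
    (hS : ∀ u, mact hR g u ∈ S ↔ u ∈ S) (x : D.Mon → V) :
    tensorAct hR g φ (S.indicator x) = S.indicator (tensorAct hR g φ x) := by
  refine funext_mact hR g fun u => ?_
  rw [tensorAct_mact]
  by_cases hu : u ∈ S
  · rw [Set.indicator_of_mem hu, Set.indicator_of_mem ((hS u).2 hu), tensorAct_mact]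
  · rw [Set.indicator_of_notMem hu, Set.indicator_of_notMem (mt (hS u).1 hu), map_zero, smul_zero]

theorem act_restr (g : Γ) {S T : Set D.Mon} (h : ∀ u, mact hR g u ∈ T ↔ u ∈ S) (x : D.R k) :
    a g (restr S x) = restr T (a g x) := by
  refine coeff_ext fun w => ?_
  obtain ⟨u, rfl⟩ : ∃ u, mact hR g u = w := ⟨_, mact_mact_inv hR g w⟩
  rw [coeff_act]
  by_cases hu : u ∈ S
  · rw [coeff_restr_of_mem hu, coeff_restr_of_mem ((h u).2 hu), coeff_act]
  · rw [coeff_restr_of_notMem hu, coeff_restr_of_notMem (mt (h u).1 hu), mul_zero]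

variable [Fintype Γ]

/-- The average of a formal sum over `Γ`. -/
noncomputable def average (ρ : Representation k Γ V) : (D.Mon → V) →ₗ[k] (D.Mon → V) :=
  (Fintype.card Γ : k)⁻¹ • ∑ g, tensorAct hR g (ρ g)

theorem tensorAct_average (ρ : Representation k Γ V) (h : Γ) (x : D.Mon → V) :
    tensorAct hR h (ρ h) (average hR ρ x) = average hR ρ x := by
  rw [average, LinearMap.smul_apply, LinearMap.sum_apply, map_smul, map_sum]
  congr 1
  refine Fintype.sum_equiv (Equiv.mulLeft h) _ _ fun g => ?_
  rw [← tensorAct_mul, Equiv.coe_mulLeft, map_mul]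
  rfl

theorem average_of_invariant [CharZero k] (ρ : Representation k Γ V) {x : D.Mon → V}
    (hx : ∀ g, tensorAct hR g (ρ g) x = x) : average hR ρ x = x := by
  rw [average, LinearMap.smul_apply, LinearMap.sum_apply, Finset.sum_congr rfl fun g _ => hx g,
    Finset.sum_const, Finset.card_univ, ← Nat.cast_smul_eq_nsmul k, smul_smul, inv_mul_cancel₀,
    one_smul]
  exact_mod_cast Fintype.card_ne_zero

theorem sum_mem_Hat {I : Type*} (s : Finset I) {gr : G → Submodule k V} {z : G}
    {x : I → D.Mon → V} (h : ∀ i ∈ s, x i ∈ D.Hat gr z) : ∑ i ∈ s, x i ∈ D.Hat gr z := by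
  classical
  induction s using Finset.induction with
  | empty => exact zero_mem_Hat
  | insert i s hi ih =>
    rw [Finset.sum_insert hi]
    exact add_mem_Hat (h i (Finset.mem_insert_self _ _))
      (ih fun j hj => h j (Finset.mem_insert_of_mem hj))

theorem average_mem_Hat {ρ : Representation k Γ V} {gr : G → Submodule k V}
    (hρ : ∀ g y, ∀ v ∈ gr y, ρ g v ∈ gr (g • y)) {z : G} (hz : ∀ g : Γ, g • z = z) {x : D.Mon → V}
    (hx : x ∈ D.Hat gr z) : average hR ρ x ∈ D.Hat gr z := by
  rw [average, LinearMap.smul_apply, LinearMap.sum_apply]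
  exact smul_mem_Hat _ (sum_mem_Hat _ fun g _ => tensorAct_mem_Hat hR g (hρ g) (hz g) hx)

/-- The average of a family of elements of `R` indexed by `P`. -/
noncomputable def averageR (a : Γ →* (D.R k ≃ₐ[k] D.R k)) (c : P → D.R k) (p : P) : D.R k :=
  (Fintype.card Γ : k)⁻¹ • ∑ g : Γ, a g (c (g⁻¹ • p))

theorem act_averageR (a : Γ →* (D.R k ≃ₐ[k] D.R k)) (c : P → D.R k) (h : Γ) (p : P) :
    a h (averageR a c p) = averageR a c (h • p) := by
  rw [averageR, averageR, map_smul, map_sum]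
  congr 1
  refine Fintype.sum_equiv (Equiv.mulLeft h) _ _ fun g => ?_
  rw [Equiv.coe_mulLeft, map_mul, AlgEquiv.mul_apply, mul_inv_rev, mul_smul, inv_smul_smul]

/-- The span of the first-order classes, as a map `R^P → V ⊗ R`. -/
noncomputable def spanMap (h : ∀ p, Pi.single p 1 ∈ D.monoid) (α : D.Mon → V) :
    (P → D.R k) →ₗ[k] (D.Mon → V) where
  toFun c := ∑ p, hatSMul (c p) (firstOrder h α p)
  map_add' c c' := by
    rw [← Finset.sum_add_distrib]
    refine Finset.sum_congr rfl fun p _ => funext fun u => ?_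
    simp only [hatSMul, Pi.add_apply, coeff_add, add_smul, Finset.sum_add_distrib]
  map_smul' t c := by
    rw [Finset.smul_sum]
    refine Finset.sum_congr rfl fun p _ => funext fun u => ?_
    simp only [hatSMul, Pi.smul_apply, coeff_smul, mul_smul, Finset.smul_sum, RingHom.id_apply]

theorem spanMap_apply (h : ∀ p, Pi.single p 1 ∈ D.monoid) (α : D.Mon → V) (c : P → D.R k) :
    spanMap h α c = ∑ p, hatSMul (c p) (firstOrder h α p) := rfl

/-- Invariance of `α` means that `g` carries the cochain `r_p α_{u_p}` to the one for `g • p`, the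
signs being absorbed. Averaging a combination of these cochains therefore only averages its
coefficients. -/
theorem average_spanMap (ρ : Representation k Γ V) {α : D.Mon → V}
    (hα : ∀ g, tensorAct hR g (ρ g) α = α) (c : P → D.R k) :
    average hR ρ (spanMap hD.mem α c) = spanMap hD.mem α (averageR a c) := by
  have h1 : averageR a c = (Fintype.card Γ : k)⁻¹ • ∑ g : Γ, fun p => a g (c (g⁻¹ • p)) := by
    funext p
    simp [averageR]
  rw [h1, map_smul, map_sum, average, LinearMap.smul_apply, LinearMap.sum_apply]
  congr 1
  refine Finset.sum_congr rfl fun g _ => ?_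
  rw [spanMap_apply, spanMap_apply, map_sum]
  refine Fintype.sum_equiv (MulAction.toPerm g) _ _ fun p => ?_
  rw [tensorAct_hatSMul, tensorAct_firstOrder, hα, MulAction.toPerm_apply, inv_smul_smul]

end averaging

end CoeffDatum

namespace DGLA

open CoeffDatum

/-! ### Obstruction, correction and successive approximation -/

section completeness

variable {P : Type*} [Fintype P] [DecidableEq P] {G : Type*} [AddCommGroup G] [DecidableEq G]
  {𝔾 : GradingDatum G} {D : CoeffDatum P 𝔾} {k : Type*} [Field k] [CharZero k] {hD : D.IsNice k}
  {Γ : Type*} [Group Γ] [Fintype Γ] [DistribMulAction Γ G] [MulAction Γ P]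
  {a : Γ →* (D.R k ≃ₐ[k] D.R k)} (hR : IsSpecialAction hD a)
  {L : Type*} [AddCommGroup L] [Module k L] {𝔤 : DGLA k 𝔾 L} {ρ : Representation k Γ L}

theorem isCoboundary_zero (S : Set D.Mon) : IsCoboundary (𝔤.toEqComplex ρ) S (0 : D.Mon → L) :=
  ⟨0, ⟨⟨zero_mem_Hat, rfl⟩, Set.finite_empty.subset fun _ h => h rfl⟩,
    fun _ _ => (map_zero 𝔤.d).symm⟩

theorem isInvClass_of_invariant {S : Set D.Mon} {x : D.Mon → L}
    (hx : ∀ g, tensorAct hR g (ρ g) x = x) : IsInvClass a (𝔤.toEqComplex ρ) S x := by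
  intro g
  have : tensorMap (a g) ((𝔤.toEqComplex ρ).act g) x - x = 0 := sub_eq_zero.2 (hx g)
  rw [this]
  exact isCoboundary_zero S

/-- Subtracting the two equations gives `2∂(x - y) = -([x - y, x] + [y, x - y])`. Each bracket pairs
an element of step `s` with one without constant term, and so lies in step `s + 1`. -/
theorem d_sub_eq_zero {s : ℕ} {x y : D.Mon → L} (hx : x ∈ MC D 𝔤) (hy : y ∈ MC D 𝔤)
    (hs : SuppIn (filt hD.mem s) (x - y)) {u : D.Mon} (hu : u ∉ filt hD.mem (s + 1)) :
    𝔤.d ((x - y) u) = 0 := by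
  rw [mem_MC_iff] at hx hy
  have h1 : (2 : k) • 𝔤.hatD (x - y) = -(conv 𝔤.br (x - y) x + conv 𝔤.br y (x - y)) := by
    simp only [map_sub, smul_sub, ← convₗ_apply, LinearMap.sub_apply]
    rw [convₗ_apply, convₗ_apply, convₗ_apply, eq_neg_of_add_eq_zero_left hx.2,
      eq_neg_of_add_eq_zero_left hy.2]
    abel
  have h2 := congrFun h1 u
  rw [Pi.smul_apply, Pi.neg_apply, ((conv_suppIn_filt_left hs hx.1.2).add
    (conv_suppIn_filt_right hy.1.2 hs)) u hu, neg_zero, smul_eq_zero] at h2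
  exact h2.resolve_left two_ne_zero

/-- The comparison of `β` with the zero solution at step one: the coordinates lie outside step two.
-/
theorem d_basis_eq_zero {β : D.Mon → L} (hβ : β ∈ MC D 𝔤) (p : P) :
    𝔤.d (β (basis hD.mem p)) = 0 := by
  have h0 : (0 : D.Mon → L) ∈ MC D 𝔤 := by
    rw [mem_MC_iff, map_zero, smul_zero, ← convₗ_apply, map_zero, add_zero]
    exact ⟨⟨zero_mem_Hat, rfl⟩, rfl⟩
  have := d_sub_eq_zero (hD := hD) (s := 1) hβ h0 (fun u hu => by
    rw [mem_filt_one, not_not] at hu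
    rw [hu, sub_zero]
    exact hβ.1.2) (u := basis hD.mem p) fun h => ((mem_filt_two hD).1 h).2 p rfl
  rwa [sub_zero] at this

theorem polyM_indicator {S : Set D.Mon} {x : D.Mon → L} {z : G} (hx : x ∈ D.Hat 𝔤.gr z)
    (h0 : (0 : D.Mon) ∉ S) {n : ℕ} (hS : ∀ u ∈ S, u ∉ D.pow n) :
    S.indicator x ∈ D.PolyM 𝔤.gr z := by
  refine ⟨⟨indicator_mem_Hat S hx, Set.indicator_of_notMem h0 x⟩, (hx.2 n).subset fun u hu => ?_⟩
  have h1 : u ∈ S := by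
    by_contra hc
    exact hu (Set.indicator_of_notMem hc x)
  exact ⟨fun h => hu (by rw [Set.indicator_of_mem h1, h]), hS u h1⟩

/-- The spanning hypothesis applies to the sum of all first-order terms `r_p β_{u_p}`, which is
invariant as a whole although its summands are permuted. At the irreducible monomial `r_p` only the
constant term of the `p`-th coefficient survives. It is used with `S` empty and with `S = D.pow 2`.
-/
theorem exists_basis_eq {α β : D.Mon → L} (hβ : β ∈ MC D 𝔤)
    (hβi : ∀ g, tensorAct hR g (ρ g) β = β) {S : Set D.Mon}
    (hS : ∀ p, basis hD.mem p ∉ S) (hα : SpansInv hD.mem a (𝔤.toEqComplex ρ) S α) (p : P) :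
    ∃ t : k, ∃ y ∈ 𝔤.gr (0 - D.deg (basis hD.mem p)),
      𝔤.d y = β (basis hD.mem p) - t • α (basis hD.mem p) := by
  let B : Set D.Mon := Set.range (basis hD.mem)
  have hBi : ∀ (g : Γ) (u : D.Mon), mact hR g u ∈ B ↔ u ∈ B := by
    intro g u
    constructor
    · rintro ⟨q, hq⟩
      refine ⟨g⁻¹ • q, ?_⟩
      rw [← mact_basis hR, hq, mact_inv_mact]
    · rintro ⟨q, rfl⟩
      exact ⟨g • q, (mact_basis hR g q).symm⟩
  obtain ⟨c, -, y, hy, hyx⟩ := hα (B.indicator β) (by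
      refine ⟨polyM_indicator hβ.1.1 ?_ (n := 2) ?_, fun u _ => ?_⟩
      · rintro ⟨q, hq⟩
        exact hD.basis_ne_zero q hq
      · rintro _ ⟨q, rfl⟩
        exact hD.basis_notMem_pow_two q
      · by_cases hu : u ∈ B
        · obtain ⟨q, rfl⟩ := hu
          rw [Set.indicator_of_mem (show basis hD.mem q ∈ B from ⟨q, rfl⟩)]
          exact d_basis_eq_zero (hD := hD) hβ q
        · rw [Set.indicator_of_notMem hu]
          exact map_zero 𝔤.d)
    (isInvClass_of_invariant hR fun g => by rw [tensorAct_indicator hR g (ρ g) (hBi g), hβi])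
  refine ⟨coeff 0 (c p), y (basis hD.mem p), hy.1.1.1 _, ?_⟩
  have h1 := hyx (basis hD.mem p) (hS p)
  rw [Pi.sub_apply, Set.indicator_of_mem (show basis hD.mem p ∈ B from ⟨p, rfl⟩), Finset.sum_apply, Finset.sum_eq_single p] at h1
  · have h2 := hatSMul_firstOrder_add hD.mem (c p) α p 0
    rw [zero_add] at h2
    rw [h2] at h1
    exact h1.symm
  · intro q _ hq
    by_contra hne
    obtain ⟨v, hv, -⟩ := exists_of_hatSMul_firstOrder_ne_zero hD.mem hne
    by_cases hv0 : v = 0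
    · subst hv0
      rw [zero_add] at hv
      exact hq (basis_injective _ hv)
    · exact hD.add_ne_basis hv0 (hD.basis_ne_zero q) p hv
  · simp

/-- Each class of `β` is a multiple of the class of `α` at the same coordinate, and conversely,
because both families of classes span. The freedom left where the class of `α` vanishes is used to
make the multiples non-zero and constant on orbits. -/
theorem exists_scalars (hρ : 𝔤.IsAction ρ) {α β : D.Mon → L}
    (hα : α ∈ MC D 𝔤) (hαi : ∀ g, tensorAct hR g (ρ g) α = α)
    (hαs : SpansInv hD.mem a (𝔤.toEqComplex ρ) ∅ α) (hβ : β ∈ MC D 𝔤)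
    (hβi : ∀ g, tensorAct hR g (ρ g) β = β)
    (hβs : SpansInv hD.mem a (𝔤.toEqComplex ρ) (D.pow 2) β) :
    ∃ t : P → k, (∀ p, t p ≠ 0) ∧ (∀ (g : Γ) p, t (g • p) = t p) ∧
      ∀ p, ∃ y ∈ 𝔤.gr (0 - D.deg (basis hD.mem p)),
        𝔤.d y = β (basis hD.mem p) - t p • α (basis hD.mem p) := by
  classical
  have h1 := exists_basis_eq hR hβ hβi (S := ∅) (fun p => Set.notMem_empty _) hαs
  have h2 := exists_basis_eq hR hα hαi (fun p => hD.basis_notMem_pow_two p) hβs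
  have hact : ∀ (g : Γ) (p : P) (t : k), (∃ y ∈ 𝔤.gr (0 - D.deg (basis hD.mem p)),
      𝔤.d y = β (basis hD.mem p) - t • α (basis hD.mem p)) →
      ∃ y ∈ 𝔤.gr (0 - D.deg (basis hD.mem (g • p))),
        𝔤.d y = β (basis hD.mem (g • p)) - t • α (basis hD.mem (g • p)) := by
    rintro g p t ⟨y, hy, hyd⟩
    refine ⟨msgn hR g (basis hD.mem p) • ρ g y, Submodule.smul_mem _ _ ?_, ?_⟩
    · have := hρ.mem g _ y hy
      rwa [smul_sub, smul_zero, ← deg_mact hR, mact_basis] at this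
    · rw [map_smul, ← hρ.d, hyd, ← mact_basis hR, ← hβi g, ← hαi g, tensorAct_mact,
        tensorAct_mact, hβi, hαi, map_sub, map_smul, smul_sub, smul_comm]
  have hact0 : ∀ (g : Γ) (p : P), ClassIsZero hD.mem (𝔤.toEqComplex ρ) α p →
      ClassIsZero hD.mem (𝔤.toEqComplex ρ) α (g • p) := by
    rintro g p ⟨y, hy, hyd⟩
    refine ⟨msgn hR g (basis hD.mem p) • ρ g y, Submodule.smul_mem _ _ ?_, ?_⟩
    · have := hρ.mem g _ y hy
      rwa [smul_sub, smul_zero, ← deg_mact hR, mact_basis] at this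
    · change 𝔤.d _ = _
      change 𝔤.d y = _ at hyd
      rw [map_smul, ← hρ.d, hyd, ← mact_basis hR]
      conv_rhs => rw [← hαi g, tensorAct_mact]
  choose c hc using h1
  -- Where the class of `α` vanishes, any scalar works, and `1` is the invariant non-zero choice.
  refine ⟨fun p => if ClassIsZero hD.mem (𝔤.toEqComplex ρ) α p then 1 else c p, fun p => ?_,
    fun g p => ?_, fun p => ?_⟩
  · beta_reduce
    split_ifs with h0
    · exact one_ne_zero
    -- If the scalar were zero, the class of `β` would vanish, and with it the class of `α`, which
    -- is a multiple of it.
    · intro hcp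
      obtain ⟨y, hy, hyd⟩ := hc p
      obtain ⟨t, z, hz, hzd⟩ := h2 p
      apply h0
      refine ⟨z + t • y, Submodule.add_mem _ hz (Submodule.smul_mem _ _ hy), ?_⟩
      change 𝔤.d _ = _
      rw [map_add, map_smul, hzd, hyd, hcp, zero_smul, sub_zero]
      abel
  · have hiff : ClassIsZero hD.mem (𝔤.toEqComplex ρ) α (g • p) ↔
        ClassIsZero hD.mem (𝔤.toEqComplex ρ) α p :=
      ⟨fun h => by simpa using hact0 g⁻¹ _ h, hact0 g p⟩
    simp only [hiff]
    split_ifs with h0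
    · rfl
    -- Both `c p` and `c (g • p)` are admissible at `g • p`. If they differed, the class of `α`
    -- there would be zero.
    · by_contra hne
      apply h0
      rw [← hiff]
      obtain ⟨y, hy, hyd⟩ := hact g p _ (hc p)
      obtain ⟨z, hz, hzd⟩ := hc (g • p)
      refine ⟨(c (g • p) - c p)⁻¹ • (y - z), Submodule.smul_mem _ _ (Submodule.sub_mem _ hy hz), ?_⟩
      change 𝔤.d _ = _
      rw [map_smul, map_sub, hyd, hzd, sub_sub_sub_cancel_left, ← sub_smul, smul_smul,
        inv_mul_cancel₀ (sub_ne_zero.2 hne), one_smul]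
  · beta_reduce
    split_ifs with h0
    · obtain ⟨y, hy, hyd⟩ := hc p
      obtain ⟨z, hz, hzd⟩ := h0
      change 𝔤.d z = _ at hzd
      refine ⟨y + (c p - 1) • z, Submodule.add_mem _ hy (Submodule.smul_mem _ _ hz), ?_⟩
      rw [map_add, map_smul, hyd, hzd, one_smul, sub_smul, one_smul]
      abel
    · exact hc p

/-- An approximate solution up to the `s`-th step of the filtration. -/
structure IsApprox (hR : IsSpecialAction hD a) (ρ : Representation k Γ L) (𝔤 : DGLA k 𝔾 L)
    (α β : D.Mon → L) (s : ℕ) (x : (D.Mon → L) × (P → unitsZero D k)) : Prop where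
  mem : x.1 ∈ D.HatM 𝔤.gr 0
  inv : ∀ g, tensorAct hR g (ρ g) x.1 = x.1
  inv_unit : ∀ g p, a g (unitElt x.2 p) = unitElt x.2 (g • p)
  supp : SuppIn (filt hD.mem s) (gauge D 𝔤 x.1 β - pull x.2 α)

/-- The base case takes constant units equal to the scalars, and for `γ` the average of primitives
of the differences at the coordinates. -/
theorem exists_isApprox_two (hρ : 𝔤.IsAction ρ) {α β : D.Mon → L}
    (hα : α ∈ MC D 𝔤) (hαi : ∀ g, tensorAct hR g (ρ g) α = α)
    (hαs : SpansInv hD.mem a (𝔤.toEqComplex ρ) ∅ α) (hβ : β ∈ MC D 𝔤)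
    (hβi : ∀ g, tensorAct hR g (ρ g) β = β)
    (hβs : SpansInv hD.mem a (𝔤.toEqComplex ρ) (D.pow 2) β) :
    ∃ x, IsApprox hR ρ 𝔤 α β 2 x := by
  classical
  obtain ⟨t, ht0, htg, hty⟩ := exists_scalars hR hρ hα hαi hαs hβ hβi hβs
  choose y hy hyd using hty
  let c : P → unitsZero D k := fun p =>
    ⟨Units.map (algebraMap k (D.R k) : k →* D.R k) (Units.mk0 (t p) (ht0 p)), by
      change algebraMap k (D.R k) (t p) ∈ D.homog k 0
      intro u hu
      rw [Algebra.algebraMap_eq_smul_one, coeff_smul] at hu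
      exact one_mem_homog u (right_ne_zero_of_mul hu)⟩
  have hcelt : ∀ p, unitElt c p = algebraMap k (D.R k) (t p) := fun p => rfl
  have hc0 : ∀ p, coeff 0 (unitElt c p) = t p := fun p => by
    rw [hcelt, Algebra.algebraMap_eq_smul_one, coeff_smul, coeff_one, if_pos rfl, mul_one]
  have hci : ∀ g p, a g (unitElt c p) = unitElt c (g • p) := fun g p => by
    rw [hcelt, hcelt, htg, AlgEquiv.commutes]
  let y0 : D.Mon → L := fun u => if h : ∃ p, u = basis hD.mem p then y h.choose else 0
  have hy0b : ∀ p, y0 (basis hD.mem p) = y p := by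
    intro p
    have h : ∃ q, basis hD.mem p = basis hD.mem q := ⟨p, rfl⟩
    have h2 : h.choose = p := (basis_injective _ h.choose_spec).symm
    change dite _ _ _ = _
    rw [dif_pos h, h2]
  have hy0n : ∀ u, (∀ p, u ≠ basis hD.mem p) → y0 u = 0 := fun u hu =>
    dif_neg (by push Not; exact hu)
  have hy0m : y0 ∈ D.Hat 𝔤.gr 0 := by
    refine ⟨fun u => ?_, fun n => (Set.finite_range (basis hD.mem)).subset ?_⟩
    · by_cases h : ∃ p, u = basis hD.mem p
      · obtain ⟨p, rfl⟩ := h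
        rw [hy0b]; exact hy p
      · push Not at h
        rw [hy0n u h]; exact Submodule.zero_mem _
    · rintro u ⟨hu, -⟩
      by_contra hc
      exact hu (hy0n u fun p hp => hc ⟨p, hp.symm⟩)
  let B : Set D.Mon := Set.range (basis hD.mem)
  have hBi : ∀ (g : Γ) (u : D.Mon), mact hR g u ∈ B ↔ u ∈ B := by
    intro g u
    constructor
    · rintro ⟨q, hq⟩
      refine ⟨g⁻¹ • q, ?_⟩
      rw [← mact_basis hR, hq, mact_inv_mact]
    · rintro ⟨q, rfl⟩
      exact ⟨g • q, (mact_basis hR g q).symm⟩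
  have hE : 𝔤.hatD y0 = B.indicator (β - pull c α) := by
    funext u
    by_cases hu : u ∈ B
    · obtain ⟨p, rfl⟩ := hu
      rw [hatD_apply, hy0b, hyd, Set.indicator_of_mem (show basis hD.mem p ∈ B from ⟨p, rfl⟩), Pi.sub_apply, pull_basis (hD := hD), hc0]
    · rw [hatD_apply, Set.indicator_of_notMem hu, hy0n u fun p hp => hu ⟨p, hp.symm⟩, map_zero]
  have hEi : ∀ g, tensorAct hR g (ρ g) (B.indicator (β - pull c α)) =
      B.indicator (β - pull c α) := fun g => by
    rw [tensorAct_indicator hR g (ρ g) (hBi g), map_sub, hβi,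
      tensorAct_pull hR g (hci g), hαi]
  let γ := average hR ρ y0
  -- The differential commutes with averaging, and the right hand side is already invariant, so
  -- averaging the primitive does no harm.
  have hγd : 𝔤.hatD γ = B.indicator (β - pull c α) := by
    rw [← average_of_invariant hR ρ hEi, ← hE]
    simp only [γ, average, LinearMap.smul_apply, LinearMap.sum_apply, map_smul, map_sum,
      tensorAct_hatD hR hρ]
  have hy00 : y0 0 = 0 := hy0n 0 fun p hp => hD.basis_ne_zero p hp.symm
  have hγ0 : γ 0 = 0 := by
    have : ∀ g, tensorAct hR g (ρ g) y0 0 = 0 := fun g => by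
      have := tensorAct_mact hR g (ρ g) y0 0
      rwa [mact_zero, hy00, map_zero, smul_zero] at this
    simp only [γ, average, LinearMap.smul_apply, LinearMap.sum_apply, Pi.smul_apply,
      Finset.sum_apply, this, Finset.sum_const_zero, smul_zero]
  refine ⟨(γ, c), ⟨average_mem_Hat hR hρ.mem (fun g => smul_zero g) hy0m, hγ0⟩,
    fun g => tensorAct_average hR ρ g y0, hci, fun u hu => ?_⟩
  have h1 := suppIn_gauge_sub (𝔤 := 𝔤) (h := hD.mem) (γ := 0) (γ' := γ) rfl hγ0 hβ.1.2 (s := 1)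
    (fun v hv => by
      rw [mem_filt_one, not_not] at hv
      rw [sub_zero, hv, hγ0]) u hu
  rw [gauge_zero, sub_zero, hγd, Pi.add_apply, Pi.sub_apply] at h1
  rw [mem_filt_two hD, not_and_or, not_not] at hu
  rw [Pi.sub_apply]
  by_cases h0 : u = 0
  · subst h0
    rw [(gauge_mem ⟨average_mem_Hat hR hρ.mem (fun g => smul_zero g) hy0m, hγ0⟩ hβ.1).2,
      pull_apply_zero, hα.1.2, sub_zero]
  · obtain ⟨p, hp⟩ : ∃ p, u = basis hD.mem p := by simpa using hu.resolve_left h0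
    rw [Set.indicator_of_mem (show u ∈ B from ⟨p, hp.symm⟩), Pi.sub_apply] at h1
    rw [← h1]
    abel

/-- The linearised problem in a single layer of the filtration. It is the place where the spanning
hypothesis without completion enters. -/
theorem exists_correction (hρ : 𝔤.IsAction ρ) {α : D.Mon → L}
    (hαi : ∀ g, tensorAct hR g (ρ g) α = α)
    (hαs : SpansInv hD.mem a (𝔤.toEqComplex ρ) ∅ α) {E : D.Mon → L} {s : ℕ} (hs : 1 ≤ s)
    (hE : E ∈ D.Hat 𝔤.gr (𝔾.ι 1)) (hEs : SuppIn (filt hD.mem s) E)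
    (hEd : ∀ u ∉ filt hD.mem (s + 1), 𝔤.d (E u) = 0)
    (hEi : ∀ g, tensorAct hR g (ρ g) E = E) :
    ∃ y ∈ D.HatM 𝔤.gr 0, ∃ e : P → D.R k, (∀ g, tensorAct hR g (ρ g) y = y) ∧
      SuppIn (filt hD.mem s) y ∧ (∀ p, e p ∈ D.homog k 0) ∧
      (∀ p v, coeff v (e p) ≠ 0 → v + basis hD.mem p ∈ filt hD.mem s) ∧
      (∀ g p, a g (e p) = e (g • p)) ∧
      SuppIn (filt hD.mem (s + 1)) (E - 𝔤.hatD y - spanMap hD.mem α e) := by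
  let T : Set D.Mon := (filt hD.mem (s + 1))ᶜ
  have hT : ∀ (g : Γ) (u : D.Mon), mact hR g u ∈ T ↔ u ∈ T := fun g u =>
    not_congr (mact_mem_filt hR)
  -- The layer between two consecutive steps. It avoids `D.pow (s + 1)`, so `E` restricted to it has
  -- finitely many terms.
  let S : Set D.Mon := filt hD.mem s ∩ T
  have hS : ∀ (g : Γ) (u : D.Mon), mact hR g u ∈ S ↔ u ∈ S := fun g u =>
    and_congr (mact_mem_filt hR) (hT g u)
  have hS0 : (0 : D.Mon) ∉ S := fun h => mem_filt_one.1 (filt_antitone hs h.1) rfl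
  let x := S.indicator E
  have hxi : ∀ g, tensorAct hR g (ρ g) x = x := fun g => by
    rw [tensorAct_indicator hR g (ρ g) (hS g), hEi]
  obtain ⟨c, hc, y, hy, hyx⟩ := hαs x
    ⟨polyM_indicator hE hS0 (n := s + 1) fun u hu h => hu.2 (pow_subset_filt _ h), fun u _ => by
      by_cases hu : u ∈ S
      · rw [show x u = E u from Set.indicator_of_mem hu E]
        exact hEd u hu.2
      · rw [show x u = 0 from Set.indicator_of_notMem hu E]
        exact map_zero 𝔤.d⟩ (isInvClass_of_invariant hR hxi)
  have hx1 : x = 𝔤.hatD y + spanMap hD.mem α c := by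
    funext u
    have := hyx u (Set.notMem_empty u)
    rw [Pi.sub_apply, sub_eq_iff_eq_add] at this
    exact this
  -- Since `x` is invariant, it equals its own average, and averaging the given solution yields an
  -- equivariant one.
  let y1 := average hR ρ y
  let c1 := averageR a c
  have hx2 : x = 𝔤.hatD y1 + spanMap hD.mem α c1 := by
    rw [← average_of_invariant hR ρ hxi, hx1, map_add, average_spanMap hR ρ hαi]
    congr 1
    simp only [y1, average, LinearMap.smul_apply, LinearMap.sum_apply, map_smul, map_sum,
      tensorAct_hatD hR hρ]
  have hy1 : y1 ∈ D.Hat 𝔤.gr 0 := average_mem_Hat hR hρ.mem (fun g => smul_zero g) hy.1.1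
  have hc1 : ∀ p, c1 p ∈ D.homog k 0 := by
    intro p u hu
    rw [show c1 p = averageR a c p from rfl, averageR, coeff_smul, coeff_sum] at hu
    obtain ⟨g, -, hg⟩ := Finset.exists_ne_zero_of_sum_ne_zero (right_ne_zero_of_mul hu)
    have := hR.graded g 0 _ (hc (g⁻¹ • p)).2 u hg
    rwa [smul_zero] at this
  -- The solution is truncated to the layer so that the correction disturbs no earlier step.
  -- Multiplication by `r_p` is injective on monomials, so truncating the product amounts to
  -- truncating the coefficient.
  let Sp : P → Set D.Mon := fun p => {v | v + basis hD.mem p ∈ S}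
  have hspan : ∀ p u, hatSMul (restr (Sp p) (c1 p)) (firstOrder hD.mem α p) u =
      S.indicator (hatSMul (c1 p) (firstOrder hD.mem α p)) u := by
    intro p u
    by_cases h : ∃ v, v + basis hD.mem p = u
    · obtain ⟨v, rfl⟩ := h
      rw [hatSMul_firstOrder_add]
      by_cases hv : v ∈ Sp p
      · rw [Set.indicator_of_mem (show v + basis hD.mem p ∈ S from hv), hatSMul_firstOrder_add,
          coeff_restr_of_mem hv]
      · rw [Set.indicator_of_notMem (show v + basis hD.mem p ∉ S from hv), coeff_restr_of_notMem hv, zero_smul]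
    · have h1 : ∀ c' : D.R k, hatSMul c' (firstOrder hD.mem α p) u = 0 := fun c' => by
        by_contra hne
        obtain ⟨v, hv, -⟩ := exists_of_hatSMul_firstOrder_ne_zero hD.mem hne
        exact h ⟨v, hv⟩
      rw [h1]
      by_cases hu : u ∈ S
      · rw [Set.indicator_of_mem hu, h1]
      · rw [Set.indicator_of_notMem hu]
  have hmemSp : ∀ p v, coeff v (restr (Sp p) (c1 p)) ≠ 0 → v ∈ Sp p := fun p v hv => by
    by_contra hc
    exact hv (coeff_restr_of_notMem hc _)
  refine ⟨S.indicator y1, ⟨indicator_mem_Hat S hy1, Set.indicator_of_notMem hS0 _⟩,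
    fun p => restr (Sp p) (c1 p), fun g => ?_, fun u hu => ?_, fun p u hu => ?_,
    fun p v hv => (hmemSp p v hv).1, fun g p => ?_, fun u hu => ?_⟩
  · rw [tensorAct_indicator hR g (ρ g) (hS g), tensorAct_average]
  · exact Set.indicator_of_notMem (fun h => hu h.1) _
  · rw [coeff_restr_of_mem (hmemSp p u hu)] at hu
    exact hc1 p u hu
  · rw [act_restr hR g (T := Sp (g • p)), act_averageR]
    intro u
    change mact hR g u + basis hD.mem (g • p) ∈ S ↔ _
    rw [← mact_basis hR, ← mact_add, hS]
    rfl
  · rw [Pi.sub_apply, Pi.sub_apply, spanMap_apply, Finset.sum_apply]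
    simp only [hspan]
    by_cases hu' : u ∈ filt hD.mem s
    · have huS : u ∈ S := ⟨hu', hu⟩
      simp only [hatD_apply, Set.indicator_of_mem huS]
      have := congrFun hx2 u
      rw [show x u = E u from Set.indicator_of_mem huS E, Pi.add_apply, spanMap_apply,
        Finset.sum_apply, hatD_apply] at this
      rw [this]
      abel
    · have huS : u ∉ S := fun h => hu' h.1
      simp only [hatD_apply, Set.indicator_of_notMem huS]
      rw [hEs u hu', map_zero, Finset.sum_const_zero, sub_zero, sub_zero]

/-- Replacing `γ` by `γ + y` and `c_p` by `c_p + e_p` changes the error, modulo the next step, by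
`-∂y - ∑ e_p r_p α_{u_p}`, which cancels it. -/
theorem IsApprox.step (hρ : 𝔤.IsAction ρ) {α β : D.Mon → L}
    (hα : α ∈ MC D 𝔤) (hαi : ∀ g, tensorAct hR g (ρ g) α = α)
    (hαs : SpansInv hD.mem a (𝔤.toEqComplex ρ) ∅ α) (hβ : β ∈ MC D 𝔤)
    (hβi : ∀ g, tensorAct hR g (ρ g) β = β) {s : ℕ} (hs : 2 ≤ s)
    {x : (D.Mon → L) × (P → unitsZero D k)} (hx : IsApprox hR ρ 𝔤 α β s x) :
    ∃ x', IsApprox hR ρ 𝔤 α β (s + 1) x' ∧ SuppIn (filt hD.mem s) (x'.1 - x.1) ∧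
      ∀ p v, coeff v (unitElt x'.2 p - unitElt x.2 p) ≠ 0 →
        v + basis hD.mem p ∈ filt hD.mem s := by
  obtain ⟨γ, c⟩ := x
  have hγ : γ ∈ D.HatM 𝔤.gr 0 := hx.mem
  have hgm := gauge_mem_MC hγ hβ
  have hpm := pull_mem_MC c hα
  obtain ⟨y, hy, e, hyi, hys, he0, hes, hei, hE⟩ := exists_correction hR hρ hαi hαs
    (by omega : 1 ≤ s) (sub_mem_Hat hgm.1.1 hpm.1.1) hx.supp
    (fun u hu => d_sub_eq_zero (hD := hD) hgm hpm hx.supp hu)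
    (fun g => by rw [map_sub, tensorAct_gauge hR hρ g hγ.2 (hx.inv g) (hβi g),
      tensorAct_pull hR g (hx.inv_unit g), hαi])
  have hu : ∀ p, ∃ z : unitsZero D k, ((z : (D.R k)ˣ) : D.R k) = unitElt c p + e p := by
    intro p
    have hh : unitElt c p + e p ∈ D.homog k 0 := by
      intro u hu
      by_cases h0 : coeff u (e p) = 0
      · exact (c p).2 u fun h1 => hu (by rw [coeff_add, h1, h0, add_zero])
      · exact he0 p u h0
    -- This is where `2 ≤ s` matters: `r_p` is outside step two, so `e_p` has no constant term and
    -- `c_p + e_p` is still a unit.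
    have he : coeff 0 (e p) = 0 := by
      by_contra hne
      have := filt_antitone hs (hes p 0 hne)
      rw [zero_add, mem_filt_two hD] at this
      exact this.2 p rfl
    obtain ⟨z, hz⟩ := isUnit_of_coeff_zero hh (by
      rw [coeff_add, he, add_zero]
      exact coeff_zero_ne_zero (c p : (D.R k)ˣ).mul_inv)
    exact ⟨⟨z, by change (z : D.R k) ∈ D.homog k 0; rw [hz]; exact hh⟩, hz⟩
  choose c' hc' using hu
  have hdiff : ∀ p, unitElt c' p - unitElt c p = e p := fun p => by
    rw [unitElt, hc', add_sub_cancel_left]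
  have hγ' : γ + y ∈ D.HatM 𝔤.gr 0 :=
    ⟨add_mem_Hat hγ.1 hy.1, by rw [Pi.add_apply, hγ.2, hy.2, add_zero]⟩
  refine ⟨(γ + y, c'), ⟨hγ', fun g => ?_, fun g p => ?_, ?_⟩, ?_, fun p v hv => ?_⟩
  · have := hx.inv g
    simp only at this ⊢
    rw [map_add, this, hyi]
  · have := hx.inv_unit g p
    simp only at this ⊢
    have hce : ∀ p, unitElt c' p = unitElt c p + e p := hc'
    rw [hce, hce, map_add, this, hei]
  · have hsub : γ + y - γ = y := by abel
    have h1 := suppIn_gauge_sub (𝔤 := 𝔤) hγ.2 hγ'.2 hβ.1.2 (h := hD.mem) (s := s)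
      (by simp only [hsub]; exact hys)
    have h2 := suppIn_pull_sub (h := hD.mem) (c := c) (c' := c') hα.1.2 (s := s)
      (fun p v hv => hes p v (by rwa [hdiff] at hv))
    simp only [hsub] at h1
    simp only [hdiff, ← spanMap_apply] at h2
    have h3 := (h1.add h2.neg).add hE
    intro u hu
    have := h3 u hu
    simp only [Pi.add_apply, Pi.sub_apply, Pi.neg_apply] at this ⊢
    rw [← this]
    abel
  · have hsub : γ + y - γ = y := by abel
    change SuppIn _ (γ + y - γ)
    rw [hsub]
    exact hys
  · exact hes p v (by rw [← hdiff]; exact hv)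

end completeness

end DGLA

theorem exists_limit {X V : Type*} {I : ℕ → Set X} (hI : Antitone I) (hI' : ∀ u, ∃ n, u ∉ I n)
    {f : ℕ → X → V} (hf : ∀ n, ∀ u ∉ I n, f (n + 1) u = f n u) :
    ∃ F : X → V, ∀ n, ∀ u ∉ I n, F u = f n u := by
  have key : ∀ n j, ∀ u ∉ I n, f (n + j) u = f n u := by
    intro n j u hu
    induction j with
    | zero => rfl
    | succ j ih => rw [← add_assoc, hf _ _ fun h => hu (hI (by omega) h), ih]
  choose N hN using hI'
  refine ⟨fun u => f (N u) u, fun n u hu => ?_⟩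
  rcases le_total n (N u) with h | h
  · obtain ⟨j, hj⟩ := Nat.exists_eq_add_of_le h
    beta_reduce
    rw [hj, key n j u hu]
  · obtain ⟨j, hj⟩ := Nat.exists_eq_add_of_le h
    beta_reduce
    rw [hj, key (N u) j u (hN u)]

namespace DGLA

open CoeffDatum

/-! ### Passage to the limit -/

section completeness

variable {P : Type*} [Fintype P] [DecidableEq P] {G : Type*} [AddCommGroup G] [DecidableEq G]
  {𝔾 : GradingDatum G} {D : CoeffDatum P 𝔾} {k : Type*} [Field k] [CharZero k] {hD : D.IsNice k}
  {Γ : Type*} [Group Γ] [Fintype Γ] [DistribMulAction Γ G] [MulAction Γ P]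
  {a : Γ →* (D.R k ≃ₐ[k] D.R k)} (hR : IsSpecialAction hD a)
  {L : Type*} [AddCommGroup L] [Module k L] {𝔤 : DGLA k 𝔾 L} {ρ : Representation k Γ L}

include hR in
-- The corrections lie in deeper and deeper steps, so `γ` and the units stabilise coefficientwise,
-- and the error of the limit vanishes at every monomial.
theorem exists_gauge_eq_pull (hρ : 𝔤.IsAction ρ) {α β : D.Mon → L}
    (hα : α ∈ MC D 𝔤) (hαi : IsInvElt a (𝔤.toEqComplex ρ) α)
    (hαs : SpansInv hD.mem a (𝔤.toEqComplex ρ) ∅ α) (hβ : β ∈ 𝔤.MCprime ρ hD.mem a) :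
    ∃ γ ∈ D.HatM 𝔤.gr 0, ∃ c : P → unitsZero D k, gauge D 𝔤 γ β = pull c α := by
  obtain ⟨hβ, hβi, hβs⟩ := hβ
  obtain ⟨x0, hx0⟩ := exists_isApprox_two hR hρ hα hαi hαs hβ hβi hβs
  have hstep := fun (n : ℕ) (x : {x // IsApprox hR ρ 𝔤 α β (n + 2) x}) =>
    x.2.step hR hρ hα hαi hαs hβ hβi (by omega)
  choose next hnext hnext1 hnext2 using hstep
  -- The `n`-th term is exact up to step `n + 2`, the base case being step two.
  let seq : ∀ n : ℕ, {x // IsApprox hR ρ 𝔤 α β (n + 2) x} := fun n =>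
    Nat.rec ⟨x0, hx0⟩ (fun n x => ⟨next n x, hnext n x⟩) n
  have hseq1 : ∀ n, SuppIn (filt hD.mem (n + 2)) ((seq (n + 1)).1.1 - (seq n).1.1) :=
    fun n => hnext1 n (seq n)
  have hseq2 : ∀ n p v, coeff v (unitElt (seq (n + 1)).1.2 p - unitElt (seq n).1.2 p) ≠ 0 →
      v + basis hD.mem p ∈ filt hD.mem (n + 2) := fun n => hnext2 n (seq n)
  have hanti : Antitone fun n => filt (D := D) hD.mem (n + 2) := fun i j hij =>
    filt_antitone (by omega)
  have hex : ∀ u : D.Mon, ∃ n, u ∉ filt hD.mem (n + 2) := fun u => by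
    obtain ⟨s, hs⟩ := exists_notMem_filt hD u
    exact ⟨s, fun h => hs (filt_antitone (by omega) h)⟩
  obtain ⟨γ, hγ⟩ := exists_limit hanti hex (f := fun n => (seq n).1.1)
    fun n u hu => sub_eq_zero.1 (hseq1 n u hu)
  have hlim := fun p => exists_limit (I := fun n => {v : D.Mon | v + basis hD.mem p ∈ filt hD.mem (n + 2)})
    (fun i j hij v hv => hanti hij hv) (fun v => hex _)
    (f := fun n v => coeff v (unitElt (seq n).1.2 p)) fun n v hv => by
      by_contra hne
      exact hv (hseq2 n p v (by rw [coeff_sub]; exact sub_ne_zero.2 hne))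
  choose F hF using hlim
  have hFdeg : ∀ p v, F p v ≠ 0 → D.deg v = 0 := fun p v hv => by
    obtain ⟨n, hn⟩ := hex (v + basis hD.mem p)
    rw [hF p n v hn] at hv
    exact ((seq n).1.2 p).2 v hv
  -- The limit is an element of `R`: for a suitable stage `s`, all its coefficients outside `D.pow
  -- N` are those of stage `s`. This rests on the control of quotients by `r_p` in
  -- `exists_filt_subset`.
  let z : P → D.R k := fun p => ⟨F p, (Set.finite_singleton 0).subset (by
      rintro y ⟨v, hv, rfl⟩
      exact hFdeg p v hv), fun N => by
      obtain ⟨s, hs⟩ := exists_filt_subset hD N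
      refine ((unitElt (seq s).1.2 p).2.2 N).subset ?_
      rintro v ⟨hv, hvN⟩
      refine ⟨?_, hvN⟩
      have : v + basis hD.mem p ∉ filt hD.mem (s + 2) := fun h =>
        hvN ((hs _ (filt_antitone (by omega) h)).2 v p (hFdeg p v hv) rfl)
      have h2 := hF p s v this
      change F p v ≠ 0 at hv
      rw [h2] at hv
      exact hv⟩
  have hz : ∀ p n v, v + basis hD.mem p ∉ filt hD.mem (n + 2) →
      coeff v (z p) = coeff v (unitElt (seq n).1.2 p) := fun p n v hv => hF p n v hv
  have hc : ∀ p, ∃ c : unitsZero D k, ((c : (D.R k)ˣ) : D.R k) = z p := by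
    intro p
    have hh : z p ∈ D.homog k 0 := fun v hv => hFdeg p v hv
    -- The constant term is already settled at the initial stage, because `r_p` is outside step two.
    obtain ⟨w, hw⟩ := isUnit_of_coeff_zero hh (by
      rw [hz p 0 0 fun h => ((mem_filt_two hD).1 h).2 p (zero_add _)]
      exact coeff_zero_ne_zero ((seq 0).1.2 p : (D.R k)ˣ).mul_inv)
    exact ⟨⟨w, by change (w : D.R k) ∈ D.homog k 0; rw [hw]; exact hh⟩, hw⟩
  choose c hc using hc
  have hce : ∀ p, unitElt c p = z p := hc
  have hγ0 : γ 0 = 0 := by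
    obtain ⟨n, hn⟩ := hex 0
    rw [hγ n 0 hn]
    exact (seq n).2.mem.2
  have hγm : γ ∈ D.HatM 𝔤.gr 0 := by
    refine ⟨⟨fun u => ?_, fun N => ?_⟩, hγ0⟩
    · obtain ⟨n, hn⟩ := hex u
      rw [hγ n u hn]
      exact (seq n).2.mem.1.1 u
    · obtain ⟨s, hs⟩ := exists_filt_subset hD N
      refine ((seq s).2.mem.1.2 N).subset ?_
      rintro u ⟨hu, huN⟩
      refine ⟨?_, huN⟩
      rwa [hγ s u fun h => huN (hs u (filt_antitone (by omega) h)).1] at hu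
  refine ⟨γ, hγm, c, funext fun u => ?_⟩
  -- At the given monomial, the gauge transform and the pullback for the limit agree with those of a
  -- late enough stage, where the error vanishes.
  obtain ⟨n, hn⟩ := hex u
  have hn3 : u ∉ filt hD.mem (n + 2 + 1) := fun h => hn (filt_antitone (by omega) h)
  have h1 := suppIn_gauge_sub (𝔤 := 𝔤) (seq n).2.mem.2 hγ0 hβ.1.2 (h := hD.mem) (s := n + 2)
    (fun v hv => sub_eq_zero.2 (hγ n v hv)) u hn3
  have h2 := suppIn_pull_sub (h := hD.mem) (c := (seq n).1.2) (c' := c) hα.1.2 (s := n + 2)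
    (fun p v hv => by
      by_contra hnv
      rw [hce, coeff_sub, hz p n v hnv, sub_self] at hv
      exact hv rfl) u hn3
  have h3 : (∑ p, hatSMul (unitElt c p - unitElt (seq n).1.2 p) (firstOrder hD.mem α p)) u = 0 := by
    rw [Finset.sum_apply]
    refine Finset.sum_eq_zero fun p _ => ?_
    by_contra hne
    obtain ⟨v, hv, hv0⟩ := exists_of_hatSMul_firstOrder_ne_zero hD.mem hne
    rw [hce, coeff_sub, hz p n v (by rw [hv]; exact hn), sub_self] at hv0
    exact hv0 rfl
  have h4 := (seq n).2.supp u hn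
  rw [Pi.add_apply, hatD_apply, Pi.sub_apply, Pi.sub_apply, hγ n u hn, sub_self, map_zero,
    add_zero, sub_eq_zero] at h1
  rw [Pi.sub_apply, h3, sub_zero, Pi.sub_apply, sub_eq_zero] at h2
  rw [Pi.sub_apply, sub_eq_zero] at h4
  rw [h1, h2, h4]

include hR in
theorem isComplete (hρ : 𝔤.IsAction ρ) {α : D.Mon → L}
    (hα : α ∈ MC D 𝔤) (hαi : IsInvElt a (𝔤.toEqComplex ρ) α)
    (hαs : SpansInv hD.mem a (𝔤.toEqComplex ρ) ∅ α) :
    IsComplete (𝔤.MCprime ρ hD.mem a) (𝔤.PullbackEquiv α) := by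
  intro β hβ
  obtain ⟨γ, hγ, c, hc⟩ := exists_gauge_eq_pull hR hρ hα hαi hαs hβ
  exact ⟨rescale c, isAut_rescale c, γ, hγ, by
    rw [tensorMap_eq_pull (rescale_mono c), hc]⟩

end completeness

end DGLA

namespace CoeffDatum

/-! ### Uniqueness of the map on `𝔪/𝔪²` -/

section versality

variable {P : Type*} [Fintype P] [DecidableEq P] {G : Type*} [AddCommGroup G]
  {𝔾 : GradingDatum G} {D : CoeffDatum P 𝔾} {k : Type*} [Field k] {hD : D.IsNice k}
  {Γ : Type*} {V : Type*} [AddCommGroup V] [Module k V]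

/-- If two automorphisms work for the same `β`, the difference of the constant terms of their `p`-th
units times `α_{u_p}` is a coboundary. As the class is non-zero, the constant terms agree. Only the
first-order effect of the equivalence enters, so the argument serves both gauge equivalences and
`A∞` homomorphisms. -/
theorem IsComplete.isVersal {T : Set (D.Mon → V)} {α : D.Mon → V}
    {rel : (D.R k ≃ₐ[k] D.R k) → (D.Mon → V) → Prop} (h : IsComplete T rel)
    (C : EqComplex k Γ G V) (d : V →ₗ[k] V) (hd : ∀ v, C.d0 v = d v)
    (hα : ∀ p, ¬ ClassIsZero hD.mem C α p)
    (hrel : ∀ β ∈ T, ∀ ψ, rel ψ β → ∀ p, ∃ y ∈ C.gr (0 - D.deg (basis hD.mem p)),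
      tensorMap ψ id α (basis hD.mem p) = β (basis hD.mem p) - d y) :
    IsVersal T rel := by
  refine ⟨h, fun β hβ ψ ψ' hψ hψ' h1 h2 x hx => ?_⟩
  obtain ⟨c, hc⟩ := hψ.exists_units hD
  obtain ⟨c', hc'⟩ := hψ'.exists_units hD
  refine sub_mem_fil_two hψ.2 hψ'.2 hc hc' (fun p => ?_) hx
  obtain ⟨y, hy, hyd⟩ := hrel β hβ ψ h1 p
  obtain ⟨y', hy', hyd'⟩ := hrel β hβ ψ' h2 p
  rw [tensorMap_eq_pull hc, pull_basis hD] at hyd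
  rw [tensorMap_eq_pull hc', pull_basis hD] at hyd'
  by_contra hne
  refine hα p ⟨(coeff 0 (unitElt c p) - coeff 0 (unitElt c' p))⁻¹ • (y' - y),
    Submodule.smul_mem _ _ (Submodule.sub_mem _ hy' hy), ?_⟩
  have : d (y' - y) = (coeff 0 (unitElt c p) - coeff 0 (unitElt c' p)) • α (basis hD.mem p) := by
    rw [sub_smul, hyd, hyd', map_sub]
    abel
  rw [hd, map_smul, this, smul_smul, inv_mul_cancel₀ (sub_ne_zero.2 hne), one_smul]

end versality

end CoeffDatum

namespace DGLA

open CoeffDatum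

/-! ### Versality for differential graded Lie algebras -/

section versality

variable {P : Type*} [Fintype P] [DecidableEq P] {G : Type*} [AddCommGroup G] [DecidableEq G]
  {𝔾 : GradingDatum G} {D : CoeffDatum P 𝔾} {k : Type*} [Field k] [CharZero k] {hD : D.IsNice k}
  {L : Type*} [AddCommGroup L] [Module k L] {𝔤 : DGLA k 𝔾 L}

/-- The comparison of `γ` with the trivial gauge transformation at step one, read at a monomial
outside step two. -/
theorem gauge_basis (hD : D.IsNice k) {γ β : D.Mon → L} (hγ : γ ∈ D.HatM 𝔤.gr 0)
    (hβ : β ∈ MC D 𝔤) (p : P) :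
    gauge D 𝔤 γ β (basis hD.mem p) = β (basis hD.mem p) - 𝔤.d (γ (basis hD.mem p)) := by
  have h1 := suppIn_gauge_sub (𝔤 := 𝔤) (h := hD.mem) (γ := 0) (γ' := γ) rfl hγ.2 hβ.1.2 (s := 1)
    (fun v hv => by
      rw [mem_filt_one, not_not] at hv
      rw [sub_zero, hv, hγ.2]) (basis hD.mem p) fun h => ((mem_filt_two hD).1 h).2 p rfl
  rw [gauge_zero, sub_zero, Pi.add_apply, Pi.sub_apply, hatD_apply] at h1
  rw [eq_sub_iff_add_eq, ← sub_eq_zero, ← h1]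
  abel

theorem isVersal {Γ : Type*} [Group Γ] {a : Γ →* (D.R k ≃ₐ[k] D.R k)}
    {ρ : Representation k Γ L} {α : D.Mon → L}
    (h : IsComplete (𝔤.MCprime ρ hD.mem a) (𝔤.PullbackEquiv α))
    (hα : ∀ p, ¬ ClassIsZero hD.mem (𝔤.toEqComplex ρ) α p) :
    IsVersal (𝔤.MCprime ρ hD.mem a) (𝔤.PullbackEquiv α) := by
  refine h.isVersal (hD := hD) (𝔤.toEqComplex ρ) 𝔤.d (fun _ => rfl) hα ?_
  rintro β hβ ψ ⟨γ, hγ, hγe⟩ p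
  exact ⟨γ (basis hD.mem p), hγ.1.1 _, by rw [hγe, gauge_basis hD hγ hβ.1]⟩

end versality

end DGLA

/-! ### Sums over the ways of cutting a list -/

section splitSum

variable {A M N : Type*} [AddCommMonoid M] [AddCommMonoid N]

/-- The sum of `g x y` over all `x`, `y` with `x ++ y = l`. -/
def splitSum (g : List A → List A → M) : List A → M
  | [] => g [] []
  | a :: l => g [] (a :: l) + splitSum (fun x y => g (a :: x) y) l

theorem splitSum_nil (g : List A → List A → M) : splitSum g [] = g [] [] := rfl

theorem splitSum_cons (g : List A → List A → M) (a : A) (l : List A) :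
    splitSum g (a :: l) = g [] (a :: l) + splitSum (fun x y => g (a :: x) y) l := rfl

theorem splitSum_eq_sum (g : List A → List A → M) (l : List A) :
    splitSum g l = ∑ i ∈ Finset.range (l.length + 1), g (l.take i) (l.drop i) := by
  induction l generalizing g with
  | nil => simp [splitSum]
  | cons a l ih => rw [splitSum, ih, List.length_cons, Finset.sum_range_succ' _ (l.length + 1), add_comm]; simp

theorem splitSum_congr {g g' : List A → List A → M} {l : List A}
    (h : ∀ x y, x ++ y = l → g x y = g' x y) : splitSum g l = splitSum g' l := by
  rw [splitSum_eq_sum, splitSum_eq_sum]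
  exact Finset.sum_congr rfl fun i _ => h _ _ (List.take_append_drop i l)

theorem splitSum_add (g g' : List A → List A → M) (l : List A) :
    splitSum (fun x y => g x y + g' x y) l = splitSum g l + splitSum g' l := by
  simp only [splitSum_eq_sum, Finset.sum_add_distrib]

theorem map_splitSum {F : Type*} [FunLike F M N] [AddMonoidHomClass F M N] (f : F)
    (g : List A → List A → M) (l : List A) :
    f (splitSum g l) = splitSum (fun x y => f (g x y)) l := by
  simp only [splitSum_eq_sum, map_sum]

theorem splitSum_zero (l : List A) : splitSum (fun _ _ => (0 : M)) l = 0 := by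
  simp [splitSum_eq_sum]

theorem splitSum_comm (g : List A → List A → List A → List A → M) (l l' : List A) :
    splitSum (fun x y => splitSum (g x y) l') l =
      splitSum (fun z w => splitSum (fun x y => g x y z w) l) l' := by
  simp only [splitSum_eq_sum]
  exact Finset.sum_comm

/-- Coassociativity of cutting: both sides run over the ways to cut the list into three parts. -/
theorem splitSum_assoc (h : List A → List A → List A → M) (l : List A) :
    splitSum (fun r z => splitSum (fun x y => h x y z) r) l =
      splitSum (fun x r => splitSum (h x) r) l := by
  induction l generalizing h with
  | nil => rfl
  | cons a l ih => simp only [splitSum_cons, splitSum_nil, splitSum_add, ih, add_assoc]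

/-- The cut falls either before or after the marked entry. -/
theorem splitSum_append_cons (g : List A → List A → M) (p : List A) (c : A) (q : List A) :
    splitSum g (p ++ c :: q) =
      splitSum (fun x y => g x (y ++ c :: q)) p + splitSum (fun x y => g (p ++ c :: x) y) q := by
  induction p generalizing g with
  | nil => rfl
  | cons a p ih => simp only [List.cons_append, splitSum_cons, ih, add_assoc]

theorem splitSum_map {B : Type*} (f : B → A) (g : List A → List A → M) (l : List B) :
    splitSum g (l.map f) = splitSum (fun x y => g (x.map f) (y.map f)) l := by
  induction l generalizing g with
  | nil => rfl
  | cons a l ih => simp only [List.map_cons, splitSum_cons, ih, List.map_nil]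

theorem splitSum_append_singleton (g : List A → List A → M) (l : List A) (a : A) :
    splitSum g (l ++ [a]) = splitSum (fun x y => g x (y ++ [a])) l + g (l ++ [a]) [] := by
  rw [splitSum_append_cons, splitSum_nil]

theorem splitSum_reverse (g : List A → List A → M) (l : List A) :
    splitSum g l.reverse = splitSum (fun x y => g y.reverse x.reverse) l := by
  induction l generalizing g with
  | nil => rfl
  | cons a l ih =>
    rw [List.reverse_cons, splitSum_append_singleton, ih, splitSum_cons, add_comm]
    simp

theorem splitSum_mem {R : Type*} [Semiring R] [Module R M] (S : Submodule R M)
    {g : List A → List A → M} {l : List A} (h : ∀ x y, x ++ y = l → g x y ∈ S) :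
    splitSum g l ∈ S := by
  rw [splitSum_eq_sum]
  exact Submodule.sum_mem _ fun i _ => h _ _ (List.take_append_drop i l)

theorem splitSum_sum {ι : Type*} (s : Finset ι) (g : ι → List A → List A → M) (l : List A) :
    splitSum (fun x y => ∑ i ∈ s, g i x y) l = ∑ i ∈ s, splitSum (g i) l := by
  simp only [splitSum_eq_sum]
  exact Finset.sum_comm

theorem splitSum_smul {R : Type*} [Monoid R] [DistribMulAction R M] (c : R)
    (g : List A → List A → M) (l : List A) :
    splitSum (fun x y => c • g x y) l = c • splitSum g l := by
  simp only [splitSum_eq_sum, Finset.smul_sum]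

theorem isLinearMap_splitSum {k V W : Type*} [Semiring k] [AddCommMonoid V] [Module k V]
    [AddCommMonoid W] [Module k W]
    {g : V → List A → List A → W} (h : ∀ x y, IsLinearMap k fun a => g a x y) (l : List A) :
    IsLinearMap k fun a => splitSum (g a) l := by
  simp only [splitSum_eq_sum]
  exact ⟨fun a b => by simp only [(h _ _).map_add, Finset.sum_add_distrib],
    fun c a => by simp only [(h _ _).map_smul, Finset.smul_sum]⟩

end splitSum

theorem sgn_add (s t : ZMod 2) : sgn (s + t) = sgn s * sgn t := by
  revert s t; decide

theorem sgn_mul_self (s : ZMod 2) : sgn s * sgn s = 1 := by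
  revert s; decide

theorem sgn_eq_or (s : ZMod 2) : sgn s = 1 ∨ sgn s = -1 := by
  revert s; decide

theorem sgn_smul_sgn_smul {M : Type*} [AddCommGroup M] (s : ZMod 2) (x : M) :
    sgn s • sgn s • x = x := by
  rw [smul_smul, sgn_mul_self, one_smul]

theorem exists_of_forall₂_append {X Y : Type*} {R : X → Y → Prop} {l : List X} {l₁ l₂ : List Y}
    (h : List.Forall₂ R l (l₁ ++ l₂)) :
    ∃ m₁ m₂, List.Forall₂ R m₁ l₁ ∧ List.Forall₂ R m₂ l₂ ∧ l = m₁ ++ m₂ :=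
  ⟨_, _, List.forall₂_take_append l l₁ l₂ h, List.forall₂_drop_append l l₁ l₂ h,
    (List.take_append_drop _ _).symm⟩

namespace Ainf

open CoeffDatum

variable {G : Type*} [AddCommGroup G] [DecidableEq G]
  (𝔾 : GradingDatum G) {k : Type*} [Field k] {A : Type*} [AddCommGroup A] [Module k A]
  (gr : G → Submodule k A)

/-! ### Multilinear cochains -/

variable (k A) in
/-- The cochains which are multilinear on lists of each length. -/
def ML : Submodule k (Cochain A) where
  carrier := {η | ∀ l₁ l₂ : List A, IsLinearMap k fun a => η (l₁ ++ a :: l₂)}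
  zero_mem' := fun l₁ l₂ => ⟨by simp, by simp⟩
  add_mem' := by
    rintro η ξ h1 h3 l₁ l₂
    refine ⟨fun a b => ?_, fun c a => ?_⟩
    · simp only [Pi.add_apply, (h1 l₁ l₂).map_add, (h3 l₁ l₂).map_add]; abel
    · simp only [Pi.add_apply, (h1 l₁ l₂).map_smul, (h3 l₁ l₂).map_smul, smul_add]
  smul_mem' := by
    rintro t η h1 l₁ l₂
    refine ⟨fun a b => ?_, fun c a => ?_⟩
    · simp only [Pi.smul_apply, (h1 l₁ l₂).map_add, smul_add]
    · simp only [Pi.smul_apply, (h1 l₁ l₂).map_smul, smul_comm t c]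

/-- Inserting a multilinear cochain's entry, as a linear map. -/
def ML.slot {η : Cochain A} (h : η ∈ ML k A) (l₁ l₂ : List A) : A →ₗ[k] A :=
  (h l₁ l₂).mk' _

theorem ML.slot_apply {η : Cochain A} (h : η ∈ ML k A) (l₁ l₂ : List A) (a : A) :
    ML.slot h l₁ l₂ a = η (l₁ ++ a :: l₂) := rfl

theorem ML.map_splitSum {η : Cochain A} (h : η ∈ ML k A) (l₁ l₂ : List A)
    (g : List A → List A → A) (l : List A) :
    η (l₁ ++ splitSum g l :: l₂) = splitSum (fun x y => η (l₁ ++ g x y :: l₂)) l :=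
  EqVers.map_splitSum (ML.slot h l₁ l₂) g l

theorem ML.map_sgn {η : Cochain A} (h : η ∈ ML k A) (l₁ l₂ : List A) (s : ZMod 2) (a : A) :
    η (l₁ ++ (sgn s • a) :: l₂) = sgn s • η (l₁ ++ a :: l₂) :=
  map_zsmul (ML.slot h l₁ l₂) _ _

theorem ML.map_zero {η : Cochain A} (h : η ∈ ML k A) (l₁ l₂ : List A) :
    η (l₁ ++ 0 :: l₂) = 0 :=
  _root_.map_zero (ML.slot h l₁ l₂)

theorem isLinearMap_add {V W : Type*} [AddCommMonoid V] [Module k V] [AddCommMonoid W]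
    [Module k W] {f g : V → W} (hf : IsLinearMap k f) (hg : IsLinearMap k g) :
    IsLinearMap k fun a => f a + g a :=
  ((hf.mk' f) + (hg.mk' g)).isLinear

section signs

variable [DirectSum.Decomposition gr]

/-- The inputs are decomposed one at a time; the prefix `l₁` holds those already replaced by
homogeneous ones. -/
theorem ML.ext_homogeneous {η ξ : Cochain A} (hη : η ∈ ML k A) (hξ : ξ ∈ ML k A)
    (h : ∀ (xs : List G) (l : List A), List.Forall₂ (fun x a => a ∈ gr x) xs l → η l = ξ l) :
    η = ξ := by
  have key : ∀ (l₂ l₁ : List A) (xs : List G), List.Forall₂ (fun x a => a ∈ gr x) xs l₁ →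
      η (l₁ ++ l₂) = ξ (l₁ ++ l₂) := by
    intro l₂
    induction l₂ with
    | nil => intro l₁ xs hxs; rw [List.append_nil]; exact h xs l₁ hxs
    | cons a l₂ ih =>
      intro l₁ xs hxs
      rw [← ML.slot_apply hη, ← ML.slot_apply hξ]
      induction a using DirectSum.Decomposition.inductionOn gr with
      | zero => rw [_root_.map_zero, _root_.map_zero]
      | @homogeneous i a =>
        rw [ML.slot_apply, ML.slot_apply]
        have := ih (l₁ ++ [(a : A)]) (xs ++ [i])
          (List.rel_append hxs (List.Forall₂.cons a.2 List.Forall₂.nil))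
        simpa using this
      | add a b h1 h2 => rw [map_add, map_add, h1, h2]
  funext l
  exact key l [] [] List.Forall₂.nil

/-! ### Koszul signs -/

theorem parPart_of_mem {x : G} {a : A} (ha : a ∈ gr x) (s : ZMod 2) :
    parPart 𝔾 gr s a = if 𝔾.par x + 1 = s then a else 0 := by
  rw [parPart, LinearMap.comp_apply, LinearEquiv.coe_coe, DirectSum.decomposeLinearEquiv_apply,
    DirectSum.decompose_of_mem gr ha, ← DirectSum.lof_eq_of k, DirectSum.toModule_lof]
  split_ifs <;> rfl

theorem koszul_of_mem {x : G} {a : A} (ha : a ∈ gr x) (s : ZMod 2) :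
    koszul 𝔾 gr s a = sgn (s * (𝔾.par x + 1)) • a := by
  rw [koszul, LinearMap.add_apply, LinearMap.smul_apply, parPart_of_mem 𝔾 gr ha,
    parPart_of_mem 𝔾 gr ha]
  obtain h | h : 𝔾.par x + 1 = 0 ∨ 𝔾.par x + 1 = 1 := by
    generalize 𝔾.par x + 1 = t
    revert t; decide
  · simp [h, sgn_zero]
  · simp [h]

theorem koszul_mem {x : G} {a : A} (ha : a ∈ gr x) (s : ZMod 2) : koszul 𝔾 gr s a ∈ gr x := by
  rw [koszul_of_mem 𝔾 gr ha]
  exact zsmul_mem ha _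

variable {gr} in
theorem linearMap_ext_homogeneous {V : Type*} [AddCommGroup V] [Module k V] {f g : A →ₗ[k] V}
    (h : ∀ x, ∀ a ∈ gr x, f a = g a) : f = g := by
  ext a
  induction a using DirectSum.Decomposition.inductionOn gr with
  | zero => rw [map_zero, map_zero]
  | homogeneous a => exact h _ _ a.2
  | add a b h1 h2 => rw [map_add, map_add, h1, h2]

theorem koszul_zero : koszul 𝔾 gr 0 = LinearMap.id := by
  refine linearMap_ext_homogeneous (gr := gr) fun x a ha => ?_
  rw [koszul_of_mem 𝔾 gr ha, zero_mul, sgn_zero, one_smul, LinearMap.id_apply]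

theorem koszul_koszul (s t : ZMod 2) (a : A) :
    koszul 𝔾 gr s (koszul 𝔾 gr t a) = koszul 𝔾 gr (s + t) a := by
  have : koszul 𝔾 gr s ∘ₗ koszul 𝔾 gr t = koszul 𝔾 gr (s + t) := by
    refine linearMap_ext_homogeneous (gr := gr) fun x a ha => ?_
    rw [LinearMap.comp_apply, koszul_of_mem 𝔾 gr ha, map_zsmul, koszul_of_mem 𝔾 gr ha,
      koszul_of_mem 𝔾 gr ha, smul_smul, ← sgn_add]
    congr 2
    ring
  exact LinearMap.congr_fun this a

theorem map_koszul_map_koszul (s t : ZMod 2) (l : List A) :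
    (l.map (koszul 𝔾 gr t)).map (koszul 𝔾 gr s) = l.map (koszul 𝔾 gr (s + t)) := by
  rw [List.map_map]
  exact List.map_congr_left fun a _ => koszul_koszul 𝔾 gr s t a

theorem map_koszul_zero (l : List A) : l.map (koszul 𝔾 gr 0) = l := by
  rw [koszul_zero]
  exact List.map_id l

theorem forall₂_map_koszul {xs : List G} {l : List A}
    (h : List.Forall₂ (fun x a => a ∈ gr x) xs l) (s : ZMod 2) :
    List.Forall₂ (fun x a => a ∈ gr x) xs (l.map (koszul 𝔾 gr s)) := by
  induction h with
  | nil => exact List.Forall₂.nil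
  | cons h1 _ ih => exact List.Forall₂.cons (koszul_mem 𝔾 gr h1 s) ih

/-- The sum of the shifted parities of a list of degrees. -/
def parSum (xs : List G) : ZMod 2 := (xs.map fun x => 𝔾.par x + 1).sum

theorem par_sum_shift (xs : List G) : 𝔾.par ((xs.map fun x => x - 𝔾.ι 1).sum) = parSum 𝔾 xs := by
  induction xs with
  | nil => simp [parSum]
  | cons x xs ih =>
    rw [List.map_cons, List.sum_cons, map_add, ih, parSum, parSum, List.map_cons, List.sum_cons,
      map_sub, par_ι_one, CharTwo.sub_eq_add]

theorem ML.map_koszul {η : Cochain A} (h : η ∈ ML k A) {xs : List G} {l : List A}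
    (hl : List.Forall₂ (fun x a => a ∈ gr x) xs l) (s : ZMod 2) (l₁ l₂ : List A) :
    η (l₁ ++ l.map (koszul 𝔾 gr s) ++ l₂) = sgn (s * parSum 𝔾 xs) • η (l₁ ++ l ++ l₂) := by
  induction hl generalizing l₁ with
  | nil => simp [parSum, sgn_zero]
  | @cons x a xs l hx hl ih =>
    have h1 := ih (l₁ ++ [koszul 𝔾 gr s a])
    simp only [List.append_assoc, List.cons_append, List.nil_append, List.map_cons] at h1 ⊢
    rw [h1, koszul_of_mem 𝔾 gr hx, ML.map_sgn h, smul_smul, ← sgn_add]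
    congr 2
    simp only [parSum, List.map_cons, List.sum_cons]
    ring

theorem ML_map_koszul_mem {η : Cochain A} (h : η ∈ ML k A) (f : A →ₗ[k] A) :
    (fun l : List A => η (l.map f)) ∈ ML k A := by
  intro l₁ l₂
  simp only [List.map_append, List.map_cons]
  exact ((ML.slot h _ _).comp f).isLinear

theorem ML_comp_mem {η : Cochain A} (h : η ∈ ML k A) (f : A →ₗ[k] A) :
    (fun l : List A => f (η l)) ∈ ML k A := fun l₁ l₂ =>
  (f.comp (ML.slot h l₁ l₂)).isLinear

/-- The shifted parity of an output is the parity of `η` plus the shifted parities of the inputs: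
the unit added by the degree convention cancels that of the shift. Hence passing the sign operator
through `η` costs only the parity of `η`. -/
theorem koszul_apply_cochain {y : G} {η : Cochain A} (hη : η ∈ CC 𝔾 gr y) (s : ZMod 2)
    (l : List A) :
    koszul 𝔾 gr s (η l) = sgn (s * 𝔾.par y) • η (l.map (koszul 𝔾 gr s)) := by
  have h2 : (fun l => koszul 𝔾 gr s (η l)) =
      sgn (s * 𝔾.par y) • fun l => η (l.map (koszul 𝔾 gr s)) := by
    refine ML.ext_homogeneous gr (ML_comp_mem hη.1 _)
      (zsmul_mem (ML_map_koszul_mem hη.1 _) _) fun xs l hl => ?_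
    have h3 := ML.map_koszul 𝔾 gr hη.1 hl s [] []
    simp only [List.nil_append, List.append_nil] at h3
    rw [Pi.smul_apply, h3, koszul_of_mem 𝔾 gr (hη.2 xs l hl), smul_smul, ← sgn_add]
    congr 2
    rw [map_add, map_add, par_sum_shift, par_ι_one]
    have : (1 : ZMod 2) + 1 = 0 := by decide
    rw [add_assoc, this, add_zero]
    ring
  exact congrFun h2 l

/-! ### The Gerstenhaber product -/

theorem circ_eq_splitSum (s : ZMod 2) (φ ψ : Cochain A) (l : List A) :
    circ 𝔾 gr s φ ψ l = splitSum (fun x r => splitSum (fun y z =>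
      φ (x.map (koszul 𝔾 gr s) ++ ψ y :: z)) r) l := by
  rw [circ, splitSum_eq_sum]
  refine Finset.sum_congr rfl fun i _ => ?_
  rw [splitSum_eq_sum, List.length_drop]
  refine Finset.sum_congr rfl fun j _ => ?_
  rw [List.drop_drop]

/-- The three terms correspond to the marked input lying after, inside or before the inserted block.
-/
theorem circ_append_cons (s : ZMod 2) (φ ψ : Cochain A) (p : List A) (c : A) (q : List A) :
    circ 𝔾 gr s φ ψ (p ++ c :: q) =
      splitSum (fun x r => splitSum (fun y z =>
        φ (x.map (koszul 𝔾 gr s) ++ ψ y :: (z ++ c :: q))) r) p +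
      splitSum (fun x r => splitSum (fun y z =>
        φ (x.map (koszul 𝔾 gr s) ++ ψ (r ++ c :: y) :: z)) q) p +
      splitSum (fun x r => splitSum (fun y z =>
        φ (p.map (koszul 𝔾 gr s) ++ koszul 𝔾 gr s c :: (x.map (koszul 𝔾 gr s) ++ ψ y :: z))) r)
        q := by
  rw [circ_eq_splitSum, splitSum_append_cons]
  simp only [splitSum_append_cons, splitSum_add, List.map_append, List.map_cons, List.append_assoc,
    List.cons_append]

theorem circ_mem_ML (s : ZMod 2) {φ ψ : Cochain A} (hφ : φ ∈ ML k A) (hψ : ψ ∈ ML k A) :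
    circ 𝔾 gr s φ ψ ∈ ML k A := by
  intro p q
  simp only [circ_append_cons]
  refine isLinearMap_add (isLinearMap_add ?_ ?_) ?_
  · refine isLinearMap_splitSum (fun x r => isLinearMap_splitSum (fun y z => ?_) _) _
    have := hφ (x.map (koszul 𝔾 gr s) ++ ψ y :: z) q
    simpa using this
  · refine isLinearMap_splitSum (fun x r => isLinearMap_splitSum (fun y z => ?_) _) _
    exact ((ML.slot hφ _ z).comp (ML.slot hψ r y)).isLinear
  · refine isLinearMap_splitSum (fun x r => isLinearMap_splitSum (fun y z => ?_) _) _
    exact ((ML.slot hφ _ _).comp (koszul 𝔾 gr s)).isLinear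

theorem circ_mem (s : ZMod 2) {y z : G} {φ ψ : Cochain A} (hφ : φ ∈ CC 𝔾 gr y)
    (hψ : ψ ∈ CC 𝔾 gr z) : circ 𝔾 gr s φ ψ ∈ CC 𝔾 gr (y + z) := by
  refine ⟨circ_mem_ML 𝔾 gr s hφ.1 hψ.1, fun xs l hl => ?_⟩
  rw [circ_eq_splitSum]
  refine splitSum_mem _ fun l1 r hr => splitSum_mem _ fun l2 l3 hr' => ?_
  subst hr' hr
  obtain ⟨xs1, xr, h1, h2, rfl⟩ := exists_of_forall₂_append hl
  obtain ⟨xs2, xs3, h3, h4, rfl⟩ := exists_of_forall₂_append h2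
  have := hφ.2 (xs1 ++ (z + (xs2.map fun x => x - 𝔾.ι 1).sum + 𝔾.ι 1) :: xs3) _
    (List.rel_append (forall₂_map_koszul 𝔾 gr h1 s) (List.Forall₂.cons (hψ.2 xs2 l2 h3) h4))
  convert this using 2
  simp only [List.map_append, List.map_cons, List.sum_append, List.sum_cons]
  abel

theorem circ_add_left (s : ZMod 2) (φ φ' ψ : Cochain A) :
    circ 𝔾 gr s (φ + φ') ψ = circ 𝔾 gr s φ ψ + circ 𝔾 gr s φ' ψ := by
  funext l
  simp only [circ_eq_splitSum, Pi.add_apply, splitSum_add]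

theorem circ_smul_left (s : ZMod 2) (c : k) (φ ψ : Cochain A) :
    circ 𝔾 gr s (c • φ) ψ = c • circ 𝔾 gr s φ ψ := by
  funext l
  simp only [circ_eq_splitSum, Pi.smul_apply, splitSum_smul]

theorem circ_add_right (s : ZMod 2) {φ : Cochain A} (hφ : φ ∈ ML k A) (ψ ψ' : Cochain A) :
    circ 𝔾 gr s φ (ψ + ψ') = circ 𝔾 gr s φ ψ + circ 𝔾 gr s φ ψ' := by
  funext l
  simp only [circ_eq_splitSum, Pi.add_apply, (hφ _ _).map_add, splitSum_add]

theorem circ_smul_right (s : ZMod 2) {φ : Cochain A} (hφ : φ ∈ ML k A) (c : k) (ψ : Cochain A) :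
    circ 𝔾 gr s φ (c • ψ) = c • circ 𝔾 gr s φ ψ := by
  funext l
  simp only [circ_eq_splitSum, Pi.smul_apply, (hφ _ _).map_smul, splitSum_smul]

/-- The double insertion `∑ ± φ(…, χ(…), …, ψ(…), …)`. -/
noncomputable def circ₂ (s t : ZMod 2) (φ ψ χ : Cochain A) : Cochain A := fun l =>
  splitSum (fun x r => splitSum (fun y r => splitSum (fun z r => splitSum (fun w v =>
    φ (x.map (koszul 𝔾 gr (s + t)) ++ koszul 𝔾 gr s (χ y) ::
      (z.map (koszul 𝔾 gr s) ++ ψ w :: v))) r) r) r) l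

/-- In the iterated product, `χ` is inserted inside `ψ`, which gives the nested product, or beside
it. When `ψ` precedes `χ`, moving `χ` past `ψ` produces the extra sign. -/
theorem circ_circ_left (t : ZMod 2) {y : G} {φ ψ χ : Cochain A} (hφ : φ ∈ ML k A) (hψ : ψ ∈ CC 𝔾 gr y) :
    circ 𝔾 gr t (circ 𝔾 gr (𝔾.par y) φ ψ) χ =
      circ 𝔾 gr (𝔾.par y + t) φ (circ 𝔾 gr t ψ χ) +
      (circ₂ 𝔾 gr (𝔾.par y) (t) φ ψ χ +
        sgn (𝔾.par y * t) • circ₂ 𝔾 gr t (𝔾.par y) φ χ ψ) := by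
  funext l
  set s := 𝔾.par y
  have hψt : ∀ l, ψ (l.map (koszul 𝔾 gr t)) = sgn (s * t) • koszul 𝔾 gr t (ψ l) := by
    intro l
    rw [koszul_apply_cochain 𝔾 gr hψ, mul_comm, sgn_smul_sgn_smul]
  rw [circ_eq_splitSum]
  simp only [circ_append_cons, splitSum_add, splitSum_map, map_koszul_map_koszul, Pi.add_apply]
  have hB : splitSum (fun x r => splitSum (fun y z => splitSum (fun x' p' => splitSum (fun q' z' =>
      φ (x'.map (koszul 𝔾 gr (s + t)) ++ ψ (p'.map (koszul 𝔾 gr t) ++ χ y :: q') :: z')) z) x) r) l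
      = circ 𝔾 gr (s + t) φ (circ 𝔾 gr t ψ χ) l := by
    rw [circ_eq_splitSum]
    simp only [circ_eq_splitSum, ML.map_splitSum hφ, splitSum_assoc]
    rw [← splitSum_assoc (fun x' p' r => splitSum (fun y z => splitSum (fun q' z' =>
      φ (x'.map (koszul 𝔾 gr (s + t)) ++ ψ (p'.map (koszul 𝔾 gr t) ++ χ y :: q') :: z')) z) r)]
    refine splitSum_congr fun x r _ => ?_
    rw [splitSum_comm (fun x' p' y z => splitSum (fun q' z' =>
      φ (x'.map (koszul 𝔾 gr (s + t)) ++ ψ (p'.map (koszul 𝔾 gr t) ++ χ y :: q') :: z')) z)]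
  have hA : splitSum (fun x r => splitSum (fun y z => splitSum (fun x' u => splitSum (fun y' p' =>
      φ (x'.map (koszul 𝔾 gr (s + t)) ++ ψ (y'.map (koszul 𝔾 gr t)) ::
        (p'.map (koszul 𝔾 gr t) ++ χ y :: z))) u) x) r) l =
      (sgn (s * t) • circ₂ 𝔾 gr t s φ χ ψ) l := by
    rw [Pi.smul_apply, circ₂]
    simp only [hψt, ML.map_sgn hφ, splitSum_smul, ← splitSum_assoc, add_comm t s]
  rw [hB, hA, circ₂]
  abel

/-- The graded pre-Lie identity. -/
theorem circ_preLie {y z : G} {φ ψ χ : Cochain A} (hφ : φ ∈ ML k A) (hψ : ψ ∈ CC 𝔾 gr y)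
    (hχ : χ ∈ CC 𝔾 gr z) :
    circ 𝔾 gr (𝔾.par z) (circ 𝔾 gr (𝔾.par y) φ ψ) χ -
        circ 𝔾 gr (𝔾.par y + 𝔾.par z) φ (circ 𝔾 gr (𝔾.par z) ψ χ) =
      sgn (𝔾.par y * 𝔾.par z) • (circ 𝔾 gr (𝔾.par y) (circ 𝔾 gr (𝔾.par z) φ χ) ψ -
        circ 𝔾 gr (𝔾.par y + 𝔾.par z) φ (circ 𝔾 gr (𝔾.par y) χ ψ)) := by
  -- The two associators consist of the same two double insertions, and agree up to the sign of
  -- exchanging `ψ` and `χ`.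
  rw [circ_circ_left 𝔾 gr _ hφ hψ, circ_circ_left 𝔾 gr _ hφ hχ, add_sub_cancel_left,
    add_comm (𝔾.par z), add_sub_cancel_left, smul_add, mul_comm (𝔾.par z), sgn_smul_sgn_smul,
    add_comm]

/-! ### The Gerstenhaber bracket -/

/-- The Gerstenhaber bracket of cochains of parity `s` and `t`. -/
noncomputable def gbr (s t : ZMod 2) (φ ψ : Cochain A) : Cochain A :=
  circ 𝔾 gr t φ ψ - sgn (s * t) • circ 𝔾 gr s ψ φ

theorem gbr_mem {y z : G} {φ ψ : Cochain A} (hφ : φ ∈ CC 𝔾 gr y) (hψ : ψ ∈ CC 𝔾 gr z)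
    (s t : ZMod 2) : gbr 𝔾 gr s t φ ψ ∈ CC 𝔾 gr (y + z) :=
  sub_mem (circ_mem 𝔾 gr t hφ hψ) (zsmul_mem (by rw [add_comm]; exact circ_mem 𝔾 gr s hψ hφ) _)

theorem gbr_symm (s t : ZMod 2) (φ ψ : Cochain A) :
    gbr 𝔾 gr s t φ ψ = -(sgn (s * t) • gbr 𝔾 gr t s ψ φ) := by
  rw [gbr, gbr, smul_sub, mul_comm t s, sgn_smul_sgn_smul, neg_sub]

theorem circ_sub_left (s : ZMod 2) (φ φ' ψ : Cochain A) :
    circ 𝔾 gr s (φ - φ') ψ = circ 𝔾 gr s φ ψ - circ 𝔾 gr s φ' ψ := by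
  rw [eq_sub_iff_add_eq, ← circ_add_left, sub_add_cancel]

theorem circ_sub_right (s : ZMod 2) {φ : Cochain A} (hφ : φ ∈ ML k A) (ψ ψ' : Cochain A) :
    circ 𝔾 gr s φ (ψ - ψ') = circ 𝔾 gr s φ ψ - circ 𝔾 gr s φ ψ' := by
  rw [eq_sub_iff_add_eq, ← circ_add_right 𝔾 gr s hφ, sub_add_cancel]

theorem circ_sgn_left (s t : ZMod 2) (φ ψ : Cochain A) :
    circ 𝔾 gr s (sgn t • φ) ψ = sgn t • circ 𝔾 gr s φ ψ := by
  rw [← Int.cast_smul_eq_zsmul k, circ_smul_left, Int.cast_smul_eq_zsmul]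

theorem circ_sgn_right (s t : ZMod 2) {φ : Cochain A} (hφ : φ ∈ ML k A) (ψ : Cochain A) :
    circ 𝔾 gr s φ (sgn t • ψ) = sgn t • circ 𝔾 gr s φ ψ := by
  rw [← Int.cast_smul_eq_zsmul k, circ_smul_right 𝔾 gr s hφ, Int.cast_smul_eq_zsmul]

/-- A formal consequence of the pre-Lie identity with each of the three cochains in the outer
position. Only three signs occur, and their eight combinations are checked. -/
theorem gbr_jacobi {x y z : G} {φ ψ χ : Cochain A} (hφ : φ ∈ CC 𝔾 gr x) (hψ : ψ ∈ CC 𝔾 gr y)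
    (hχ : χ ∈ CC 𝔾 gr z) :
    gbr 𝔾 gr (𝔾.par x) (𝔾.par (y + z)) φ (gbr 𝔾 gr (𝔾.par y) (𝔾.par z) ψ χ) =
      gbr 𝔾 gr (𝔾.par (x + y)) (𝔾.par z) (gbr 𝔾 gr (𝔾.par x) (𝔾.par y) φ ψ) χ +
      sgn (𝔾.par x * 𝔾.par y) •
        gbr 𝔾 gr (𝔾.par y) (𝔾.par (x + z)) ψ (gbr 𝔾 gr (𝔾.par x) (𝔾.par z) φ χ) := by
  have h1 := circ_preLie 𝔾 gr hφ.1 hψ hχ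
  have h2 := circ_preLie 𝔾 gr hψ.1 hφ hχ
  have h3 := circ_preLie 𝔾 gr hχ.1 hφ hψ
  simp only [gbr, map_add]
  generalize 𝔾.par x = r at *
  generalize 𝔾.par y = s at *
  generalize 𝔾.par z = t at *
  simp only [circ_sub_left, circ_sub_right 𝔾 gr _ hφ.1, circ_sub_right 𝔾 gr _ hψ.1,
    circ_sub_right 𝔾 gr _ hχ.1, circ_sgn_left, circ_sgn_right 𝔾 gr _ _ hφ.1,
    circ_sgn_right 𝔾 gr _ _ hψ.1, circ_sgn_right 𝔾 gr _ _ hχ.1] at *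
  rw [sub_eq_iff_eq_add] at h1 h2 h3
  rw [h1, h2, h3]
  simp only [smul_sub, smul_add, smul_smul, mul_add, add_mul, sgn_add, mul_comm s r,
    add_comm]
  rcases sgn_eq_or (r * s) with e1 | e1 <;> rcases sgn_eq_or (r * t) with e2 | e2 <;>
    rcases sgn_eq_or (s * t) with e3 | e3 <;>
    simp only [e1, e2, e3, one_smul, neg_smul, mul_one, mul_neg, neg_neg] <;> abel

end signs

end Ainf

namespace Ainf

open CoeffDatum

variable {G : Type*} [AddCommGroup G] [DecidableEq G]
  (𝔾 : GradingDatum G) {k : Type*} [Field k] {A : Type*} [AddCommGroup A] [Module k A]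
  (gr : G → Submodule k A) [DirectSum.Decomposition gr]

/-! ### Opposite cochains -/

/-- The sum of the products of the shifted parities over all pairs in a list of degrees. -/
def pairSum : List G → ZMod 2
  | [] => 0
  | x :: xs => (𝔾.par x + 1) * parSum 𝔾 xs + pairSum xs

theorem parSum_cons (x : G) (xs : List G) :
    parSum 𝔾 (x :: xs) = 𝔾.par x + 1 + parSum 𝔾 xs := by
  rw [parSum, parSum, List.map_cons, List.sum_cons]

theorem parSum_append (xs ys : List G) : parSum 𝔾 (xs ++ ys) = parSum 𝔾 xs + parSum 𝔾 ys := by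
  rw [parSum, parSum, parSum, List.map_append, List.sum_append]

theorem parSum_reverse (xs : List G) : parSum 𝔾 xs.reverse = parSum 𝔾 xs := by
  rw [parSum, parSum, List.map_reverse, List.sum_reverse]

theorem pairSum_append (xs ys : List G) :
    pairSum 𝔾 (xs ++ ys) = pairSum 𝔾 xs + pairSum 𝔾 ys + parSum 𝔾 xs * parSum 𝔾 ys := by
  induction xs with
  | nil => simp [pairSum, parSum]
  | cons x xs ih =>
    rw [List.cons_append, pairSum, pairSum, ih, parSum_append, parSum_cons]
    ring

theorem pairSum_reverse (xs : List G) : pairSum 𝔾 xs.reverse = pairSum 𝔾 xs := by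
  induction xs with
  | nil => rfl
  | cons x xs ih =>
    rw [List.reverse_cons, pairSum_append, ih, pairSum, parSum_reverse, pairSum, pairSum,
      parSum_cons]
    simp only [parSum, List.map_nil, List.sum_nil]
    ring

theorem opAux_isLinearMap_acc {η : Cochain A} (h : η ∈ ML k A) (l : List A) (s : ZMod 2)
    (p q : List A) : IsLinearMap k fun a => opAux 𝔾 gr η (p ++ a :: q) s l := by
  induction l generalizing s p with
  | nil => exact h p q
  | cons b l ih =>
    simp only [opAux]
    have h1 := ih s (parPart 𝔾 gr 0 b :: p)
    have h2 := ih (s + 1) (parPart 𝔾 gr 1 b :: p)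
    exact isLinearMap_add h1 ((sgn s • h2.mk' _).isLinear)

theorem opAux_isLinearMap {η : Cochain A} (h : η ∈ ML k A) (l₁ l₂ : List A) (s : ZMod 2)
    (acc : List A) : IsLinearMap k fun a => opAux 𝔾 gr η acc s (l₁ ++ a :: l₂) := by
  induction l₁ generalizing s acc with
  | nil =>
    simp only [List.nil_append, opAux]
    have h1 := opAux_isLinearMap_acc 𝔾 gr h l₂ s [] acc
    have h2 := opAux_isLinearMap_acc 𝔾 gr h l₂ (s + 1) [] acc
    exact isLinearMap_add ((h1.mk' _).comp (parPart 𝔾 gr 0)).isLinear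
      (sgn s • (h2.mk' _).comp (parPart 𝔾 gr 1)).isLinear
  | cons b l₁ ih =>
    simp only [List.cons_append, opAux]
    exact isLinearMap_add (ih _ _) ((sgn s • (ih (s + 1) _).mk' _).isLinear)

theorem op_mem_ML {η : Cochain A} (h : η ∈ ML k A) : op 𝔾 gr η ∈ ML k A := fun l₁ l₂ =>
  opAux_isLinearMap 𝔾 gr h l₁ l₂ 0 []

/-- For a homogeneous input one of the two branches of the recursion vanishes, so a single signed
term survives. The argument `s` records the parity of what has been read already. -/
theorem opAux_of_forall₂ {η : Cochain A} (h : η ∈ ML k A) {xs : List G} {l : List A}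
    (hl : List.Forall₂ (fun x a => a ∈ gr x) xs l) (s : ZMod 2) (acc : List A) :
    opAux 𝔾 gr η acc s l = sgn (pairSum 𝔾 xs + s * parSum 𝔾 xs) • η (l.reverse ++ acc) := by
  induction hl generalizing s acc with
  | nil => simp [opAux, pairSum, parSum, sgn_zero]
  | @cons x a xs l hx hl ih =>
    rw [opAux, ih, ih, parPart_of_mem 𝔾 gr hx, parPart_of_mem 𝔾 gr hx, pairSum, parSum_cons,
      List.reverse_cons, List.append_assoc, List.singleton_append]
    obtain e | e : 𝔾.par x + 1 = 0 ∨ 𝔾.par x + 1 = 1 := by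
      generalize 𝔾.par x + 1 = t
      revert t; decide
    · simp [e, ML.map_zero h]
    · rw [e, if_neg (by decide), if_pos rfl, ML.map_zero h, smul_zero, zero_add, smul_smul,
        ← sgn_add]
      congr 2
      ring

theorem op_of_forall₂ {η : Cochain A} (h : η ∈ ML k A) {xs : List G} {l : List A}
    (hl : List.Forall₂ (fun x a => a ∈ gr x) xs l) :
    op 𝔾 gr η l = sgn (pairSum 𝔾 xs) • η l.reverse := by
  rw [op, opAux_of_forall₂ 𝔾 gr h hl, zero_mul, add_zero, List.append_nil]

theorem op_mem {y : G} {η : Cochain A} (h : η ∈ CC 𝔾 gr y) : op 𝔾 gr η ∈ CC 𝔾 gr y := by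
  refine ⟨op_mem_ML 𝔾 gr h.1, fun xs l hl => ?_⟩
  rw [op_of_forall₂ 𝔾 gr h.1 hl]
  refine zsmul_mem ?_ _
  have := h.2 xs.reverse l.reverse (List.rel_reverse hl)
  rwa [List.map_reverse, List.sum_reverse] at this

theorem op_op {η : Cochain A} (h : η ∈ ML k A) : op 𝔾 gr (op 𝔾 gr η) = η := by
  refine ML.ext_homogeneous gr (op_mem_ML 𝔾 gr (op_mem_ML 𝔾 gr h)) h fun xs l hl => ?_
  rw [op_of_forall₂ 𝔾 gr (op_mem_ML 𝔾 gr h) hl, op_of_forall₂ 𝔾 gr h (List.rel_reverse hl),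
    pairSum_reverse, sgn_smul_sgn_smul, List.reverse_reverse]

/-- Reversal exchanges the inputs before and after the insertion. In the shifted grading the change
of the Koszul sign is exactly compensated by the signs of reversal, so `op` respects the
Gerstenhaber product. -/
theorem op_circ {z : G} {φ ψ : Cochain A} (hφ : φ ∈ ML k A) (hψ : ψ ∈ CC 𝔾 gr z) :
    op 𝔾 gr (circ 𝔾 gr (𝔾.par z) φ ψ) =
      circ 𝔾 gr (𝔾.par z) (op 𝔾 gr φ) (op 𝔾 gr ψ) := by
  have hc := circ_mem_ML 𝔾 gr (𝔾.par z) hφ hψ.1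
  refine ML.ext_homogeneous gr (op_mem_ML 𝔾 gr hc)
    (circ_mem_ML 𝔾 gr _ (op_mem_ML 𝔾 gr hφ) (op_mem 𝔾 gr hψ).1) fun xs l hl => ?_
  rw [op_of_forall₂ 𝔾 gr hc hl, circ_eq_splitSum, circ_eq_splitSum, splitSum_reverse]
  simp only [splitSum_reverse]
  rw [splitSum_assoc (fun x y r => φ (r.reverse.map (koszul 𝔾 gr (𝔾.par z)) ++
    ψ y.reverse :: x.reverse)), ← splitSum_smul]
  refine splitSum_congr fun l1 r hr => ?_
  rw [← splitSum_smul]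
  refine splitSum_congr fun l2 l3 hr' => ?_
  subst hr' hr
  obtain ⟨xs1, xr, h1, h2, rfl⟩ := exists_of_forall₂_append hl
  obtain ⟨xs2, xs3, h3, h4, rfl⟩ := exists_of_forall₂_append h2
  have hw := (op_mem 𝔾 gr hψ).2 xs2 l2 h3
  rw [op_of_forall₂ 𝔾 gr hφ (List.rel_append (forall₂_map_koszul 𝔾 gr h1 _)
    (List.Forall₂.cons hw h4)), op_of_forall₂ 𝔾 gr hψ.1 h3, List.reverse_append,
    List.reverse_cons, List.append_assoc, List.singleton_append, ML.map_sgn hφ, ← List.map_reverse]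
  have e1 := ML.map_koszul 𝔾 gr hφ (List.rel_reverse h4) (𝔾.par z) [] (ψ l2.reverse :: l1.reverse)
  have e2 := ML.map_koszul 𝔾 gr hφ (List.rel_reverse h1) (𝔾.par z)
    (l3.reverse ++ [ψ l2.reverse]) []
  simp only [List.append_nil, List.nil_append, List.append_assoc, List.singleton_append] at e1 e2
  rw [e1, e2, smul_smul, smul_smul, smul_smul, ← sgn_add, ← sgn_add, ← sgn_add]
  congr 2
  simp only [pairSum_append, pairSum, parSum_append, parSum_cons, parSum_reverse, map_add,
    par_sum_shift, par_ι_one]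
  -- The two sign exponents differ only by terms that occur twice.
  have h2 : (2 : ZMod 2) = 0 := by decide
  linear_combination (-(parSum 𝔾 xs1 * 𝔾.par z) - parSum 𝔾 xs1 - parSum 𝔾 xs3) * h2

variable {𝔾 gr} in
theorem op_add (η ξ : Cochain A) : op 𝔾 gr (η + ξ) = op 𝔾 gr η + op 𝔾 gr ξ := by
  have key : ∀ (l acc : List A) (s : ZMod 2), opAux 𝔾 gr (η + ξ) acc s l =
      opAux 𝔾 gr η acc s l + opAux 𝔾 gr ξ acc s l := by
    intro l
    induction l with
    | nil => intro acc s; rfl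
    | cons a l ih => intro acc s; simp only [opAux, ih, smul_add]; abel
  exact funext fun l => key l [] 0

variable {𝔾 gr} in
theorem op_smul (c : k) (η : Cochain A) : op 𝔾 gr (c • η) = c • op 𝔾 gr η := by
  have key : ∀ (l acc : List A) (s : ZMod 2), opAux 𝔾 gr (c • η) acc s l =
      c • opAux 𝔾 gr η acc s l := by
    intro l
    induction l with
    | nil => intro acc s; rfl
    | cons a l ih => intro acc s; simp only [opAux, ih, smul_add, smul_comm c (sgn s)]
  exact funext fun l => key l [] 0

/-! ### Signed group actions -/

section action

variable {Γ : Type*} [Group Γ] [DistribMulAction Γ G] (σ : Γ →* Multiplicative (ZMod 2))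
  (ρ : Representation k Γ A)

/-- The action of a group element on cochains by conjugation. -/
def conj (g : Γ) (η : Cochain A) : Cochain A := fun l => ρ g (η (l.map (ρ g⁻¹)))

theorem signedAct_eq (g : Γ) (η : Cochain A) :
    signedAct 𝔾 gr σ ρ g η = conj ρ g (if σ g = 1 then η else op 𝔾 gr η) := rfl

/-- `signedAct` as a linear map. -/
noncomputable def signedActₗ (g : Γ) : Cochain A →ₗ[k] Cochain A where
  toFun := signedAct 𝔾 gr σ ρ g
  map_add' η ξ := by
    funext l
    by_cases h : σ g = 1 <;> simp [signedAct, h, op_add]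
  map_smul' c η := by
    funext l
    by_cases h : σ g = 1 <;> simp [signedAct, h, op_smul]

theorem signedActₗ_apply (g : Γ) (η : Cochain A) :
    signedActₗ 𝔾 gr σ ρ g η = signedAct 𝔾 gr σ ρ g η := rfl

theorem conj_mem_ML {η : Cochain A} (h : η ∈ ML k A) (g : Γ) : conj ρ g η ∈ ML k A := by
  intro l₁ l₂
  simp only [conj, List.map_append, List.map_cons]
  exact ((ρ g).comp ((ML.slot h _ _).comp (ρ g⁻¹))).isLinear

theorem conj_one (η : Cochain A) : conj ρ 1 η = η := by
  funext l
  simp only [conj, inv_one, map_one, Module.End.one_apply]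
  congr 1
  exact List.map_id l

theorem conj_mul (g h : Γ) (η : Cochain A) : conj ρ (g * h) η = conj ρ g (conj ρ h η) := by
  funext l
  simp only [conj, mul_inv_rev, map_mul, Module.End.mul_apply, List.map_map]
  rfl

variable {𝔾 gr ρ}

theorem koszul_rho (h𝔾 : 𝔾.IsInvariant Γ) (hρ : ∀ g y, ∀ a ∈ gr y, ρ g a ∈ gr (g • y))
    (g : Γ) (s : ZMod 2) (a : A) : koszul 𝔾 gr s (ρ g a) = ρ g (koszul 𝔾 gr s a) := by
  have : koszul 𝔾 gr s ∘ₗ ρ g = ρ g ∘ₗ koszul 𝔾 gr s := by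
    refine linearMap_ext_homogeneous (gr := gr) fun x a ha => ?_
    rw [LinearMap.comp_apply, LinearMap.comp_apply, koszul_of_mem 𝔾 gr (hρ g x a ha),
      koszul_of_mem 𝔾 gr ha, h𝔾.2, map_zsmul]
  exact LinearMap.congr_fun this a

theorem parPart_rho (h𝔾 : 𝔾.IsInvariant Γ) (hρ : ∀ g y, ∀ a ∈ gr y, ρ g a ∈ gr (g • y))
    (g : Γ) (s : ZMod 2) (a : A) : parPart 𝔾 gr s (ρ g a) = ρ g (parPart 𝔾 gr s a) := by
  have : parPart 𝔾 gr s ∘ₗ ρ g = ρ g ∘ₗ parPart 𝔾 gr s := by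
    refine linearMap_ext_homogeneous (gr := gr) fun x a ha => ?_
    rw [LinearMap.comp_apply, LinearMap.comp_apply, parPart_of_mem 𝔾 gr (hρ g x a ha),
      parPart_of_mem 𝔾 gr ha, h𝔾.2]
    split_ifs
    · rfl
    · rw [map_zero]
  exact LinearMap.congr_fun this a

theorem op_conj (h𝔾 : 𝔾.IsInvariant Γ) (hρ : ∀ g y, ∀ a ∈ gr y, ρ g a ∈ gr (g • y))
    (g : Γ) (η : Cochain A) : op 𝔾 gr (conj ρ g η) = conj ρ g (op 𝔾 gr η) := by
  have key : ∀ (l acc : List A) (s : ZMod 2), opAux 𝔾 gr (conj ρ g η) acc s l =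
      ρ g (opAux 𝔾 gr η (acc.map (ρ g⁻¹)) s (l.map (ρ g⁻¹))) := by
    intro l
    induction l with
    | nil => intro acc s; rfl
    | cons a l ih =>
      intro acc s
      simp only [opAux, ih, List.map_cons, map_add, map_zsmul, parPart_rho h𝔾 hρ]
  exact funext fun l => key l [] 0

theorem conj_circ (h𝔾 : 𝔾.IsInvariant Γ) (hρ : ∀ g y, ∀ a ∈ gr y, ρ g a ∈ gr (g • y))
    (g : Γ) (s : ZMod 2) (φ ψ : Cochain A) :
    conj ρ g (circ 𝔾 gr s φ ψ) = circ 𝔾 gr s (conj ρ g φ) (conj ρ g ψ) := by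
  funext l
  have h1 : ∀ a, ρ g⁻¹ (ρ g a) = a := fun a => by
    rw [← Module.End.mul_apply, ← map_mul, inv_mul_cancel, map_one, Module.End.one_apply]
  have h2 : ∀ x : List A, (x.map (koszul 𝔾 gr s)).map (ρ g⁻¹) =
      (x.map (ρ g⁻¹)).map (koszul 𝔾 gr s) := fun x => by
    rw [List.map_map, List.map_map]
    exact List.map_congr_left fun a _ => (koszul_rho h𝔾 hρ g⁻¹ s a).symm
  simp only [conj, circ_eq_splitSum, map_splitSum, splitSum_map, List.map_append, List.map_cons,
    h1, h2]

theorem forall₂_map_rho (hρ : ∀ g y, ∀ a ∈ gr y, ρ g a ∈ gr (g • y)) (g : Γ) {xs : List G}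
    {l : List A} (h : List.Forall₂ (fun x a => a ∈ gr x) xs l) :
    List.Forall₂ (fun x a => a ∈ gr x) (xs.map (g • ·)) (l.map (ρ g)) := by
  induction h with
  | nil => exact List.Forall₂.nil
  | cons h1 _ ih => exact List.Forall₂.cons (hρ g _ _ h1) ih

theorem conj_mem (h𝔾 : 𝔾.IsInvariant Γ) (hρ : ∀ g y, ∀ a ∈ gr y, ρ g a ∈ gr (g • y))
    {y : G} {η : Cochain A} (h : η ∈ CC 𝔾 gr y) (g : Γ) : conj ρ g η ∈ CC 𝔾 gr (g • y) := by
  refine ⟨conj_mem_ML ρ h.1 g, fun xs l hl => ?_⟩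
  have h1 := hρ g _ _ (h.2 _ _ (forall₂_map_rho hρ g⁻¹ hl))
  have h2 : g • ((xs.map (g⁻¹ • ·)).map fun x => x - 𝔾.ι 1).sum =
      (xs.map fun x => x - 𝔾.ι 1).sum := by
    rw [List.smul_sum, List.map_map, List.map_map]
    congr 1
    refine List.map_congr_left fun x _ => ?_
    simp only [Function.comp_apply, smul_sub, smul_inv_smul, h𝔾.1]
  rwa [smul_add, smul_add, h2, h𝔾.1] at h1

theorem signedAct_mem (h𝔾 : 𝔾.IsInvariant Γ) (hρ : ∀ g y, ∀ a ∈ gr y, ρ g a ∈ gr (g • y))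
    {y : G} {η : Cochain A} (h : η ∈ CC 𝔾 gr y) (g : Γ) :
    signedAct 𝔾 gr σ ρ g η ∈ CC 𝔾 gr (g • y) := by
  rw [signedAct_eq]
  split_ifs
  · exact conj_mem h𝔾 hρ h g
  · exact conj_mem h𝔾 hρ (op_mem 𝔾 gr h) g

theorem signedAct_one (η : Cochain A) : signedAct 𝔾 gr σ ρ 1 η = η := by
  rw [signedAct_eq, map_one, if_pos rfl, conj_one]

/-- Taking opposites commutes with conjugation and is an involution on multilinear cochains, so two
odd elements compose to an even one. -/
theorem signedAct_mul (h𝔾 : 𝔾.IsInvariant Γ) (hρ : ∀ g y, ∀ a ∈ gr y, ρ g a ∈ gr (g • y))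
    {η : Cochain A} (h : η ∈ ML k A) (g g' : Γ) :
    signedAct 𝔾 gr σ ρ (g * g') η = signedAct 𝔾 gr σ ρ g (signedAct 𝔾 gr σ ρ g' η) := by
  have key : ∀ a b : Multiplicative (ZMod 2), a ≠ 1 → b ≠ 1 → a * b = 1 := by decide
  simp only [signedAct_eq, conj_mul, map_mul]
  by_cases h1 : σ g = 1 <;> by_cases h2 : σ g' = 1
  · simp [h1, h2]
  · simp [h1, h2]
  · simp [h1, h2, op_conj h𝔾 hρ]
  · simp [h1, h2, key _ _ h1 h2, op_conj h𝔾 hρ, op_op 𝔾 gr h]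

theorem signedAct_circ (h𝔾 : 𝔾.IsInvariant Γ) (hρ : ∀ g y, ∀ a ∈ gr y, ρ g a ∈ gr (g • y))
    {z : G} {φ ψ : Cochain A} (hφ : φ ∈ ML k A) (hψ : ψ ∈ CC 𝔾 gr z) (g : Γ) :
    signedAct 𝔾 gr σ ρ g (circ 𝔾 gr (𝔾.par z) φ ψ) =
      circ 𝔾 gr (𝔾.par z) (signedAct 𝔾 gr σ ρ g φ) (signedAct 𝔾 gr σ ρ g ψ) := by
  simp only [signedAct_eq]
  split_ifs
  · exact conj_circ h𝔾 hρ g _ φ ψ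
  · rw [op_circ 𝔾 gr hφ hψ, conj_circ h𝔾 hρ]

theorem signedAct_gbr (h𝔾 : 𝔾.IsInvariant Γ) (hρ : ∀ g y, ∀ a ∈ gr y, ρ g a ∈ gr (g • y))
    {y z : G} {φ ψ : Cochain A} (hφ : φ ∈ CC 𝔾 gr y) (hψ : ψ ∈ CC 𝔾 gr z) (g : Γ) :
    signedAct 𝔾 gr σ ρ g (gbr 𝔾 gr (𝔾.par y) (𝔾.par z) φ ψ) =
      gbr 𝔾 gr (𝔾.par y) (𝔾.par z) (signedAct 𝔾 gr σ ρ g φ) (signedAct 𝔾 gr σ ρ g ψ) := by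
  rw [gbr, gbr, ← signedActₗ_apply, map_sub, map_zsmul, signedActₗ_apply, signedActₗ_apply,
    signedAct_circ σ h𝔾 hρ hφ.1 hψ, signedAct_circ σ h𝔾 hρ hψ.1 hφ]

end action

end Ainf

/-! ### External direct sums as internal ones -/

section directSum

variable {k ι : Type*} [Field k] [DecidableEq ι] {V : ι → Type*} [∀ i, AddCommGroup (V i)]
  [∀ i, Module k (V i)]

/-- This provides the grading of `HL`, whose homogeneous parts are the images of the summands. -/
theorem isInternal_range_lof :
    DirectSum.IsInternal fun i => LinearMap.range (DirectSum.lof k ι V i) := by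
  let dec : (DirectSum ι V) →ₗ[k] DirectSum ι fun i => LinearMap.range (DirectSum.lof k ι V i) :=
    DirectSum.toModule k ι _ fun i =>
      DirectSum.lof k ι (fun i => LinearMap.range (DirectSum.lof k ι V i)) i ∘ₗ
        (DirectSum.lof k ι V i).rangeRestrict
  have h1 : ∀ i (x : V i), dec (DirectSum.lof k ι V i x) =
      DirectSum.lof k ι (fun i => LinearMap.range (DirectSum.lof k ι V i)) i
        ⟨DirectSum.lof k ι V i x, x, rfl⟩ := fun i x => DirectSum.toModule_lof k i x
  let _ : DirectSum.Decomposition fun i => LinearMap.range (DirectSum.lof k ι V i) :=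
    DirectSum.Decomposition.ofLinearMap _ dec
      (by
        refine DirectSum.linearMap_ext k fun i => LinearMap.ext fun x => ?_
        rw [LinearMap.comp_apply, LinearMap.comp_apply, h1, DirectSum.coeLinearMap_lof]
        rfl)
      (by
        refine DirectSum.linearMap_ext k fun i => LinearMap.ext fun x => ?_
        obtain ⟨_, x, rfl⟩ := x
        rw [LinearMap.comp_apply, LinearMap.comp_apply, DirectSum.coeLinearMap_lof, h1]
        rfl)
  exact DirectSum.Decomposition.isInternal _

end directSum

namespace Ainf

open CoeffDatum

variable {G : Type*} [AddCommGroup G] [DecidableEq G]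
  (𝔾 : GradingDatum G) {k : Type*} [Field k] {A : Type*} [AddCommGroup A] [Module k A]
  (gr : G → Submodule k A)

/-! ### The Hochschild cochains as a differential graded Lie algebra -/

/-- The direct sum of the homogeneous parts of the Hochschild cochains. -/
def HL : Type _ := DirectSum G fun y => CC 𝔾 gr y

noncomputable instance : AddCommGroup (HL 𝔾 gr) :=
  inferInstanceAs (AddCommGroup (DirectSum G fun y => CC 𝔾 gr y))

noncomputable instance : Module k (HL 𝔾 gr) :=
  inferInstanceAs (Module k (DirectSum G fun y => CC 𝔾 gr y))

/-- The inclusion of a homogeneous part, as a linear map. -/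
noncomputable def HL.inc (y : G) : CC 𝔾 gr y →ₗ[k] HL 𝔾 gr :=
  DirectSum.lof k G (fun y => CC 𝔾 gr y) y

/-- The linear map with given values on the homogeneous parts. -/
noncomputable def HL.lift {W : Type*} [AddCommGroup W] [Module k W]
    (f : ∀ y, CC 𝔾 gr y →ₗ[k] W) : HL 𝔾 gr →ₗ[k] W :=
  DirectSum.toModule k G W f

theorem HL.lift_inc {W : Type*} [AddCommGroup W] [Module k W]
    (f : ∀ y, CC 𝔾 gr y →ₗ[k] W) (y : G) (x : CC 𝔾 gr y) :
    HL.lift 𝔾 gr f (HL.inc 𝔾 gr y x) = f y x :=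
  DirectSum.toModule_lof (M := fun y => CC 𝔾 gr y) k y x

/-- The map which forgets the decomposition into homogeneous parts. -/
noncomputable def HL.π : HL 𝔾 gr →ₗ[k] Cochain A := HL.lift 𝔾 gr fun y => (CC 𝔾 gr y).subtype

/-- The homogeneous parts of `HL`. -/
noncomputable def HL.part (y : G) : Submodule k (HL 𝔾 gr) :=
  LinearMap.range (HL.inc 𝔾 gr y)

variable {𝔾 gr}

/-- The inclusion of a homogeneous part. -/
noncomputable def HL.of {y : G} {φ : Cochain A} (h : φ ∈ CC 𝔾 gr y) : HL 𝔾 gr :=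
  HL.inc 𝔾 gr y ⟨φ, h⟩

theorem HL.of_mem {y : G} {φ : Cochain A} (h : φ ∈ CC 𝔾 gr y) : HL.of h ∈ HL.part 𝔾 gr y :=
  ⟨_, rfl⟩

theorem HL.π_of {y : G} {φ : Cochain A} (h : φ ∈ CC 𝔾 gr y) : HL.π 𝔾 gr (HL.of h) = φ :=
  HL.lift_inc 𝔾 gr _ y _

theorem HL.exists_of {y : G} {a : HL 𝔾 gr} (h : a ∈ HL.part 𝔾 gr y) :
    ∃ (φ : Cochain A) (hφ : φ ∈ CC 𝔾 gr y), a = HL.of hφ := by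
  obtain ⟨⟨φ, hφ⟩, rfl⟩ := h
  exact ⟨φ, hφ, rfl⟩

theorem HL.π_mem {y : G} {a : HL 𝔾 gr} (h : a ∈ HL.part 𝔾 gr y) : HL.π 𝔾 gr a ∈ CC 𝔾 gr y := by
  obtain ⟨φ, hφ, rfl⟩ := HL.exists_of h
  rwa [HL.π_of]

/-- Arbitrary functions of lists are not sums of homogeneous multilinear cochains, which is why `HL`
is built as a direct sum. Within one degree nothing is lost in passing to cochains, so identities in
`HL` are checked there. -/
theorem HL.ext {y : G} {a b : HL 𝔾 gr} (ha : a ∈ HL.part 𝔾 gr y) (hb : b ∈ HL.part 𝔾 gr y)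
    (h : HL.π 𝔾 gr a = HL.π 𝔾 gr b) : a = b := by
  obtain ⟨φ, hφ, rfl⟩ := HL.exists_of ha
  obtain ⟨ψ, hψ, rfl⟩ := HL.exists_of hb
  rw [HL.π_of, HL.π_of] at h
  subst h
  rfl

theorem HL.linearMap_ext {W : Type*} [AddCommGroup W] [Module k W] {f f' : HL 𝔾 gr →ₗ[k] W}
    (h : ∀ y, ∀ a ∈ HL.part 𝔾 gr y, f a = f' a) : f = f' :=
  DirectSum.linearMap_ext k fun y => LinearMap.ext fun x => h y _ ⟨x, rfl⟩

variable [DirectSum.Decomposition gr]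

theorem isLinearMap_gbr_left (s t : ZMod 2) {ψ : Cochain A} (hψ : ψ ∈ ML k A) :
    IsLinearMap k fun φ : Cochain A => gbr 𝔾 gr s t φ ψ := by
  refine ⟨fun φ φ' => ?_, fun c φ => ?_⟩
  · simp only [gbr, circ_add_left, circ_add_right 𝔾 gr s hψ, smul_add]
    abel
  · simp only [gbr, circ_smul_left, circ_smul_right 𝔾 gr s hψ, smul_sub, smul_comm c]

theorem isLinearMap_gbr_right (s t : ZMod 2) {φ : Cochain A} (hφ : φ ∈ ML k A) :
    IsLinearMap k fun ψ : Cochain A => gbr 𝔾 gr s t φ ψ := by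
  refine ⟨fun ψ ψ' => ?_, fun c ψ => ?_⟩
  · simp only [gbr, circ_add_left, circ_add_right 𝔾 gr t hφ, smul_add]
    abel
  · simp only [gbr, circ_smul_left, circ_smul_right 𝔾 gr t hφ, smul_sub, smul_comm c]

variable (𝔾 gr) in
/-- The bracket of homogeneous elements. -/
noncomputable def HL.brHom (y z : G) : CC 𝔾 gr y →ₗ[k] CC 𝔾 gr z →ₗ[k] HL 𝔾 gr :=
  LinearMap.mk₂ k (fun φ ψ => HL.inc 𝔾 gr (y + z)
      ⟨gbr 𝔾 gr (𝔾.par y) (𝔾.par z) φ ψ, gbr_mem 𝔾 gr φ.2 ψ.2 _ _⟩)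
    (fun φ φ' ψ => by
      rw [← map_add]
      congr 1
      exact Subtype.ext ((isLinearMap_gbr_left _ _ ψ.2.1).map_add _ _))
    (fun c φ ψ => by
      rw [← map_smul]
      congr 1
      exact Subtype.ext ((isLinearMap_gbr_left _ _ ψ.2.1).map_smul _ _))
    (fun φ ψ ψ' => by
      rw [← map_add]
      congr 1
      exact Subtype.ext ((isLinearMap_gbr_right _ _ φ.2.1).map_add _ _))
    (fun c φ ψ => by
      rw [← map_smul]
      congr 1
      exact Subtype.ext ((isLinearMap_gbr_right _ _ φ.2.1).map_smul _ _))

variable (𝔾 gr) in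
/-- The Gerstenhaber bracket. -/
noncomputable def HL.br : HL 𝔾 gr →ₗ[k] HL 𝔾 gr →ₗ[k] HL 𝔾 gr :=
  HL.lift 𝔾 gr fun y =>
    (HL.lift 𝔾 gr fun z => (HL.brHom 𝔾 gr y z).flip).flip

theorem HL.br_of {y z : G} {φ ψ : Cochain A} (hφ : φ ∈ CC 𝔾 gr y) (hψ : ψ ∈ CC 𝔾 gr z) :
    HL.br 𝔾 gr (HL.of hφ) (HL.of hψ) = HL.of (gbr_mem 𝔾 gr hφ hψ (𝔾.par y) (𝔾.par z)) := by
  rw [HL.of, HL.of, HL.br, HL.lift_inc, LinearMap.flip_apply, HL.lift_inc]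
  rfl

theorem HL.br_mem {y z : G} {a b : HL 𝔾 gr} (ha : a ∈ HL.part 𝔾 gr y) (hb : b ∈ HL.part 𝔾 gr z) :
    HL.br 𝔾 gr a b ∈ HL.part 𝔾 gr (y + z) := by
  obtain ⟨φ, hφ, rfl⟩ := HL.exists_of ha
  obtain ⟨ψ, hψ, rfl⟩ := HL.exists_of hb
  rw [HL.br_of]
  exact HL.of_mem _

theorem HL.π_br {y z : G} {a b : HL 𝔾 gr} (ha : a ∈ HL.part 𝔾 gr y) (hb : b ∈ HL.part 𝔾 gr z) :
    HL.π 𝔾 gr (HL.br 𝔾 gr a b) =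
      gbr 𝔾 gr (𝔾.par y) (𝔾.par z) (HL.π 𝔾 gr a) (HL.π 𝔾 gr b) := by
  obtain ⟨φ, hφ, rfl⟩ := HL.exists_of ha
  obtain ⟨ψ, hψ, rfl⟩ := HL.exists_of hb
  rw [HL.br_of, HL.π_of, HL.π_of, HL.π_of]

theorem HL.br_symm {y z : G} {a b : HL 𝔾 gr} (ha : a ∈ HL.part 𝔾 gr y) (hb : b ∈ HL.part 𝔾 gr z) :
    HL.br 𝔾 gr a b = -(sgn (𝔾.par y * 𝔾.par z) • HL.br 𝔾 gr b a) := by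
  refine HL.ext (HL.br_mem ha hb)
    (neg_mem (zsmul_mem (by rw [add_comm y]; exact HL.br_mem hb ha) _)) ?_
  rw [map_neg, map_zsmul, HL.π_br ha hb, HL.π_br hb ha, gbr_symm]

theorem HL.jacobi {y z : G} {a b : HL 𝔾 gr} (ha : a ∈ HL.part 𝔾 gr y) (hb : b ∈ HL.part 𝔾 gr z)
    (c : HL 𝔾 gr) : HL.br 𝔾 gr a (HL.br 𝔾 gr b c) = HL.br 𝔾 gr (HL.br 𝔾 gr a b) c +
      sgn (𝔾.par y * 𝔾.par z) • HL.br 𝔾 gr b (HL.br 𝔾 gr a c) := by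
  have : HL.br 𝔾 gr a ∘ₗ HL.br 𝔾 gr b = HL.br 𝔾 gr (HL.br 𝔾 gr a b) +
      sgn (𝔾.par y * 𝔾.par z) • HL.br 𝔾 gr b ∘ₗ HL.br 𝔾 gr a := by
    refine HL.linearMap_ext fun x c hc => ?_
    rw [LinearMap.comp_apply, LinearMap.add_apply, LinearMap.smul_apply, LinearMap.comp_apply]
    refine HL.ext (HL.br_mem ha (HL.br_mem hb hc)) (add_mem ?_ (zsmul_mem ?_ _)) ?_
    · rw [← add_assoc]
      exact HL.br_mem (HL.br_mem ha hb) hc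
    · rw [add_left_comm]
      exact HL.br_mem hb (HL.br_mem ha hc)
    · rw [map_add, map_zsmul, HL.π_br ha (HL.br_mem hb hc), HL.π_br hb hc,
        HL.π_br (HL.br_mem ha hb) hc, HL.π_br ha hb, HL.π_br hb (HL.br_mem ha hc), HL.π_br ha hc,
        gbr_jacobi 𝔾 gr (HL.π_mem ha) (HL.π_mem hb) (HL.π_mem hc)]
  exact LinearMap.congr_fun this c

section dgla

variable [CharZero k] {μ : Cochain A} (hμ : IsAinf 𝔾 gr μ)

include hμ in
-- The Jacobi identity with `[μ, μ] = 0` gives `[μ, [μ, a]] = -[μ, [μ, a]]`, and two is invertible.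
theorem HL.d_d (a : HL 𝔾 gr) :
    HL.br 𝔾 gr (HL.of hμ.mem) (HL.br 𝔾 gr (HL.of hμ.mem) a) = 0 := by
  have h1 : HL.br 𝔾 gr (HL.of hμ.mem) (HL.of hμ.mem) = 0 := by
    refine HL.ext (HL.br_mem (HL.of_mem _) (HL.of_mem _)) (zero_mem _) ?_
    rw [HL.π_br (HL.of_mem _) (HL.of_mem _), HL.π_of, par_ι_one, gbr, hμ.rel, smul_zero, sub_zero,
      map_zero]
  have h2 := HL.jacobi (HL.of_mem hμ.mem) (HL.of_mem hμ.mem) a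
  rw [h1, map_zero, LinearMap.zero_apply, zero_add, par_ι_one, mul_one, sgn_one, neg_smul,
    one_smul, eq_neg_iff_add_eq_zero, ← two_smul k, smul_eq_zero] at h2
  exact h2.resolve_left two_ne_zero

/-- The Hochschild cochains of an `A∞` algebra as a differential graded Lie algebra. -/
noncomputable def hochDGLA : DGLA k 𝔾 (HL 𝔾 gr) where
  gr := HL.part 𝔾 gr
  isInternal := isInternal_range_lof
  d := HL.br 𝔾 gr (HL.of hμ.mem)
  d_mem y a ha := by
    rw [add_comm]
    exact HL.br_mem (HL.of_mem _) ha
  d_d := HL.d_d hμ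
  br := HL.br 𝔾 gr
  br_mem y z a ha b hb := HL.br_mem ha hb
  br_symm y z a ha b hb := HL.br_symm ha hb
  d_br y z a ha b hb := by
    have := HL.jacobi (HL.of_mem hμ.mem) ha b
    rwa [par_ι_one, one_mul] at this
  jacobi y z a ha b hb c := HL.jacobi ha hb c

theorem π_d {y : G} {a : HL 𝔾 gr} (ha : a ∈ HL.part 𝔾 gr y) :
    HL.π 𝔾 gr ((hochDGLA hμ).d a) = hochD 𝔾 gr μ (𝔾.par y) (HL.π 𝔾 gr a) := by
  refine (HL.π_br (HL.of_mem hμ.mem) ha).trans ?_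
  rw [HL.π_of, par_ι_one, gbr, hochD, one_mul]

end dgla

section action

variable {Γ : Type*} [Group Γ] [DistribMulAction Γ G] (σ : Γ →* Multiplicative (ZMod 2))
  {ρ : Representation k Γ A}

/-- The operator on `HL` induced by a group element. -/
noncomputable def HL.actHom (h𝔾 : 𝔾.IsInvariant Γ)
    (hρ : ∀ g y, ∀ a ∈ gr y, ρ g a ∈ gr (g • y)) (g : Γ) : HL 𝔾 gr →ₗ[k] HL 𝔾 gr :=
  HL.lift 𝔾 gr fun y => HL.inc 𝔾 gr (g • y) ∘ₗ
    (signedActₗ 𝔾 gr σ ρ g).restrict fun _ hη => signedAct_mem σ h𝔾 hρ hη g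

variable (h𝔾 : 𝔾.IsInvariant Γ) (hρ : ∀ g y, ∀ a ∈ gr y, ρ g a ∈ gr (g • y))

theorem HL.actHom_of (g : Γ) {y : G} {φ : Cochain A} (hφ : φ ∈ CC 𝔾 gr y) :
    HL.actHom σ h𝔾 hρ g (HL.of hφ) = HL.of (signedAct_mem σ h𝔾 hρ hφ g) := by
  rw [HL.of, HL.actHom, HL.lift_inc]
  rfl

theorem HL.actHom_mem (g : Γ) {y : G} {a : HL 𝔾 gr} (ha : a ∈ HL.part 𝔾 gr y) :
    HL.actHom σ h𝔾 hρ g a ∈ HL.part 𝔾 gr (g • y) := by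
  obtain ⟨φ, hφ, rfl⟩ := HL.exists_of ha
  rw [HL.actHom_of]
  exact HL.of_mem _

theorem HL.π_actHom (g : Γ) (a : HL 𝔾 gr) :
    HL.π 𝔾 gr (HL.actHom σ h𝔾 hρ g a) = signedAct 𝔾 gr σ ρ g (HL.π 𝔾 gr a) := by
  have : HL.π 𝔾 gr ∘ₗ HL.actHom σ h𝔾 hρ g = signedActₗ 𝔾 gr σ ρ g ∘ₗ HL.π 𝔾 gr := by
    refine HL.linearMap_ext fun y a ha => ?_
    obtain ⟨φ, hφ, rfl⟩ := HL.exists_of ha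
    rw [LinearMap.comp_apply, LinearMap.comp_apply, HL.actHom_of, HL.π_of, HL.π_of]
    rfl
  exact LinearMap.congr_fun this a

/-- The representation on `HL` induced by a signed action. -/
noncomputable def HL.rep : Representation k Γ (HL 𝔾 gr) where
  toFun := HL.actHom σ h𝔾 hρ
  map_one' := by
    refine HL.linearMap_ext fun y a ha => ?_
    have h1 := HL.actHom_mem σ h𝔾 hρ 1 ha
    rw [one_smul] at h1
    refine HL.ext h1 ha ?_
    rw [HL.π_actHom, signedAct_one, Module.End.one_apply]
  map_mul' g g' := by
    refine HL.linearMap_ext fun y a ha => ?_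
    have h1 := HL.actHom_mem σ h𝔾 hρ (g * g') ha
    rw [mul_smul] at h1
    refine HL.ext h1 (HL.actHom_mem σ h𝔾 hρ g (HL.actHom_mem σ h𝔾 hρ g' ha)) ?_
    rw [HL.π_actHom, Module.End.mul_apply, HL.π_actHom, HL.π_actHom, signedAct_mul σ h𝔾 hρ (HL.π_mem ha).1]

theorem HL.π_rep (g : Γ) (a : HL 𝔾 gr) :
    HL.π 𝔾 gr (HL.rep σ h𝔾 hρ g a) = signedAct 𝔾 gr σ ρ g (HL.π 𝔾 gr a) :=
  HL.π_actHom σ h𝔾 hρ g a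

theorem HL.rep_br (g : Γ) (a b : HL 𝔾 gr) : HL.rep σ h𝔾 hρ g (HL.br 𝔾 gr a b) =
    HL.br 𝔾 gr (HL.rep σ h𝔾 hρ g a) (HL.rep σ h𝔾 hρ g b) := by
  have : (HL.br 𝔾 gr).compr₂ (HL.rep σ h𝔾 hρ g) =
      (HL.br 𝔾 gr).compl₁₂ (HL.rep σ h𝔾 hρ g) (HL.rep σ h𝔾 hρ g) := by
    refine HL.linearMap_ext fun y a ha => HL.linearMap_ext fun z b hb => ?_
    have h1 : HL.rep σ h𝔾 hρ g a ∈ HL.part 𝔾 gr (g • y) := HL.actHom_mem σ h𝔾 hρ g ha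
    have h2 : HL.rep σ h𝔾 hρ g b ∈ HL.part 𝔾 gr (g • z) := HL.actHom_mem σ h𝔾 hρ g hb
    have h3 : HL.rep σ h𝔾 hρ g (HL.br 𝔾 gr a b) ∈ HL.part 𝔾 gr (g • (y + z)) :=
      HL.actHom_mem σ h𝔾 hρ g (HL.br_mem ha hb)
    rw [smul_add] at h3
    rw [LinearMap.compr₂_apply, LinearMap.compl₁₂_apply]
    refine HL.ext h3 (HL.br_mem h1 h2) ?_
    rw [HL.π_rep, HL.π_br ha hb, HL.π_br h1 h2, HL.π_rep, HL.π_rep, h𝔾.2, h𝔾.2,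
      signedAct_gbr σ h𝔾 hρ (HL.π_mem ha) (HL.π_mem hb)]
  exact LinearMap.congr_fun (LinearMap.congr_fun this a) b

/-- The differential is the bracket with `μ`, and `μ` is invariant under the signed group. -/
theorem isAction_rep [CharZero k] {μ : Cochain A} (hμ : IsAinf 𝔾 gr μ)
    (hs : IsSignedAction 𝔾 gr μ σ ρ) :
    (hochDGLA hμ).IsAction (HL.rep σ h𝔾 hs.mem) where
  mem g y a ha := HL.actHom_mem σ h𝔾 hs.mem g ha
  br := HL.rep_br σ h𝔾 hs.mem
  d g a := by
    refine (HL.rep_br σ h𝔾 hs.mem g _ a).trans ?_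
    have : HL.rep σ h𝔾 hs.mem g (HL.of hμ.mem) = HL.of hμ.mem := by
      have h1 := HL.actHom_mem σ h𝔾 hs.mem g (HL.of_mem hμ.mem)
      rw [h𝔾.1] at h1
      refine HL.ext h1 (HL.of_mem _) ?_
      rw [HL.π_rep, HL.π_of, hs.map_μ]
    rw [this]
    rfl

end action

end Ainf

namespace Ainf

open CoeffDatum

/-! ### Deformations as Maurer–Cartan elements -/

section transfer

variable {P : Type*} [Fintype P] [DecidableEq P] {G : Type*} [AddCommGroup G] [DecidableEq G]
  {𝔾 : GradingDatum G} {D : CoeffDatum P 𝔾} {k : Type*} [Field k] [CharZero k] {hD : D.IsNice k}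
  {Γ : Type*} [Group Γ] [DistribMulAction Γ G] [MulAction Γ P]
  {a : Γ →* (D.R k ≃ₐ[k] D.R k)} (hR : IsSpecialAction hD a)
  {A : Type*} [AddCommGroup A] [Module k A] {gr : G → Submodule k A}
  [DirectSum.Decomposition gr] {μ : Cochain A} (hμ : IsAinf 𝔾 gr μ)
  {σ : Γ →* Multiplicative (ZMod 2)} {ρ : Representation k Γ A}
  (h𝔾 : 𝔾.IsInvariant Γ) (hs : IsSignedAction 𝔾 gr μ σ ρ)

theorem map_hatSMul {V W : Type*} [AddCommGroup V] [Module k V] [AddCommGroup W] [Module k W]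
    (f : V →ₗ[k] W) (c : D.R k) (x : D.Mon → V) (u : D.Mon) :
    f (hatSMul c x u) = hatSMul c (fun u => f (x u)) u := by
  simp only [hatSMul, map_sum, map_smul]

theorem map_firstOrder {V W : Type*} [AddCommGroup V] [Module k V] [AddCommGroup W] [Module k W]
    (f : V →ₗ[k] W) (h : ∀ p, Pi.single p 1 ∈ D.monoid) {x : D.Mon → V} {y : D.Mon → W} {p : P}
    (hxy : f (x (basis h p)) = y (basis h p)) :
    (fun u => f (firstOrder h x p u)) = firstOrder h y p := by
  classical
  funext u
  by_cases hu : u = basis h p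
  · subst hu
    simp [firstOrder, hxy]
  · simp [firstOrder, Pi.single_eq_of_ne hu]

theorem hatSMul_firstOrder_mem {V : Type*} [AddCommGroup V] [Module k V] {gr : G → Submodule k V}
    (h : ∀ p, Pi.single p 1 ∈ D.monoid) {c : D.R k} (hc : c ∈ D.homog k 0) {x : D.Mon → V} {p : P}
    {z : G} (hx : x (basis h p) ∈ gr (z - D.deg (basis h p))) (u : D.Mon) :
    hatSMul c (firstOrder h x p) u ∈ gr (z - D.deg u) := by
  by_cases h0 : hatSMul c (firstOrder h x p) u = 0
  · rw [h0]
    exact Submodule.zero_mem _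
  · obtain ⟨v, rfl, hv⟩ := exists_of_hatSMul_firstOrder_ne_zero h h0
    rw [hatSMul_firstOrder_add, deg_add, hc v hv, zero_add]
    exact Submodule.smul_mem _ _ hx

include hR in
theorem tensorMap_rep (g : Γ) (x : D.Mon → HL 𝔾 gr) (u : D.Mon) :
    HL.π 𝔾 gr (tensorMap (a g) (HL.rep σ h𝔾 hs.mem g) x u) =
      tensorMap (a g) (signedAct 𝔾 gr σ ρ g) (fun u => HL.π 𝔾 gr (x u)) u := by
  obtain ⟨v, rfl⟩ : ∃ v, mact hR g v = u := ⟨mact hR g⁻¹ u, mact_mact_inv hR g u⟩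
  rw [tensorMap_mact hR, tensorMap_mact hR, map_smul, HL.π_rep]

theorem polyM_π {z : G} {x : D.Mon → HL 𝔾 gr} (hx : x ∈ D.PolyM (HL.part 𝔾 gr) z) :
    (fun u => HL.π 𝔾 gr (x u)) ∈ D.PolyM (CC 𝔾 gr) z := by
  have h0 : ∀ u, HL.π 𝔾 gr (x u) ≠ 0 → x u ≠ 0 := fun u h h' => h (by rw [h', map_zero])
  refine ⟨⟨⟨fun u => HL.π_mem (hx.1.1.1 u), fun n => (hx.1.1.2 n).subset fun u hu => ?_⟩, ?_⟩,
    hx.2.subset fun u hu => h0 u hu⟩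
  · exact ⟨h0 u hu.1, hu.2⟩
  · simp only [hx.1.2, map_zero]

/-- The lift of a formal sum of homogeneous cochains. -/
noncomputable def HL.liftHat {z : G} {x : D.Mon → Cochain A}
    (hx : ∀ u, x u ∈ CC 𝔾 gr (z - D.deg u)) : D.Mon → HL 𝔾 gr := fun u => HL.of (hx u)

theorem HL.liftHat_mem {z : G} {x : D.Mon → Cochain A}
    (hx : ∀ u, x u ∈ CC 𝔾 gr (z - D.deg u)) (u : D.Mon) :
    HL.liftHat hx u ∈ HL.part 𝔾 gr (z - D.deg u) := HL.of_mem _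

theorem HL.π_liftHat {z : G} {x : D.Mon → Cochain A}
    (hx : ∀ u, x u ∈ CC 𝔾 gr (z - D.deg u)) (u : D.Mon) :
    HL.π 𝔾 gr (HL.liftHat hx u) = x u := HL.π_of _

theorem HL.liftHat_eq_zero {z : G} {x : D.Mon → Cochain A}
    {hx : ∀ u, x u ∈ CC 𝔾 gr (z - D.deg u)} {u : D.Mon} (h : x u = 0) :
    HL.liftHat hx u = 0 :=
  HL.ext (HL.liftHat_mem hx u) (zero_mem _) (by rw [HL.π_liftHat, h, map_zero])

theorem par_sub_deg (z : G) (u : D.Mon) : 𝔾.par (z - D.deg u) = 𝔾.par z := by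
  rw [map_sub, par_deg, sub_zero]

include hR in
-- In total degree zero or one the coefficients have a fixed parity, so the parity-dependent
-- Hochschild differentials coincide with the differential of `hochDGLA`. Cocycles and coboundaries
-- then correspond degree by degree.
theorem spansInv_lift {S : Set D.Mon} {α : D.Mon → HL 𝔾 gr} {m : D.Mon → Cochain A}
    (hα : ∀ p, α (basis hD.mem p) ∈ HL.part 𝔾 gr (𝔾.ι 1 - D.deg (basis hD.mem p)))
    (hm : ∀ p, HL.π 𝔾 gr (α (basis hD.mem p)) = m (basis hD.mem p))
    (h : SpansInv hD.mem a (hochComplex 𝔾 gr μ σ ρ) S m) :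
    SpansInv hD.mem a ((hochDGLA hμ).toEqComplex (HL.rep σ h𝔾 hs.mem)) S α := by
  intro x hx hxi
  have hd1 : ∀ u, HL.π 𝔾 gr ((hochDGLA hμ).d (x u)) = hochD 𝔾 gr μ 1 (HL.π 𝔾 gr (x u)) :=
    fun u => by rw [π_d hμ (hx.1.1.1.1 u), par_sub_deg, par_ι_one]
  have hd0 : ∀ (u : D.Mon) (y : HL 𝔾 gr), y ∈ HL.part 𝔾 gr (0 - D.deg u) →
      HL.π 𝔾 gr ((hochDGLA hμ).d y) = hochD 𝔾 gr μ 0 (HL.π 𝔾 gr y) := fun u y hy => by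
    rw [π_d hμ hy, par_sub_deg, map_zero]
  obtain ⟨c, hc, y, hy, hyx⟩ := h (fun u => HL.π 𝔾 gr (x u))
    ⟨polyM_π hx.1, fun u hu => by
      have h1 : (hochDGLA hμ).d (x u) = 0 := hx.2 u hu
      change hochD 𝔾 gr μ 1 _ = 0
      rw [← hd1, h1, map_zero]⟩
    (fun g => by
      obtain ⟨y, hy, hyx⟩ := hxi g
      refine ⟨fun u => HL.π 𝔾 gr (y u), polyM_π hy, fun u hu => ?_⟩
      have h1 := congrArg (HL.π 𝔾 gr) (hyx u hu)
      refine Eq.trans ?_ (h1.trans (hd0 u _ (hy.1.1.1 u)))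
      rw [Pi.sub_apply, Pi.sub_apply, map_sub]
      congr 1
      exact (tensorMap_rep hR h𝔾 hs g x u).symm)
  have hy0 := hy.1.1.1
  refine ⟨c, hc, HL.liftHat (z := 0) hy0,
    ⟨⟨⟨fun u => HL.liftHat_mem (z := 0) hy0 u, fun n => (hy.1.1.2 n).subset fun u hu => ?_⟩, ?_⟩,
      hy.2.subset fun u hu => ?_⟩, fun u hu => ?_⟩
  · exact ⟨fun h0 => hu.1 (HL.liftHat_eq_zero h0), hu.2⟩
  · exact HL.liftHat_eq_zero hy.1.2
  · exact fun h0 => hu (HL.liftHat_eq_zero h0)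
  · have h1 := hyx u hu
    have h2 := (hochDGLA hμ).d_mem _ _ (HL.liftHat_mem (z := 0) hy0 u)
    rw [zero_sub, neg_add_eq_sub] at h2
    refine HL.ext (y := 𝔾.ι 1 - D.deg u) ?_ h2 ?_
    · rw [Pi.sub_apply, Finset.sum_apply]
      exact sub_mem (hx.1.1.1.1 u) (Submodule.sum_mem _ fun p _ =>
        hatSMul_firstOrder_mem hD.mem (hc p).2 (hα p) u)
    · refine Eq.trans ?_ (h1.trans ?_)
      · rw [Pi.sub_apply, Pi.sub_apply, map_sub, Finset.sum_apply, Finset.sum_apply, map_sum]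
        congr 1
        refine Finset.sum_congr rfl fun p _ => ?_
        rw [map_hatSMul, map_firstOrder (HL.π 𝔾 gr) hD.mem (hm p)]
      · refine Eq.trans ?_ (hd0 u _ (HL.liftHat_mem (z := 0) hy0 u)).symm
        exact congrArg (hochD 𝔾 gr μ 0) (HL.π_liftHat (z := 0) hy0 u).symm

/-- The part of a deformation of positive order. -/
noncomputable def posPart (m : D.Mon → Cochain A) : D.Mon → Cochain A :=
  open Classical in fun u => if u = 0 then 0 else m u

theorem posPart_zero (m : D.Mon → Cochain A) : posPart m 0 = 0 := if_pos rfl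

theorem posPart_of_ne (m : D.Mon → Cochain A) {u : D.Mon} (hu : u ≠ 0) : posPart m u = m u :=
  if_neg hu

theorem posPart_mem {m : D.Mon → Cochain A} (hm : m ∈ Deformations D gr μ) (u : D.Mon) :
    posPart m u ∈ CC 𝔾 gr (𝔾.ι 1 - D.deg u) := by
  by_cases hu : u = 0
  · subst hu
    rw [posPart_zero]
    exact zero_mem _
  · rw [posPart_of_ne m hu]
    exact hm.1.1 u

/-- The two extreme decompositions of `u`, in which one factor has order zero, are the ones that
involve `μ`. -/
theorem sum_antidiagonal_posPart {m : D.Mon → Cochain A} (hm : m ∈ Deformations D gr μ)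
    (F : Cochain A → Cochain A → Cochain A) (h1 : ∀ x ∈ ML k A, F x 0 = 0) (h2 : ∀ x, F 0 x = 0)
    {u : D.Mon} (hu : u ≠ 0) :
    ∑ v ∈ Finset.HasAntidiagonal.antidiagonal u, F (m v.1) (m v.2) =
      ∑ v ∈ Finset.HasAntidiagonal.antidiagonal u, F (posPart m v.1) (posPart m v.2) +
        F μ (posPart m u) + F (posPart m u) μ := by
  classical
  have key : ∀ v ∈ Finset.HasAntidiagonal.antidiagonal u, F (m v.1) (m v.2) =
      F (posPart m v.1) (posPart m v.2) + (if v = (0, u) then F μ (posPart m u) else 0) +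
        (if v = (u, 0) then F (posPart m u) μ else 0) := by
    rintro ⟨v, w⟩ hvw
    rw [Finset.HasAntidiagonal.mem_antidiagonal] at hvw
    simp only at hvw ⊢
    by_cases hv : v = 0
    · subst hv
      rw [zero_add] at hvw
      subst hvw
      rw [if_pos rfl, if_neg fun h => hu (Prod.mk.inj h).2, posPart_zero, h2, hm.2.1,
        posPart_of_ne m hu, zero_add, add_zero]
    · rw [if_neg fun h => hv (Prod.mk.inj h).1]
      by_cases hw : w = 0
      · subst hw
        rw [add_zero] at hvw
        subst hvw
        rw [if_pos rfl, posPart_zero, h1 _ (posPart_mem hm v).1, hm.2.1, posPart_of_ne m hu, zero_add, zero_add]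
      · rw [if_neg fun h => hw (Prod.mk.inj h).2, posPart_of_ne m hv, posPart_of_ne m hw,
          add_zero, add_zero]
  rw [Finset.sum_congr rfl key, Finset.sum_add_distrib, Finset.sum_add_distrib,
    Finset.sum_ite_eq', Finset.sum_ite_eq', if_pos, if_pos] <;>
  simp

/-- The Maurer–Cartan element of a deformation. -/
noncomputable def mcLift {m : D.Mon → Cochain A} (hm : m ∈ Deformations D gr μ) :
    D.Mon → HL 𝔾 gr :=
  HL.liftHat (posPart_mem hm)

theorem π_mcLift {m : D.Mon → Cochain A} (hm : m ∈ Deformations D gr μ) (u : D.Mon) :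
    HL.π 𝔾 gr (mcLift hm u) = posPart m u := HL.π_liftHat _ u

theorem circ_zero_left (s : ZMod 2) (ψ : Cochain A) : circ 𝔾 gr s 0 ψ = 0 := by
  simpa using circ_smul_left 𝔾 gr s (0 : k) 0 ψ

theorem circ_zero_right (s : ZMod 2) {φ : Cochain A} (hφ : φ ∈ ML k A) :
    circ 𝔾 gr s φ 0 = 0 := by
  simpa using circ_smul_right 𝔾 gr s hφ (0 : k) 0

/-- Writing `m = μ + α`, the equation `m ∘ m = 0` expands into `μ ∘ μ = 0` and `[μ, α] + α ∘ α = 0`.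
Since `α` is odd, `α ∘ α` is half of `[α, α]`. -/
theorem mcLift_mem_MC {m : D.Mon → Cochain A} (hm : m ∈ Deformations D gr μ) :
    mcLift hm ∈ DGLA.MC D (hochDGLA hμ) := by
  have hmem : ∀ u, mcLift hm u ∈ HL.part 𝔾 gr (𝔾.ι 1 - D.deg u) := HL.liftHat_mem _
  have hML : ∀ u, posPart m u ∈ ML k A := fun u => (posPart_mem hm u).1
  refine ⟨⟨⟨hmem, fun n => (hm.1.2 n).subset fun u hu => ⟨fun h0 => hu.1 ?_, hu.2⟩⟩,
    HL.liftHat_eq_zero (posPart_zero m)⟩, fun u => ?_⟩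
  · refine HL.liftHat_eq_zero ?_
    rw [posPart, h0, ite_self]
  · have hbr : ∀ v ∈ Finset.HasAntidiagonal.antidiagonal u,
        HL.br 𝔾 gr (mcLift hm v.1) (mcLift hm v.2) ∈
          HL.part 𝔾 gr (𝔾.ι 1 - D.deg u + 𝔾.ι 1) := fun v hv => by
      rw [Finset.HasAntidiagonal.mem_antidiagonal] at hv
      have := HL.br_mem (hmem v.1) (hmem v.2)
      rwa [← hv, deg_add, show 𝔾.ι 1 - (D.deg v.1 + D.deg v.2) + 𝔾.ι 1 =
        𝔾.ι 1 - D.deg v.1 + (𝔾.ι 1 - D.deg v.2) by abel]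
    refine HL.ext (y := 𝔾.ι 1 - D.deg u + 𝔾.ι 1) (add_mem ((hochDGLA hμ).d_mem _ _ (hmem u))
      (Submodule.smul_mem _ _ (Submodule.sum_mem _ hbr))) (zero_mem _) ?_
    rw [map_add, map_smul, π_d hμ (hmem u), par_sub_deg, par_ι_one, π_mcLift, map_zero]
    have h1 : HL.π 𝔾 gr (DGLA.hatBr D (hochDGLA hμ) (mcLift hm) (mcLift hm) u) =
        (2 : k) • ∑ v ∈ Finset.HasAntidiagonal.antidiagonal u,
          circ 𝔾 gr 1 (posPart m v.1) (posPart m v.2) := by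
      have h2 : ∀ v ∈ Finset.HasAntidiagonal.antidiagonal u,
          HL.π 𝔾 gr (HL.br 𝔾 gr (mcLift hm v.1) (mcLift hm v.2)) =
            circ 𝔾 gr 1 (posPart m v.1) (posPart m v.2) +
              circ 𝔾 gr 1 (posPart m v.2) (posPart m v.1) := fun v _ => by
        rw [HL.π_br (hmem v.1) (hmem v.2), par_sub_deg, par_sub_deg, par_ι_one, π_mcLift,
          π_mcLift, gbr, mul_one, sgn_one, neg_smul, one_smul, sub_neg_eq_add]
      refine (map_sum (HL.π 𝔾 gr) _ _).trans ?_
      refine (Finset.sum_congr rfl h2).trans ?_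
      rw [Finset.sum_add_distrib, two_smul]
      congr 1
      exact (sum_antidiagonal_swap (fun v w => circ 𝔾 gr 1 (posPart m v) (posPart m w)) u).symm
    rw [h1, smul_smul, inv_mul_cancel₀ two_ne_zero, one_smul, hochD, sgn_one, neg_smul, one_smul,
      sub_neg_eq_add]
    by_cases hu : u = 0
    · subst hu
      rw [posPart_zero, circ_zero_left, circ_zero_right 1 hμ.mem.1, add_zero, zero_add]
      refine Finset.sum_eq_zero fun v hv => ?_
      rw [Finset.HasAntidiagonal.mem_antidiagonal] at hv
      rw [Mon.add_eq_zero hv, posPart_zero, circ_zero_left]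
    · have h3 := hm.2.2 u
      rw [sum_antidiagonal_posPart hm _ (fun x hx => circ_zero_right 1 hx)
        (fun x => circ_zero_left 1 x) hu] at h3
      rw [← h3]
      abel

include hR in
theorem isInvElt_mcLift {m : D.Mon → Cochain A} (hm : m ∈ Deformations D gr μ)
    (hi : IsInvElt a (hochComplex 𝔾 gr μ σ ρ) m) :
    IsInvElt a ((hochDGLA hμ).toEqComplex (HL.rep σ h𝔾 hs.mem)) (mcLift hm) := by
  intro g
  refine funext_mact hR g fun u => ?_
  have h1 : tensorMap (a g) (signedAct 𝔾 gr σ ρ g) m (mact hR g u) = m (mact hR g u) :=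
    congrFun (hi g) _
  rw [tensorMap_mact hR] at h1
  change tensorMap (a g) (HL.rep σ h𝔾 hs.mem g) _ _ = _
  rw [tensorMap_mact hR]
  have h2 : HL.rep σ h𝔾 hs.mem g (mcLift hm u) ∈ HL.part 𝔾 gr (𝔾.ι 1 - D.deg (mact hR g u)) := by
    have := HL.actHom_mem σ h𝔾 hs.mem g (HL.liftHat_mem (posPart_mem hm) u)
    rwa [smul_sub, h𝔾.1, ← deg_mact hR] at this
  refine HL.ext (Submodule.smul_mem _ _ h2) (HL.liftHat_mem (posPart_mem hm) _) ?_
  rw [map_smul, HL.π_rep, π_mcLift, π_mcLift]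
  by_cases hu : u = 0
  · subst hu
    rw [mact_zero, posPart_zero]
    exact (congrArg _ (map_zero (signedActₗ 𝔾 gr σ ρ g))).trans (smul_zero _)
  · rw [posPart_of_ne m hu, posPart_of_ne m fun h => hu ((mact_eq_zero hR).1 h), h1]

end transfer

end Ainf

namespace CoeffDatum

/-! ### Exponentials of operators on formal sums -/

section hatOp

variable {P : Type*} [Fintype P] {G : Type*} [AddCommGroup G]
  {𝔾 : GradingDatum G} {D : CoeffDatum P 𝔾} {k : Type*} [Field k]
  {X Y : Type*} [AddCommGroup X] [Module k X] [AddCommGroup Y] [Module k Y]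

/-- The `R`-linear operator on formal sums with coefficients `T u`. -/
noncomputable def hatOp (T : D.Mon → Module.End k X) : Module.End k (D.Mon → X) :=
  convₗ (LinearMap.id : Module.End k X →ₗ[k] X →ₗ[k] X) T

theorem hatOp_apply (T : D.Mon → Module.End k X) (x : D.Mon → X) (u : D.Mon) :
    hatOp T x u = ∑ v ∈ Finset.HasAntidiagonal.antidiagonal u, T v.1 (x v.2) := rfl

theorem hatOp_hatOp (T T' : D.Mon → Module.End k X) (x : D.Mon → X) :
    hatOp T (hatOp T' x) = conv₃ (fun a b c => a (b c)) T T' x :=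
  conv_conv_right _ _ _ _ _

theorem hatOp_add (T T' : D.Mon → Module.End k X) : hatOp (T + T') = hatOp T + hatOp T' :=
  map_add (convₗ (LinearMap.id : Module.End k X →ₗ[k] X →ₗ[k] X)) T T'

theorem commute_hatOp {T T' : D.Mon → Module.End k X} (h : ∀ u v, Commute (T u) (T' v)) :
    Commute (hatOp T) (hatOp T') := by
  refine LinearMap.ext fun x => ?_
  rw [Module.End.mul_apply, Module.End.mul_apply, hatOp_hatOp, hatOp_hatOp, conv₃_swap_left]
  exact conv₃_congr fun u v w => (LinearMap.congr_fun (h v u) (x w))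

theorem suppIn_hatOp (T : D.Mon → Module.End k X) {n : ℕ} {x : D.Mon → X}
    (hx : SuppIn (D.pow n) x) : SuppIn (D.pow n) (hatOp T x) := by
  have := conv_suppIn_pow (B := (LinearMap.id : Module.End k X →ₗ[k] X →ₗ[k] X))
    (suppIn_pow_zero T) hx
  rwa [zero_add] at this

theorem suppIn_hatOp_pow {T : D.Mon → Module.End k X} (hT : T 0 = 0) {n : ℕ} {x : D.Mon → X}
    (hx : SuppIn (D.pow n) x) (i : ℕ) : SuppIn (D.pow (i + n)) ((hatOp T ^ i) x) := by
  induction i with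
  | zero => rwa [zero_add, pow_zero]
  | succ i ih =>
    rw [pow_succ', Module.End.mul_apply, add_right_comm, add_comm]
    exact conv_suppIn_pow (suppIn_pow_one.2 hT) ih

theorem hatOp_expSum (T : D.Mon → Module.End k X) {f : ℕ → D.Mon → X}
    (hf : ∀ n, SuppIn (D.pow n) (f n)) :
    hatOp T (expSum k f) = expSum k fun n => hatOp T (f n) := by
  funext u
  obtain ⟨N, hN⟩ := exists_notMem_pow u
  rw [expSum_eq_sum (fun n => suppIn_hatOp T (hf n)) hN, hatOp_apply]
  simp only [hatOp_apply, Finset.smul_sum]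
  rw [Finset.sum_comm]
  refine Finset.sum_congr rfl fun v hv => ?_
  rw [Finset.HasAntidiagonal.mem_antidiagonal] at hv
  rw [expSum_eq_sum hf (N := N) fun h => hN (by rw [← hv, add_comm]; exact pow_add_mem h), map_sum]
  simp only [map_smul]

theorem hatOp_pow_expSum {T : D.Mon → Module.End k X} (hT : T 0 = 0) {f : ℕ → D.Mon → X}
    (hf : ∀ n, SuppIn (D.pow n) (f n)) (i : ℕ) :
    (hatOp T ^ i) (expSum k f) = expSum k fun n => (hatOp T ^ i) (f n) := by
  induction i with
  | zero => rfl
  | succ i ih =>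
    simp only [pow_succ', Module.End.mul_apply]
    rw [ih, hatOp_expSum]
    exact fun n => (suppIn_hatOp_pow hT (hf n) i).mono (pow_antitone (Nat.le_add_left _ _))

/-- The exponential of `hatOp T`, for `T` of positive order. -/
noncomputable def hatExp (T : D.Mon → Module.End k X) (x : D.Mon → X) : D.Mon → X :=
  expSum k fun n => (hatOp T ^ n) x

theorem suppIn_hatExp {T : D.Mon → Module.End k X} (hT : T 0 = 0) (x : D.Mon → X) (n : ℕ) :
    SuppIn (D.pow n) ((hatOp T ^ n) x) := suppIn_hatOp_pow hT (suppIn_pow_zero x) n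

theorem hatExp_apply_zero {T : D.Mon → Module.End k X} (hT : T 0 = 0) (x : D.Mon → X) :
    hatExp T x 0 = x 0 := expSum_apply_zero (suppIn_hatExp hT x)

theorem hatExp_of_hatOp_eq_zero {T : D.Mon → Module.End k X} (hT : T 0 = 0) {x : D.Mon → X}
    (hx : hatOp T x = 0) : hatExp T x = x := by
  have h1 : ∀ n, (hatOp T ^ (n + 1)) x = 0 := fun n => by
    rw [pow_succ, Module.End.mul_apply, hx, map_zero]
  funext u
  obtain ⟨N, hN⟩ := exists_notMem_pow u
  rw [hatExp, expSum_eq_sum (N := N + 1) (suppIn_hatExp hT x)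
    fun h => hN (pow_antitone (Nat.le_succ N) h), Finset.sum_range_succ']
  simp [h1]

theorem hatExp_add_apply {T : D.Mon → Module.End k X} (hT : T 0 = 0) (x y : D.Mon → X) :
    hatExp T (x + y) = hatExp T x + hatExp T y := by
  rw [hatExp, hatExp, hatExp, expSum_add (suppIn_hatExp hT x) (suppIn_hatExp hT y)]
  simp only [map_add]

theorem hatExp_expSum [CharZero k] {T : D.Mon → Module.End k X} (hT : T 0 = 0) {f : ℕ → D.Mon → X}
    (hf : ∀ n, SuppIn (D.pow n) (f n)) :
    hatExp T (expSum k f) = expSum k fun n =>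
      ∑ ij ∈ Finset.HasAntidiagonal.antidiagonal n, n.choose ij.1 • (hatOp T ^ ij.1) (f ij.2) := by
  funext u
  obtain ⟨N, hN⟩ := exists_notMem_pow u
  rw [← expSum_expSum (T := fun i j => (hatOp T ^ i) (f j))
    (fun i j => suppIn_hatOp_pow hT (hf j) i) hN, hatExp, expSum_eq_sum (suppIn_hatExp hT _) hN]
  refine Finset.sum_congr rfl fun i _ => ?_
  rw [hatOp_pow_expSum hT hf, expSum_eq_sum (fun j => (suppIn_hatOp_pow hT (hf j) i).mono
    (pow_antitone (Nat.le_add_left _ _))) hN, Finset.smul_sum]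
  exact Finset.sum_congr rfl fun j _ => smul_smul _ _ _

/-- The binomial theorem for commuting operators. -/
theorem hatExp_add [CharZero k] {T T' : D.Mon → Module.End k X} (hT : T 0 = 0) (hT' : T' 0 = 0)
    (h : ∀ u v, Commute (T u) (T' v)) (x : D.Mon → X) :
    hatExp (T + T') x = hatExp T (hatExp T' x) := by
  rw [hatExp.eq_def T' x, hatExp_expSum hT (suppIn_hatExp hT' x), hatExp, hatOp_add]
  congr 1
  funext n
  rw [(commute_hatOp h).add_pow', LinearMap.sum_apply]
  rfl

/-- Exponentials are natural for intertwiners. This moves computations between cochains and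
functions of two lists. -/
theorem hatExp_map {T : D.Mon → Module.End k X} {T' : D.Mon → Module.End k Y} (hT : T 0 = 0)
    (L : X →ₗ[k] Y) (h : ∀ u x, L (T u x) = T' u (L x)) (x : D.Mon → X) :
    (fun u => L (hatExp T x u)) = hatExp T' fun u => L (x u) := by
  have h1 : ∀ n, L.compLeft D.Mon ((hatOp T ^ n) x) = (hatOp T' ^ n) (L.compLeft D.Mon x) := by
    intro n
    induction n with
    | zero => rfl
    | succ n ih =>
      rw [pow_succ', pow_succ', Module.End.mul_apply, Module.End.mul_apply, ← ih]
      funext u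
      rw [LinearMap.compLeft_apply, Function.comp_apply, hatOp_apply, hatOp_apply, map_sum]
      exact Finset.sum_congr rfl fun v _ => h _ _
  have h2 := compLeft_expSum L (suppIn_hatExp hT x)
  simp only [h1] at h2
  exact h2

open Classical in
/-- The constant formal sum. -/
noncomputable def const₀ (x : X) : D.Mon → X := Pi.single (M := fun _ => X) 0 x

theorem const₀_zero (x : X) : const₀ (D := D) x 0 = x := Pi.single_eq_same _ _

theorem const₀_of_ne {u : D.Mon} (hu : u ≠ 0) (x : X) : const₀ (D := D) x u = 0 :=
  Pi.single_eq_of_ne hu _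

theorem map_const₀ (L : X →ₗ[k] Y) (x : X) :
    (fun u => L (const₀ (D := D) x u)) = const₀ (L x) := by
  funext u
  by_cases hu : u = 0
  · subst hu
    rw [const₀_zero, const₀_zero]
  · rw [const₀_of_ne hu, const₀_of_ne hu, map_zero]

theorem const₀_add (x y : X) : const₀ (D := D) (x + y) = const₀ x + const₀ y :=
  Pi.single_add _ _ _

theorem hatOp_const₀ (T : D.Mon → Module.End k X) (x : X) (u : D.Mon) :
    hatOp T (const₀ x) u = T u x := by
  rw [hatOp_apply, Finset.sum_eq_single (u, 0)]
  · rw [const₀_zero]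
  · rintro ⟨v, w⟩ hvw hne
    rw [Finset.HasAntidiagonal.mem_antidiagonal] at hvw
    rw [const₀_of_ne, map_zero]
    rintro rfl
    rw [add_zero] at hvw
    exact hne (Prod.ext hvw rfl)
  · simp

theorem hatOp_pow_eq_sum (T : D.Mon → Module.End k X) (x : D.Mon → X) (n : ℕ) (u : D.Mon) :
    (hatOp T ^ n) x u = ∑ v ∈ Finset.HasAntidiagonal.antidiagonal u,
      (hatOp T ^ n) (const₀ (x v.1)) v.2 := by
  induction n generalizing u with
  | zero =>
    simp only [pow_zero, Module.End.one_apply]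
    rw [Finset.sum_eq_single (u, 0)]
    · rw [const₀_zero]
    · rintro ⟨v, w⟩ hvw hne
      rw [Finset.HasAntidiagonal.mem_antidiagonal] at hvw
      rw [const₀_of_ne]
      rintro rfl
      rw [add_zero] at hvw
      exact hne (Prod.ext hvw rfl)
    · simp
  | succ n ih =>
    simp only [pow_succ', Module.End.mul_apply]
    rw [hatOp_apply]
    simp only [ih, map_sum, hatOp_apply]
    rw [← sum_antidiagonal_triple (fun p v w => T p ((hatOp T ^ n) (const₀ (x v)) w)),
      ← sum_antidiagonal_triple (fun v p w => T p ((hatOp T ^ n) (const₀ (x v)) w))]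
    refine Finset.sum_congr rfl fun z _ => ?_
    exact sum_antidiagonal_swap (fun p v => T p ((hatOp T ^ n) (const₀ (x v)) z.2)) z.1

/-- The exponential is linear over `R`, hence determined by its values on constant formal sums. -/
theorem hatExp_eq_sum {T : D.Mon → Module.End k X} (hT : T 0 = 0) (x : D.Mon → X) (u : D.Mon) :
    hatExp T x u = ∑ v ∈ Finset.HasAntidiagonal.antidiagonal u, hatExp T (const₀ (x v.1)) v.2 := by
  obtain ⟨N, hN⟩ := exists_notMem_pow u
  rw [hatExp, expSum_eq_sum (suppIn_hatExp hT x) hN]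
  simp only [hatOp_pow_eq_sum T x, Finset.smul_sum]
  rw [Finset.sum_comm]
  refine Finset.sum_congr rfl fun v hv => ?_
  rw [Finset.HasAntidiagonal.mem_antidiagonal] at hv
  rw [hatExp, expSum_eq_sum (suppIn_hatExp hT _) (N := N)
    fun h => hN (by rw [← hv, add_comm]; exact pow_add_mem h)]

end hatOp

end CoeffDatum

theorem splitSum_of_left {A M : Type*} [AddCommMonoid M] {g : List A → List A → M}
    (h : ∀ x y, x ≠ [] → g x y = 0) (l : List A) : splitSum g l = g [] l := by
  rcases l with _ | ⟨a, l⟩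
  · rfl
  · rw [splitSum_cons]
    simp only [h _ _ (List.cons_ne_nil a _), splitSum_zero, add_zero]

theorem splitSum_of_right {A M : Type*} [AddCommMonoid M] {g : List A → List A → M}
    (h : ∀ x y, y ≠ [] → g x y = 0) (l : List A) : splitSum g l = g l [] := by
  induction l generalizing g with
  | nil => rfl
  | cons a l ih =>
    rw [splitSum_cons, h _ _ (List.cons_ne_nil a l), zero_add, ih fun x y hy => h _ y hy]

namespace Ainf

open CoeffDatum

/-! ### Insertion of even cochains and its exponential -/

section Insertion

variable {G : Type*} [AddCommGroup G] [DecidableEq G]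
  (𝔾 : GradingDatum G) {k : Type*} [Field k] {A : Type*} [AddCommGroup A] [Module k A]
  (gr : G → Submodule k A) [DirectSum.Decomposition gr]

theorem circ_zero_apply (φ ψ : Cochain A) (l : List A) :
    circ 𝔾 gr 0 φ ψ l =
      splitSum (fun x r => splitSum (fun y z => φ (x ++ ψ y :: z)) r) l := by
  rw [circ_eq_splitSum]
  simp only [map_koszul_zero]

theorem circ_comp (f : A →ₗ[k] A) (s : ZMod 2) (φ ψ : Cochain A) (l : List A) :
    circ 𝔾 gr s (fun x => f (φ x)) ψ l = f (circ 𝔾 gr s φ ψ l) := by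
  simp only [circ_eq_splitSum, map_splitSum]

/-- The operator `φ ↦ φ ∘ ψ`, for `ψ` of even parity. -/
noncomputable def circRight (ψ : Cochain A) : Module.End k (Cochain A) where
  toFun φ := circ 𝔾 gr 0 φ ψ
  map_add' φ φ' := circ_add_left 𝔾 gr 0 φ φ' ψ
  map_smul' c φ := circ_smul_left 𝔾 gr 0 c φ ψ

/-- Insertion of `ψ` in the first list of inputs. -/
noncomputable def circRight₁ (ψ : Cochain A) : Module.End k (List A → List A → A) where
  toFun Θ x y := circ 𝔾 gr 0 (fun z => Θ z y) ψ x
  map_add' Θ Θ' := by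
    funext x y
    exact congrFun (circ_add_left 𝔾 gr 0 (fun z => Θ z y) (fun z => Θ' z y) ψ) x
  map_smul' c Θ := by
    funext x y
    exact congrFun (circ_smul_left 𝔾 gr 0 c (fun z => Θ z y) ψ) x

/-- Insertion of `ψ` in the second list of inputs. -/
noncomputable def circRight₂ (ψ : Cochain A) : Module.End k (List A → List A → A) where
  toFun Θ x := circ 𝔾 gr 0 (Θ x) ψ
  map_add' Θ Θ' := by
    funext x
    exact circ_add_left 𝔾 gr 0 (Θ x) (Θ' x) ψ
  map_smul' c Θ := by
    funext x
    exact circ_smul_left 𝔾 gr 0 c (Θ x) ψ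

theorem commute_circRight₁_circRight₂ (ψ ψ' : Cochain A) :
    Commute (circRight₁ (k := k) 𝔾 gr ψ) (circRight₂ 𝔾 gr ψ') := by
  refine LinearMap.ext fun Θ => ?_
  funext x y
  change circ 𝔾 gr 0 (fun z => circ 𝔾 gr 0 (Θ z) ψ' y) ψ x =
    circ 𝔾 gr 0 (fun w => circ 𝔾 gr 0 (fun z => Θ z w) ψ x) ψ' y
  have h1 : (fun z => circ 𝔾 gr 0 (Θ z) ψ' y) = splitSum (fun p r => splitSum (fun q s =>
      (fun z => Θ z (p ++ ψ' q :: s))) r) y := by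
    funext z
    rw [circ_zero_apply]
    refine Eq.trans ?_ (map_splitSum (Pi.evalAddMonoidHom (fun _ : List A => A) z) _ _).symm
    refine congrArg (fun g => splitSum g y) (funext fun p => funext fun r => ?_)
    exact (map_splitSum (Pi.evalAddMonoidHom (fun _ : List A => A) z)
      (fun q s => fun z => Θ z (p ++ ψ' q :: s)) r).symm
  rw [h1, circ_zero_apply 𝔾 gr _ ψ' y]
  refine (map_splitSum ((LinearMap.proj x : Cochain A →ₗ[k] A) ∘ₗ circRight 𝔾 gr ψ) _ _).trans ?_
  refine congrArg (fun g => splitSum g y) (funext fun p => funext fun r => ?_)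
  exact map_splitSum ((LinearMap.proj x : Cochain A →ₗ[k] A) ∘ₗ circRight 𝔾 gr ψ) _ _

variable (k A) in
/-- The linear map `Θ ↦ ∑ Θ(x, y)`, summed over the ways of cutting the list of inputs. -/
def splitLinear : (List A → List A → A) →ₗ[k] Cochain A where
  toFun Θ l := splitSum Θ l
  map_add' Θ Θ' := funext fun l => splitSum_add Θ Θ' l
  map_smul' c Θ := funext fun l => splitSum_smul c Θ l

/-- The Leibniz rule: after the list of inputs is cut in two, `ψ` is inserted in the first or in the
second part. -/
theorem circ_splitLinear (ψ : Cochain A) (Θ : List A → List A → A) :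
    circ 𝔾 gr 0 (splitLinear k A Θ) ψ =
      splitLinear k A ((circRight₁ (k := k) 𝔾 gr ψ + circRight₂ 𝔾 gr ψ) Θ) := by
  funext l
  change _ = splitSum (fun x y => circ 𝔾 gr 0 (fun z => Θ z y) ψ x + circ 𝔾 gr 0 (Θ x) ψ y) l
  rw [splitSum_add, circ_zero_apply]
  simp only [circ_zero_apply]
  change splitSum (fun x r => splitSum (fun y z => splitSum Θ (x ++ ψ y :: z)) r) l = _
  simp only [splitSum_append_cons, splitSum_add]
  rw [add_comm]
  congr 1
  · rw [splitSum_assoc fun x r v => splitSum (fun y z => Θ (x ++ ψ y :: z) v) r]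
    refine splitSum_congr fun x t _ => ?_
    rw [splitSum_assoc fun y z v => Θ (x ++ ψ y :: z) v]
  · rw [splitSum_congr fun p s _ => circ_zero_apply 𝔾 gr (Θ p) ψ s,
      ← splitSum_assoc fun p q r => splitSum (fun y z => Θ p (q ++ ψ y :: z)) r]
    refine splitSum_congr fun x r _ => ?_
    exact splitSum_comm _ _ _

/-- The part of a cochain with no inputs. -/
def curvaturePart (η : Cochain A) : Cochain A
  | [] => η []
  | _ :: _ => 0

theorem circ_curvaturePart (s : ZMod 2) (η ψ : Cochain A) :
    circ 𝔾 gr s (curvaturePart η) ψ = 0 := by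
  funext l
  have h : ∀ (x z : List A) (a : A), curvaturePart η (x ++ a :: z) = 0 := by
    rintro (_ | _) z a <;> rfl
  simp only [circ_eq_splitSum, h, splitSum_zero, Pi.zero_apply]

theorem splitSum_idCochain {η : Cochain A} (hη : η ∈ ML k A) (l : List A) :
    splitSum (fun x y => η (idCochain x :: y)) l = if l = [] then 0 else η l := by
  have h0 : ∀ y, η (0 :: y) = 0 := fun y => ML.map_zero hη [] y
  rcases l with _ | ⟨a, l⟩
  · exact h0 _
  · rw [splitSum_cons, if_neg (List.cons_ne_nil a l), show idCochain ([] : List A) = 0 from rfl, h0,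
      zero_add]
    rcases l with _ | ⟨b, l⟩
    · rfl
    · rw [splitSum_cons]
      simp only [idCochain, h0, splitSum_zero, add_zero]

/-- The identity cochain forces the first block to be a single input, so a cochain is recovered by
splitting off its first input; only the value without inputs is missed. -/
theorem eq_curvaturePart_add {η : Cochain A} (hη : η ∈ ML k A) :
    η = curvaturePart η + splitLinear k A fun x y => η (idCochain x :: y) := by
  funext l
  change _ = _ + splitSum (fun x y => η (idCochain x :: y)) l
  rw [splitSum_idCochain hη]
  rcases l with _ | ⟨a, l⟩
  · simp [curvaturePart]
  · simp [curvaturePart]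

theorem circ_idCochain (s : ZMod 2) (ψ : Cochain A) : circ 𝔾 gr s idCochain ψ = ψ := by
  funext l
  rw [circ_eq_splitSum, splitSum_of_left, splitSum_of_right]
  · rfl
  · rintro y (_ | ⟨b, z⟩) h
    · exact absurd rfl h
    · rfl
  · rintro (_ | ⟨b, x⟩) r h
    · exact absurd rfl h
    · refine (splitSum_congr fun y z _ => ?_).trans (splitSum_zero r)
      rcases x with _ | ⟨_, _⟩ <;> rfl

/-- The family of operators `f (γ u)`, set to `0` where `γ u` vanishes. -/
noncomputable def opFamily {M X : Type*} [AddCommGroup X] [Module k X]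
    (f : Cochain A → Module.End k X) (γ : M → Cochain A) (u : M) : Module.End k X :=
  open Classical in if γ u = 0 then 0 else f (γ u)

section

variable {M X Y : Type*} [AddCommGroup X] [Module k X] [AddCommGroup Y] [Module k Y]
  (f : Cochain A → Module.End k X) {γ : M → Cochain A}

/-- Inserting the zero cochain into a cochain that is not multilinear need not give zero. The
exponential requires operators without constant term, so the value is set to zero by hand. -/
theorem opFamily_of_eq {u : M} (hu : γ u = 0) : opFamily f γ u = 0 := if_pos hu

theorem opFamily_of_ne {u : M} (hu : γ u ≠ 0) : opFamily f γ u = f (γ u) := if_neg hu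

theorem opFamily_intertwine {f' : Cochain A → Module.End k Y} {L : X →ₗ[k] Y}
    (h : ∀ ψ x, L (f ψ x) = f' ψ (L x)) (u : M) (x : X) :
    L (opFamily f γ u x) = opFamily f' γ u (L x) := by
  by_cases hu : γ u = 0
  · rw [opFamily_of_eq f hu, opFamily_of_eq f' hu, LinearMap.zero_apply, LinearMap.zero_apply,
      map_zero]
  · rw [opFamily_of_ne f hu, opFamily_of_ne f' hu, h]

theorem opFamily_add (f' : Cochain A → Module.End k X) :
    opFamily (fun ψ => f ψ + f' ψ) γ = opFamily f γ + opFamily f' γ := by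
  funext u
  by_cases hu : γ u = 0
  · simp [opFamily_of_eq _ hu]
  · simp [opFamily_of_ne _ hu]

theorem commute_opFamily {f' : Cochain A → Module.End k X} (h : ∀ ψ ψ', Commute (f ψ) (f' ψ'))
    (u v : M) : Commute (opFamily f γ u) (opFamily f' γ v) := by
  by_cases hu : γ u = 0
  · rw [opFamily_of_eq f hu]
    exact Commute.zero_left _
  by_cases hv : γ v = 0
  · rw [opFamily_of_eq f' hv]
    exact Commute.zero_right _
  rw [opFamily_of_ne f hu, opFamily_of_ne f' hv]
  exact h _ _

end

section blocks

variable {P : Type*} [Fintype P] {𝔾 : GradingDatum G} {D : CoeffDatum P 𝔾}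
  (gr : G → Submodule k A) [DirectSum.Decomposition gr] {γ : D.Mon → Cochain A} (hγ : γ 0 = 0)

/-- The exponential of the insertion of `γ`, applied to a cochain. -/
noncomputable def expInsert (γ : D.Mon → Cochain A) (η : Cochain A) : D.Mon → Cochain A :=
  hatExp (opFamily (circRight 𝔾 gr) γ) (const₀ η)

theorem isLinearMap_hatExp {X : Type*} [AddCommGroup X] [Module k X] {T : D.Mon → Module.End k X}
    (hT : T 0 = 0) : IsLinearMap k fun x : D.Mon → X => hatExp T x :=
  ⟨hatExp_add_apply hT, fun c x => by
    rw [hatExp, hatExp]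
    simp only [map_smul]
    exact (compLeft_expSum (c • (LinearMap.id : X →ₗ[k] X)) (suppIn_hatExp hT x)).symm⟩

include hγ in
theorem isLinearMap_expInsert : IsLinearMap k fun η : Cochain A => expInsert gr γ η := by
  have h := isLinearMap_hatExp (k := k) (opFamily_of_eq (circRight (k := k) 𝔾 gr) hγ)
  refine ⟨fun η ξ => ?_, fun c η => ?_⟩
  · rw [expInsert, const₀_add, h.map_add]
    rfl
  · rw [expInsert, show const₀ (D := D) (c • η) = c • const₀ η from Pi.single_smul _ _ _, h.map_smul]
    rfl

/-- The linear map `a ↦ exp(γ) η(a, …)`, with values at fixed arguments. -/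
noncomputable def expInsertSlot {η : Cochain A} (hη : η ∈ ML k A) (u : D.Mon) (l : List A) :
    A →ₗ[k] A where
  toFun a := expInsert gr γ (fun z => η (a :: z)) u l
  map_add' a b := by
    rw [show (fun z => η ((a + b) :: z)) = (fun z => η (a :: z)) + fun z => η (b :: z) from
      funext fun z => (hη [] z).map_add a b, (isLinearMap_expInsert gr hγ).map_add]
    rfl
  map_smul' c a := by
    rw [show (fun z => η ((c • a) :: z)) = c • fun z => η (a :: z) from
      funext fun z => (hη [] z).map_smul c a, (isLinearMap_expInsert gr hγ).map_smul]
    rfl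

include hγ in
theorem expInsert_comp (L : A →ₗ[k] A) (η : Cochain A) (u : D.Mon) (l : List A) :
    expInsert gr γ (fun x => L (η x)) u l = L (expInsert gr γ η u l) := by
  have h := hatExp_map (opFamily_of_eq (circRight (k := k) 𝔾 gr) hγ) (L.compLeft (List A))
    (opFamily_intertwine (circRight 𝔾 gr) (f' := circRight 𝔾 gr) fun ψ φ =>
      funext fun l => (circ_comp 𝔾 gr L 0 φ ψ l).symm) (const₀ η)
  rw [map_const₀] at h
  exact (congrFun (congrFun h u) l).symm

include hγ in
-- Insertion obeys a Leibniz rule with two commuting summands, so its exponential is a product of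
-- exponentials acting on the first block and on the rest. On the first block it turns the identity
-- into the homomorphism `exp(γ) id`.
theorem expInsert_eq [CharZero k] {η : Cochain A} (hη : η ∈ ML k A) (u : D.Mon) (l : List A) :
    expInsert gr γ η u l = const₀ (D := D) (curvaturePart η) u l +
      ∑ v ∈ Finset.HasAntidiagonal.antidiagonal u, splitSum (fun x y =>
        expInsert gr γ (fun z => η (expInsert gr γ idCochain v.1 x :: z)) v.2 y) l := by
  have h0 := opFamily_of_eq (circRight (k := k) 𝔾 gr) hγ
  have h1 := opFamily_of_eq (circRight₁ (k := k) 𝔾 gr) hγ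
  have h2 := opFamily_of_eq (circRight₂ (k := k) 𝔾 gr) hγ
  set Θ : List A → List A → A := fun x y => η (idCochain x :: y) with hΘ
  -- Nothing can be inserted in a cochain without inputs.
  have hε : hatExp (opFamily (circRight (k := k) 𝔾 gr) γ) (const₀ (curvaturePart η)) =
      const₀ (curvaturePart η) := by
    refine hatExp_of_hatOp_eq_zero h0 (funext fun v => ?_)
    rw [hatOp_const₀]
    by_cases hv : γ v = 0
    · rw [opFamily_of_eq _ hv]
      rfl
    · rw [opFamily_of_ne _ hv]
      exact circ_curvaturePart 𝔾 gr 0 η (γ v)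
  -- The exponentiated Leibniz rule: the exponential commutes with summation over cuts and factors
  -- into the two commuting insertions.
  have hS := hatExp_map (T := opFamily (fun ψ => circRight₁ (k := k) 𝔾 gr ψ + circRight₂ 𝔾 gr ψ) γ)
    (opFamily_of_eq _ hγ) (splitLinear k A) (opFamily_intertwine _ (f' := circRight 𝔾 gr)
      fun ψ Θ => (circ_splitLinear 𝔾 gr ψ Θ).symm) (const₀ Θ)
  rw [map_const₀, opFamily_add, hatExp_add h1 h2
    (commute_opFamily _ fun ψ ψ' => commute_circRight₁_circRight₂ 𝔾 gr ψ ψ')] at hS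
  -- The exponential on the second list treats the first list as a parameter, which enters linearly
  -- through the value of the identity cochain.
  have hZ : ∀ v x y, hatExp (opFamily (circRight₂ (k := k) 𝔾 gr) γ) (const₀ Θ) v x y =
      expInsertSlot gr hγ hη v y (idCochain x) := by
    intro v x y
    have h := hatExp_map h2 (LinearMap.proj x : (List A → List A → A) →ₗ[k] Cochain A) (opFamily_intertwine _ (f' := circRight 𝔾 gr)
      fun ψ Θ => rfl) (const₀ Θ)
    rw [map_const₀] at h
    exact congrFun (congrFun h v) y
  conv_lhs => rw [expInsert, eq_curvaturePart_add hη, const₀_add, hatExp_add_apply h0, hε, ← hΘ, ← hS]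
  change _ + splitSum (hatExp _ (hatExp _ (const₀ Θ)) u) l = _
  rw [← splitSum_sum]
  refine congrArg _ (splitSum_congr fun x y _ => ?_)
  let ev : (List A → List A → A) →ₗ[k] Cochain A :=
    ⟨⟨fun Θ x => Θ x y, fun _ _ => rfl⟩, fun _ _ => rfl⟩
  have h := hatExp_map h1 ev
    (opFamily_intertwine _ (f' := circRight 𝔾 gr) fun ψ Θ => rfl)
    (hatExp (opFamily (circRight₂ (k := k) 𝔾 gr) γ) (const₀ Θ))
  refine (congrFun (congrFun h u) x).trans ?_
  rw [hatExp_eq_sum h0, Finset.sum_apply]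
  refine (sum_antidiagonal_swap (fun v w => hatExp (opFamily (circRight (k := k) 𝔾 gr) γ)
    (const₀ fun x => hatExp (opFamily (circRight₂ (k := k) 𝔾 gr) γ) (const₀ Θ) v x y) w x) u).trans ?_
  refine Finset.sum_congr rfl fun v _ => ?_
  simp only [hZ]
  exact expInsert_comp gr hγ _ idCochain v.1 x

include hγ in
theorem expInsert_zero {η : Cochain A} : expInsert gr γ η 0 = η := by
  rw [expInsert, hatExp_apply_zero (opFamily_of_eq _ hγ), const₀_zero]

end blocks

end Insertion

end Ainf

namespace Ainf

open CoeffDatum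

/-! ### Cutting the inputs into labelled blocks -/

section blocks

variable {P : Type*} [Fintype P] {G : Type*} [AddCommGroup G]
  {𝔾 : GradingDatum G} {D : CoeffDatum P 𝔾} {k : Type*} [Field k]
  {A : Type*} [AddCommGroup A] [Module k A]

theorem ML.cons {η : Cochain A} (hη : η ∈ ML k A) (a : A) : (fun z => η (a :: z)) ∈ ML k A :=
  fun l₁ l₂ => hη (a :: l₁) l₂

/-- `q` cuts `l` into consecutive blocks, labelled by elements of the monoid with sum `u`, and no
empty block is labelled by `0`. -/
def IsBlocks (u : D.Mon) (l : List A) (q : List (List A × D.Mon)) : Prop :=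
  (q.map Prod.snd).sum = u ∧ (q.map Prod.fst).flatten = l ∧ ([], 0) ∉ q

theorem isBlocks_nil {u : D.Mon} {l : List A} : IsBlocks u l [] ↔ u = 0 ∧ l = [] := by
  simp [IsBlocks, eq_comm]

theorem isBlocks_cons {u : D.Mon} {l : List A} {b : List A × D.Mon} {q : List (List A × D.Mon)} :
    IsBlocks u l (b :: q) ↔ ∃ w l', b.2 + w = u ∧ b.1 ++ l' = l ∧ b ≠ ([], 0) ∧ IsBlocks w l' q := by
  constructor
  · rintro ⟨h1, h2, h3⟩
    exact ⟨_, _, h1, h2, fun h => h3 (h ▸ List.mem_cons_self), rfl, rfl,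
      fun h => h3 (List.mem_cons_of_mem _ h)⟩
  · rintro ⟨_, _, rfl, rfl, h, rfl, rfl, h'⟩
    exact ⟨rfl, rfl, fun hm => (List.mem_cons.1 hm).elim (fun e => h e.symm) h'⟩

open Classical in
-- An empty first block labelled by `0` contributes nothing, because `F` has no constant curvature.
-- Discarding it makes the recursion on blocks terminate.
theorem sum_eq_sum_filter_blocks {F : D.Mon → Cochain A} (hF : F 0 [] = 0)
    {E : Cochain A → D.Mon → Cochain A} (hE0 : E 0 = 0) {η : Cochain A} (hη : η ∈ ML k A)
    (u : D.Mon) (l : List A) :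
    ∑ v ∈ Finset.HasAntidiagonal.antidiagonal u, splitSum (fun x y =>
        E (fun z => η (F v.1 x :: z)) v.2 y) l =
      ∑ j ∈ (Finset.HasAntidiagonal.antidiagonal u ×ˢ Finset.range (l.length + 1)) with
        (l.take j.2, j.1.1) ≠ ([], 0),
        E (fun z => η (F j.1.1 (l.take j.2) :: z)) j.1.2 (l.drop j.2) := by
  classical
  simp only [splitSum_eq_sum]
  rw [← Finset.sum_product', Finset.sum_filter_of_ne]
  rintro ⟨v, i⟩ _ hne h
  refine hne ?_
  rw [Prod.mk.injEq] at h
  have h0 : (fun z => η (F v.1 (l.take i) :: z)) = 0 := by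
    funext z
    rw [h.1, h.2, hF]
    exact ML.map_zero hη [] z
  change E (fun z => η (F v.1 (l.take i) :: z)) v.2 (l.drop i) = 0
  rw [h0, hE0]
  rfl

/-- A family satisfying the recursion obtained by splitting off the first block is given by the sum
over all the ways of cutting the list of inputs into blocks. -/
theorem exists_sum_blocks {F : D.Mon → Cochain A} (hF : F 0 [] = 0) {U : Set D.Mon}
    (hU : ∀ v w, v + w ∈ U → w ∈ U) {E : Cochain A → D.Mon → Cochain A} (hE0 : E 0 = 0)
    (hE : ∀ η ∈ ML k A, ∀ u ∈ U, ∀ l, E η u l = const₀ (D := D) (curvaturePart η) u l +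
      ∑ v ∈ Finset.HasAntidiagonal.antidiagonal u, splitSum (fun x y =>
        E (fun z => η (F v.1 x :: z)) v.2 y) l) (u : D.Mon) (hu : u ∈ U) (l : List A) :
    ∃ s : Finset (List (List A × D.Mon)), (∀ q, q ∈ s ↔ IsBlocks u l q) ∧
      ∀ η ∈ ML k A, ∑ q ∈ s, η (q.map fun b => F b.2 b.1) = E η u l := by
  classical
  -- Removing the first block either lowers the monomial to a proper divisor or, if the block is
  -- labelled by `0`, shortens the list, since such a block is not empty.
  induction u using Mon.divisor_induction generalizing l with
  | h u ihu =>
  induction hn : l.length using Nat.strong_induction_on generalizing l with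
  | h n ihl =>
  subst hn
  set J := (Finset.HasAntidiagonal.antidiagonal u ×ˢ Finset.range (l.length + 1)).filter
    fun j => (l.take j.2, j.1.1) ≠ ([], 0) with hJ
  have hJm : ∀ j, j ∈ J ↔ (j.1.1 + j.1.2 = u ∧ j.2 < l.length + 1) ∧
      (l.take j.2, j.1.1) ≠ ([], 0) := by
    intro j
    rw [hJ, Finset.mem_filter, Finset.mem_product, Finset.HasAntidiagonal.mem_antidiagonal,
      Finset.mem_range]
  have ih : ∀ j, ∃ s : Finset (List (List A × D.Mon)), j ∈ J →
      (∀ q, q ∈ s ↔ IsBlocks j.1.2 (l.drop j.2) q) ∧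
      ∀ η ∈ ML k A, ∑ q ∈ s, η (q.map fun b => F b.2 b.1) = E η j.1.2 (l.drop j.2) := by
    intro j
    by_cases hj : j ∈ J
    · obtain ⟨⟨h1, h2⟩, h3⟩ := (hJm j).1 hj
      by_cases h0 : j.1.1 = 0
      · have h4 : j.1.2 = u := by rw [← h1, h0, zero_add]
        have h5 : j.2 ≠ 0 := by
          rintro h5
          exact h3 (by rw [h5, h0, List.take_zero])
        have h6 : l ≠ [] := by
          rintro rfl
          exact h3 (by rw [h0, List.take_nil])
        have h7 := List.length_pos_iff.2 h6
        obtain ⟨s, hs⟩ := ihl (l.drop j.2).length (by rw [List.length_drop]; omega) _ rfl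
        exact ⟨s, fun _ => by rwa [h4]⟩
      · obtain ⟨s, hs⟩ := ihu j.1.2 j.1.1 (by rw [add_comm, h1]) h0 (hU j.1.1 _ (by rwa [h1])) (l.drop j.2)
        exact ⟨s, fun _ => hs⟩
    · exact ⟨∅, fun h => absurd h hj⟩
  choose s hs using ih
  let cons' : (D.Mon × D.Mon) × ℕ → List (List A × D.Mon) ↪ List (List A × D.Mon) := fun j =>
    ⟨fun q => (l.take j.2, j.1.1) :: q, List.cons_injective⟩
  have hdisj : Set.PairwiseDisjoint (J : Set ((D.Mon × D.Mon) × ℕ)) fun j => (s j).map (cons' j) := by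
    intro i hi j hj hne
    refine Finset.disjoint_left.2 fun q h1 h2 => hne ?_
    obtain ⟨q₁, h1, rfl⟩ := Finset.mem_map.1 h1
    obtain ⟨q₂, h2, h3⟩ := Finset.mem_map.1 h2
    obtain ⟨h4, rfl⟩ := List.cons.inj h3
    have hi := ((hJm i).1 hi).1
    have hj := ((hJm j).1 hj).1
    have h5 := congrArg (fun b : List A × D.Mon => b.1.length) h4
    simp only [List.length_take] at h5
    have h6 : j.1.1 = i.1.1 := congrArg Prod.snd h4
    refine Prod.ext (Prod.ext h6.symm ?_) (by omega)
    have h7 : i.1.1 + i.1.2 = i.1.1 + j.1.2 := by rw [hi.1, ← h6, hj.1]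
    exact add_left_cancel h7
  -- The empty family of blocks accounts for the curvature term, and the other families are sorted
  -- by their first block.
  refine ⟨(if u = 0 ∧ l = [] then {[]} else ∅) ∪ J.biUnion fun j => (s j).map (cons' j), ?_, ?_⟩
  · intro q
    rw [Finset.mem_union, Finset.mem_biUnion]
    rcases q with _ | ⟨b, q⟩
    · rw [isBlocks_nil]
      constructor
      · rintro (h | ⟨j, _, h⟩)
        · by_contra hc
          rw [if_neg hc] at h
          exact absurd h (Finset.notMem_empty _)
        · obtain ⟨q, _, h⟩ := Finset.mem_map.1 h
          exact absurd h (List.cons_ne_nil _ _)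
      · intro h
        rw [if_pos h]
        exact Or.inl (Finset.mem_singleton_self _)
    · rw [isBlocks_cons]
      constructor
      · rintro (h | ⟨j, hj, h⟩)
        · split_ifs at h
          · exact absurd (Finset.mem_singleton.1 h) (List.cons_ne_nil _ _)
          · exact absurd h (Finset.notMem_empty _)
        · obtain ⟨q', h1, h2⟩ := Finset.mem_map.1 h
          obtain ⟨rfl, rfl⟩ := List.cons.inj h2
          exact ⟨j.1.2, l.drop j.2, ((hJm j).1 hj).1.1, List.take_append_drop _ _, ((hJm j).1 hj).2,
            ((hs j hj).1 _).1 h1⟩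
      · rintro ⟨w, l', h1, rfl, h3, h4⟩
        have hj : ((b.2, w), b.1.length) ∈ J := by
          rw [hJm]
          refine ⟨⟨h1, ?_⟩, ?_⟩
          · rw [List.length_append]
            exact Nat.lt_succ_of_le (Nat.le_add_right _ _)
          · rwa [List.take_left]
        refine Or.inr ⟨_, hj, Finset.mem_map.2 ⟨q, ((hs _ hj).1 q).2 ?_, ?_⟩⟩
        · rwa [List.drop_left]
        · change (_, _) :: q = _
          rw [List.take_left]
  · intro η hη
    rw [Finset.sum_union, Finset.sum_biUnion hdisj, hE η hη u hu l,
      sum_eq_sum_filter_blocks hF hE0 hη]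
    · congr 1
      · by_cases h0 : u = 0
        · subst h0
          rw [const₀_zero]
          rcases l with _ | ⟨a, l⟩ <;> simp [curvaturePart]
        · rw [const₀_of_ne h0, if_neg fun h => h0 h.1]
          rfl
      · refine Finset.sum_congr (by rw [hJ]) fun j hj => ?_
        rw [Finset.sum_map]
        exact (hs j hj).2 _ (ML.cons hη _)
    · refine Finset.disjoint_left.2 fun q h1 h2 => ?_
      obtain ⟨j, _, h2⟩ := Finset.mem_biUnion.1 h2
      obtain ⟨q', _, rfl⟩ := Finset.mem_map.1 h2
      split_ifs at h1
      · exact absurd (Finset.mem_singleton.1 h1) (List.cons_ne_nil _ _)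
      · exact absurd h1 (Finset.notMem_empty _)

/-- The left hand side of the equation for `A∞` homomorphisms, evaluated by means of the recursion
obtained by splitting off the first block. -/
theorem finsum_blocks {F : D.Mon → Cochain A} (hF : F 0 [] = 0) {U : Set D.Mon}
    (hU : ∀ v w, v + w ∈ U → w ∈ U) {E : Cochain A → D.Mon → Cochain A} (hE0 : E 0 = 0)
    (hE : ∀ η ∈ ML k A, ∀ u ∈ U, ∀ l, E η u l = const₀ (D := D) (curvaturePart η) u l +
      ∑ v ∈ Finset.HasAntidiagonal.antidiagonal u, splitSum (fun x y =>
        E (fun z => η (F v.1 x :: z)) v.2 y) l) {m : D.Mon → Cochain A} (hm : ∀ u, m u ∈ ML k A)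
    {u : D.Mon} (hu : u ∈ U) (l : List A) :
    ∑ᶠ q : {q : D.Mon × List (List A × D.Mon) //
        q.1 + (q.2.map Prod.snd).sum = u ∧ (q.2.map Prod.fst).flatten = l},
      m q.1.1 (q.1.2.map fun b => F b.2 b.1) =
    ∑ v ∈ Finset.HasAntidiagonal.antidiagonal u, E (m v.1) v.2 l := by
  classical
  have h1 : ∀ v : D.Mon × D.Mon, ∃ s : Finset (List (List A × D.Mon)),
      v ∈ Finset.HasAntidiagonal.antidiagonal u → (∀ q, q ∈ s ↔ IsBlocks v.2 l q) ∧
      ∀ η ∈ ML k A, ∑ q ∈ s, η (q.map fun b => F b.2 b.1) = E η v.2 l := by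
    intro v
    by_cases hv : v ∈ Finset.HasAntidiagonal.antidiagonal u
    · obtain ⟨s, hs⟩ := exists_sum_blocks hF hU hE0 hE v.2
        (hU v.1 v.2 (by rwa [Finset.HasAntidiagonal.mem_antidiagonal.1 hv])) l
      exact ⟨s, fun _ => hs⟩
    · exact ⟨∅, fun h => absurd h hv⟩
  choose s hs using h1
  have h2 : ∑ v ∈ Finset.HasAntidiagonal.antidiagonal u, E (m v.1) v.2 l =
      ∑ q ∈ ((Finset.HasAntidiagonal.antidiagonal u).sigma s).image fun q => (q.1.1, q.2),
        m q.1 (q.2.map fun b => F b.2 b.1) := by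
    rw [Finset.sum_image, Finset.sum_sigma]
    · exact Finset.sum_congr rfl fun v hv => ((hs v hv).2 _ (hm v.1)).symm
    · rintro ⟨v, q⟩ hv ⟨w, q'⟩ hw h
      have hv := (Finset.mem_sigma.1 hv).1
      have hw := (Finset.mem_sigma.1 hw).1
      rw [Finset.HasAntidiagonal.mem_antidiagonal] at hv hw
      obtain ⟨h3, rfl⟩ := Prod.mk.inj h
      have h4 : v = w := by
        refine Prod.ext h3 ?_
        have h7 : v.1 + v.2 = v.1 + w.2 := by rw [hv, show v.1 = w.1 from h3, hw]
        exact add_left_cancel h7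
      subst h4
      rfl
  let f : D.Mon × List (List A × D.Mon) → A := fun q => m q.1 (q.2.map fun b => F b.2 b.1)
  rw [h2, ← finsum_mem_coe_finset]
  refine Eq.trans (finsum_set_coe_eq_finsum_mem (f := f)
    {q | q.1 + (q.2.map Prod.snd).sum = u ∧ (q.2.map Prod.fst).flatten = l}) ?_
  refine finsum_mem_inter_support_eq' _ _ _ ?_
  rintro ⟨v, q⟩ hq
  rw [Set.mem_ofPred_eq, Finset.mem_coe, Finset.mem_image]
  -- A family that contains an empty block labelled by `0` gives zero, so the formally infinite sum
  -- has its support among the finitely many genuine families of blocks.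
  have hn : ([], 0) ∉ q := by
    intro h
    obtain ⟨q₁, q₂, rfl⟩ := List.append_of_mem h
    refine hq ?_
    change m v ((q₁ ++ ([], 0) :: q₂).map fun b => F b.2 b.1) = 0
    rw [List.map_append, List.map_cons, hF]
    exact ML.map_zero (hm v) _ _
  constructor
  · rintro ⟨h1, h2⟩
    have hv : ((v, (q.map Prod.snd).sum) : D.Mon × D.Mon) ∈ Finset.HasAntidiagonal.antidiagonal u :=
      Finset.HasAntidiagonal.mem_antidiagonal.2 h1
    exact ⟨⟨(v, (q.map Prod.snd).sum), q⟩,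
      Finset.mem_sigma.2 ⟨hv, ((hs _ hv).1 q).2 ⟨rfl, h2, hn⟩⟩, rfl⟩
  · rintro ⟨⟨w, q'⟩, h, h'⟩
    obtain ⟨rfl, rfl⟩ := Prod.mk.inj h'
    obtain ⟨hv, h⟩ := Finset.mem_sigma.1 h
    obtain ⟨h1, h2, _⟩ := ((hs _ hv).1 _).1 h
    exact ⟨by rw [h1]; exact Finset.HasAntidiagonal.mem_antidiagonal.1 hv, h2⟩

end blocks

end Ainf

namespace Ainf

open CoeffDatum

/-! ### From gauge transformations to `A∞` homomorphisms -/

section flow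

variable {P : Type*} [Fintype P] [DecidableEq P] {G : Type*} [AddCommGroup G] [DecidableEq G]
  {𝔾 : GradingDatum G} {D : CoeffDatum P 𝔾} {k : Type*} [Field k] [CharZero k]
  {A : Type*} [AddCommGroup A] [Module k A]
  (gr : G → Submodule k A) [DirectSum.Decomposition gr]

/-- The iterated brackets `[γ, [γ, … [γ, m]]]`. -/
noncomputable def adIter (γ m : D.Mon → Cochain A) : ℕ → D.Mon → Cochain A
  | 0 => m
  | n + 1 => fun u => ∑ v ∈ Finset.HasAntidiagonal.antidiagonal u,
      gbr 𝔾 gr 0 1 (γ v.1) (adIter γ m n v.2)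

variable {gr} {γ m : D.Mon → Cochain A}

theorem gbr_of_even_odd (φ ψ : Cochain A) :
    gbr 𝔾 gr 0 1 φ ψ = circ 𝔾 gr 1 φ ψ - circ 𝔾 gr 0 ψ φ := by
  rw [gbr, zero_mul, sgn_zero, one_smul]

theorem adIter_mem (hγ : ∀ u, γ u ∈ CC 𝔾 gr (0 - D.deg u))
    (hm : ∀ u, m u ∈ CC 𝔾 gr (𝔾.ι 1 - D.deg u)) (n : ℕ) (u : D.Mon) :
    adIter gr γ m n u ∈ CC 𝔾 gr (𝔾.ι 1 - D.deg u) := by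
  induction n generalizing u with
  | zero => exact hm u
  | succ n ih =>
    refine Submodule.sum_mem _ fun v hv => ?_
    rw [Finset.HasAntidiagonal.mem_antidiagonal] at hv
    have h := gbr_mem 𝔾 gr (s := 0) (t := 1) (hγ v.1) (ih v.2)
    rwa [← hv, deg_add, show 𝔾.ι 1 - (D.deg v.1 + D.deg v.2) =
      0 - D.deg v.1 + (𝔾.ι 1 - D.deg v.2) by abel]

theorem suppIn_adIter (hγ : ∀ u, γ u ∈ CC 𝔾 gr (0 - D.deg u)) (hγ0 : γ 0 = 0)
    (hm : ∀ u, m u ∈ CC 𝔾 gr (𝔾.ι 1 - D.deg u)) (n : ℕ) :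
    SuppIn (D.pow n) (adIter gr γ m n) := by
  induction n with
  | zero => exact suppIn_pow_zero _
  | succ n ih =>
    intro u hu
    refine Finset.sum_eq_zero fun v hv => ?_
    rw [Finset.HasAntidiagonal.mem_antidiagonal] at hv
    by_cases h1 : γ v.1 = 0
    · rw [h1, gbr_of_even_odd, circ_zero_left, circ_zero_right 0 (adIter_mem hγ hm n v.2).1, sub_zero]
    · have h2 : adIter gr γ m n v.2 = 0 := ih _ fun h2 => hu ?_
      · rw [h2, gbr_of_even_odd, circ_zero_left, circ_zero_right 1 (hγ v.1).1, sub_zero]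
      · rw [← hv, add_comm n]
        refine add_mem_pow (mem_pow_one.2 fun h => h1 ?_) h2
        rw [h, hγ0]

/-- The operator `φ ↦ φ ∘ ψ`, for `ψ` of odd parity. -/
noncomputable def circRightOdd (𝔾 : GradingDatum G) (gr : G → Submodule k A)
    [DirectSum.Decomposition gr] (ψ : Cochain A) : Module.End k (Cochain A) where
  toFun φ := circ 𝔾 gr 1 φ ψ
  map_add' φ φ' := circ_add_left 𝔾 gr 1 φ φ' ψ
  map_smul' c φ := circ_smul_left 𝔾 gr 1 c φ ψ

theorem circRightOdd_apply (ψ φ : Cochain A) : circRightOdd 𝔾 gr ψ φ = circ 𝔾 gr 1 φ ψ := rfl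

variable (gr) in
/-- The operator `x ↦ x ∘ γ` on formal sums of cochains. -/
noncomputable abbrev insertOp (γ : D.Mon → Cochain A) : Module.End k (D.Mon → Cochain A) :=
  hatOp (opFamily (circRight 𝔾 gr) γ)

theorem opFamily_circRight {φ : Cochain A} (hφ : φ ∈ ML k A) (u : D.Mon) :
    opFamily (circRight 𝔾 gr) γ u φ = circ 𝔾 gr 0 φ (γ u) := by
  by_cases hu : γ u = 0
  · rw [opFamily_of_eq _ hu, hu, circ_zero_right 0 hφ]
    rfl
  · rw [opFamily_of_ne _ hu]
    rfl

theorem insertOp_mem_ML (hγ : ∀ u, γ u ∈ CC 𝔾 gr (0 - D.deg u)) {x : D.Mon → Cochain A}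
    (hx : ∀ u, x u ∈ ML k A) (u : D.Mon) : insertOp gr γ x u ∈ ML k A := by
  refine Submodule.sum_mem _ fun v _ => ?_
  change opFamily (circRight 𝔾 gr) γ v.1 (x v.2) ∈ _
  rw [opFamily_circRight (hx _)]
  exact circ_mem_ML 𝔾 gr 0 (hx _) (hγ _).1

/-- By the pre-Lie identity, the commutator of insertion of `m` with insertion of `γ` is insertion
of the bracket `[γ, m]`. -/
theorem circRightOdd_insertOp (hγ : ∀ u, γ u ∈ CC 𝔾 gr (0 - D.deg u))
    (hm : ∀ u, m u ∈ CC 𝔾 gr (𝔾.ι 1 - D.deg u)) (n : ℕ) {x : D.Mon → Cochain A}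
    (hx : ∀ u, x u ∈ ML k A) :
    hatOp (fun u => circRightOdd 𝔾 gr (adIter gr γ m n u)) (insertOp gr γ x) =
      insertOp gr γ (hatOp (fun u => circRightOdd 𝔾 gr (adIter gr γ m n u)) x) +
        hatOp (fun u => circRightOdd 𝔾 gr (adIter gr γ m (n + 1) u)) x := by
  have h1 : hatOp (fun u => circRightOdd 𝔾 gr (adIter gr γ m (n + 1) u)) x =
      conv₃ (fun a b c => circ 𝔾 gr 1 c (gbr 𝔾 gr 0 1 a b)) γ (adIter gr γ m n) x := by
    funext u
    refine Finset.sum_congr rfl fun v _ => ?_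
    change circ 𝔾 gr 1 (x v.2) (∑ w ∈ _, _) = _
    exact map_sum ((⟨⟨circ 𝔾 gr 1 (x v.2), circ_add_right 𝔾 gr 1 (hx _)⟩,
      circ_smul_right 𝔾 gr 1 (hx _)⟩ : Cochain A →ₗ[k] Cochain A)) _ _
  rw [insertOp, hatOp_hatOp, hatOp_hatOp, h1, conv₃_swap_left]
  funext u
  rw [Pi.add_apply, conv₃, conv₃, conv₃, ← Finset.sum_add_distrib]
  refine Finset.sum_congr rfl fun v _ => ?_
  rw [← Finset.sum_add_distrib]
  refine Finset.sum_congr rfl fun w _ => ?_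
  have hφ := adIter_mem hγ hm n w.2
  rw [circRightOdd_apply, circRightOdd_apply, opFamily_circRight (hx _),
    opFamily_circRight (circ_mem_ML 𝔾 gr 1 (hx _) hφ.1), gbr_of_even_odd,
    circ_sub_right 𝔾 gr 1 (hx _), ← sub_eq_iff_eq_add']
  have h := circ_preLie 𝔾 gr (hx v.2) (hγ w.1) hφ
  rw [par_sub_deg, par_sub_deg, par_ι_one, map_zero, zero_mul, zero_add, sgn_zero, one_smul] at h
  rw [sub_eq_sub_iff_add_eq_add] at h ⊢
  rw [← sub_eq_zero] at h ⊢
  rw [← h]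
  abel

/-- Moving the insertion past a power of `insertOp` distributes the iterated brackets binomially. -/
theorem circRightOdd_insertOp_pow (hγ : ∀ u, γ u ∈ CC 𝔾 gr (0 - D.deg u))
    (hm : ∀ u, m u ∈ CC 𝔾 gr (𝔾.ι 1 - D.deg u)) (j n : ℕ) {x : D.Mon → Cochain A}
    (hx : ∀ u, x u ∈ ML k A) :
    hatOp (fun u => circRightOdd 𝔾 gr (adIter gr γ m n u)) ((insertOp gr γ ^ j) x) =
      ∑ ij ∈ Finset.HasAntidiagonal.antidiagonal j, j.choose ij.1 • (insertOp gr γ ^ ij.1)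
        (hatOp (fun u => circRightOdd 𝔾 gr (adIter gr γ m (n + ij.2) u)) x) := by
  induction j generalizing x n with
  | zero => simp
  | succ j ih =>
    rw [pow_succ, Module.End.mul_apply, ih n (insertOp_mem_ML hγ hx),
      Finset.sum_antidiagonal_choose_succ_nsmul (fun i i' => (insertOp gr γ ^ i)
        (hatOp (fun u => circRightOdd 𝔾 gr (adIter gr γ m (n + i') u)) x))]
    simp only [circRightOdd_insertOp hγ hm _ hx, map_add, smul_add, Finset.sum_add_distrib]
    rw [add_comm]
    refine congrArg₂ _ rfl (Finset.sum_congr rfl ?_)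
    rintro ⟨i, i'⟩ hij
    rw [Nat.choose_symm_of_eq_add (Finset.HasAntidiagonal.mem_antidiagonal.1 hij).symm, pow_succ,
      Module.End.mul_apply]

theorem idCochain_mem : idCochain ∈ CC 𝔾 gr 0 := by
  refine ⟨fun l₁ l₂ => ?_, fun xs l h => ?_⟩
  · rcases l₁ with _ | ⟨b, l₁⟩
    · rcases l₂ with _ | ⟨c, l₂⟩
      · exact LinearMap.id.isLinear
      · exact (0 : A →ₗ[k] A).isLinear
    · rcases l₁ with _ | ⟨c, l₁⟩ <;> exact (0 : A →ₗ[k] A).isLinear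
  · rcases h with _ | ⟨h1, h2⟩
    · exact zero_mem _
    · rcases h2 with _ | ⟨h2, h3⟩
      · simpa [idCochain] using h1
      · exact zero_mem _

theorem const₀_mem_Hat {V : Type*} [AddCommGroup V] [Module k V] {gr : G → Submodule k V} {z : G}
    {x : V} (hx : x ∈ gr z) : const₀ x ∈ D.Hat gr z := by
  refine ⟨fun u => ?_, fun n => (Set.finite_singleton 0).subset fun u hu => ?_⟩
  · by_cases hu : u = 0
    · subst hu
      rwa [const₀_zero, deg_zero, sub_zero]
    · rw [const₀_of_ne hu]
      exact zero_mem _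
  · by_contra h
    exact hu.1 (const₀_of_ne h x)

/-- Operators are graded by the degree by which they shift cochains, so that the general statement
on convolutions applies. -/
theorem insertOp_mem_Hat (hγ : γ ∈ D.Hat (CC 𝔾 gr) 0) {x : D.Mon → Cochain A} {z : G}
    (hx : x ∈ D.Hat (CC 𝔾 gr) z) : insertOp gr γ x ∈ D.Hat (CC 𝔾 gr) z := by
  let gr' : G → Submodule k (Module.End k (Cochain A)) := fun y =>
    { carrier := {T | ∀ z, ∀ φ ∈ CC 𝔾 gr z, T φ ∈ CC 𝔾 gr (y + z)}
      zero_mem' := fun _ _ _ => zero_mem _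
      add_mem' := fun h h' z φ hφ => add_mem (h z φ hφ) (h' z φ hφ)
      smul_mem' := fun c _ h z φ hφ => Submodule.smul_mem _ c (h z φ hφ) }
  have hT : opFamily (circRight 𝔾 gr) γ ∈ D.Hat gr' 0 := by
    refine ⟨fun u y φ hφ => ?_, fun n => (hγ.2 n).subset fun u hu =>
      ⟨fun h => hu.1 (opFamily_of_eq _ h), hu.2⟩⟩
    rw [opFamily_circRight hφ.1, add_comm]
    exact circ_mem 𝔾 gr 0 hφ (hγ.1 u)
  have h := conv_mem_Hat (B := LinearMap.id) (gr₁ := gr') (gr₂ := CC 𝔾 gr) (gr₃ := CC 𝔾 gr)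
    (fun y z T hT φ hφ => hT z φ hφ) hT hx
  rwa [zero_add] at h

/-- With `F = exp(γ) id`, moving the insertion of `m` through the exponential turns `F ∘ m` into the
exponential of insertion applied to `e^{ad γ} m`, since inserting into the identity does nothing. -/
theorem adIter_sum (hγ : ∀ u, γ u ∈ CC 𝔾 gr (0 - D.deg u)) (hγ0 : γ 0 = 0)
    (hm : ∀ u, m u ∈ CC 𝔾 gr (𝔾.ι 1 - D.deg u)) :
    hatOp (fun u => circRightOdd 𝔾 gr (m u)) (expInsert gr γ idCochain) =
      hatExp (opFamily (circRight 𝔾 gr) γ) (expSum k (adIter gr γ m)) := by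
  have hid : ∀ u : D.Mon, const₀ (D := D) idCochain u ∈ ML k A := fun u =>
    ((const₀_mem_Hat (idCochain_mem (𝔾 := 𝔾) (gr := gr))).1 u).1
  have h0 := opFamily_of_eq (circRight (k := k) 𝔾 gr) hγ0
  rw [expInsert, hatExp, hatOp_expSum _ (suppIn_hatExp h0 _),
    hatExp_expSum h0 (suppIn_adIter hγ hγ0 hm)]
  congr 1
  funext n
  refine (circRightOdd_insertOp_pow hγ hm n 0 hid).trans ?_
  refine Finset.sum_congr rfl fun ij _ => ?_
  congr 2
  funext u
  rw [zero_add, hatOp_const₀]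
  exact circ_idCochain 𝔾 gr 1 _

/-- The `A∞` homomorphism obtained by exponentiating `γ`. -/
theorem isHom_expInsert (hγ : γ ∈ D.HatM (CC 𝔾 gr) 0)
    (hm : ∀ u, m u ∈ CC 𝔾 gr (𝔾.ι 1 - D.deg u)) {m' : D.Mon → Cochain A}
    (hm' : expSum k (adIter gr γ m) = m') (hML : ∀ u, m' u ∈ ML k A) :
    IsHom gr m m' (expInsert gr γ idCochain) := by
  have h0 := opFamily_of_eq (circRight (k := k) 𝔾 gr) hγ.2
  refine ⟨?_, expInsert_zero gr hγ.2, fun u l => ?_⟩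
  · refine expSum_mem_Hat (suppIn_hatExp h0 _) fun n => ?_
    induction n with
    | zero => exact const₀_mem_Hat idCochain_mem
    | succ n ih =>
      rw [pow_succ', Module.End.mul_apply]
      exact insertOp_mem_Hat hγ.1 ih
  -- The sum over blocks is the exponential of insertion applied to `m'`, because the two satisfy
  -- the same recursion. The other side of the equation is evaluated by `adIter_sum`.
  · rw [finsum_blocks (U := Set.univ) (E := expInsert gr γ)
      (by rw [expInsert_zero gr hγ.2]; rfl) (fun _ _ _ => trivial)
      (isLinearMap_expInsert gr hγ.2).map_zero (fun η hη u _ l => expInsert_eq gr hγ.2 hη u l)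
      hML trivial]
    have h := congrFun (congrFun (adIter_sum hγ.1.1 hγ.2 hm) u) l
    rw [hm', hatExp_eq_sum h0, Finset.sum_apply] at h
    refine Eq.trans h.symm ?_
    rw [hatOp_apply, Finset.sum_apply]
    exact sum_antidiagonal_swap (fun v w => circ 𝔾 gr 1 (expInsert gr γ idCochain w) (m v) l) u

end flow

end Ainf

namespace Ainf

open CoeffDatum

variable {P : Type*} [Fintype P] [DecidableEq P] {G : Type*} [AddCommGroup G] [DecidableEq G]
  {𝔾 : GradingDatum G} {D : CoeffDatum P 𝔾} {k : Type*} [Field k] [CharZero k]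
  {A : Type*} [AddCommGroup A] [Module k A] {gr : G → Submodule k A}
  [DirectSum.Decomposition gr] {μ : Cochain A}

/-! ### The gauge flow of a deformation -/

section gauge

variable (hμ : IsAinf 𝔾 gr μ)

theorem eq_posPart_add {m : D.Mon → Cochain A} (hm : m ∈ Deformations D gr μ) :
    m = posPart m + const₀ μ := by
  funext u
  rw [Pi.add_apply]
  by_cases hu : u = 0
  · subst hu
    rw [posPart_zero, const₀_zero, zero_add, hm.2.1]
  · rw [posPart_of_ne m hu, const₀_of_ne hu, add_zero]

theorem π_conv_br {γ x : D.Mon → HL 𝔾 gr} (hγ : ∀ u, γ u ∈ HL.part 𝔾 gr (0 - D.deg u))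
    (hx : ∀ u, x u ∈ HL.part 𝔾 gr (𝔾.ι 1 - D.deg u)) (u : D.Mon) :
    HL.π 𝔾 gr (conv (HL.br 𝔾 gr) γ x u) = ∑ v ∈ Finset.HasAntidiagonal.antidiagonal u,
      gbr 𝔾 gr 0 1 (HL.π 𝔾 gr (γ v.1)) (HL.π 𝔾 gr (x v.2)) := by
  rw [conv, map_sum]
  refine Finset.sum_congr rfl fun v _ => ?_
  rw [HL.π_br (hγ v.1) (hx v.2), par_sub_deg, par_sub_deg, par_ι_one, map_zero]

/-- For `m = μ + α` the inhomogeneous term `-∂γ` of the flow is `[γ, μ]`, so the flow of `α` is the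
linear flow `[γ, ·]` of `m`. Only the zeroth derivative sees that `μ` was removed. -/
theorem π_gaugeIter {γ : D.Mon → HL 𝔾 gr} (hγ : γ ∈ D.HatM (HL.part 𝔾 gr) 0)
    {m : D.Mon → Cochain A} (hm : m ∈ Deformations D gr μ) (n : ℕ) (u : D.Mon) :
    HL.π 𝔾 gr (DGLA.gaugeIter D (hochDGLA hμ) γ (mcLift hm) n u) =
      if n = 0 then posPart m u else adIter gr (fun u => HL.π 𝔾 gr (γ u)) m n u := by
  induction n generalizing u with
  | zero => exact π_mcLift hm u
  | succ n ih =>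
    have hmem := DGLA.gaugeIter_mem (𝔤 := hochDGLA hμ) hγ.1 (mcLift_mem_MC hμ hm).1.1 n
    rw [DGLA.gaugeIter_succ, Pi.sub_apply, map_sub, if_neg (Nat.succ_ne_zero n)]
    refine (congrArg (· - _) (π_conv_br hγ.1.1 hmem.1 u)).trans ?_
    simp only [ih]
    rcases n with _ | n
    · rw [if_pos rfl, DGLA.hatD_apply, π_d hμ (hγ.1.1 u), par_sub_deg, map_zero]
      simp only [if_true]
      have h1 : ∀ v : D.Mon × D.Mon, gbr 𝔾 gr 0 1 (HL.π 𝔾 gr (γ v.1)) (m v.2) =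
          gbr 𝔾 gr 0 1 (HL.π 𝔾 gr (γ v.1)) (posPart m v.2) +
            gbr 𝔾 gr 0 1 (HL.π 𝔾 gr (γ v.1)) (const₀ μ v.2) := by
        intro v
        conv_lhs => rw [eq_posPart_add hm]
        rw [Pi.add_apply, gbr_of_even_odd, gbr_of_even_odd, gbr_of_even_odd,
          circ_add_right 𝔾 gr 1 (HL.π_mem (hγ.1.1 v.1)).1, circ_add_left]
        abel
      have h2 : ∑ v ∈ Finset.HasAntidiagonal.antidiagonal u,
          gbr 𝔾 gr 0 1 (HL.π 𝔾 gr (γ v.1)) (const₀ μ v.2) =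
            gbr 𝔾 gr 0 1 (HL.π 𝔾 gr (γ u)) μ := by
        rw [Finset.sum_eq_single (u, 0)]
        · rw [const₀_zero]
        · rintro ⟨v, w⟩ hvw hne
          rw [Finset.HasAntidiagonal.mem_antidiagonal] at hvw
          rw [const₀_of_ne, gbr_of_even_odd, circ_zero_left,
            circ_zero_right 1 (HL.π_mem (hγ.1.1 v)).1, sub_zero]
          rintro rfl
          rw [add_zero] at hvw
          exact hne (Prod.ext hvw rfl)
        · simp
      change _ = ∑ v ∈ Finset.HasAntidiagonal.antidiagonal u,
        gbr 𝔾 gr 0 1 (HL.π 𝔾 gr (γ v.1)) (m v.2)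
      simp only [h1]
      rw [Finset.sum_add_distrib, h2, gbr_of_even_odd, hochD, sgn_zero, one_smul]
      abel
    · rw [if_neg (Nat.succ_ne_zero n)]
      simp only [if_neg (Nat.succ_ne_zero n)]
      rw [Pi.zero_apply, map_zero, sub_zero]
      rfl

theorem expSum_adIter_eq_pull {γ : D.Mon → HL 𝔾 gr} (hγ : γ ∈ D.HatM (HL.part 𝔾 gr) 0)
    {m m' : D.Mon → Cochain A} (hm : m ∈ Deformations D gr μ) (hm' : m' ∈ Deformations D gr μ)
    {c : P → unitsZero D k} (h : DGLA.gauge D (hochDGLA hμ) γ (mcLift hm) = pull c (mcLift hm')) :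
    expSum k (adIter gr (fun u => HL.π 𝔾 gr (γ u)) m) = pull c m' := by
  have hγπ : ∀ u, HL.π 𝔾 gr (γ u) ∈ CC 𝔾 gr (0 - D.deg u) := fun u => HL.π_mem (hγ.1.1 u)
  have hγ0 : HL.π 𝔾 gr (γ 0) = 0 := by rw [hγ.2, map_zero]
  funext u
  by_cases hu : u = 0
  -- Order zero is treated apart: the Maurer–Cartan elements have forgotten `μ` there.
  · subst hu
    rw [expSum_apply_zero (suppIn_adIter hγπ hγ0 hm.1.1), pull_apply_zero, hm'.2.1]
    exact hm.2.1
  · have h1 := compLeft_expSum (HL.π 𝔾 gr)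
      (DGLA.suppIn_gaugeIter (𝔤 := hochDGLA hμ) hγ.2 (mcLift hm))
    rw [← DGLA.gauge_eq_expSum, h] at h1
    have h2 : HL.π 𝔾 gr (pull c (mcLift hm') u) = pull c m' u := by
      rw [pull, pull, map_sum]
      refine Finset.sum_congr rfl fun v hv => ?_
      rw [Finset.HasAntidiagonal.mem_antidiagonal] at hv
      rw [map_smul, π_mcLift]
      by_cases h0 : v.1 = 0
      · rw [h0, unitVal_zero, coeff_one, if_neg, zero_smul, zero_smul]
        rintro h3
        exact hu (by rw [← hv, h0, h3, add_zero])
      · rw [posPart_of_ne _ h0]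
    rw [← h2]
    refine Eq.trans ?_ (congrFun h1 u).symm
    refine finsum_congr fun n => congrArg _ ?_
    refine Eq.trans ?_ (π_gaugeIter hμ hγ hm n u).symm
    rcases n with _ | n
    · rw [if_pos rfl, posPart_of_ne _ hu]
      rfl
    · rw [if_neg (Nat.succ_ne_zero n)]

theorem map_π_mem_HatM {γ : D.Mon → HL 𝔾 gr} (hγ : γ ∈ D.HatM (HL.part 𝔾 gr) 0) :
    (fun u => HL.π 𝔾 gr (γ u)) ∈ D.HatM (CC 𝔾 gr) 0 :=
  ⟨⟨fun u => HL.π_mem (hγ.1.1 u), fun n => (hγ.1.2 n).subset fun _ hu =>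
    ⟨fun h => hu.1 ((congrArg _ h).trans (map_zero _)), hu.2⟩⟩,
    (congrArg (HL.π 𝔾 gr) hγ.2).trans (map_zero _)⟩

end gauge

/-! ### Completeness for `A∞` algebras -/

section completeness

variable {hD : D.IsNice k} {Γ : Type*} [Group Γ] [Fintype Γ] [DistribMulAction Γ G] [MulAction Γ P]
  {a : Γ →* (D.R k ≃ₐ[k] D.R k)} (hR : IsSpecialAction hD a) (h𝔾 : 𝔾.IsInvariant Γ)
  (hμ : IsAinf 𝔾 gr μ)
  {σ : Γ →* Multiplicative (ZMod 2)} {ρ : Representation k Γ A} (hs : IsSignedAction 𝔾 gr μ σ ρ)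

include hR in
theorem spansInv_mcLift {m : D.Mon → Cochain A} (hm : m ∈ Deformations D gr μ) {S : Set D.Mon}
    (h : SpansInv hD.mem a (hochComplex 𝔾 gr μ σ ρ) S m) :
    SpansInv hD.mem a ((hochDGLA hμ).toEqComplex (HL.rep σ h𝔾 hs.mem)) S (mcLift hm) :=
  spansInv_lift hR hμ h𝔾 hs (fun p => (mcLift_mem_MC hμ hm).1.1.1 _)
    (fun p => by rw [π_mcLift, posPart_of_ne m (hD.basis_ne_zero p)]) h

include hR h𝔾 hμ hs in
-- The gauge transformation found for the Maurer–Cartan elements of the two deformations is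
-- exponentiated to the required homomorphism.
theorem isComplete {m : D.Mon → Cochain A} (hm : m ∈ Deformations D gr μ)
    (hi : IsInvElt a (hochComplex 𝔾 gr μ σ ρ) m)
    (hS : SpansInv hD.mem a (hochComplex 𝔾 gr μ σ ρ) ∅ m) :
    IsComplete (DeformationsPrime gr μ σ ρ hD.mem a) (PullbackHom gr m) := by
  rintro β ⟨hβ, hβi, hβs⟩
  obtain ⟨γ, hγ, c, hc⟩ := DGLA.exists_gauge_eq_pull hR (isAction_rep σ h𝔾 hμ hs)
    (mcLift_mem_MC hμ hm) (isInvElt_mcLift hR hμ h𝔾 hs hm hi) (spansInv_mcLift hR h𝔾 hμ hs hm hS)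
    ⟨mcLift_mem_MC hμ hβ, isInvElt_mcLift hR hμ h𝔾 hs hβ hβi, spansInv_mcLift hR h𝔾 hμ hs hβ hβs⟩
  refine ⟨rescale c, isAut_rescale c, expInsert gr (fun u => HL.π 𝔾 gr (γ u)) idCochain, ?_⟩
  rw [tensorMap_eq_pull (rescale_mono c)]
  exact isHom_expInsert (map_π_mem_HatM hγ) hβ.1.1 (expSum_adIter_eq_pull hμ hγ hβ hm hc)
    fun u => ((pull_mem_Hat c hm.1).1 u).1

end completeness

/-! ### Versality for `A∞` algebras -/

section versality

/-- The insertion goes either into the first block, where the identity sits, or into the remaining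
inputs. This is the recursion of `expInsert_eq` to first order. -/
theorem circ_eq_splitSum_add {η : Cochain A} (hη : η ∈ ML k A) (ψ : Cochain A) (l : List A) :
    circ 𝔾 gr 0 η ψ l = splitSum (fun x y => circ 𝔾 gr 0 (fun z => η (idCochain x :: z)) ψ y) l +
      splitSum (fun x y => η (ψ x :: y)) l := by
  conv_lhs => rw [eq_curvaturePart_add hη, circ_add_left, circ_curvaturePart, zero_add,
    circ_splitLinear]
  change splitSum (fun x y => circ 𝔾 gr 0 (fun z => η (idCochain z :: y)) ψ x +
    circ 𝔾 gr 0 (fun z => η (idCochain x :: z)) ψ y) l = _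
  rw [splitSum_add, add_comm]
  congr 1
  refine splitSum_congr fun x y _ => ?_
  exact (circ_comp 𝔾 gr (ML.slot hη [] y) 0 idCochain ψ x).trans
    (congrArg (fun ξ : Cochain A => η (ξ x :: y)) (circ_idCochain 𝔾 gr 0 ψ))

theorem sum_antidiagonal_of_irreducible {M : Type*} [AddCommMonoid M] {u : D.Mon} (hu : u ≠ 0)
    (h : ∀ v w, v + w = u → v = 0 ∨ w = 0) (f : D.Mon × D.Mon → M) :
    ∑ v ∈ Finset.HasAntidiagonal.antidiagonal u, f v = f (0, u) + f (u, 0) := by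
  classical
  rw [show Finset.HasAntidiagonal.antidiagonal u = {((0 : D.Mon), u), (u, (0 : D.Mon))} from ?_,
    Finset.sum_pair fun h => hu (Prod.mk.inj h).2]
  ext ⟨v, w⟩
  rw [Finset.HasAntidiagonal.mem_antidiagonal, Finset.mem_insert, Finset.mem_singleton, Prod.mk.injEq,
    Prod.mk.injEq]
  constructor
  · intro hvw
    rcases h v w hvw with rfl | rfl
    · exact Or.inl ⟨rfl, by simpa using hvw⟩
    · exact Or.inr ⟨by simpa using hvw, rfl⟩
  · rintro (⟨rfl, rfl⟩ | ⟨rfl, rfl⟩)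
    · exact zero_add _
    · exact add_zero _

theorem sum_antidiagonal_zero {M : Type*} [AddCommMonoid M] (f : D.Mon × D.Mon → M) :
    ∑ v ∈ Finset.HasAntidiagonal.antidiagonal (0 : D.Mon), f v = f (0, 0) := by
  refine Finset.sum_eq_single (0, 0) (fun v hv hne => ?_) (by simp)
  rw [Finset.HasAntidiagonal.mem_antidiagonal] at hv
  exact absurd (Prod.ext (Mon.add_eq_zero hv) (Mon.add_eq_zero' hv)) hne

/-- At an irreducible monomial each surviving term has a single factor of order `u` and all others
of order zero. The equation reads `m'_u + m'_0 ∘ F_u = m_u + F_u ∘ m_0`, while in order zero it says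
`m'_0 = m_0`. -/
theorem IsHom.apply_irreducible {m m' F : D.Mon → Cochain A} (hF : IsHom gr m m' F)
    (hm' : ∀ u, m' u ∈ ML k A) {u : D.Mon} (hu : u ≠ 0)
    (h : ∀ v w, v + w = u → v = 0 ∨ w = 0) : m' u = m u - hochD 𝔾 gr (m 0) 0 (F u) := by
  classical
  -- A first-order substitute for the exponential. It satisfies the block recursion at `0` and `u`,
  -- a set of monomials closed under divisors because `u` is irreducible.
  let E : Cochain A → D.Mon → Cochain A := fun η v => if v = 0 then η else circ 𝔾 gr 0 η (F v)
  have hE0 : E 0 = 0 := by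
    funext v
    change (if v = 0 then 0 else circ 𝔾 gr 0 0 (F v)) = 0
    rw [circ_zero_left, ite_self]
  have hEz : ∀ η, E η 0 = η := fun η => if_pos rfl
  have hEu : ∀ η, E η u = circ 𝔾 gr 0 η (F u) := fun η => if_neg hu
  have hU : ∀ v w : D.Mon, v + w ∈ ({0, u} : Set D.Mon) → w ∈ ({0, u} : Set D.Mon) := by
    rintro v w (hvw | hvw)
    · exact Or.inl (Mon.add_eq_zero' hvw)
    · rcases h v w hvw with rfl | rfl
      · exact Or.inr (by simpa using hvw)
      · exact Or.inl rfl
  have hF0 : F 0 [] = 0 := by rw [hF.zero]; rfl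
  have hE : ∀ η ∈ ML k A, ∀ w ∈ ({0, u} : Set D.Mon), ∀ l, E η w l =
      const₀ (D := D) (curvaturePart η) w l +
      ∑ v ∈ Finset.HasAntidiagonal.antidiagonal w, splitSum (fun x y =>
        E (fun z => η (F v.1 x :: z)) v.2 y) l := by
    rintro η hη w (rfl | rfl) l
    · rw [sum_antidiagonal_zero, const₀_zero, hEz, hF.zero]
      simp only [hEz]
      exact congrFun (eq_curvaturePart_add hη) l
    · rw [sum_antidiagonal_of_irreducible hu h, const₀_of_ne hu, hEu, Pi.zero_apply, zero_add, hF.zero]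
      simp only [hEz, hEu]
      exact circ_eq_splitSum_add hη (F w) l
  have hrel : ∀ w ∈ ({0, u} : Set D.Mon), ∑ v ∈ Finset.HasAntidiagonal.antidiagonal w,
      E (m' v.1) v.2 = ∑ v ∈ Finset.HasAntidiagonal.antidiagonal w, circ 𝔾 gr 1 (F v.1) (m v.2) := by
    intro w hw
    funext l
    rw [Finset.sum_apply, Finset.sum_apply, ← hF.rel w l]
    exact (finsum_blocks hF0 hU hE0 hE hm' hw l).symm
  have h0 := hrel 0 (Or.inl rfl)
  rw [sum_antidiagonal_zero, sum_antidiagonal_zero, hEz, hF.zero, circ_idCochain] at h0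
  have h1 := hrel u (Or.inr rfl)
  rw [sum_antidiagonal_of_irreducible hu h, sum_antidiagonal_of_irreducible hu h, hEz, hEu, hF.zero,
    circ_idCochain, h0] at h1
  rw [hochD, sgn_zero, one_smul, eq_sub_of_add_eq' h1]
  abel

theorem tensorMap_mem {V : Type*} [AddCommGroup V] [Module k V] (S : Submodule k V)
    (ψ : D.R k ≃ₐ[k] D.R k) {x : D.Mon → V} (hx : ∀ u, x u ∈ S) (u : D.Mon) :
    tensorMap ψ id x u ∈ S :=
  finsum_induction (· ∈ S) S.zero_mem (fun _ _ => S.add_mem) fun v => S.smul_mem _ (hx v)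

theorem isVersal {hD : D.IsNice k} {Γ : Type*} [Group Γ] (hμ : IsAinf 𝔾 gr μ)
    {a : Γ →* (D.R k ≃ₐ[k] D.R k)}
    {σ : Γ →* Multiplicative (ZMod 2)} {ρ : Representation k Γ A}
    {m : D.Mon → Cochain A} (hm : m ∈ Deformations D gr μ)
    (h : IsComplete (DeformationsPrime gr μ σ ρ hD.mem a) (PullbackHom gr m))
    (hα : ∀ p, ¬ ClassIsZero hD.mem (hochComplex 𝔾 gr μ σ ρ) m p) :
    IsVersal (DeformationsPrime gr μ σ ρ hD.mem a) (PullbackHom gr m) := by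
  let d : Cochain A →ₗ[k] Cochain A :=
    { toFun := hochD 𝔾 gr μ 0
      map_add' := fun φ ψ => by
        rw [hochD, hochD, hochD, circ_add_right 𝔾 gr 0 hμ.mem.1, circ_add_left, smul_add]
        abel
      map_smul' := fun c φ => by
        rw [hochD, hochD, circ_smul_right 𝔾 gr 0 hμ.mem.1, circ_smul_left, smul_comm, RingHom.id_apply,
          smul_sub] }
  refine h.isVersal (hD := hD) (hochComplex 𝔾 gr μ σ ρ) d (fun _ => rfl) hα ?_
  rintro β hβ ψ ⟨F, hF⟩ p
  refine ⟨F (basis hD.mem p), hF.mem.1 _, ?_⟩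
  have h1 := hF.apply_irreducible (tensorMap_mem (ML k A) ψ fun u => (hm.1.1 u).1)
    (hD.basis_ne_zero p) (fun v w hvw => ?_)
  · rwa [hβ.1.2.1] at h1
  · by_contra! hc
    exact hD.basis_notMem_pow_two p (by rw [← hvw]; exact add_mem_pow_two hc.1 hc.2)

end versality

end Ainf

end EqVers

theorem mainTheorem4 {k : Type*} [Field k] [CharZero k]
    {G : Type*} [AddCommGroup G] [DecidableEq G] (𝔾 : EqVers.GradingDatum G)
    {P : Type*} [Fintype P] [DecidableEq P] (D : EqVers.CoeffDatum P 𝔾) (hD : D.IsNice k)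
    {Γ : Type*} [Group Γ] [Finite Γ] [DistribMulAction Γ G] [MulAction Γ P]
    (h𝔾 : 𝔾.IsInvariant Γ)
    (actR : Γ →* (D.R k ≃ₐ[k] D.R k)) (hR : EqVers.CoeffDatum.IsSpecialAction hD actR)
    {L : Type*} [AddCommGroup L] [Module k L] {A : Type*} [AddCommGroup A] [Module k A] :
    (∀ (𝔤 : EqVers.DGLA k 𝔾 L) (ρ : Representation k Γ L), 𝔤.IsAction ρ →
      ∀ α ∈ EqVers.DGLA.MC D 𝔤,
        EqVers.CoeffDatum.IsInvElt actR (𝔤.toEqComplex ρ) α →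
        EqVers.CoeffDatum.SpansInv hD.mem actR (𝔤.toEqComplex ρ) ∅ α →
        EqVers.CoeffDatum.IsComplete (𝔤.MCprime ρ hD.mem actR) (𝔤.PullbackEquiv α) ∧
        ((∀ p, ¬ EqVers.CoeffDatum.ClassIsZero hD.mem (𝔤.toEqComplex ρ) α p) →
          EqVers.CoeffDatum.IsVersal (𝔤.MCprime ρ hD.mem actR) (𝔤.PullbackEquiv α))) ∧
    (∀ (gr : G → Submodule k A) [DirectSum.Decomposition gr] (μ : EqVers.Cochain A),
      EqVers.Ainf.IsAinf 𝔾 gr μ →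
      ∀ (σ : Γ →* Multiplicative (ZMod 2)) (ρ : Representation k Γ A),
        EqVers.Ainf.IsSignedAction 𝔾 gr μ σ ρ →
      ∀ m ∈ EqVers.Ainf.Deformations D gr μ,
        EqVers.CoeffDatum.IsInvElt actR (EqVers.Ainf.hochComplex 𝔾 gr μ σ ρ) m →
        EqVers.CoeffDatum.SpansInv hD.mem actR (EqVers.Ainf.hochComplex 𝔾 gr μ σ ρ) ∅ m →
        EqVers.CoeffDatum.IsComplete
          (EqVers.Ainf.DeformationsPrime gr μ σ ρ hD.mem actR)
          (EqVers.Ainf.PullbackHom gr m) ∧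
        ((∀ p, ¬ EqVers.CoeffDatum.ClassIsZero hD.mem
            (EqVers.Ainf.hochComplex 𝔾 gr μ σ ρ) m p) →
          EqVers.CoeffDatum.IsVersal
            (EqVers.Ainf.DeformationsPrime gr μ σ ρ hD.mem actR)
            (EqVers.Ainf.PullbackHom gr m))) := by
  have := Fintype.ofFinite Γ
  refine ⟨fun 𝔤 ρ hρ α hα hi hs => ?_, fun gr _ μ hμ σ ρ hρ m hm hi hs => ?_⟩
  · have h := EqVers.DGLA.isComplete hR hρ hα hi hs
    exact ⟨h, EqVers.DGLA.isVersal (hD := hD) h⟩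
  · have h := EqVers.Ainf.isComplete hR h𝔾 hμ hρ hm hi hs
    exact ⟨h, EqVers.Ainf.isVersal (hD := hD) hμ hm h⟩
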